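/- A self-avoiding polygon (SAP) on the square lattice $\mathbb Z^2$ is the (unrooted, unoriented) graph traced out by a self-avoiding cycle; SAPs are counted up to translation. The bounding rectangle of a SAP is the smallest rectangle with sides parallel to the axes that contains it; if it has width $w$ and height $h$, the SAP is called $1$-convex if its perimeter is $2(w+h)+2$. The top arc of such a polygon is its part leading from the lowest vertex on the left side of the bounding rectangle, by way of the top side, to the lowest vertex on the right side. The polygon has a (vertical) indent on the top arc if, going along the top arc from left to right, some downward step is followed later by an upward step. All series below are formal power series with rational coefficients. Let $$\Delta=1-2x-2y-2xy+x^2+y^2,\qquad Z=\frac1{\sqrt\Delta},\qquad SP=\tfrac12\bigl(1-x-y-\sqrt\Delta\bigr),\qquad u=x+SP,\qquad v=y+SP,$$ where $\sqrt\Delta$ has constant term $1$. The half-perimeter operator $E$ keeps the terms of even degree in $x$ and in $y$ and replaces $x^{2m}y^{2n}$ by $x^my^n$, so $E[f(x,y)]=\frac14\sum_{\pm,\pm}f(\pm\sqrt x,\pm\sqrt y)$. Starred quantities inside $E$ are not affected by it: $x^*,y^*$ are treated as further independent variables while $E$ acts on $x,y$, and are then replaced by $x,y$; $u^*,v^*$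 denote $u,v$ evaluated at $(x^*,y^*)$. Put $$\begin{aligned} \Phi(x,y)={}&E\left[\frac{x(1-x)y^*}{(1-x)^2-y^*}\left(1+\frac{y^*}{(1-x)^2}\right)\left(\frac{x^*}{1-x^*-y}\right)^2\left(\frac{y^2(1-y)^2}{(1-y)^2-x^*}+\frac{x^*y^2}{1-x^*}\right)\frac{x}{1-x-y}\right]\\ &-\frac{4xyv}{\Delta}\,E\left[\left(\frac{x^*y}{1-x^*-y}\right)^2\left(\frac{(1-y)^2}{(1-y)^2-x^*}+\frac{x^*}{1-x^*}\right)\frac{u^*}{1-u^*-y}\right]\\ &-\frac{2xyu^2v}{(1-u)^2\Delta}\,E\left[\frac{x(1-x)y^*}{(1-x)^2-y^*}\left(1+\frac{y^*}{(1-x)^2}\right)\frac{x}{1-x-v^*}\right]\\ &+2v\,SP\,Z\left(\frac{2x\,SP}{\Delta}\right)^2-2x\,SP^3Z^3\left(\frac1{1-x}+uZ\right)\left(1+\frac{v}{1-u}\right). \end{aligned}$$ Then: 1. $\Phi(x,y)=\sum_{w,h}a_{w,h}x^wy^h$, where $a_{w,h}$ is the number of $1$-convex polygons with a vertical indent on the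 top arc whose bounding rectangle has width $w$ and height $h$. 2. Equivalently, the anisotropic half-perimeter generating function of these polygons, $\sum_{m,n}p_{2m,2n}x^my^n$ with $p_{2m,2n}$ the number of those with $2m$ horizontal and $2n$ vertical steps, is $y\,\Phi(x,y)$. 3. Summing over the four symmetric cases (the indent on the top, bottom, left or right arc), the anisotropic half-perimeter generating function of all $1$-convex polygons is $2\bigl(y\,\Phi(x,y)+x\,\Phi(y,x)\bigr)$. 4. Accordingly, with $q_{2n}$ the number of all $1$-convex polygons of perimeter $2n$, one obtains Lin's generating function $$\begin{aligned}\sum_n q_{2n}t^n=4\Biggl[&\frac{t^3(-4+56t-300t^2+773t^3-973t^4+535t^5-90t^6+24t^7)}{(1-t)(1-3t+t^2)(1-4t)^3}\\&+\frac{4t^3(1-9t+25t^2-23t^3+3t^4)}{(1-t)(1-4t)^{5/2}}\Biggr].\end{aligned}$$ -/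

import Mathlib

noncomputable section

namespace AlmostConvex

/-! Lattice polygons -/

/-- The square lattice: vertex set `ℤ × ℤ`, edges between vertices at distance one. -/
def squareLattice : SimpleGraph (ℤ × ℤ) where
  Adj a b := (a.2 = b.2 ∧ |a.1 - b.1| = 1) ∨ (a.1 = b.1 ∧ |a.2 - b.2| = 1)
  symm := ⟨fun a b h => by simpa only [eq_comm, abs_sub_comm] using h⟩
  loopless := ⟨fun a h => by simp at h⟩

/-- A self-avoiding polygon: the subgraph of the square lattice traced out by a cycle
(no root and no orientation). -/
def IsPolygon (P : squareLattice.Subgraph) : Prop :=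
  ∃ (a : ℤ × ℤ) (c : squareLattice.Walk a a), c.IsCycle ∧ c.toSubgraph = P

/-- The horizontal edges of `P`. -/
def horizontalSteps (P : squareLattice.Subgraph) : Set (Sym2 (ℤ × ℤ)) :=
  {e | e ∈ P.edgeSet ∧ ∃ i j : ℤ, e = s((i, j), (i + 1, j))}

/-- The vertical edges of `P`. -/
def verticalSteps (P : squareLattice.Subgraph) : Set (Sym2 (ℤ × ℤ)) :=
  {e | e ∈ P.edgeSet ∧ ∃ i j : ℤ, e = s((i, j), (i, j + 1))}

/-- The minimum bounding rectangle of `P` is `[0, w] × [0, h]`. Fixing its lower left corner at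
the origin selects exactly one representative of every translation class. -/
def HasBoundingRectangle (P : squareLattice.Subgraph) (w h : ℕ) : Prop :=
  IsLeast (Prod.fst '' P.verts) 0 ∧ IsGreatest (Prod.fst '' P.verts) (w : ℤ) ∧
    IsLeast (Prod.snd '' P.verts) 0 ∧ IsGreatest (Prod.snd '' P.verts) (h : ℤ)

/-- `P` is a `k`-convex polygon with bounding rectangle `[0, w] × [0, h]`: its perimeter exceeds
that of the rectangle by `2 * k`. -/
structure IsConvexOfIndex (k : ℕ) (P : squareLattice.Subgraph) (w h : ℕ) : Prop where
  polygon : IsPolygon P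
  rectangle : HasBoundingRectangle P w h
  perimeter : P.edgeSet.ncard = 2 * (w + h) + 2 * k

/-- `p` is the top arc of `P`, traversed from left to right: the part of `P` which leads from the
lowest vertex on the left side of the bounding rectangle `[0, w] × [0, h]`, by way of the top
side, to the lowest vertex on the right side. -/
structure IsTopArc (P : squareLattice.Subgraph) (w h : ℕ) {l r : ℤ × ℤ}
    (p : squareLattice.Walk l r) : Prop where
  isPath : p.IsPath
  le : p.toSubgraph ≤ P
  left : l ∈ P.verts ∧ l.1 = 0 ∧ ∀ q ∈ P.verts, q.1 = 0 → l.2 ≤ q.2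
  right : r ∈ P.verts ∧ r.1 = w ∧ ∀ q ∈ P.verts, q.1 = w → r.2 ≤ q.2
  top : ∃ t ∈ p.support, t.2 = h

/-- `P` has a vertical indent on its top arc: a downward step of the arc is followed, not
necessarily at once, by an upward step of the arc. -/
def HasTopIndent (P : squareLattice.Subgraph) (w h : ℕ) : Prop :=
  ∃ (l r : ℤ × ℤ) (p : squareLattice.Walk l r), IsTopArc P w h p ∧
    ∃ i j : ℕ, i < j ∧ j < p.length ∧
      p.getVert (i + 1) = p.getVert i - (0, 1) ∧ p.getVert (j + 1) = p.getVert j + (0, 1)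

/-! The families that are counted, up to translation -/

/-- 1-convex polygons with a vertical indent on the top arc, with `2 * m` horizontal steps and
`2 * n` vertical steps. -/
def topIndentPolygons (m n : ℕ) : Set squareLattice.Subgraph :=
  {P | ∃ w h, IsConvexOfIndex 1 P w h ∧ HasTopIndent P w h ∧
    (horizontalSteps P).ncard = 2 * m ∧ (verticalSteps P).ncard = 2 * n}

/-- 1-convex polygons with a vertical indent on the top arc whose bounding rectangle has width `w`
and height `h`. -/
def topIndentPolygonsOfSize (w h : ℕ) : Set squareLattice.Subgraph :=
  {P | IsConvexOfIndex 1 P w h ∧ HasTopIndent P w h}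

/-- All 1-convex polygons with `2 * m` horizontal steps and `2 * n` vertical steps. -/
def oneConvexPolygons (m n : ℕ) : Set squareLattice.Subgraph :=
  {P | ∃ w h, IsConvexOfIndex 1 P w h ∧
    (horizontalSteps P).ncard = 2 * m ∧ (verticalSteps P).ncard = 2 * n}

/-- All 1-convex polygons of perimeter `2 * n`. -/
def oneConvexPolygonsOfPerimeter (n : ℕ) : Set squareLattice.Subgraph :=
  {P | ∃ w h, IsConvexOfIndex 1 P w h ∧ P.edgeSet.ncard = 2 * n}

/-! Their generating functions. The families are finite, as is proved below. -/

/-- Anisotropic half-perimeter generating function, `x` for horizontal, `y` for vertical steps. -/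
def topIndentGF : MvPowerSeries (Fin 2) ℚ :=
  fun d => ((topIndentPolygons (d 0) (d 1)).ncard : ℚ)

/-- Generating function by width (`x`) and height (`y`) of the bounding rectangle. -/
def topIndentSizeGF : MvPowerSeries (Fin 2) ℚ :=
  fun d => ((topIndentPolygonsOfSize (d 0) (d 1)).ncard : ℚ)

/-- Anisotropic half-perimeter generating function of all 1-convex polygons. -/
def oneConvexGF : MvPowerSeries (Fin 2) ℚ :=
  fun d => ((oneConvexPolygons (d 0) (d 1)).ncard : ℚ)

/-- Isotropic half-perimeter generating function of all 1-convex polygons. -/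
def oneConvexIsotropicGF : PowerSeries ℚ :=
  PowerSeries.mk fun n => ((oneConvexPolygonsOfPerimeter n).ncard : ℚ)

/-! The half-perimeter operator -/

/-- The half-perimeter operator in both variables: it keeps the terms of even degree in `x` and in
`y`, and replaces `x ^ (2 * m) * y ^ (2 * n)` by `x ^ m * y ^ n`; that is,
`E f = (f(√x, √y) + f(-√x, √y) + f(√x, -√y) + f(-√x, -√y)) / 4`. -/
def E (f : MvPowerSeries (Fin 2) ℚ) : MvPowerSeries (Fin 2) ℚ :=
  fun d => MvPowerSeries.coeff (2 • d) f

/-- The asterisk, inside the argument of `E`: a starred series is not affected by `E`. Since `E`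
halves the exponents, this is achieved by doubling them beforehand; see `E_mul_starred`. -/
def starred (f : MvPowerSeries (Fin 2) ℚ) : MvPowerSeries (Fin 2) ℚ :=
  MvPowerSeries.expand 2 two_ne_zero f

/-- `E [f(x, y) g(x*, y*)] = g(x, y) E [f(x, y)]`. -/
theorem E_mul_starred (f g : MvPowerSeries (Fin 2) ℚ) : E (f * starred g) = g * E f := by
  classical
  ext d
  change MvPowerSeries.coeff (2 • d) (f * starred g) = MvPowerSeries.coeff d (g * E f)
  rw [MvPowerSeries.coeff_mul, MvPowerSeries.coeff_mul]
  symm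
  refine Finset.sum_of_injOn (fun p => (2 • p.2, 2 • p.1)) ?_ ?_ ?_ ?_
  · rintro ⟨a, b⟩ - ⟨a', b'⟩ - h
    simp only [Prod.mk.injEq] at h
    have h1 := smul_right_injective (Fin 2 →₀ ℕ) two_ne_zero h.1
    have h2 := smul_right_injective (Fin 2 →₀ ℕ) two_ne_zero h.2
    rw [h1, h2]
  · rintro ⟨a, b⟩ h
    simp only [Finset.mem_coe, Finset.HasAntidiagonal.mem_antidiagonal] at h ⊢
    rw [← h, ← smul_add, add_comm]
  · rintro ⟨p, q⟩ hpq hn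
    rw [Finset.HasAntidiagonal.mem_antidiagonal] at hpq
    simp only at hpq
    by_cases hq : ∀ i, 2 ∣ q i
    · exfalso
      apply hn
      have hle : ∀ i, p i + q i = 2 * d i := fun i => by
        have := DFunLike.congr_fun hpq i
        simpa using this
      refine ⟨(q.mapRange (· / 2) rfl, p.mapRange (· / 2) rfl), ?_, ?_⟩
      · simp only [Finset.mem_coe, Finset.HasAntidiagonal.mem_antidiagonal]
        ext i
        have := hle i
        have := hq i
        simp only [Finsupp.add_apply, Finsupp.mapRange_apply]
        omega
      · simp only [Prod.mk.injEq]
        constructor <;> ext i <;> have := hle i <;> have := hq i <;>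
          simp only [Finsupp.smul_apply, Finsupp.mapRange_apply, smul_eq_mul] <;> omega
    · rw [not_forall] at hq
      obtain ⟨i, hi⟩ := hq
      simp only [starred]
      rw [MvPowerSeries.coeff_expand_of_not_dvd 2 two_ne_zero _ hi, mul_zero]
  · rintro ⟨a, b⟩ -
    simp only [starred, MvPowerSeries.coeff_expand_smul]
    exact mul_comm _ _

/-! The basic series -/

abbrev x : MvPowerSeries (Fin 2) ℚ := MvPowerSeries.X 0
abbrev y : MvPowerSeries (Fin 2) ℚ := MvPowerSeries.X 1

/-- `Δ = 1 - 2x - 2y - 2xy + x² + y²`. -/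
def Δ : MvPowerSeries (Fin 2) ℚ := 1 - 2 * x - 2 * y - 2 * x * y + x ^ 2 + y ^ 2

/-- The square root of `Δ` with constant term `1`, as `(1 + t) ^ (1 / 2)` at `t = Δ - 1`. -/
def sqrtΔ : MvPowerSeries (Fin 2) ℚ :=
  (PowerSeries.binomialSeries ℚ (1 / 2 : ℚ)).subst (Δ - 1)

theorem hasSubst_Δ : PowerSeries.HasSubst (Δ - 1) :=
  PowerSeries.HasSubst.of_constantCoeff_zero (by simp [Δ])

theorem sqrtΔ_sq : sqrtΔ ^ 2 = Δ := by
  rw [sqrtΔ, sq, ← PowerSeries.subst_mul hasSubst_Δ, ← PowerSeries.binomialSeries_add]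
  have h : (1 / 2 + 1 / 2 : ℚ) = ((1 : ℕ) : ℚ) := by norm_num
  rw [h, PowerSeries.binomialSeries_nat, pow_one, PowerSeries.subst_add hasSubst_Δ,
    PowerSeries.subst_X hasSubst_Δ]
  have h1 : PowerSeries.subst (Δ - 1) (1 : PowerSeries ℚ) = 1 := by
    rw [← PowerSeries.coe_substAlgHom hasSubst_Δ, map_one]
  rw [h1]
  ring

theorem constantCoeff_sqrtΔ : MvPowerSeries.constantCoeff sqrtΔ = 1 := by
  rw [sqrtΔ, PowerSeries.constantCoeff_subst hasSubst_Δ, finsum_eq_single _ 0]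
  · simp
  · intro n hn
    simp [Δ, hn]

/-- `Z = 1 / √Δ`. -/
def Z : MvPowerSeries (Fin 2) ℚ := sqrtΔ⁻¹

/-- The staircase polygon generating function `SP = (1 - x - y - √Δ) / 2`. -/
def SP : MvPowerSeries (Fin 2) ℚ := MvPowerSeries.C (1 / 2 : ℚ) * (1 - x - y - sqrtΔ)

def u : MvPowerSeries (Fin 2) ℚ := x + SP
def v : MvPowerSeries (Fin 2) ℚ := y + SP

/-- The closed-form expression for 1-convex polygons with their indent on the top arc. Every
series that is inverted has constant term `1`. -/
def topIndentExpression : MvPowerSeries (Fin 2) ℚ :=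
  E (x * (1 - x) * starred y * ((1 - x) ^ 2 - starred y)⁻¹
      * ((1 + starred y * ((1 - x) ^ 2)⁻¹) * (starred x * (1 - starred x - y)⁻¹) ^ 2
        * (y ^ 2 * (1 - y) ^ 2 * ((1 - y) ^ 2 - starred x)⁻¹
            + starred x * y ^ 2 * (1 - starred x)⁻¹)
        * (x * (1 - x - y)⁻¹)))
  - 4 * x * y * v * Δ⁻¹
    * E ((starred x * y * (1 - starred x - y)⁻¹) ^ 2
        * ((1 - y) ^ 2 * ((1 - y) ^ 2 - starred x)⁻¹ + starred x * (1 - starred x)⁻¹)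
        * (starred u * (1 - starred u - y)⁻¹))
  - 2 * x * y * u ^ 2 * v * ((1 - u) ^ 2 * Δ)⁻¹
    * E (x * (1 - x) * starred y * ((1 - x) ^ 2 - starred y)⁻¹
        * ((1 + starred y * ((1 - x) ^ 2)⁻¹) * (x * (1 - x - starred v)⁻¹)))
  + 2 * v * SP * Z * (2 * x * SP * Δ⁻¹) ^ 2
  - 2 * x * SP ^ 3 * Z ^ 3 * ((1 - x)⁻¹ + u * Z) * (1 + v * (1 - u)⁻¹)

/-- Interchange of the two variables, `f(x, y) ↦ f(y, x)`. -/
def swapXY (f : MvPowerSeries (Fin 2) ℚ) : MvPowerSeries (Fin 2) ℚ :=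
  MvPowerSeries.rename (Equiv.swap (0 : Fin 2) 1) f

/-- `(1 - 4t) ^ (-5 / 2)`. -/
def oneSubFourPow : PowerSeries ℚ :=
  PowerSeries.rescale (-4 : ℚ) (PowerSeries.binomialSeries ℚ (-5 / 2 : ℚ))

/-- `t³ (-4 + 56t - 300t² + 773t³ - 973t⁴ + 535t⁵ - 90t⁶ + 24t⁷) / ((1 - t)(1 - 3t + t²)(1 - 4t)³)
+ 4t³ (1 - 9t + 25t² - 23t³ + 3t⁴) / ((1 - t)(1 - 4t)^(5/2))`. -/
def linSeries : PowerSeries ℚ :=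
  let t : PowerSeries ℚ := PowerSeries.X
  t ^ 3 * (-4 + 56 * t - 300 * t ^ 2 + 773 * t ^ 3 - 973 * t ^ 4 + 535 * t ^ 5 - 90 * t ^ 6
      + 24 * t ^ 7) * ((1 - t) * (1 - 3 * t + t ^ 2) * (1 - 4 * t) ^ 3)⁻¹
    + 4 * t ^ 3 * (1 - 9 * t + 25 * t ^ 2 - 23 * t ^ 3 + 3 * t ^ 4) * (1 - t)⁻¹ * oneSubFourPow

/-! The families above are finite, so that `Set.ncard` is the number of their members. -/

theorem finite_boundingRectangle (w h : ℕ) :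
    {P : squareLattice.Subgraph | HasBoundingRectangle P w h}.Finite := by
  classical
  set B : Set (ℤ × ℤ) := Set.Icc 0 (w : ℤ) ×ˢ Set.Icc 0 (h : ℤ) with hB
  have hfin : B.Finite := (Set.finite_Icc _ _).prod (Set.finite_Icc _ _)
  have hsub : ∀ P : squareLattice.Subgraph, HasBoundingRectangle P w h → P.verts ⊆ B := by
    rintro P ⟨h1, h2, h3, h4⟩ q hq
    exact ⟨⟨h1.2 ⟨q, hq, rfl⟩, h2.2 ⟨q, hq, rfl⟩⟩, ⟨h3.2 ⟨q, hq, rfl⟩, h4.2 ⟨q, hq, rfl⟩⟩⟩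
  refine Set.Finite.of_finite_image (f := fun P : squareLattice.Subgraph =>
    (P.verts, {q : (ℤ × ℤ) × (ℤ × ℤ) | P.Adj q.1 q.2})) ?_ ?_
  · refine (hfin.powerset.prod (hfin.prod hfin).powerset).subset ?_
    rintro _ ⟨P, hP, rfl⟩
    exact ⟨hsub P hP, fun q hq => ⟨hsub P hP (P.edge_vert hq), hsub P hP (P.edge_vert hq.symm)⟩⟩
  · rintro P - Q - hPQ
    simp only [Prod.mk.injEq] at hPQ
    refine SimpleGraph.Subgraph.ext hPQ.1 ?_
    funext a b
    exact congrArg (fun s : Set ((ℤ × ℤ) × (ℤ × ℤ)) => (a, b) ∈ s) hPQ.2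

theorem IsPolygon.finite_edgeSet {P : squareLattice.Subgraph} (hP : IsPolygon P) :
    P.edgeSet.Finite := by
  obtain ⟨a, c, -, rfl⟩ := hP
  rw [SimpleGraph.Walk.edgeSet_toSubgraph]
  exact c.edges.finite_toSet

theorem finite_of_perimeter_le (N : ℕ) :
    {P : squareLattice.Subgraph | ∃ w h, IsConvexOfIndex 1 P w h ∧ P.edgeSet.ncard ≤ N}.Finite := by
  refine ((Set.finite_Iic N).biUnion fun w _ => (Set.finite_Iic N).biUnion fun h _ =>
    finite_boundingRectangle w h).subset ?_
  rintro P ⟨w, h, hP, hN⟩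
  have := hP.perimeter
  simp only [Set.mem_iUnion, Set.mem_Iic, Set.mem_ofPred_eq]
  exact ⟨w, by omega, h, by omega, hP.rectangle⟩

theorem finite_oneConvexPolygonsOfPerimeter (n : ℕ) : (oneConvexPolygonsOfPerimeter n).Finite :=
  (finite_of_perimeter_le (2 * n)).subset fun _ ⟨w, h, hP, hn⟩ => ⟨w, h, hP, hn.le⟩

theorem finite_topIndentPolygonsOfSize (w h : ℕ) : (topIndentPolygonsOfSize w h).Finite :=
  (finite_boundingRectangle w h).subset fun _ hP => hP.1.rectangle

theorem finite_oneConvexPolygons (m n : ℕ) : (oneConvexPolygons m n).Finite := by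
  refine (finite_of_perimeter_le (2 * m + 2 * n)).subset ?_
  rintro P ⟨w, h, hP, hm, hn⟩
  refine ⟨w, h, hP, ?_⟩
  rw [← hm, ← hn]
  refine (Set.ncard_le_ncard ?_ ?_).trans (Set.ncard_union_le _ _)
  · intro e he
    induction e with
    | _ a b =>
      obtain ⟨a1, a2⟩ := a
      obtain ⟨b1, b2⟩ := b
      have hadj : squareLattice.Adj (a1, a2) (b1, b2) := P.adj_sub he
      rcases hadj with ⟨h1, h2⟩ | ⟨h1, h2⟩ <;> simp only at h1 h2 <;> subst h1
      · refine Or.inl ⟨he, ?_⟩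
        rcases (abs_eq zero_le_one).1 h2 with h | h
        · exact ⟨b1, a2, by rw [Sym2.eq_swap, show a1 = b1 + 1 by omega]⟩
        · exact ⟨a1, a2, by rw [show b1 = a1 + 1 by omega]⟩
      · refine Or.inr ⟨he, ?_⟩
        rcases (abs_eq zero_le_one).1 h2 with h | h
        · exact ⟨a1, b2, by rw [Sym2.eq_swap, show a2 = b2 + 1 by omega]⟩
        · exact ⟨a1, a2, by rw [show b2 = a2 + 1 by omega]⟩
  · exact (hP.polygon.finite_edgeSet.subset fun _ he => he.1).union
      (hP.polygon.finite_edgeSet.subset fun _ he => he.1)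

theorem finite_topIndentPolygons (m n : ℕ) : (topIndentPolygons m n).Finite :=
  (finite_oneConvexPolygons m n).subset fun _ ⟨w, h, hP, _, hmn⟩ => ⟨w, h, hP, hmn⟩

end AlmostConvex

end

noncomputable section

namespace AlmostConvex

open SimpleGraph

/-! ### Polygons as connected 2-regular subgraphs -/

/-! A polygon is a finite connected 2-regular subgraph, and a parity argument shows that every
column of the bounding rectangle is crossed by an even number, at least two, of horizontal edges;
the same holds for rows. As the perimeter exceeds that of the rectangle by two, either every column
is crossed exactly twice and there are `2 * h + 2` vertical steps, or the transposed statement holds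
(`IsConvexOfIndex.cases`). In the second case the top arc has no vertical indent
(`Profile.not_hasTopIndent_transpose`). In the first case the polygon bounds the region between a
lower profile `B` and an upper profile `T` (`exists_profile`), and the top arc has an indent exactly
if `T` falls and later rises (`Profile.hasTopIndent_iff`).

The excess of a profile is its variation beyond the least possible value. The two excesses are even
and add up to two, so one profile is unimodal and the other has a dent of one unit. A dented profile
has a unit rise in its falling part or a unit fall in its rising part. Reflection in a vertical line
exchanges the two kinds, and they overlap in the flat dents at the maximum; hence the count is twice
that of one kind minus that of the flat dents (`ncard_wordsOfExcess`).

Read from left to right, polygons are words of pairs of increments, accepted by finite automata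
together with the height `n` of the current column. The generating functions satisfy linear
recurrences in families indexed by `n`, and each letter contributes a factor `x`, so the solutions
are unique (`eq_of_recurrence`). Since `SP = u * v`, one has `x = u * (1 - v)` and `y = v * (1 -
u)`. In these parameters the characteristic roots are rational, except for the pair `1 / (1 ± √x)`,
which the sequences `K` and `J` encode rationally. The recurrences are then solved by exhibiting
solutions in the span of nine sequences and checking rational identities for their coefficients.

Both sides of the main formula become the rational function `topIndentRational u v`: the generating
function by evaluating closed forms at height one, the expression by splitting the arguments of `E`
into parts of even and odd degree. On the diagonal `x = y = t` one has `u = v = c`, `t = c * (1 -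
c)` and `√(1 - 4t) = 1 - 2c`, which turns Lin's formula into a rational identity in `c`. -/

/-- The horizontal edge from `(i, j)` to `(i + 1, j)` belongs to `P`. -/
def hAdj (P : squareLattice.Subgraph) (i j : ℤ) : Prop := P.Adj (i, j) (i + 1, j)

/-- The vertical edge from `(i, j)` to `(i, j + 1)` belongs to `P`. -/
def vAdj (P : squareLattice.Subgraph) (i j : ℤ) : Prop := P.Adj (i, j) (i, j + 1)

theorem squareLattice_adj_iff {a b : ℤ × ℤ} : squareLattice.Adj a b ↔
    b = (a.1 + 1, a.2) ∨ b = (a.1 - 1, a.2) ∨ b = (a.1, a.2 + 1) ∨ b = (a.1, a.2 - 1) := by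
  obtain ⟨a1, a2⟩ := a
  obtain ⟨b1, b2⟩ := b
  simp only [squareLattice, Prod.mk.injEq, abs_eq zero_le_one]
  omega

theorem adj_iff_hAdj_vAdj {P : squareLattice.Subgraph} {a b : ℤ × ℤ} : P.Adj a b ↔
    (b = (a.1 + 1, a.2) ∧ hAdj P a.1 a.2) ∨ (b = (a.1 - 1, a.2) ∧ hAdj P (a.1 - 1) a.2) ∨
    (b = (a.1, a.2 + 1) ∧ vAdj P a.1 a.2) ∨ (b = (a.1, a.2 - 1) ∧ vAdj P a.1 (a.2 - 1)) := by
  obtain ⟨a1, a2⟩ := a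
  constructor
  · intro h
    rcases squareLattice_adj_iff.1 (P.adj_sub h) with rfl | rfl | rfl | rfl
    · exact Or.inl ⟨rfl, h⟩
    · refine Or.inr (Or.inl ⟨rfl, ?_⟩)
      simpa [hAdj] using h.symm
    · exact Or.inr (Or.inr (Or.inl ⟨rfl, h⟩))
    · refine Or.inr (Or.inr (Or.inr ⟨rfl, ?_⟩))
      simpa [vAdj] using h.symm
  · rintro (⟨rfl, h⟩ | ⟨rfl, h⟩ | ⟨rfl, h⟩ | ⟨rfl, h⟩)
    · exact h
    · simpa [hAdj] using (show P.Adj _ _ from h).symm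
    · exact h
    · simpa [vAdj] using (show P.Adj _ _ from h).symm

/-- A polygon is the same as a finite connected subgraph in which all degrees are two. -/
structure IsTwoRegular (P : squareLattice.Subgraph) : Prop where
  finite : P.verts.Finite
  connected : P.Connected
  degree : ∀ a ∈ P.verts, (P.neighborSet a).ncard = 2

/-- For the converse, a finite graph with all degrees two has a cycle through all vertices of a
component. Connectedness makes this cycle spanning, and since it already uses two edges at every
vertex, no edge of `P` is left over. -/
theorem isPolygon_iff {P : squareLattice.Subgraph} : IsPolygon P ↔ IsTwoRegular P := by
  constructor
  · rintro ⟨a, c, hc, rfl⟩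
    refine ⟨?_, c.toSubgraph_connected, fun b hb => ?_⟩
    · rw [Walk.verts_toSubgraph]
      exact c.support.finite_toSet
    · exact hc.ncard_neighborSet_toSubgraph_eq_two (c.mem_verts_toSubgraph.1 hb)
  · intro hP
    have : Finite P.verts := hP.finite
    have hdeg : ∀ a : P.verts, (P.coe.neighborSet a).ncard = 2 := by
      intro a
      rw [← hP.degree a a.2]
      refine Set.ncard_congr (fun b _ => (b : ℤ × ℤ)) (fun b hb => hb)
        (fun b c _ _ h => Subtype.ext h) (fun b hb => ⟨⟨b, P.edge_vert hb.symm⟩, hb, rfl⟩)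
    have hcyc : P.coe.IsCycles := fun a _ => hdeg a
    obtain ⟨a0⟩ := hP.connected.coe.nonempty
    obtain ⟨p, hp, hverts⟩ := hcyc.exists_cycle_toSubgraph_verts_eq_connectedComponentSupp
      (v := a0) (c := P.coe.connectedComponentMk a0) rfl
      (Set.nonempty_of_ncard_ne_zero (by rw [hdeg]; norm_num))
    have htop : ∀ a, a ∈ p.toSubgraph.verts := by
      intro a
      rw [hverts, ConnectedComponent.mem_supp_iff, ConnectedComponent.eq]
      exact hP.connected.coe.preconnected a a0
    refine ⟨_, p.map P.hom, hp.map Subtype.val_injective, ?_⟩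
    have : ∀ a b, p.toSubgraph.Adj a b ↔ P.coe.Adj a b := by
      intro a b
      classical
      have : P.coe.LocallyFinite := fun v => Fintype.ofFinite _
      exact hp.adj_toSubgraph_iff_of_isCycles hcyc (htop a) b
    rw [Walk.toSubgraph_map]
    refine Subgraph.ext ?_ ?_
    · ext a
      simp only [Subgraph.map_verts, Set.mem_image]
      constructor
      · rintro ⟨b, -, rfl⟩
        exact b.2
      · intro ha
        exact ⟨⟨a, ha⟩, htop _, rfl⟩
    · ext a b
      simp only [Subgraph.map_adj, Relation.Map]
      constructor
      · rintro ⟨a', b', h, rfl, rfl⟩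
        exact (this _ _).1 h
      · intro h
        exact ⟨⟨a, P.edge_vert h⟩, ⟨b, P.edge_vert h.symm⟩, (this _ _).2 h, rfl, rfl⟩

open scoped Classical in
theorem ncard_neighborSet (P : squareLattice.Subgraph) (i j : ℤ) :
    (P.neighborSet (i, j)).ncard = (if hAdj P i j then 1 else 0) +
      (if hAdj P (i - 1) j then 1 else 0) + (if vAdj P i j then 1 else 0) +
      (if vAdj P i (j - 1) then 1 else 0) := by
  have : P.neighborSet (i, j) = (({(i + 1, j), (i - 1, j), (i, j + 1), (i, j - 1)} :
      Finset (ℤ × ℤ)).filter fun b => P.Adj (i, j) b : Finset (ℤ × ℤ)) := by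
    ext b
    simp only [Subgraph.mem_neighborSet, Finset.coe_filter, Finset.mem_insert,
      Finset.mem_singleton, Set.mem_ofPred_eq]
    exact ⟨fun h => ⟨squareLattice_adj_iff.1 (P.adj_sub h), h⟩, fun h => h.2⟩
  rw [this, Set.ncard_coe_finset, Finset.card_filter]
  rw [Finset.sum_insert, Finset.sum_insert, Finset.sum_insert, Finset.sum_singleton]
  · have h1 : P.Adj (i, j) (i - 1, j) ↔ hAdj P (i - 1) j := by
      rw [hAdj, P.adj_comm]; simp
    have h2 : P.Adj (i, j) (i, j - 1) ↔ vAdj P i (j - 1) := by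
      rw [vAdj, P.adj_comm]; simp
    simp only [h1, h2]
    simp only [hAdj, vAdj, add_assoc]
    congr!
  all_goals simp
  all_goals omega

theorem IsTwoRegular.mem_verts_iff {P : squareLattice.Subgraph} (hP : IsTwoRegular P) {a : ℤ × ℤ} :
    a ∈ P.verts ↔ hAdj P a.1 a.2 ∨ hAdj P (a.1 - 1) a.2 ∨ vAdj P a.1 a.2 ∨ vAdj P a.1 (a.2 - 1) := by
  constructor
  · intro h
    obtain ⟨b, hb⟩ := Set.nonempty_of_ncard_ne_zero (by rw [hP.degree a h]; norm_num)
    rcases adj_iff_hAdj_vAdj.1 hb with ⟨-, h⟩ | ⟨-, h⟩ | ⟨-, h⟩ | ⟨-, h⟩ <;> tauto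
  · rintro (h | h | h | h)
    · exact P.edge_vert h
    · simpa using P.edge_vert h.symm
    · exact P.edge_vert h
    · simpa using P.edge_vert h.symm

theorem IsTwoRegular.ext {P Q : squareLattice.Subgraph} (hP : IsTwoRegular P)
    (hQ : IsTwoRegular Q) (hh : ∀ i j, hAdj P i j ↔ hAdj Q i j)
    (hv : ∀ i j, vAdj P i j ↔ vAdj Q i j) : P = Q := by
  refine Subgraph.ext ?_ ?_
  · ext a
    rw [hP.mem_verts_iff, hQ.mem_verts_iff, hh, hh, hv, hv]
  · ext a b
    rw [adj_iff_hAdj_vAdj, adj_iff_hAdj_vAdj, hh, hh, hv, hv]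

/-- In a two-regular graph every vertex sees an even number of edges. -/
theorem IsTwoRegular.vertex_parity {P : squareLattice.Subgraph} (hP : IsTwoRegular P) (i j : ℤ) :
    (vAdj P i (j - 1) ↔ vAdj P i j) ↔ (hAdj P (i - 1) j ↔ hAdj P i j) := by
  classical
  by_cases h : (i, j) ∈ P.verts
  · have h1 := hP.degree _ h
    rw [ncard_neighborSet] at h1
    by_cases h2 : hAdj P i j <;> by_cases h3 : hAdj P (i - 1) j <;> by_cases h4 : vAdj P i j <;>
      by_cases h5 : vAdj P i (j - 1) <;> simp [h2, h3, h4, h5] at h1 ⊢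
  · rw [hP.mem_verts_iff] at h
    simp only [not_or] at h
    obtain ⟨h1, h2, h3, h4⟩ := h
    simp [h1, h2, h3, h4]

/-- A set of vertices of a connected graph that no edge leaves is everything or nothing. -/
theorem IsTwoRegular.closed_set {P : squareLattice.Subgraph} (hP : IsTwoRegular P)
    (S : Set (ℤ × ℤ)) (hS : ∀ a b, P.Adj a b → a ∈ S → b ∈ S) {a b : ℤ × ℤ} (ha : a ∈ P.verts)
    (hb : b ∈ P.verts) (haS : a ∈ S) : b ∈ S := by
  obtain ⟨p⟩ := hP.connected.coe.preconnected ⟨a, ha⟩ ⟨b, hb⟩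
  have : ∀ (c d : P.verts) (_ : P.coe.Walk c d), (c : ℤ × ℤ) ∈ S → (d : ℤ × ℤ) ∈ S := by
    intro c d q
    induction q with
    | nil => exact id
    | cons h _ ih => exact fun hc => ih (hS _ _ h hc)
  exact this _ _ p haS

/-! ### Transposition -/

/-- The reflection of a subgraph in the diagonal. -/
def transpose (P : squareLattice.Subgraph) : squareLattice.Subgraph where
  verts := {a | a.swap ∈ P.verts}
  Adj a b := P.Adj a.swap b.swap
  adj_sub := fun {a b} h => by
    have := squareLattice_adj_iff.1 (P.adj_sub h)
    rw [squareLattice_adj_iff]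
    obtain ⟨a1, a2⟩ := a
    obtain ⟨b1, b2⟩ := b
    simp only [Prod.swap_prod_mk, Prod.mk.injEq] at this ⊢
    tauto
  edge_vert := fun {a b} h => P.edge_vert h
  symm := ⟨fun _ _ h => Subgraph.Adj.symm h⟩

@[simp] theorem transpose_transpose (P : squareLattice.Subgraph) : transpose (transpose P) = P := rfl

@[simp] theorem hAdj_transpose {P : squareLattice.Subgraph} {i j : ℤ} :
    hAdj (transpose P) i j ↔ vAdj P j i := Iff.rfl

@[simp] theorem vAdj_transpose {P : squareLattice.Subgraph} {i j : ℤ} :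
    vAdj (transpose P) i j ↔ hAdj P j i := Iff.rfl

theorem isPolygon_transpose {P : squareLattice.Subgraph} (hP : IsPolygon P) :
    IsPolygon (transpose P) := by
  obtain ⟨a, c, hc, rfl⟩ := hP
  have hsw : ∀ {a b : ℤ × ℤ}, squareLattice.Adj a b → squareLattice.Adj a.swap b.swap := by
    intro a b h
    rw [squareLattice_adj_iff] at h ⊢
    obtain ⟨a1, a2⟩ := a
    obtain ⟨b1, b2⟩ := b
    simp only [Prod.swap_prod_mk, Prod.mk.injEq] at h ⊢
    tauto
  let f : squareLattice →g squareLattice := ⟨Prod.swap, hsw⟩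
  refine ⟨_, c.map f, hc.map Prod.swap_injective, ?_⟩
  rw [Walk.toSubgraph_map]
  refine Subgraph.ext ?_ ?_
  · ext a
    constructor
    · rintro ⟨b, hb, rfl⟩
      exact hb
    · exact fun h => ⟨a.swap, h, rfl⟩
  · ext a b
    constructor
    · rintro ⟨a', b', h, rfl, rfl⟩
      exact h
    · exact fun h => ⟨a.swap, b.swap, h, rfl, rfl⟩

theorem IsTwoRegular.transpose {P : squareLattice.Subgraph} (hP : IsTwoRegular P) :
    IsTwoRegular (transpose P) :=
  isPolygon_iff.1 (isPolygon_transpose (isPolygon_iff.2 hP))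

theorem HasBoundingRectangle.transpose {P : squareLattice.Subgraph} {w h : ℕ}
    (hP : HasBoundingRectangle P w h) : HasBoundingRectangle (transpose P) h w := by
  have h1 : Prod.fst '' (AlmostConvex.transpose P).verts = Prod.snd '' P.verts := by
    ext k
    constructor
    · rintro ⟨a, ha, rfl⟩
      exact ⟨a.swap, ha, rfl⟩
    · rintro ⟨a, ha, rfl⟩
      exact ⟨a.swap, ha, rfl⟩
  have h2 : Prod.snd '' (AlmostConvex.transpose P).verts = Prod.fst '' P.verts := by
    ext k
    constructor
    · rintro ⟨a, ha, rfl⟩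
      exact ⟨a.swap, ha, rfl⟩
    · rintro ⟨a, ha, rfl⟩
      exact ⟨a.swap, ha, rfl⟩
  unfold HasBoundingRectangle
  rw [h1, h2]
  exact ⟨hP.2.2.1, hP.2.2.2, hP.1, hP.2.1⟩

/-! ### Crossing numbers of columns and rows -/

/-- The heights of the horizontal edges of `P` in the column between `i` and `i + 1`. -/
def hSet (P : squareLattice.Subgraph) (i : ℤ) : Set ℤ := {j | hAdj P i j}

theorem HasBoundingRectangle.bounds {P : squareLattice.Subgraph} {w h : ℕ}
    (hP : HasBoundingRectangle P w h) {a : ℤ × ℤ} (ha : a ∈ P.verts) :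
    0 ≤ a.1 ∧ a.1 ≤ w ∧ 0 ≤ a.2 ∧ a.2 ≤ h :=
  ⟨hP.1.2 ⟨a, ha, rfl⟩, hP.2.1.2 ⟨a, ha, rfl⟩, hP.2.2.1.2 ⟨a, ha, rfl⟩, hP.2.2.2.2 ⟨a, ha, rfl⟩⟩

theorem HasBoundingRectangle.hAdj_bounds {P : squareLattice.Subgraph} {w h : ℕ}
    (hP : HasBoundingRectangle P w h) {i j : ℤ} (hij : hAdj P i j) :
    0 ≤ i ∧ i < w ∧ 0 ≤ j ∧ j ≤ h := by
  have h1 := hP.bounds (P.edge_vert hij)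
  have h2 := hP.bounds (P.edge_vert (Subgraph.Adj.symm hij))
  simp only at h1 h2
  omega

theorem HasBoundingRectangle.vAdj_bounds {P : squareLattice.Subgraph} {w h : ℕ}
    (hP : HasBoundingRectangle P w h) {i j : ℤ} (hij : vAdj P i j) :
    0 ≤ i ∧ i ≤ w ∧ 0 ≤ j ∧ j < h := by
  have h1 := hP.bounds (P.edge_vert hij)
  have h2 := hP.bounds (P.edge_vert (Subgraph.Adj.symm hij))
  simp only at h1 h2
  omega

theorem HasBoundingRectangle.finite_hSet {P : squareLattice.Subgraph} {w h : ℕ}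
    (hP : HasBoundingRectangle P w h) (i : ℤ) : (hSet P i).Finite :=
  (Set.finite_Icc (0 : ℤ) h).subset fun _ hj =>
    ⟨(hP.hAdj_bounds (i := i) hj).2.2.1, (hP.hAdj_bounds (i := i) hj).2.2.2⟩

/-- A discrete Jordan curve argument: the cell with lower left corner `(a, j)` is inside if an odd
number of horizontal edges of its column lies at height at most `j`, and a vertical edge is present
exactly between an inner and an outer cell. The induction climbs the line `a` vertex by vertex, with
`vertex_parity` at each of them. -/
theorem vAdj_iff_parity {P : squareLattice.Subgraph} {w h : ℕ} (hP : IsTwoRegular P)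
    (hR : HasBoundingRectangle P w h) (a j : ℤ) :
    vAdj P a j ↔ ¬ (Even (hSet P (a - 1) ∩ Set.Iic j).ncard ↔ Even (hSet P a ∩ Set.Iic j).ncard) := by
  classical
  have hstep : ∀ i j, (hSet P i ∩ Set.Iic j).ncard =
      (hSet P i ∩ Set.Iic (j - 1)).ncard + if hAdj P i j then 1 else 0 := by
    intro i j
    have hfin : (hSet P i ∩ Set.Iic (j - 1)).Finite := (hR.finite_hSet i).inter_of_left _
    by_cases hij : hAdj P i j
    · rw [if_pos hij, ← Set.ncard_insert_of_notMem (a := j) (by simp) hfin]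
      congr 1
      ext k
      simp only [Set.mem_inter_iff, Set.mem_Iic, Set.mem_insert_iff]
      constructor
      · rintro ⟨h1, h2⟩
        by_cases hk : k = j
        · exact Or.inl hk
        · exact Or.inr ⟨h1, by omega⟩
      · rintro (rfl | ⟨h1, h2⟩)
        · exact ⟨hij, le_rfl⟩
        · exact ⟨h1, by omega⟩
    · rw [if_neg hij, add_zero]
      congr 1
      ext k
      simp only [Set.mem_inter_iff, Set.mem_Iic]
      constructor
      · rintro ⟨h1, h2⟩
        refine ⟨h1, ?_⟩
        have : k ≠ j := by
          rintro rfl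
          exact hij h1
        omega
      · rintro ⟨h1, h2⟩
        exact ⟨h1, by omega⟩
  have hneg : ∀ i j, j < 0 → (hSet P i ∩ Set.Iic j).ncard = 0 := by
    intro i j hj
    rw [Set.ncard_eq_zero ((hR.finite_hSet i).inter_of_left _), Set.eq_empty_iff_forall_notMem]
    rintro k ⟨h1, h2⟩
    have := (hR.hAdj_bounds (i := i) h1).2.2.1
    simp only [Set.mem_Iic] at h2
    omega
  -- Below the rectangle there are no edges at all, so the induction on `j` can start at `-1`.
  by_cases hj : j < 0
  · rw [hneg _ _ hj, hneg _ _ hj]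
    have : ¬ vAdj P a j := fun h => by
      have := (hR.vAdj_bounds h).2.2.1
      omega
    simp [this]
  · have hj' : -1 ≤ j := by omega
    clear hj
    induction j, hj' using Int.leInduction with
    | base =>
      rw [hneg _ _ (by norm_num), hneg _ _ (by norm_num)]
      have : ¬ vAdj P a (-1) := fun h => by
        have := (hR.vAdj_bounds h).2.2.1
        omega
      simp [this]
    | succ j _ ih =>
      have h1 := hP.vertex_parity a (j + 1)
      rw [hstep (a - 1) (j + 1), hstep a (j + 1)]
      rw [add_sub_cancel_right] at h1 ⊢
      by_cases h2 : hAdj P (a - 1) (j + 1) <;> by_cases h3 : hAdj P a (j + 1) <;>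
        simp only [h2, h3, if_true, if_false, Nat.even_add_one, add_zero] at h1 ⊢ <;> tauto

/-- No vertical edge starts at the height `h` of the top side, so by `vAdj_iff_parity` neighbouring
columns have crossing numbers of equal parity; the column left of the rectangle is empty. -/
theorem even_ncard_hSet {P : squareLattice.Subgraph} {w h : ℕ} (hP : IsTwoRegular P)
    (hR : HasBoundingRectangle P w h) (i : ℤ) : Even (hSet P i).ncard := by
  have hall : ∀ i, hSet P i ∩ Set.Iic (h : ℤ) = hSet P i := fun i =>
    Set.inter_eq_left.2 fun _ hj => (hR.hAdj_bounds (i := i) hj).2.2.2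
  have hneg : ∀ i < 0, (hSet P i).ncard = 0 := by
    intro i hi
    rw [Set.ncard_eq_zero (hR.finite_hSet i), Set.eq_empty_iff_forall_notMem]
    intro k hk
    have := (hR.hAdj_bounds (i := i) hk).1
    omega
  by_cases hi : i < 0
  · simp [hneg i hi]
  · have hi' : -1 ≤ i := by omega
    clear hi
    induction i, hi' using Int.leInduction with
    | base => simp [hneg (-1) (by norm_num)]
    | succ i _ ih =>
      have h1 := vAdj_iff_parity hP hR (i + 1) h
      have h2 : ¬ vAdj P (i + 1) h := fun h => by
        have := (hR.vAdj_bounds h).2.2.2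
        omega
      rw [hall, hall, add_sub_cancel_right] at h1
      tauto

/-- If the column were not crossed, no edge would leave the set of vertices to its left, which
contradicts connectedness because both vertical sides of the rectangle are met. Parity improves one
crossing to two. -/
theorem two_le_ncard_hSet {P : squareLattice.Subgraph} {w h : ℕ} (hP : IsTwoRegular P)
    (hR : HasBoundingRectangle P w h) {i : ℤ} (h0 : 0 ≤ i) (hw : i < w) :
    2 ≤ (hSet P i).ncard := by
  obtain ⟨a, ha, ha0⟩ := hR.1.1
  obtain ⟨b, hb, hbw⟩ := hR.2.1.1
  have hne : (hSet P i).Nonempty := by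
    by_contra hcon
    rw [Set.not_nonempty_iff_eq_empty, Set.eq_empty_iff_forall_notMem] at hcon
    have := hP.closed_set {c | c.1 ≤ i} ?_ ha hb (by simp only [Set.mem_ofPred_eq]; omega)
    · simp only [Set.mem_ofPred_eq] at this
      omega
    · intro c d hcd hc
      simp only [Set.mem_ofPred_eq] at hc ⊢
      rcases adj_iff_hAdj_vAdj.1 hcd with ⟨rfl, h⟩ | ⟨rfl, -⟩ | ⟨rfl, -⟩ | ⟨rfl, -⟩
      · have : c.1 ≠ i := by
          rintro rfl
          exact hcon _ h
        simp only
        omega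
      all_goals simp only; omega
  have h1 := (Set.ncard_pos (hR.finite_hSet i)).2 hne
  obtain ⟨k, hk⟩ := even_ncard_hSet hP hR i
  omega

theorem ncard_horizontalSteps {P : squareLattice.Subgraph} {w h : ℕ}
    (hR : HasBoundingRectangle P w h) :
    (horizontalSteps P).ncard = ∑ i ∈ Finset.Ico (0 : ℤ) w, (hSet P i).ncard := by
  classical
  set f : ℤ × ℤ → Sym2 (ℤ × ℤ) := fun p => s((p.1, p.2), (p.1 + 1, p.2)) with hf
  have hinj : Function.Injective f := by
    rintro ⟨i, j⟩ ⟨k, l⟩ h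
    simp only [hf, Sym2.eq_iff, Prod.mk.injEq] at h ⊢
    omega
  have himg : horizontalSteps P = f '' {p | hAdj P p.1 p.2} := by
    ext e
    constructor
    · rintro ⟨he, i, j, rfl⟩
      exact ⟨(i, j), he, rfl⟩
    · rintro ⟨⟨i, j⟩, h, rfl⟩
      exact ⟨h, i, j, rfl⟩
  have hfin : {p : ℤ × ℤ | hAdj P p.1 p.2}.Finite :=
    ((Set.finite_Icc (0 : ℤ) w).prod (Set.finite_Icc (0 : ℤ) h)).subset fun p hp => by
      have := hR.hAdj_bounds (i := p.1) (j := p.2) hp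
      simp only [Set.mem_prod, Set.mem_Icc]
      omega
  rw [himg, Set.ncard_image_of_injective _ hinj, Set.ncard_eq_toFinset_card _ hfin,
    Finset.card_eq_sum_card_fiberwise (f := Prod.fst) (t := Finset.Ico (0 : ℤ) w)]
  · refine Finset.sum_congr rfl fun i _ => ?_
    rw [← Set.ncard_coe_finset]
    refine Set.ncard_congr (fun p _ => p.2) ?_ ?_ ?_
    · rintro ⟨k, l⟩ hp
      simp only [Finset.coe_filter, Set.Finite.mem_toFinset, Set.mem_ofPred_eq] at hp
      obtain ⟨hp, rfl⟩ := hp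
      exact hp
    · rintro ⟨k, l⟩ ⟨k', l'⟩ hp hp' h
      simp only [Finset.coe_filter, Set.Finite.mem_toFinset, Set.mem_ofPred_eq] at hp hp'
      simp only [Prod.mk.injEq]
      simp only at h
      omega
    · intro j hj
      exact ⟨(i, j), by simpa using (show hAdj P i j from hj), rfl⟩
  · intro p hp
    have := hR.hAdj_bounds (i := p.1) (j := p.2) (by simpa using hp)
    simp only [Finset.coe_Ico, Set.mem_Ico]
    omega

theorem ncard_verticalSteps (P : squareLattice.Subgraph) :
    (verticalSteps P).ncard = (horizontalSteps (transpose P)).ncard := by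
  refine Set.ncard_congr (fun e _ => e.map Prod.swap) ?_ ?_ ?_
  · rintro e ⟨he, i, j, rfl⟩
    exact ⟨he, j, i, rfl⟩
  · intro e e' _ _ h
    exact Sym2.map.injective Prod.swap_injective h
  · rintro e ⟨he, i, j, rfl⟩
    exact ⟨s((j, i), (j, i + 1)), ⟨he, j, i, rfl⟩, rfl⟩

theorem ncard_edgeSet {P : squareLattice.Subgraph} (hP : IsPolygon P) :
    P.edgeSet.ncard = (horizontalSteps P).ncard + (verticalSteps P).ncard := by
  have hf := hP.finite_edgeSet
  rw [← Set.ncard_union_eq ?_ (hf.subset fun e he => he.1) (hf.subset fun e he => he.1)]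
  · congr 1
    ext e
    constructor
    · intro he
      induction e with
      | _ a b =>
        obtain ⟨a1, a2⟩ := a
        obtain ⟨b1, b2⟩ := b
        have hab := adj_iff_hAdj_vAdj.1 (show P.Adj (a1, a2) (b1, b2) from he)
        simp only [Prod.mk.injEq] at hab
        rcases hab with ⟨⟨rfl, rfl⟩, -⟩ | ⟨⟨rfl, rfl⟩, -⟩ | ⟨⟨rfl, rfl⟩, -⟩ | ⟨⟨rfl, rfl⟩, -⟩
        · exact Or.inl ⟨he, _, _, rfl⟩
        · exact Or.inl ⟨he, a1 - 1, _, by rw [Sym2.eq_swap, sub_add_cancel]⟩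
        · exact Or.inr ⟨he, _, _, rfl⟩
        · exact Or.inr ⟨he, _, a2 - 1, by rw [Sym2.eq_swap, sub_add_cancel]⟩
    · rintro (h | h) <;> exact h.1
  · rw [Set.disjoint_left]
    rintro e ⟨-, i, j, rfl⟩ ⟨-, k, l, h⟩
    simp only [Sym2.eq_iff, Prod.mk.injEq] at h
    omega

/-- A sum of even numbers which are at least two. -/
theorem sum_even_ge_two {s : Finset ℤ} {f : ℤ → ℕ} (h2 : ∀ i ∈ s, 2 ≤ f i)
    (he : ∀ i ∈ s, Even (f i)) :
    Even (∑ i ∈ s, f i) ∧ 2 * s.card ≤ ∑ i ∈ s, f i ∧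
      (∑ i ∈ s, f i = 2 * s.card → ∀ i ∈ s, f i = 2) := by
  refine ⟨Finset.even_sum _ he, ?_, ?_⟩
  · rw [mul_comm, ← smul_eq_mul]
    exact Finset.card_nsmul_le_sum _ _ _ h2
  · intro h i hi
    by_contra hne
    have : ∑ _i ∈ s, 2 < ∑ i ∈ s, f i :=
      Finset.sum_lt_sum h2 ⟨i, hi, lt_of_le_of_ne (h2 i hi) (Ne.symm hne)⟩
    rw [Finset.sum_const, smul_eq_mul, h] at this
    omega

/-- In a 1-convex polygon either all columns or all rows are convex. -/
theorem IsConvexOfIndex.cases {P : squareLattice.Subgraph} {w h : ℕ}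
    (hP : IsConvexOfIndex 1 P w h) :
    ((horizontalSteps P).ncard = 2 * w ∧ (verticalSteps P).ncard = 2 * h + 2) ∨
    ((horizontalSteps P).ncard = 2 * w + 2 ∧ (verticalSteps P).ncard = 2 * h) := by
  have hT := isPolygon_iff.1 hP.polygon
  have hR := hP.rectangle
  have h1 := hP.perimeter
  rw [ncard_edgeSet hP.polygon] at h1
  have key : ∀ {Q : squareLattice.Subgraph} {w h : ℕ}, IsTwoRegular Q →
      HasBoundingRectangle Q w h →
      Even (horizontalSteps Q).ncard ∧ 2 * w ≤ (horizontalSteps Q).ncard := by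
    intro Q w h hQ hR
    have := sum_even_ge_two (s := Finset.Ico (0 : ℤ) w) (f := fun i => (hSet Q i).ncard)
      (fun i hi => two_le_ncard_hSet hQ hR (Finset.mem_Ico.1 hi).1 (Finset.mem_Ico.1 hi).2)
      (fun i _ => even_ncard_hSet hQ hR i)
    rw [ncard_horizontalSteps hR]
    rw [Int.card_Ico, sub_zero, Int.toNat_natCast] at this
    exact ⟨this.1, this.2.1⟩
  obtain ⟨⟨a, ha⟩, h3⟩ := key hT hR
  obtain ⟨⟨b, hb⟩, h5⟩ := key hT.transpose hR.transpose
  rw [← ncard_verticalSteps] at hb h5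
  omega

theorem ncard_hSet_eq_two {P : squareLattice.Subgraph} {w h : ℕ} (hP : IsTwoRegular P)
    (hR : HasBoundingRectangle P w h) (hw : (horizontalSteps P).ncard = 2 * w) {i : ℤ}
    (h0 : 0 ≤ i) (hi : i < w) : (hSet P i).ncard = 2 := by
  have := sum_even_ge_two (s := Finset.Ico (0 : ℤ) w) (f := fun i => (hSet P i).ncard)
      (fun i hi => two_le_ncard_hSet hP hR (Finset.mem_Ico.1 hi).1 (Finset.mem_Ico.1 hi).2)
      (fun i _ => even_ncard_hSet hP hR i)
  refine this.2.2 ?_ i (Finset.mem_Ico.2 ⟨h0, hi⟩)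
  rw [← ncard_horizontalSteps hR, hw]
  simp

/-! ### Column-convex polygons and their profiles -/

/-- `B` and `T` are the lower and upper profile of a column-convex polygon of width `w`; outside
of the columns `0, …, w - 1` both are continued by the first and last value of `B`. -/
structure Profile (w : ℕ) (B T : ℤ → ℤ) : Prop where
  pos : 0 < w
  lt : ∀ i : ℤ, 0 ≤ i → i < w → B i < T i
  overlap : ∀ i : ℤ, 0 < i → i < w → B (i - 1) < T i ∧ B i < T (i - 1)
  left : ∀ i : ℤ, i < 0 → B i = B 0 ∧ T i = B 0
  right : ∀ i : ℤ, w ≤ i → B i = B (w - 1) ∧ T i = B (w - 1)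

namespace Profile

variable {w : ℕ} {B T : ℤ → ℤ}

theorem le (hp : Profile w B T) (i : ℤ) : B i ≤ T i := by
  by_cases h0 : i < 0
  · have := hp.left i h0; omega
  by_cases h1 : i < w
  · exact (hp.lt i (by omega) h1).le
  · have := hp.right i (by omega); omega

theorem overlap_le (hp : Profile w B T) (i : ℤ) : B (i - 1) ≤ T i ∧ B i ≤ T (i - 1) := by
  have hpos := hp.pos
  by_cases h0 : i < 0
  · have h1 := hp.left i h0
    have h2 := hp.left (i - 1) (by omega)
    omega
  by_cases h1 : i = 0
  · subst h1
    have h1 := hp.left (0 - 1) (by omega)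
    have := hp.le 0
    omega
  by_cases h2 : i < w
  · have := hp.overlap i (by omega) h2
    omega
  · by_cases h3 : i = w
    · subst h3
      have h1 := hp.right w le_rfl
      have := hp.le (w - 1)
      omega
    · have h1 := hp.right i (by omega)
      have h2 := hp.right (i - 1) (by omega)
      omega

end Profile

/-- The subgraph with prescribed horizontal and vertical edges. -/
def ofEdges (H V : ℤ → ℤ → Prop) : squareLattice.Subgraph where
  Adj a b := (b = (a.1 + 1, a.2) ∧ H a.1 a.2) ∨ (b = (a.1 - 1, a.2) ∧ H (a.1 - 1) a.2) ∨
    (b = (a.1, a.2 + 1) ∧ V a.1 a.2) ∨ (b = (a.1, a.2 - 1) ∧ V a.1 (a.2 - 1))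
  verts := {a | H a.1 a.2 ∨ H (a.1 - 1) a.2 ∨ V a.1 a.2 ∨ V a.1 (a.2 - 1)}
  adj_sub := fun {a b} h => squareLattice_adj_iff.2 (by tauto)
  edge_vert := fun {a b} h => by
    simp only [Set.mem_ofPred_eq]
    tauto
  symm := ⟨fun a b h => by
    rcases h with ⟨rfl, h⟩ | ⟨rfl, h⟩ | ⟨rfl, h⟩ | ⟨rfl, h⟩
    · right; left; simpa using h
    · left; simpa using h
    · right; right; right; simpa using h
    · right; right; left; simpa using h⟩

@[simp] theorem hAdj_ofEdges {H V : ℤ → ℤ → Prop} {i j : ℤ} : hAdj (ofEdges H V) i j ↔ H i j := by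
  simp [hAdj, ofEdges]
  omega

@[simp] theorem vAdj_ofEdges {H V : ℤ → ℤ → Prop} {i j : ℤ} : vAdj (ofEdges H V) i j ↔ V i j := by
  simp [vAdj, ofEdges]
  omega

/-- The polygon with lower profile `B` and upper profile `T`. -/
def profileGraph (w : ℕ) (B T : ℤ → ℤ) : squareLattice.Subgraph :=
  ofEdges (fun i j => 0 ≤ i ∧ i < w ∧ (j = B i ∨ j = T i))
    (fun i j => (min (B (i - 1)) (B i) ≤ j ∧ j < max (B (i - 1)) (B i)) ∨
      (min (T (i - 1)) (T i) ≤ j ∧ j < max (T (i - 1)) (T i)))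

namespace Profile

variable {w : ℕ} {B T : ℤ → ℤ}

theorem hAdj_iff {i j : ℤ} :
    hAdj (profileGraph w B T) i j ↔ 0 ≤ i ∧ i < w ∧ (j = B i ∨ j = T i) := hAdj_ofEdges

theorem vAdj_iff {i j : ℤ} : vAdj (profileGraph w B T) i j ↔
    (min (B (i - 1)) (B i) ≤ j ∧ j < max (B (i - 1)) (B i)) ∨
      (min (T (i - 1)) (T i) ≤ j ∧ j < max (T (i - 1)) (T i)) := vAdj_ofEdges

/-- The graph is the boundary of the region of all cells `(i, j)` with `B i ≤ j < T i`: an edge is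
present exactly if one of its two cells is inside. Outside the columns `0, …, w - 1` the continued
profiles coincide, so no cell there is inside. -/
theorem hAdj_iff_cells (hp : Profile w B T) {i j : ℤ} : hAdj (profileGraph w B T) i j ↔
    ¬ ((B i ≤ j - 1 ∧ j - 1 < T i) ↔ (B i ≤ j ∧ j < T i)) := by
  rw [hAdj_iff]
  by_cases h0 : i < 0
  · have := hp.left i h0; omega
  by_cases h1 : i < w
  · have := hp.lt i (by omega) h1; omega
  · have := hp.right i (by omega); omega

theorem vAdj_iff_cells (hp : Profile w B T) {i j : ℤ} : vAdj (profileGraph w B T) i j ↔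
    ¬ ((B (i - 1) ≤ j ∧ j < T (i - 1)) ↔ (B i ≤ j ∧ j < T i)) := by
  rw [vAdj_iff]
  have h1 := hp.overlap_le i
  have h2 := hp.le i
  have h3 := hp.le (i - 1)
  omega

theorem mem_verts_iff (hp : Profile w B T) {a j : ℤ} : (a, j) ∈ (profileGraph w B T).verts ↔
    0 ≤ a ∧ a ≤ w ∧ ((min (B (a - 1)) (B a) ≤ j ∧ j ≤ max (B (a - 1)) (B a)) ∨
      (min (T (a - 1)) (T a) ≤ j ∧ j ≤ max (T (a - 1)) (T a))) := by
  have hpos := hp.pos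
  have h : (a, j) ∈ (profileGraph w B T).verts ↔
      hAdj (profileGraph w B T) a j ∨ hAdj (profileGraph w B T) (a - 1) j ∨
      vAdj (profileGraph w B T) a j ∨ vAdj (profileGraph w B T) a (j - 1) := by
    rw [hAdj_iff, hAdj_iff, vAdj_iff, vAdj_iff]
    rfl
  rw [h, hAdj_iff, hAdj_iff, vAdj_iff, vAdj_iff]
  by_cases h0 : a < 0
  · have h1 := hp.left a h0
    have h2 := hp.left (a - 1) (by omega)
    omega
  by_cases h1 : a ≤ w
  · rcases eq_or_ne a 0 with rfl | h2
    · have h3 := hp.left (0 - 1) (by omega)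
      have := hp.lt 0 le_rfl (by omega)
      omega
    · rcases eq_or_ne a w with rfl | h3
      · have h3 := hp.right w le_rfl
        have := hp.lt (w - 1) (by omega) (by omega)
        omega
      · omega
  · have h1 := hp.right a (by omega)
    have h2 := hp.right (a - 1) (by omega)
    omega

/-- The degree is the number of changes between inside and outside in the cyclic sequence of the
four cells at the vertex, hence zero, two or four. Zero is excluded for a vertex of the graph, four
by the overlap of neighbouring columns. -/
theorem degree (hp : Profile w B T) {a : ℤ × ℤ} (ha : a ∈ (profileGraph w B T).verts) :
    ((profileGraph w B T).neighborSet a).ncard = 2 := by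
  classical
  obtain ⟨i, j⟩ := a
  have h : hAdj (profileGraph w B T) i j ∨ hAdj (profileGraph w B T) (i - 1) j ∨
      vAdj (profileGraph w B T) i j ∨ vAdj (profileGraph w B T) i (j - 1) := by
    rw [hAdj_iff, hAdj_iff, vAdj_iff, vAdj_iff]
    exact ha
  -- The two checkerboard patterns, where only diagonally opposite cells agree, are the ones of
  -- degree four.
  have hno : ¬ ((B (i - 1) ≤ j - 1 ∧ j - 1 < T (i - 1)) ∧ (B i ≤ j ∧ j < T i) ∧
      ¬ (B (i - 1) ≤ j ∧ j < T (i - 1)) ∧ ¬ (B i ≤ j - 1 ∧ j - 1 < T i)) ∧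
      ¬ (¬ (B (i - 1) ≤ j - 1 ∧ j - 1 < T (i - 1)) ∧ ¬ (B i ≤ j ∧ j < T i) ∧
      (B (i - 1) ≤ j ∧ j < T (i - 1)) ∧ (B i ≤ j - 1 ∧ j - 1 < T i)) := by
    by_cases h0 : i ≤ 0
    · have := hp.left (i - 1) (by omega)
      omega
    by_cases h1 : i < w
    · have := hp.overlap i (by omega) h1
      omega
    · have := hp.right i (by omega)
      omega
  have e1 := hp.hAdj_iff_cells (i := i) (j := j)
  have e2 := hp.hAdj_iff_cells (i := i - 1) (j := j)
  have e3 := hp.vAdj_iff_cells (i := i) (j := j)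
  have e4 := hp.vAdj_iff_cells (i := i) (j := j - 1)
  rw [ncard_neighborSet]
  generalize (B (i - 1) ≤ j - 1 ∧ j - 1 < T (i - 1)) = c1 at hno e1 e2 e3 e4
  generalize (B i ≤ j ∧ j < T i) = c2 at hno e1 e2 e3 e4
  generalize (B (i - 1) ≤ j ∧ j < T (i - 1)) = c3 at hno e1 e2 e3 e4
  generalize (B i ≤ j - 1 ∧ j - 1 < T i) = c4 at hno e1 e2 e3 e4
  by_cases h1 : c1 <;> by_cases h2 : c2 <;> by_cases h3 : c3 <;> by_cases h4 : c4 <;>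
    simp only [h1, h2, h3, h4, not_true_eq_false, iff_true, iff_false,
      not_false_eq_true, iff_self, and_self, and_true, true_and] at hno e1 e2 e3 e4 <;>
    first
    | exact hno.elim
    | (simp only [e1, e2, e3, e4, or_self] at h
       done)
    | simp [e1, e2, e3, e4]

theorem reach_vertical {P : squareLattice.Subgraph} {a j k : ℤ} (hjk : j ≤ k)
    (h : ∀ l, j ≤ l → l < k → vAdj P a l) : Relation.ReflTransGen P.Adj (a, j) (a, k) := by
  induction k, hjk using Int.leInduction with
  | base => exact .refl
  | succ k hk ih =>
    exact (ih fun l h1 h2 => h l h1 (by omega)).tail (h k hk (by omega))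

theorem reach_symm {P : squareLattice.Subgraph} {a b : ℤ × ℤ}
    (h : Relation.ReflTransGen P.Adj a b) : Relation.ReflTransGen P.Adj b a := by
  induction h with
  | refl => exact .refl
  | tail _ h ih => exact Relation.ReflTransGen.head h.symm ih

theorem reach_between {P : squareLattice.Subgraph} {a j k s t : ℤ}
    (h : ∀ l, min s t ≤ l → l < max s t → vAdj P a l) (hj : min s t ≤ j ∧ j ≤ max s t)
    (hk : min s t ≤ k ∧ k ≤ max s t) : Relation.ReflTransGen P.Adj (a, j) (a, k) := by
  rcases le_total j k with hjk | hjk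
  · exact reach_vertical hjk fun l h1 h2 => h l (by omega) (by omega)
  · exact reach_symm (reach_vertical hjk fun l h1 h2 => h l (by omega) (by omega))

theorem reach_arc {P : squareLattice.Subgraph} {F : ℤ → ℤ}
    (hv : ∀ a l : ℤ, min (F (a - 1)) (F a) ≤ l → l < max (F (a - 1)) (F a) → vAdj P a l)
    (hh : ∀ a : ℤ, 0 ≤ a → a < w → hAdj P a (F a)) {a : ℤ} (h0 : 0 ≤ a) (hw : a ≤ w) :
    Relation.ReflTransGen P.Adj (0, F (0 - 1)) (a, F (a - 1)) := by
  induction a, h0 using Int.leInduction with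
  | base => exact .refl
  | succ a ha ih =>
    rw [add_sub_cancel_right]
    have h1 : Relation.ReflTransGen P.Adj (a, F (a - 1)) (a, F a) :=
      reach_between (hv a) (by omega) (by omega)
    exact ((ih (by omega)).trans h1).tail (hh a ha (by omega))

/-- Connectedness: every vertex lies on the lower or the upper arc, and both arcs can be followed
from their common starting point `(0, B 0)`. -/
theorem isTwoRegular (hp : Profile w B T) : IsTwoRegular (profileGraph w B T) := by
  have hpos := hp.pos
  refine ⟨?_, ?_, fun a ha => hp.degree ha⟩
  · refine ((Set.finite_Icc (0 : ℤ) w).biUnion fun a _ =>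
      (((Set.finite_Icc (min (B (a - 1)) (B a)) (max (B (a - 1)) (B a))).union
      (Set.finite_Icc (min (T (a - 1)) (T a)) (max (T (a - 1)) (T a)))).image
        (fun j => (a, j)))).subset ?_
    rintro ⟨a, j⟩ h
    rw [hp.mem_verts_iff] at h
    simp only [Set.mem_iUnion, Set.mem_image, Set.mem_union, Set.mem_Icc, Prod.mk.injEq]
    exact ⟨a, ⟨h.1, h.2.1⟩, j, h.2.2, rfl, rfl⟩
  · have hroot : ∀ a ∈ (profileGraph w B T).verts,
        Relation.ReflTransGen (profileGraph w B T).Adj (0, B 0) a := by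
      rintro ⟨a, j⟩ ha
      rw [hp.mem_verts_iff] at ha
      obtain ⟨h0, hw, h | h⟩ := ha
      · have h1 : Relation.ReflTransGen (profileGraph w B T).Adj _ _ :=
          reach_arc (F := B) (fun a l h1 h2 => vAdj_iff.2 (Or.inl ⟨h1, h2⟩))
            (fun a h1 h2 => hAdj_iff.2 ⟨h1, h2, Or.inl rfl⟩) h0 hw
        rw [(hp.left (0 - 1) (by omega)).1] at h1
        exact h1.trans (reach_between (fun l h1 h2 => vAdj_iff.2 (Or.inl ⟨h1, h2⟩))
          (by omega) h)
      · have h1 : Relation.ReflTransGen (profileGraph w B T).Adj _ _ :=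
          reach_arc (F := T) (fun a l h1 h2 => vAdj_iff.2 (Or.inr ⟨h1, h2⟩))
            (fun a h1 h2 => hAdj_iff.2 ⟨h1, h2, Or.inr rfl⟩) h0 hw
        rw [(hp.left (0 - 1) (by omega)).2] at h1
        exact h1.trans (reach_between (fun l h1 h2 => vAdj_iff.2 (Or.inr ⟨h1, h2⟩))
          (by omega) h)
    have hr : (0, B 0) ∈ (profileGraph w B T).verts :=
      (profileGraph w B T).edge_vert (hAdj_iff.2 ⟨le_rfl, by omega, Or.inl rfl⟩ :
        (profileGraph w B T).Adj (0, B 0) (0 + 1, B 0))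
    have hreach : ∀ b, Relation.ReflTransGen (profileGraph w B T).Adj (0, B 0) b →
        ∃ hb : b ∈ (profileGraph w B T).verts,
          (profileGraph w B T).coe.Reachable ⟨(0, B 0), hr⟩ ⟨b, hb⟩ := by
      intro b hb
      induction hb with
      | refl => exact ⟨hr, Reachable.refl _⟩
      | tail _ h ih =>
        obtain ⟨hc, hc'⟩ := ih
        exact ⟨(profileGraph w B T).edge_vert h.symm, hc'.trans (Adj.reachable (by exact h))⟩
    rw [Subgraph.connected_iff']
    refine @SimpleGraph.Connected.mk _ _ (fun a b => ?_) ⟨⟨_, hr⟩⟩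
    exact (hreach _ (hroot _ a.2)).2.symm.trans (hreach _ (hroot _ b.2)).2

theorem hasBoundingRectangle_iff (hp : Profile w B T) {h : ℕ} :
    HasBoundingRectangle (profileGraph w B T) w h ↔
      ((∀ i : ℤ, 0 ≤ i → i < w → 0 ≤ B i) ∧ (∃ i : ℤ, 0 ≤ i ∧ i < w ∧ B i = 0)) ∧
      ((∀ i : ℤ, 0 ≤ i → i < w → T i ≤ h) ∧ (∃ i : ℤ, 0 ≤ i ∧ i < w ∧ T i = h)) := by
  have hpos := hp.pos
  -- The continued values on both sides are values of `B` in genuine columns, so extreme heights of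
  -- vertices are attained by `B` or `T` in the columns `0, …, w - 1`.
  have hB : ∀ i : ℤ, ∃ k : ℤ, 0 ≤ k ∧ k < w ∧ B i = B k ∧ (T i = T k ∨ T i = B k) := by
    intro i
    by_cases h0 : i < 0
    · exact ⟨0, le_rfl, by omega, (hp.left i h0).1, Or.inr (hp.left i h0).2⟩
    by_cases h1 : i < w
    · exact ⟨i, by omega, h1, rfl, Or.inl rfl⟩
    · exact ⟨w - 1, by omega, by omega, (hp.right i (by omega)).1,
        Or.inr (hp.right i (by omega)).2⟩
  have hmem : ∀ i : ℤ, 0 ≤ i → i < w → (i, B i) ∈ (profileGraph w B T).verts ∧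
      (i, T i) ∈ (profileGraph w B T).verts := by
    intro i h0 h1
    rw [hp.mem_verts_iff, hp.mem_verts_iff]
    omega
  constructor
  · rintro ⟨h1, h2, h3, h4⟩
    refine ⟨⟨fun i h0 hi => h3.2 ⟨_, (hmem i h0 hi).1, rfl⟩, ?_⟩,
      ⟨fun i h0 hi => h4.2 ⟨_, (hmem i h0 hi).2, rfl⟩, ?_⟩⟩
    · obtain ⟨⟨a, j⟩, ha, rfl⟩ := h3.1
      have hlow : ∀ i : ℤ, 0 ≤ i → i < w → 0 ≤ B i :=
        fun i h0 hi => h3.2 ⟨_, (hmem i h0 hi).1, rfl⟩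
      rw [hp.mem_verts_iff] at ha
      obtain ⟨k, hk0, hk1, hk2, hk3⟩ := hB a
      obtain ⟨l, hl0, hl1, hl2, hl3⟩ := hB (a - 1)
      have hk4 := hlow k hk0 hk1
      have hl4 := hlow l hl0 hl1
      have hk5 := hp.le a
      have hl5 := hp.le (a - 1)
      have : B k = 0 ∨ B l = 0 := by omega
      rcases this with h | h
      · exact ⟨k, hk0, hk1, h⟩
      · exact ⟨l, hl0, hl1, h⟩
    · obtain ⟨⟨a, j⟩, ha, hj⟩ := h4.1
      simp only at hj
      subst hj
      have hhigh : ∀ i : ℤ, 0 ≤ i → i < w → T i ≤ h :=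
        fun i h0 hi => h4.2 ⟨_, (hmem i h0 hi).2, rfl⟩
      rw [hp.mem_verts_iff] at ha
      obtain ⟨k, hk0, hk1, hk2, hk3⟩ := hB a
      obtain ⟨l, hl0, hl1, hl2, hl3⟩ := hB (a - 1)
      have hk4 := hhigh k hk0 hk1
      have hl4 := hhigh l hl0 hl1
      have hk5 := hp.lt k hk0 hk1
      have hl5 := hp.lt l hl0 hl1
      have : T k = h ∨ T l = h := by omega
      rcases this with h | h
      · exact ⟨k, hk0, hk1, h⟩
      · exact ⟨l, hl0, hl1, h⟩
  · rintro ⟨⟨h1, i, hi0, hi1, hi⟩, ⟨h2, k, hk0, hk1, hk⟩⟩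
    refine ⟨⟨⟨(0, B 0), (hmem 0 le_rfl (by omega)).1, rfl⟩, ?_⟩,
      ⟨⟨((w : ℤ), B (w - 1)), ?_, rfl⟩, ?_⟩, ⟨⟨(i, B i), (hmem i hi0 hi1).1, hi⟩, ?_⟩,
      ⟨⟨(k, T k), (hmem k hk0 hk1).2, hk⟩, ?_⟩⟩
    · rintro _ ⟨⟨a, j⟩, ha, rfl⟩
      exact (hp.mem_verts_iff.1 ha).1
    · rw [hp.mem_verts_iff]
      omega
    · rintro _ ⟨⟨a, j⟩, ha, rfl⟩
      exact (hp.mem_verts_iff.1 ha).2.1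
    all_goals
      rintro _ ⟨⟨a, j⟩, ha, rfl⟩
      rw [hp.mem_verts_iff] at ha
      obtain ⟨k, hk0, hk1, hk2, hk3⟩ := hB a
      obtain ⟨l, hl0, hl1, hl2, hl3⟩ := hB (a - 1)
      have hk4 := h1 k hk0 hk1
      have hl4 := h1 l hl0 hl1
      have hk5 := hp.lt k hk0 hk1
      have hl5 := hp.lt l hl0 hl1
      have hk6 := h2 k hk0 hk1
      have hl6 := h2 l hl0 hl1
      simp only
      omega

theorem hSet_eq {i : ℤ} (h0 : 0 ≤ i) (hi : i < w) : hSet (profileGraph w B T) i = {B i, T i} := by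
  ext j
  simp only [hSet, Set.mem_ofPred_eq, hAdj_iff, Set.mem_insert_iff, Set.mem_singleton_iff]
  tauto

theorem ncard_horizontalSteps (hp : Profile w B T) {h : ℕ}
    (hR : HasBoundingRectangle (profileGraph w B T) w h) :
    (horizontalSteps (profileGraph w B T)).ncard = 2 * w := by
  rw [AlmostConvex.ncard_horizontalSteps hR, Finset.sum_congr rfl (g := fun _ => 2)]
  · simp [mul_comm]
  · intro i hi
    rw [Finset.mem_Ico] at hi
    rw [hSet_eq hi.1 hi.2, Set.ncard_pair (hp.lt i hi.1 hi.2).ne]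

/-- On each line the runs of `B` and of `T` are disjoint because of `overlap_le`, so the vertical
edges are counted by the two variations. The terms `a = 0` and `a = w` are the left and right sides
of the polygon. -/
theorem ncard_verticalSteps (hp : Profile w B T) :
    ((verticalSteps (profileGraph w B T)).ncard : ℤ) =
      ∑ a ∈ Finset.Icc (0 : ℤ) w, (|T a - T (a - 1)| + |B a - B (a - 1)|) := by
  classical
  set f : ℤ × ℤ → Sym2 (ℤ × ℤ) := fun p => s((p.1, p.2), (p.1, p.2 + 1)) with hf
  have hinj : Function.Injective f := by
    rintro ⟨i, j⟩ ⟨k, l⟩ h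
    simp only [hf, Sym2.eq_iff, Prod.mk.injEq] at h ⊢
    omega
  set S : Finset (ℤ × ℤ) := (Finset.Icc (0 : ℤ) w).biUnion fun a =>
    (Finset.Ico (min (B (a - 1)) (B a)) (max (B (a - 1)) (B a)) ∪
      Finset.Ico (min (T (a - 1)) (T a)) (max (T (a - 1)) (T a))).map
        ⟨fun j => (a, j), fun _ _ h => (Prod.mk.inj h).2⟩ with hS
  have himg : verticalSteps (profileGraph w B T) = f '' S := by
    ext e
    simp only [hS, Finset.coe_biUnion, Finset.coe_map, Finset.coe_union, Finset.coe_Ico,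
      Set.mem_image, Set.mem_iUnion, Finset.coe_Icc, Set.mem_Icc, Set.mem_union, Set.mem_Ico]
    constructor
    · rintro ⟨he, i, j, rfl⟩
      have hv : vAdj (profileGraph w B T) i j := he
      have hi := hp.mem_verts_iff.1 ((profileGraph w B T).edge_vert hv)
      exact ⟨(i, j), ⟨i, ⟨hi.1, hi.2.1⟩, j, vAdj_iff.1 hv, rfl⟩, rfl⟩
    · rintro ⟨_, ⟨i, -, j, hj, rfl⟩, rfl⟩
      exact ⟨vAdj_iff.2 hj, i, j, rfl⟩
  rw [himg, Set.ncard_image_of_injective _ hinj, Set.ncard_coe_finset, hS, Finset.card_biUnion]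
  · push_cast
    refine Finset.sum_congr rfl fun a _ => ?_
    rw [Finset.card_map, Finset.card_union_of_disjoint, Int.card_Ico, Int.card_Ico]
    · have h1 : ∀ s t : ℤ, (((max s t - min s t).toNat : ℕ) : ℤ) = |t - s| := by
        intro s t
        rw [abs_eq_max_neg]
        omega
      push_cast [h1]
      ring
    · rw [Finset.disjoint_left]
      intro j h1 h2
      rw [Finset.mem_Ico] at h1 h2
      have h3 := hp.overlap_le a
      have h4 := hp.le a
      have h5 := hp.le (a - 1)
      omega
  · intro a _ b _ hab
    simp only [Function.onFun]
    rw [Finset.disjoint_left]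
    intro p h1 h2
    simp only [Finset.mem_map] at h1 h2
    obtain ⟨j, -, rfl⟩ := h1
    obtain ⟨k, -, h⟩ := h2
    exact hab (Prod.mk.inj h).1.symm

end Profile

/-! ### From a polygon with convex columns to its profiles. -/

theorem even_ncard_pair_inter {b t : ℤ} (hbt : b < t) (j : ℤ) :
    Even (({b, t} : Set ℤ) ∩ Set.Iic j).ncard ↔ ¬ (b ≤ j ∧ j < t) := by
  rcases lt_or_ge j b with h1 | h1
  · have : ({b, t} : Set ℤ) ∩ Set.Iic j = ∅ := by
      ext k
      simp only [Set.mem_inter_iff, Set.mem_insert_iff, Set.mem_singleton_iff, Set.mem_Iic,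
        Set.mem_empty_iff_false, iff_false]
      omega
    rw [this]
    simp only [Set.ncard_empty, Even.zero, true_iff]
    omega
  rcases lt_or_ge j t with h2 | h2
  · have : ({b, t} : Set ℤ) ∩ Set.Iic j = {b} := by
      ext k
      simp only [Set.mem_inter_iff, Set.mem_insert_iff, Set.mem_singleton_iff, Set.mem_Iic]
      omega
    rw [this]
    simp [h1, h2]
  · have : ({b, t} : Set ℤ) ∩ Set.Iic j = {b, t} := by
      ext k
      simp only [Set.mem_inter_iff, Set.mem_insert_iff, Set.mem_singleton_iff, Set.mem_Iic]
      omega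
    rw [this, Set.ncard_pair hbt.ne]
    simp only [even_two, true_iff]
    omega

/-- A polygon all of whose columns are convex is given by its profiles. -/
theorem exists_profile {P : squareLattice.Subgraph} {w h : ℕ} (hP : IsTwoRegular P)
    (hR : HasBoundingRectangle P w h) (hw : (horizontalSteps P).ncard = 2 * w) :
    ∃ B T : ℤ → ℤ, Profile w B T ∧ P = profileGraph w B T := by
  have hcol : ∀ i : ℤ, ∃ b t : ℤ, 0 ≤ i → i < w → b < t ∧ hSet P i = {b, t} := by
    intro i
    by_cases hi : 0 ≤ i ∧ i < w
    · obtain ⟨b, t, hne, h⟩ := Set.ncard_eq_two.1 (ncard_hSet_eq_two hP hR hw hi.1 hi.2)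
      rcases lt_or_gt_of_ne hne with hbt | hbt
      · exact ⟨b, t, fun _ _ => ⟨hbt, h⟩⟩
      · exact ⟨t, b, fun _ _ => ⟨hbt, by rw [h, Set.pair_comm]⟩⟩
    · exact ⟨0, 0, fun h1 h2 => (hi ⟨h1, h2⟩).elim⟩
  choose b t hbt using hcol
  have hemp : ∀ i : ℤ, ¬ (0 ≤ i ∧ i < w) → hSet P i = ∅ := by
    intro i hi
    rw [Set.eq_empty_iff_forall_notMem]
    intro j hj
    have := hR.hAdj_bounds (i := i) hj
    omega
  have hpos : 0 < w := by
    rcases Nat.eq_zero_or_pos w with rfl | hpos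
    · exfalso
      obtain ⟨⟨a, j⟩, ha, -⟩ := hR.1.1
      rw [hP.mem_verts_iff] at ha
      have h1 : ∀ i j, ¬ hAdj P i j := fun i j hij => by
        have := hR.hAdj_bounds hij
        omega
      have h2 : ∀ i j, ¬ vAdj P i j := fun i j => by
        rw [vAdj_iff_parity hP hR, hemp _ (by omega), hemp _ (by omega)]
        simp
      simp [h1, h2] at ha
    · exact hpos
  set B : ℤ → ℤ := fun i => if i < 0 then b 0 else if i < w then b i else b (w - 1) with hB
  set T : ℤ → ℤ := fun i => if i < 0 then b 0 else if i < w then t i else b (w - 1) with hT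
  have hin : ∀ i : ℤ, 0 ≤ i → i < w → B i < T i ∧ hSet P i = {B i, T i} := by
    intro i h0 h1
    have := hbt i h0 h1
    simpa only [hB, hT, if_neg (not_lt.2 h0), if_pos h1] using this
  have hleft : ∀ i : ℤ, i < 0 → B i = B 0 ∧ T i = B 0 := by
    intro i hi
    have h0 : (0 : ℤ) < w := by omega
    simp [hB, hT, hi, hpos]
  have hright : ∀ i : ℤ, (w : ℤ) ≤ i → B i = B (w - 1) ∧ T i = B (w - 1) := by
    intro i hi
    have h0 : ¬ i < 0 := by omega
    have h1 : ¬ (w : ℤ) - 1 < 0 := by omega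
    simp only [hB, hT, h0, h1, not_lt.2 hi, if_false]
    simp
  have hcell : ∀ a j : ℤ, Even (hSet P a ∩ Set.Iic j).ncard ↔ ¬ (B a ≤ j ∧ j < T a) := by
    intro a j
    by_cases ha : 0 ≤ a ∧ a < w
    · rw [(hin a ha.1 ha.2).2, even_ncard_pair_inter (hin a ha.1 ha.2).1]
    · rw [hemp a ha]
      simp only [Set.empty_inter, Set.ncard_empty, Even.zero, true_iff]
      by_cases h0 : a < 0
      · have := hleft a h0
        omega
      · have := hright a (by omega)
        omega
  have hv : ∀ a j : ℤ, vAdj P a j ↔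
      ¬ ((B (a - 1) ≤ j ∧ j < T (a - 1)) ↔ (B a ≤ j ∧ j < T a)) := by
    intro a j
    rw [vAdj_iff_parity hP hR, hcell, hcell]
    tauto
  have hh : ∀ i j : ℤ, hAdj P i j ↔ 0 ≤ i ∧ i < w ∧ (j = B i ∨ j = T i) := by
    intro i j
    constructor
    · intro hij
      have h1 := hR.hAdj_bounds hij
      have h2 : j ∈ hSet P i := hij
      rw [(hin i h1.1 h1.2.1).2] at h2
      exact ⟨h1.1, h1.2.1, h2⟩
    · rintro ⟨h0, h1, h2⟩
      have : j ∈ hSet P i := by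
        rw [(hin i h0 h1).2]
        exact h2
      exact this
  -- A vertex with three edges would contradict degree two; this excludes columns that touch in a
  -- single point.
  have hcross : ∀ i j : ℤ, hAdj P (i - 1) j → hAdj P i j → ¬ vAdj P i j := by
    intro i j h1 h2 h3
    have h4 := hP.degree (i, j) (P.edge_vert h2)
    classical
    rw [ncard_neighborSet, if_pos h1, if_pos h2, if_pos h3] at h4
    omega
  -- Suppose that column `i` lies weakly below or weakly above column `i - 1`. If they touch,
  -- `hcross` is violated at the point of contact. Otherwise the vertices on one side of the line
  -- `i`, with the part of that line at or below the top of the lower column, form a set that no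
  -- edge leaves, so the graph is disconnected.
  have hover : ∀ i : ℤ, 0 < i → i < w → B (i - 1) < T i ∧ B i < T (i - 1) := by
    intro i h0 hi
    obtain ⟨p, hpv, hp0⟩ := hR.1.1
    obtain ⟨q, hqv, hqw⟩ := hR.2.1.1
    have h1 := (hin i h0.le hi).1
    have h2 := (hin (i - 1) (by omega) (by omega)).1
    constructor
    · by_contra hcon
      rcases eq_or_lt_of_le (not_lt.1 hcon) with heq | hlt
      · refine hcross i (T i) ((hh _ _).2 ⟨by omega, by omega, Or.inl heq⟩)
          ((hh _ _).2 ⟨by omega, by omega, Or.inr rfl⟩) ((hv _ _).2 (by omega))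
      · have := hP.closed_set {c | i < c.1 ∨ (c.1 = i ∧ c.2 ≤ T i)} ?_ hqv hpv
          (by simp only [Set.mem_ofPred_eq]; omega)
        · simp only [Set.mem_ofPred_eq] at this
          omega
        · rintro ⟨c1, c2⟩ ⟨d1, d2⟩ hcd hc
          have hcd := adj_iff_hAdj_vAdj.1 hcd
          simp only [Set.mem_ofPred_eq, hh, hv, Prod.mk.injEq] at hc hcd ⊢
          rcases hcd with ⟨⟨rfl, rfl⟩, h⟩ | ⟨⟨rfl, rfl⟩, h⟩ | ⟨⟨rfl, rfl⟩, h⟩ | ⟨⟨rfl, rfl⟩, h⟩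
          · omega
          · rcases hc with hc | ⟨rfl, hc⟩
            · by_cases h5 : c1 = i + 1
              · subst h5
                rw [add_sub_cancel_right] at h
                omega
              · omega
            · omega
          · rcases hc with hc | ⟨rfl, hc⟩
            · omega
            · by_cases h5 : c2 = T d1
              · subst h5
                omega
              · omega
          · omega
    · by_contra hcon
      rcases eq_or_lt_of_le (not_lt.1 hcon) with heq | hlt
      · refine hcross i (B i) ((hh _ _).2 ⟨by omega, by omega, Or.inr heq.symm⟩)
          ((hh _ _).2 ⟨by omega, by omega, Or.inl rfl⟩) ((hv _ _).2 (by omega))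
      · have := hP.closed_set {c | c.1 < i ∨ (c.1 = i ∧ c.2 ≤ T (i - 1))} ?_ hpv hqv
          (by simp only [Set.mem_ofPred_eq]; omega)
        · simp only [Set.mem_ofPred_eq] at this
          omega
        · rintro ⟨c1, c2⟩ ⟨d1, d2⟩ hcd hc
          have hcd := adj_iff_hAdj_vAdj.1 hcd
          simp only [Set.mem_ofPred_eq, hh, hv, Prod.mk.injEq] at hc hcd ⊢
          rcases hcd with ⟨⟨rfl, rfl⟩, h⟩ | ⟨⟨rfl, rfl⟩, h⟩ | ⟨⟨rfl, rfl⟩, h⟩ | ⟨⟨rfl, rfl⟩, h⟩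
          · rcases hc with hc | ⟨rfl, hc⟩
            · by_cases h5 : c1 = i - 1
              · subst h5
                omega
              · omega
            · omega
          · omega
          · rcases hc with hc | ⟨rfl, hc⟩
            · omega
            · by_cases h5 : c2 = T (d1 - 1)
              · subst h5
                omega
              · omega
          · omega
  have hprof : Profile w B T := ⟨hpos, fun i h0 h1 => (hin i h0 h1).1, hover, hleft, hright⟩
  refine ⟨B, T, hprof, hP.ext hprof.isTwoRegular (fun i j => ?_) fun i j => ?_⟩
  · rw [hh, Profile.hAdj_iff]
  · rw [hv, hprof.vAdj_iff_cells]

namespace Profile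

/-- The last column that contains horizontal edges determines the width, and `B < T` tells the two
heights of each column apart. The continued values are functions of those in the columns. -/
theorem graph_injective {w w' : ℕ} {B T B' T' : ℤ → ℤ} (hp : Profile w B T)
    (hp' : Profile w' B' T') (h : profileGraph w B T = profileGraph w' B' T') :
    w = w' ∧ B = B' ∧ T = T' := by
  have hh : ∀ i j : ℤ, (0 ≤ i ∧ i < w ∧ (j = B i ∨ j = T i)) ↔
      (0 ≤ i ∧ i < w' ∧ (j = B' i ∨ j = T' i)) := fun i j => by
    rw [← hAdj_iff, ← hAdj_iff, h]
  have hw : w = w' := by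
    have h1 := hp.pos
    have h2 := hp'.pos
    have h3 := hh (w - 1) (B (w - 1))
    have h4 := hh (w' - 1) (B' (w' - 1))
    omega
  subst hw
  have hin : ∀ i : ℤ, 0 ≤ i → i < w → B i = B' i ∧ T i = T' i := by
    intro i h0 h1
    have h2 := hp.lt i h0 h1
    have h3 := hp'.lt i h0 h1
    have h4 := hh i (B i)
    have h5 := hh i (T i)
    omega
  have hpos := hp.pos
  refine ⟨rfl, funext fun i => ?_, funext fun i => ?_⟩
  · by_cases h0 : i < 0
    · rw [(hp.left i h0).1, (hp'.left i h0).1, (hin 0 le_rfl (by omega)).1]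
    by_cases h1 : i < w
    · exact (hin i (by omega) h1).1
    · rw [(hp.right i (by omega)).1, (hp'.right i (by omega)).1,
        (hin (w - 1) (by omega) (by omega)).1]
  · by_cases h0 : i < 0
    · rw [(hp.left i h0).2, (hp'.left i h0).2, (hin 0 le_rfl (by omega)).1]
    by_cases h1 : i < w
    · exact (hin i (by omega) h1).2
    · rw [(hp.right i (by omega)).2, (hp'.right i (by omega)).2,
        (hin (w - 1) (by omega) (by omega)).1]

end Profile

/-! ### Arcs of a column-convex polygon -/

theorem dvd_of_dvd_of_eq {N a b : ℤ} (h : N ∣ a) (e : a = b) : N ∣ b := e ▸ h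

/-- A self-avoiding sequence of neighbours in `P`. -/
structure IsTrack (P : squareLattice.Subgraph) (g : ℕ → ℤ × ℤ) (m : ℕ) : Prop where
  adj : ∀ k < m, P.Adj (g k) (g (k + 1))
  inj : ∀ k ≤ m, ∀ l ≤ m, g k = g l → k = l

theorem isTrack_of_isPath {P : squareLattice.Subgraph} {a b : ℤ × ℤ}
    {p : squareLattice.Walk a b} (hp : p.IsPath) (hle : p.toSubgraph ≤ P) :
    IsTrack P p.getVert p.length :=
  ⟨fun _ hk => hle.2 (p.toSubgraph_adj_getVert hk),
    fun _ hk _ hl h => hp.getVert_injOn hk hl h⟩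

/-- A track along which a rank changes by one modulo `N` at every step is monotone, if the rank is
injective modulo `N`. -/
theorem IsTrack.follow {P : squareLattice.Subgraph} {g : ℕ → ℤ × ℤ} {m : ℕ}
    (hg : IsTrack P g m) {N : ℤ} {ρ : ℤ × ℤ → ℤ}
    (hstep : ∀ z z', P.Adj z z' → N ∣ ρ z' - ρ z - 1 ∨ N ∣ ρ z' - ρ z + 1)
    (hinj : ∀ z ∈ P.verts, ∀ z' ∈ P.verts, N ∣ ρ z - ρ z' → z = z') :
    (∀ k ≤ m, N ∣ ρ (g k) - ρ (g 0) - k) ∨ (∀ k ≤ m, N ∣ ρ (g k) - ρ (g 0) + k) := by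
  rcases Nat.eq_zero_or_pos m with rfl | hm
  · left
    intro k hk
    obtain rfl : k = 0 := by omega
    simp
  -- The sign `e` of the first step is kept forever: two consecutive residues are carried along, so
  -- that a reversal can be recognized as a return to the vertex before.
  have key : ∀ e : ℤ, (e = 1 ∨ e = -1) → N ∣ ρ (g 1) - ρ (g 0) - e →
      ∀ k, k + 1 ≤ m → N ∣ ρ (g k) - ρ (g 0) - e * k ∧
        N ∣ ρ (g (k + 1)) - ρ (g 0) - e * (k + 1) := by
    intro e he h1 k
    induction k with
    | zero => exact fun _ => by simpa using h1
    | succ k ih =>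
      intro hk
      obtain ⟨h2, h3⟩ := ih (by omega)
      refine ⟨by exact_mod_cast h3, ?_⟩
      have hgood : N ∣ ρ (g (k + 1 + 1)) - ρ (g (k + 1)) - e →
          N ∣ ρ (g (k + 1 + 1)) - ρ (g 0) - e * ((k + 1 : ℕ) + 1) := by
        intro h
        have := dvd_add h h3
        exact dvd_of_dvd_of_eq this (by push_cast; ring)
      -- A step in the opposite direction leads back to the residue of `g k`, hence to the vertex `g
      -- k`, against self-avoidance.
      have hbad : ¬ N ∣ ρ (g (k + 1 + 1)) - ρ (g (k + 1)) + e := by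
        intro h
        have h4 := hinj _ (P.edge_vert (hg.adj (k + 1) (by omega)).symm) _
          (P.edge_vert (hg.adj k (by omega))) (by
            have := dvd_sub (dvd_add h h3) h2
            exact dvd_of_dvd_of_eq this (by ring))
        have := hg.inj _ hk _ (by omega) h4
        omega
      rcases hstep _ _ (hg.adj (k + 1) (by omega)) with h | h <;> rcases he with rfl | rfl
      · exact hgood h
      · exact (hbad (by simpa [sub_eq_add_neg] using h)).elim
      · exact (hbad h).elim
      · exact hgood (by simpa using h)
  have hall : ∀ e : ℤ, (e = 1 ∨ e = -1) → N ∣ ρ (g 1) - ρ (g 0) - e →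
      ∀ k ≤ m, N ∣ ρ (g k) - ρ (g 0) - e * k := by
    intro e he h1 k hk
    rcases Nat.eq_zero_or_pos k with rfl | hk0
    · simp
    · obtain ⟨k, rfl⟩ := Nat.exists_eq_add_of_lt hk0
      have := (key e he h1 (0 + k) (by omega)).2
      exact_mod_cast this
  rcases hstep _ _ (hg.adj 0 hm) with h | h
  · left
    simpa using hall 1 (Or.inl rfl) (by simpa using h)
  · right
    simpa using hall (-1) (Or.inr rfl) (by simpa using h)

/-- The lattice path which consists of the vertical runs from `F (a - 1)` to `F a` on the line
`a`, for `0 ≤ a ≤ w`, and of the horizontal steps between them. -/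
def OnArc (w : ℕ) (F : ℤ → ℤ) (z : ℤ × ℤ) : Prop :=
  0 ≤ z.1 ∧ z.1 ≤ w ∧ min (F (z.1 - 1)) (F z.1) ≤ z.2 ∧ z.2 ≤ max (F (z.1 - 1)) (F z.1)

/-- The number of vertical steps of the arc before it reaches the line `a`. -/
def rise (F : ℤ → ℤ) (a : ℤ) : ℤ := ∑ k ∈ Finset.Ico 0 a, |F k - F (k - 1)|

/-- The number of steps of the arc before the vertex `z`. -/
def arcRank (F : ℤ → ℤ) (z : ℤ × ℤ) : ℤ := z.1 + rise F z.1 + |z.2 - F (z.1 - 1)|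

theorem rise_zero (F : ℤ → ℤ) : rise F 0 = 0 := by simp [rise]

theorem rise_succ (F : ℤ → ℤ) {a : ℤ} (ha : 0 ≤ a) :
    rise F (a + 1) = rise F a + |F a - F (a - 1)| := by
  rw [rise, rise, ← Finset.insert_Ico_right_eq_Ico_add_one ha,
    Finset.sum_insert Finset.right_notMem_Ico, add_comm]

theorem rise_mono (F : ℤ → ℤ) {a b : ℤ} (hab : a ≤ b) : rise F a ≤ rise F b :=
  Finset.sum_le_sum_of_subset_of_nonneg (Finset.Ico_subset_Ico_right hab)
    fun _ _ _ => abs_nonneg _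

theorem rise_nonneg (F : ℤ → ℤ) (a : ℤ) : 0 ≤ rise F a :=
  Finset.sum_nonneg fun _ _ => abs_nonneg _

section ArcRank

variable {w : ℕ} {F : ℤ → ℤ}

theorem OnArc.rank_le {z : ℤ × ℤ} (hz : OnArc w F z) : arcRank F z ≤ z.1 + rise F (z.1 + 1) := by
  obtain ⟨h0, -, h1, h2⟩ := hz
  rw [arcRank, rise_succ F h0]
  have : |z.2 - F (z.1 - 1)| ≤ |F z.1 - F (z.1 - 1)| := by
    rw [abs_eq_max_neg, abs_eq_max_neg]
    omega
  omega

theorem le_arcRank (F : ℤ → ℤ) (z : ℤ × ℤ) : z.1 + rise F z.1 ≤ arcRank F z := by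
  have := abs_nonneg (z.2 - F (z.1 - 1))
  rw [arcRank]
  omega

theorem OnArc.rank_lt {z z' : ℤ × ℤ} (hz : OnArc w F z) (h : z.1 < z'.1) :
    arcRank F z < arcRank F z' := by
  have h1 := hz.rank_le
  have h2 := le_arcRank F z'
  have h3 := rise_mono F (show z.1 + 1 ≤ z'.1 by omega)
  omega

/-- Ranks separate different lines by `OnArc.rank_lt`; on one line the run leaves `F (z.1 - 1)` in
one direction only, so the distance from there determines the vertex. -/
theorem OnArc.rank_inj {z z' : ℤ × ℤ} (hz : OnArc w F z) (hz' : OnArc w F z')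
    (h : arcRank F z = arcRank F z') : z = z' := by
  have h1 : z.1 = z'.1 := by
    rcases lt_trichotomy z.1 z'.1 with h1 | h1 | h1
    · have := hz.rank_lt h1
      omega
    · exact h1
    · have := hz'.rank_lt h1
      omega
  obtain ⟨a, j⟩ := z
  obtain ⟨a', j'⟩ := z'
  simp only at h1
  subst h1
  simp only [arcRank, OnArc] at h hz hz'
  have : |j - F (a - 1)| = |j' - F (a - 1)| := by omega
  rw [abs_eq_max_neg, abs_eq_max_neg] at this
  simp only [Prod.mk.injEq, true_and]
  omega

theorem OnArc.rank_nonneg {z : ℤ × ℤ} (hz : OnArc w F z) : 0 ≤ arcRank F z := by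
  have h1 := le_arcRank F z
  have h2 := rise_nonneg F z.1
  have h3 := hz.1
  omega

/-- The length of the arc. -/
def arcLength (w : ℕ) (F : ℤ → ℤ) : ℤ := w + rise F (w + 1)

theorem OnArc.rank_le_length {z : ℤ × ℤ} (hz : OnArc w F z) : arcRank F z ≤ arcLength w F := by
  have h1 := hz.rank_le
  have h2 := rise_mono F (show z.1 + 1 ≤ w + 1 by have := hz.2.1; omega)
  have := hz.2.1
  rw [arcLength]
  omega

theorem rank_end (F : ℤ → ℤ) : arcRank F ((w : ℤ), F w) = arcLength w F := by
  rw [arcRank, arcLength, rise_succ F (by omega)]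
  ring

theorem rank_start (F : ℤ → ℤ) : arcRank F (0, F (0 - 1)) = 0 := by
  simp [arcRank, rise_zero]

theorem onArc_end : OnArc w F ((w : ℤ), F w) := by
  simp only [OnArc]
  omega

theorem onArc_start : OnArc w F (0, F (0 - 1)) := by
  simp only [OnArc]
  omega

theorem rank_horizontal {a : ℤ} (h0 : 0 ≤ a) (h1 : a < w) :
    OnArc w F (a, F a) ∧ OnArc w F (a + 1, F a) ∧
      arcRank F (a + 1, F a) = arcRank F (a, F a) + 1 := by
  refine ⟨?_, ?_, ?_⟩
  · simp only [OnArc]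
    omega
  · simp only [OnArc, add_sub_cancel_right]
    omega
  · simp only [arcRank, add_sub_cancel_right, rise_succ F h0]
    simp
    ring

theorem rank_vertical {a j : ℤ} (h0 : 0 ≤ a) (h1 : a ≤ w)
    (h2 : min (F (a - 1)) (F a) ≤ j ∧ j < max (F (a - 1)) (F a)) :
    OnArc w F (a, j) ∧ OnArc w F (a, j + 1) ∧
      ((F (a - 1) < F a ∧ arcRank F (a, j + 1) = arcRank F (a, j) + 1) ∨
        (F a < F (a - 1) ∧ arcRank F (a, j + 1) = arcRank F (a, j) - 1)) := by
  refine ⟨?_, ?_, ?_⟩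
  · simp only [OnArc]
    omega
  · simp only [OnArc]
    omega
  · simp only [arcRank]
    rw [abs_eq_max_neg, abs_eq_max_neg]
    omega

end ArcRank

namespace Profile

variable {w : ℕ} {B T : ℤ → ℤ}

theorem onArc_of_mem_verts (hp : Profile w B T) {z : ℤ × ℤ}
    (hz : z ∈ (profileGraph w B T).verts) : OnArc w T z ∨ OnArc w B z := by
  have := hp.mem_verts_iff.1 (show (z.1, z.2) ∈ _ from hz)
  simp only [OnArc]
  tauto

theorem mem_verts_of_onArc (hp : Profile w B T) {z : ℤ × ℤ} (hz : OnArc w T z ∨ OnArc w B z) :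
    z ∈ (profileGraph w B T).verts := by
  refine hp.mem_verts_iff.2 (?_ : _)
  simp only [OnArc] at hz
  tauto

/-- Because `T` is continued by the end values of `B`, the left and right sides of the polygon are
runs of `T`. The upper arc thus joins the lowest vertices of these sides, as `IsTopArc` requires,
and the lower arc has no vertical run there. -/
theorem T_start (hp : Profile w B T) : T (0 - 1) = B 0 := (hp.left _ (by norm_num)).2

theorem B_start (hp : Profile w B T) : B (0 - 1) = B 0 := (hp.left _ (by norm_num)).1

theorem T_end (hp : Profile w B T) : T w = B w := by
  rw [(hp.right _ le_rfl).2, (hp.right _ le_rfl).1]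

/-- The two arcs meet at their end points only. -/
theorem eq_of_onArc_both (hp : Profile w B T) {z : ℤ × ℤ} (h1 : OnArc w T z) (h2 : OnArc w B z) :
    z = (0, B 0) ∨ z = ((w : ℤ), B w) := by
  obtain ⟨a, j⟩ := z
  simp only [OnArc] at h1 h2
  simp only [Prod.mk.injEq]
  have hpos := hp.pos
  by_cases h3 : a = 0
  · subst h3
    have := hp.B_start
    omega
  by_cases h4 : a < w
  · have h5 := hp.overlap a (by omega) h4
    have h6 := hp.lt a (by omega) h4
    have h7 := hp.lt (a - 1) (by omega) (by omega)
    omega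
  · obtain rfl : a = w := by omega
    have h5 := hp.right w le_rfl
    omega

open scoped Classical in
/-- The position of a vertex on the boundary, counted along the upper arc from the lowest vertex
on the left, modulo the perimeter. -/
def boundaryRank (w : ℕ) (B T : ℤ → ℤ) (z : ℤ × ℤ) : ℤ :=
  if OnArc w T z then arcRank T z else - arcRank B z

theorem boundaryRank_top {z : ℤ × ℤ} (hz : OnArc w T z) : boundaryRank w B T z = arcRank T z :=
  if_pos hz

/-- The only conflict between the two branches is at the common end points: both ranks vanish at the
left one, and at the right one they are the two arc lengths, whose sum is the modulus. -/
theorem boundaryRank_bottom (hp : Profile w B T) {z : ℤ × ℤ} (hz : OnArc w B z) :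
    arcLength w T + arcLength w B ∣ boundaryRank w B T z + arcRank B z := by
  by_cases h : OnArc w T z
  · rw [boundaryRank_top h]
    rcases hp.eq_of_onArc_both h hz with rfl | rfl
    · have h1 : arcRank T (0, B 0) = 0 := by rw [← hp.T_start, rank_start]
      have h2 : arcRank B (0, B 0) = 0 := by
        conv_lhs => rw [← hp.B_start, rank_start]
      rw [h1, h2]
      exact dvd_zero _
    · rw [rank_end]
      rw [← hp.T_end, rank_end]
  · rw [boundaryRank, if_neg h, neg_add_cancel]
    exact dvd_zero _

theorem adj_cases (hp : Profile w B T) {z z' : ℤ × ℤ} (h : (profileGraph w B T).Adj z z') :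
    (OnArc w T z ∧ OnArc w T z' ∧ (arcRank T z' = arcRank T z + 1 ∨
      arcRank T z' = arcRank T z - 1)) ∨
    (OnArc w B z ∧ OnArc w B z' ∧ (arcRank B z' = arcRank B z + 1 ∨
      arcRank B z' = arcRank B z - 1)) := by
  obtain ⟨a, j⟩ := z
  have hv : ∀ a j : ℤ, vAdj (profileGraph w B T) a j → 0 ≤ a ∧ a ≤ w := fun a j h => by
    have := hp.mem_verts_iff.1 ((profileGraph w B T).edge_vert h)
    exact ⟨this.1, this.2.1⟩
  rcases adj_iff_hAdj_vAdj.1 h with ⟨rfl, h'⟩ | ⟨rfl, h'⟩ | ⟨rfl, h'⟩ | ⟨rfl, h'⟩ <;>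
    simp only at h' ⊢
  · obtain ⟨h0, h1, rfl | rfl⟩ := hAdj_iff.1 h'
    · have := rank_horizontal (F := B) h0 h1
      tauto
    · have := rank_horizontal (F := T) h0 h1
      tauto
  · obtain ⟨h0, h1, h2 | h2⟩ := hAdj_iff.1 h'
    · have := rank_horizontal (F := B) h0 h1
      subst h2
      rw [sub_add_cancel] at this
      refine Or.inr ⟨this.2.1, this.1, Or.inr (by omega)⟩
    · have := rank_horizontal (F := T) h0 h1
      subst h2
      rw [sub_add_cancel] at this
      refine Or.inl ⟨this.2.1, this.1, Or.inr (by omega)⟩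
  · obtain ⟨h0, h1⟩ := hv _ _ h'
    rcases vAdj_iff.1 h' with h2 | h2
    · have := rank_vertical (F := B) h0 h1 h2
      tauto
    · have := rank_vertical (F := T) h0 h1 h2
      tauto
  · obtain ⟨h0, h1⟩ := hv _ _ h'
    rcases vAdj_iff.1 h' with h2 | h2
    · have := rank_vertical (F := B) h0 h1 h2
      rw [sub_add_cancel] at this
      refine Or.inr ⟨this.2.1, this.1, ?_⟩
      omega
    · have := rank_vertical (F := T) h0 h1 h2
      rw [sub_add_cancel] at this
      refine Or.inl ⟨this.2.1, this.1, ?_⟩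
      omega

theorem boundaryRank_adj (hp : Profile w B T) {z z' : ℤ × ℤ}
    (h : (profileGraph w B T).Adj z z') :
    arcLength w T + arcLength w B ∣ boundaryRank w B T z' - boundaryRank w B T z - 1 ∨
    arcLength w T + arcLength w B ∣ boundaryRank w B T z' - boundaryRank w B T z + 1 := by
  rcases hp.adj_cases h with ⟨h1, h2, h3⟩ | ⟨h1, h2, h3⟩
  · rw [boundaryRank_top h1, boundaryRank_top h2]
    rcases h3 with h3 | h3 <;> rw [h3]
    · left; simp
    · right; simp
  · have := dvd_sub (hp.boundaryRank_bottom h2) (hp.boundaryRank_bottom h1)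
    rcases h3 with h3 | h3 <;> rw [h3] at this
    · right
      exact dvd_of_dvd_of_eq this (by ring)
    · left
      exact dvd_of_dvd_of_eq this (by ring)

theorem arcLength_pos (hp : Profile w B T) (F : ℤ → ℤ) : 0 < arcLength w F := by
  have h1 := rise_nonneg F (w + 1)
  have h2 := hp.pos
  rw [arcLength]
  omega

/-- The sum of the ranks lies between zero and the modulus, so it is one of these two values. Then
both vertices are starting points or both are end points of their arcs. -/
theorem eq_of_top_bottom (hp : Profile w B T) {z z' : ℤ × ℤ} (hz : OnArc w T z)
    (hz' : OnArc w B z') (h : arcLength w T + arcLength w B ∣ arcRank T z + arcRank B z') :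
    z = z' ∧ (z = (0, B 0) ∨ z = ((w : ℤ), B w)) := by
  have h1 := hz.rank_nonneg
  have h2 := hz'.rank_nonneg
  have h3 := hz.rank_le_length
  have h4 := hz'.rank_le_length
  have h5 := hp.arcLength_pos T
  have h6 := hp.arcLength_pos B
  obtain ⟨c, hc⟩ := h
  have hc0 : c = 0 ∨ c = 1 := by
    have h7 : 0 ≤ c := by
      by_contra h7
      nlinarith
    have h8 : c ≤ 1 := by
      by_contra h8
      nlinarith
    omega
  rcases hc0 with rfl | rfl
  · have e1 : z = (0, T (0 - 1)) := hz.rank_inj onArc_start (by rw [rank_start]; omega)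
    have e2 : z' = (0, B (0 - 1)) := hz'.rank_inj onArc_start (by rw [rank_start]; omega)
    rw [hp.T_start] at e1
    rw [hp.B_start] at e2
    rw [e1, e2]
    simp
  · have e1 : z = ((w : ℤ), T w) := hz.rank_inj onArc_end (by rw [rank_end]; omega)
    have e2 : z' = ((w : ℤ), B w) := hz'.rank_inj onArc_end (by rw [rank_end]; omega)
    rw [hp.T_end] at e1
    rw [e1, e2]
    simp

theorem dvd_small {N d : ℤ} (h : N ∣ d) (h1 : -N < d) (h2 : d < N) : d = 0 :=
  Int.eq_zero_of_abs_lt_dvd h (abs_lt.2 ⟨h1, h2⟩)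

theorem boundaryRank_inj (hp : Profile w B T) {z z' : ℤ × ℤ}
    (hz : z ∈ (profileGraph w B T).verts) (hz' : z' ∈ (profileGraph w B T).verts)
    (h : arcLength w T + arcLength w B ∣ boundaryRank w B T z - boundaryRank w B T z') :
    z = z' := by
  have h5 := hp.arcLength_pos T
  have h6 := hp.arcLength_pos B
  rcases hp.onArc_of_mem_verts hz with h1 | h1 <;> rcases hp.onArc_of_mem_verts hz' with h2 | h2
  · rw [boundaryRank_top h1, boundaryRank_top h2] at h
    have := h1.rank_nonneg
    have := h2.rank_nonneg
    have := h1.rank_le_length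
    have := h2.rank_le_length
    have := dvd_small h (by omega) (by omega)
    exact h1.rank_inj h2 (by omega)
  · refine (hp.eq_of_top_bottom h1 h2 ?_).1
    have := dvd_add h (hp.boundaryRank_bottom h2)
    rw [boundaryRank_top h1] at this
    exact dvd_of_dvd_of_eq this (by ring)
  · refine ((hp.eq_of_top_bottom h2 h1 ?_).1).symm
    have := dvd_sub (hp.boundaryRank_bottom h1) h
    rw [boundaryRank_top h2] at this
    exact dvd_of_dvd_of_eq this (by ring)
  · have h3 := dvd_sub h (dvd_sub (hp.boundaryRank_bottom h1) (hp.boundaryRank_bottom h2))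
    have := h1.rank_nonneg
    have := h2.rank_nonneg
    have := h1.rank_le_length
    have := h2.rank_le_length
    have := dvd_small h3 (by omega) (by omega)
    exact h1.rank_inj h2 (by omega)

end Profile

/-! ### Indents on the top arc -/

/-- The upper profile goes down and later up again. -/
def TopDent (w : ℕ) (T : ℤ → ℤ) : Prop :=
  ∃ a b : ℤ, 0 < a ∧ a < b ∧ b < w ∧ T a < T (a - 1) ∧ T (b - 1) < T b

namespace Profile

variable {w : ℕ} {B T : ℤ → ℤ}

theorem start_mem (hp : Profile w B T) : (0, B 0) ∈ (profileGraph w B T).verts := by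
  refine hp.mem_verts_of_onArc (Or.inr ?_)
  rw [← hp.B_start]
  exact onArc_start

theorem end_mem (hp : Profile w B T) : ((w : ℤ), B w) ∈ (profileGraph w B T).verts :=
  hp.mem_verts_of_onArc (Or.inr onArc_end)

theorem onArc_T_start (hp : Profile w B T) :
    OnArc w T (0, B 0) ∧ arcRank T (0, B 0) = 0 := by
  rw [← hp.T_start]
  exact ⟨onArc_start, rank_start T⟩

theorem onArc_B_start (hp : Profile w B T) :
    OnArc w B (0, B 0) ∧ arcRank B (0, B 0) = 0 := by
  have h1 := onArc_start (w := w) (F := B)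
  have h2 := rank_start B
  rw [hp.B_start] at h1 h2
  exact ⟨h1, h2⟩

theorem onArc_T_end (hp : Profile w B T) :
    OnArc w T ((w : ℤ), B w) ∧ arcRank T ((w : ℤ), B w) = arcLength w T := by
  rw [← hp.T_end]
  exact ⟨onArc_end, rank_end T⟩

theorem boundaryRank_start (hp : Profile w B T) : boundaryRank w B T (0, B 0) = 0 := by
  rw [boundaryRank_top hp.onArc_T_start.1, hp.onArc_T_start.2]

theorem boundaryRank_end (hp : Profile w B T) :
    boundaryRank w B T ((w : ℤ), B w) = arcLength w T := by
  rw [boundaryRank_top hp.onArc_T_end.1, hp.onArc_T_end.2]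

theorem track_mem {P : squareLattice.Subgraph} {g : ℕ → ℤ × ℤ} {m : ℕ} (hg : IsTrack P g m)
    (h0 : g 0 ∈ P.verts) {k : ℕ} (hk : k ≤ m) : g k ∈ P.verts := by
  rcases Nat.eq_zero_or_pos k with rfl | hk0
  · exact h0
  · have := hg.adj (k - 1) (by omega)
    rw [Nat.sub_add_cancel hk0] at this
    exact P.edge_vert this.symm

/-- A track that starts along the upper arc stays on it. -/
theorem track_top (hp : Profile w B T) {g : ℕ → ℤ × ℤ} {m : ℕ}
    (hg : IsTrack (profileGraph w B T) g m) (h0 : g 0 = (0, B 0)) (h1 : g m = ((w : ℤ), B w))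
    (hr : ∀ k ≤ m, arcLength w T + arcLength w B ∣
      boundaryRank w B T (g k) - boundaryRank w B T (g 0) - k) :
    (m : ℤ) = arcLength w T ∧ ∀ k ≤ m, OnArc w T (g k) ∧ arcRank T (g k) = k := by
  have hT := hp.arcLength_pos T
  have hB := hp.arcLength_pos B
  simp only [h0, hp.boundaryRank_start, sub_zero] at hr
  have hverts : ∀ k ≤ m, g k ∈ (profileGraph w B T).verts := fun k hk =>
    track_mem hg (by rw [h0]; exact hp.start_mem) hk
  have hm : (m : ℤ) = arcLength w T := by
    have h2 := hr m le_rfl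
    rw [h1, hp.boundaryRank_end] at h2
    -- A track longer than the arc would be at the right end point already at the index `arcLength w
    -- T`; a shorter one has not reached its residue.
    by_cases hle : arcLength w T ≤ m
    · obtain ⟨l, hl⟩ := Int.eq_ofNat_of_zero_le hT.le
      have h3 := hr l (by omega)
      rw [← hl] at h3
      have h4 : g l = g m := by
        refine hp.boundaryRank_inj (hverts _ (by omega)) (hverts _ le_rfl) ?_
        rw [h1, hp.boundaryRank_end]
        exact h3
      have := hg.inj _ (by omega) _ le_rfl h4
      omega
    · have := dvd_small h2 (by omega) (by omega)
      omega
  refine ⟨hm, fun k hk => ?_⟩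
  have h2 := hr k hk
  rcases hp.onArc_of_mem_verts (hverts k hk) with h3 | h3
  · rw [boundaryRank_top h3] at h2
    have h4 := h3.rank_nonneg
    have h5 := h3.rank_le_length
    have := dvd_small h2 (by omega) (by omega)
    exact ⟨h3, by omega⟩
  · have h4 : arcLength w T + arcLength w B ∣ (k : ℤ) + arcRank B (g k) :=
      dvd_of_dvd_of_eq (dvd_sub (hp.boundaryRank_bottom h3) h2) (by ring)
    have h5 := h3.rank_nonneg
    have h6 := h3.rank_le_length
    rcases eq_or_ne ((k : ℤ) + arcRank B (g k)) 0 with h7 | h7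
    · have h8 : g k = g 0 := by
        rw [h0]
        exact h3.rank_inj hp.onArc_B_start.1 (by rw [hp.onArc_B_start.2]; omega)
      rw [h8, h0, hp.onArc_T_start.2]
      exact ⟨hp.onArc_T_start.1, by omega⟩
    · have h8 := Int.le_of_dvd (by omega) h4
      have h9 : g k = ((w : ℤ), B w) := h3.rank_inj onArc_end (by rw [rank_end]; omega)
      rw [h9, hp.onArc_T_end.2]
      exact ⟨hp.onArc_T_end.1, by omega⟩

/-- A track that starts along the lower arc stays on it. -/
theorem track_bottom (hp : Profile w B T) {g : ℕ → ℤ × ℤ} {m : ℕ}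
    (hg : IsTrack (profileGraph w B T) g m) (h0 : g 0 = (0, B 0)) (h1 : g m = ((w : ℤ), B w))
    (hr : ∀ k ≤ m, arcLength w T + arcLength w B ∣
      boundaryRank w B T (g k) - boundaryRank w B T (g 0) + k) :
    ∀ k ≤ m, OnArc w B (g k) := by
  have hT := hp.arcLength_pos T
  have hB := hp.arcLength_pos B
  simp only [h0, hp.boundaryRank_start, sub_zero] at hr
  have hverts : ∀ k ≤ m, g k ∈ (profileGraph w B T).verts := fun k hk =>
    track_mem hg (by rw [h0]; exact hp.start_mem) hk
  have hm : (m : ℤ) ≤ arcLength w B := by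
    by_contra hlt
    obtain ⟨l, hl⟩ := Int.eq_ofNat_of_zero_le hB.le
    have h3 := hr l (by omega)
    rw [← hl] at h3
    have h4 : g l = g m := by
      refine hp.boundaryRank_inj (hverts _ (by omega)) (hverts _ le_rfl) ?_
      rw [h1, hp.boundaryRank_end]
      exact dvd_of_dvd_of_eq (dvd_sub h3 (dvd_refl _)) (by ring)
    have := hg.inj _ (by omega) _ le_rfl h4
    omega
  intro k hk
  rcases hp.onArc_of_mem_verts (hverts k hk) with h3 | h3
  · have h2 := hr k hk
    rw [boundaryRank_top h3] at h2
    have h4 := h3.rank_nonneg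
    have h5 := h3.rank_le_length
    rcases eq_or_ne (arcRank T (g k) + k) 0 with h6 | h6
    · have h8 : g k = (0, B 0) :=
        h3.rank_inj hp.onArc_T_start.1 (by rw [hp.onArc_T_start.2]; omega)
      rw [h8]
      exact hp.onArc_B_start.1
    · have h7 := Int.le_of_dvd (by omega) h2
      have h8 : g k = ((w : ℤ), B w) :=
        h3.rank_inj hp.onArc_T_end.1 (by rw [hp.onArc_T_end.2]; omega)
      rw [h8]
      exact onArc_end
  · exact h3

theorem onArc_down {F : ℤ → ℤ} {a j : ℤ} (h : OnArc w F (a, j - 1))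
    (hr : arcRank F (a, j - 1) = arcRank F (a, j) + 1) : F a < F (a - 1) := by
  simp only [OnArc, arcRank] at h hr
  rw [abs_eq_max_neg, abs_eq_max_neg] at hr
  omega

theorem onArc_up {F : ℤ → ℤ} {a j : ℤ} (h : OnArc w F (a, j + 1))
    (hr : arcRank F (a, j + 1) = arcRank F (a, j) + 1) : F (a - 1) < F a := by
  simp only [OnArc, arcRank] at h hr
  rw [abs_eq_max_neg, abs_eq_max_neg] at hr
  omega

theorem topDent_of_track (hp : Profile w B T) {g : ℕ → ℤ × ℤ} {m : ℕ}
    (hr : ∀ k ≤ m, OnArc w T (g k) ∧ arcRank T (g k) = k) {i j : ℕ} (hij : i < j) (hj : j < m)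
    (hi1 : g (i + 1) = g i - (0, 1)) (hj1 : g (j + 1) = g j + (0, 1)) : TopDent w T := by
  obtain ⟨h1, h2⟩ := hr i (by omega)
  obtain ⟨h3, h4⟩ := hr (i + 1) (by omega)
  obtain ⟨h5, h6⟩ := hr j (by omega)
  obtain ⟨h7, h8⟩ := hr (j + 1) (by omega)
  rw [hi1] at h3 h4
  rw [hj1] at h7 h8
  have hle : (g i).1 ≤ (g j).1 := by
    by_contra hlt
    have := h5.rank_lt (not_le.1 hlt)
    omega
  generalize g i = z at *
  generalize g j = z' at *
  obtain ⟨a, s⟩ := z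
  obtain ⟨b, t⟩ := z'
  simp only [Prod.mk_sub_mk, sub_zero, Prod.mk_add_mk, add_zero] at h3 h4 h7 h8 hle
  have hd := onArc_down h3 (by rw [h4, h2]; push_cast; ring)
  have hu := onArc_up h7 (by rw [h8, h6]; push_cast; ring)
  have hpos := hp.pos
  -- On the line `0` the upper arc only rises, from `B 0` to `T 0`, and on the line `w` it only
  -- falls; on any single line it is monotone. Hence the fall and the later rise occur on different
  -- interior lines.
  have ha : a ≠ 0 := by
    rintro rfl
    rw [hp.T_start] at hd
    have := hp.le 0
    omega
  have hb : b ≠ w := by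
    rintro rfl
    rw [hp.T_end, (hp.right _ le_rfl).1] at hu
    have := hp.le (w - 1)
    omega
  have hab : a ≠ b := by
    rintro rfl
    omega
  have h9 := h1.1
  have h10 := h5.2.1
  simp only at h9 h10
  exact ⟨a, b, by omega, by omega, by omega, hd, hu⟩

theorem eq_start (hp : Profile w B T) {l : ℤ × ℤ}
    (hl : l ∈ (profileGraph w B T).verts ∧ l.1 = 0 ∧
      ∀ q ∈ (profileGraph w B T).verts, q.1 = 0 → l.2 ≤ q.2) : l = (0, B 0) := by
  obtain ⟨a, j⟩ := l
  obtain ⟨h1, h2, h3⟩ := hl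
  simp only at h2
  subst h2
  have h4 := h3 _ hp.start_mem rfl
  rw [hp.mem_verts_iff, hp.B_start, hp.T_start] at h1
  have := hp.le 0
  simp only [Prod.mk.injEq, true_and] at h4 ⊢
  omega

theorem eq_end (hp : Profile w B T) {r : ℤ × ℤ}
    (hr : r ∈ (profileGraph w B T).verts ∧ r.1 = w ∧
      ∀ q ∈ (profileGraph w B T).verts, q.1 = w → r.2 ≤ q.2) : r = ((w : ℤ), B w) := by
  obtain ⟨a, j⟩ := r
  obtain ⟨h1, h2, h3⟩ := hr
  simp only at h2
  subst h2
  have h4 := h3 _ hp.end_mem rfl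
  rw [hp.mem_verts_iff, hp.T_end, (hp.right w le_rfl).1] at h1
  rw [(hp.right w le_rfl).1] at h4 ⊢
  have := hp.le (w - 1)
  simp only [Prod.mk.injEq, true_and] at h4 ⊢
  omega

theorem topDent_of_hasTopIndent (hp : Profile w B T) {h : ℕ}
    (hR : HasBoundingRectangle (profileGraph w B T) w h)
    (hd : HasTopIndent (profileGraph w B T) w h) : TopDent w T := by
  obtain ⟨l, r, p, harc, i, j, hij, hj, hi1, hj1⟩ := hd
  have hl := hp.eq_start harc.left
  have hr := hp.eq_end harc.right
  have hg := isTrack_of_isPath harc.isPath harc.le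
  have h0 : p.getVert 0 = (0, B 0) := by rw [Walk.getVert_zero, hl]
  have h1 : p.getVert p.length = ((w : ℤ), B w) := by rw [Walk.getVert_length, hr]
  rcases hg.follow (fun z z' h => hp.boundaryRank_adj h)
    (fun z hz z' hz' h => hp.boundaryRank_inj hz hz' h) with hf | hf
  · exact hp.topDent_of_track (hp.track_top hg h0 h1 hf).2 hij hj hi1 hj1
  -- The other direction is the lower arc, which stays strictly below the height `h` and so never
  -- meets the top side.
  · exfalso
    obtain ⟨t, ht, hth⟩ := harc.top
    obtain ⟨k, rfl, hk⟩ := Walk.mem_support_iff_exists_getVert.1 ht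
    have h2 := hp.track_bottom hg h0 h1 hf k hk
    have h3 := (hp.hasBoundingRectangle_iff.1 hR).2.1
    have hlt : ∀ i, B i < h := by
      intro i
      have hpos := hp.pos
      by_cases h0 : i < 0
      · have := hp.left i h0
        have := hp.lt 0 le_rfl (by omega)
        have := h3 0 le_rfl (by omega)
        omega
      by_cases h1 : i < w
      · have := hp.lt i (by omega) h1
        have := h3 i (by omega) h1
        omega
      · have := hp.right i (by omega)
        have := hp.lt (w - 1) (by omega) (by omega)
        have := h3 (w - 1) (by omega) (by omega)
        omega
    have h4 := hlt (p.getVert k).1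
    have h5 := hlt ((p.getVert k).1 - 1)
    have h6 := h2.2.2.2
    omega

/-- The polygon has a path along its upper arc. -/
theorem exists_top_path (hp : Profile w B T) :
    ∃ p : squareLattice.Walk ((0 : ℤ), B 0) ((w : ℤ), B w), p.IsPath ∧
      p.toSubgraph ≤ profileGraph w B T ∧
      (p.length : ℤ) = arcLength w T ∧
      ∀ k ≤ p.length, OnArc w T (p.getVert k) ∧ arcRank T (p.getVert k) = k := by
  classical
  obtain ⟨a, c, hc, hcP⟩ := isPolygon_iff.2 hp.isTwoRegular
  have hl : ((0 : ℤ), B 0) ∈ c.support := by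
    rw [← Walk.mem_verts_toSubgraph, hcP]
    exact hp.start_mem
  obtain ⟨c, hc, hcP⟩ : ∃ c : squareLattice.Walk ((0 : ℤ), B 0) (0, B 0), c.IsCycle ∧
      c.toSubgraph = profileGraph w B T :=
    ⟨c.rotate _ hl, hc.rotate hl, by rw [Walk.toSubgraph_rotate, hcP]⟩
  have hr : ((w : ℤ), B w) ∈ c.support := by
    rw [← Walk.mem_verts_toSubgraph, hcP]
    exact hp.end_mem
  have hne : ((w : ℤ), B w) ≠ (0, B 0) := fun h => by
    have := hp.pos
    have := (Prod.mk.inj h).1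
    omega
  -- The cycle, rooted at the left end point, is cut at the right one. The two halves, both read
  -- from left to right, begin with different neighbours of the root, so they cannot both follow the
  -- lower arc; one of them is the required path.
  obtain ⟨p, q, hpq⟩ : ∃ (p : squareLattice.Walk ((0 : ℤ), B 0) ((w : ℤ), B w))
      (q : squareLattice.Walk ((w : ℤ), B w) (0, B 0)), p.append q = c :=
    ⟨c.takeUntil _ hr, c.dropUntil _ hr, c.take_spec hr⟩
  subst hpq
  have hpn : ¬ p.Nil := Walk.not_nil_of_ne hne.symm
  have hqn : ¬ q.Nil := Walk.not_nil_of_ne hne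
  have hpP : p.IsPath := hc.isPath_of_append_left hqn
  have hqP : q.reverse.IsPath := (hc.isPath_of_append_right hpn).reverse
  rw [Walk.toSubgraph_append] at hcP
  have hple : p.toSubgraph ≤ profileGraph w B T := hcP ▸ le_sup_left
  have hqle : q.reverse.toSubgraph ≤ profileGraph w B T := by
    rw [Walk.toSubgraph_reverse, ← hcP]
    exact le_sup_right
  have hpl : 0 < p.length := Walk.not_nil_iff_lt_length.1 hpn
  have hql : 0 < q.length := Walk.not_nil_iff_lt_length.1 hqn
  have hdiff : p.getVert 1 ≠ q.reverse.getVert 1 := by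
    have h1 := hc.snd_ne_penultimate
    rw [Walk.snd, Walk.penultimate, Walk.getVert_append, Walk.getVert_append,
      Walk.length_append] at h1
    rw [Walk.getVert_reverse]
    have h2 : ¬ p.length + q.length - 1 < p.length := by omega
    have h3 : p.length + q.length - 1 - p.length = q.length - 1 := by omega
    rw [if_neg h2, h3] at h1
    split_ifs at h1 with h4
    · exact h1
    · have h5 : p.length = 1 := by omega
      rw [h5, Nat.sub_self, Walk.getVert_zero] at h1
      have h6 : p.getVert 1 = ((w : ℤ), B w) := by rw [← h5, Walk.getVert_length]
      rw [h6]
      exact h1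
  have hgp := isTrack_of_isPath hpP hple
  have hgq := isTrack_of_isPath hqP hqle
  have h0 : p.getVert 0 = (0, B 0) := Walk.getVert_zero p
  have h0' : q.reverse.getVert 0 = (0, B 0) := Walk.getVert_zero _
  rcases hgp.follow (fun z z' h => hp.boundaryRank_adj h)
    (fun z hz z' hz' h => hp.boundaryRank_inj hz hz' h) with hf | hf
  · exact ⟨p, hpP, hple, hp.track_top hgp h0 (Walk.getVert_length p) hf⟩
  rcases hgq.follow (fun z z' h => hp.boundaryRank_adj h)
    (fun z hz z' hz' h => hp.boundaryRank_inj hz hz' h) with hf' | hf'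
  · exact ⟨q.reverse, hqP, hqle, hp.track_top hgq h0' (Walk.getVert_length _) hf'⟩
  · exfalso
    rw [Walk.length_reverse] at hf'
    have h1 := hf 1 hpl
    have h2 := hf' 1 hql
    rw [h0] at h1
    rw [h0'] at h2
    refine hdiff (hp.boundaryRank_inj (track_mem hgp (by rw [h0]; exact hp.start_mem) hpl)
      (track_mem hgq (by rw [h0']; exact hp.start_mem) (by rwa [Walk.length_reverse])) ?_)
    exact dvd_of_dvd_of_eq (dvd_sub h1 h2) (by ring)

theorem hasTopIndent_of_topDent (hp : Profile w B T) {h : ℕ}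
    (hR : HasBoundingRectangle (profileGraph w B T) w h) (hd : TopDent w T) :
    HasTopIndent (profileGraph w B T) w h := by
  obtain ⟨p, hpP, hple, hlen, hrank⟩ := hp.exists_top_path
  have hfind : ∀ z, OnArc w T z → ∃ k ≤ p.length, p.getVert k = z ∧ arcRank T z = k := by
    intro z hz
    obtain ⟨k, hk⟩ := Int.eq_ofNat_of_zero_le hz.rank_nonneg
    have hkl : k ≤ p.length := by
      have := hz.rank_le_length
      omega
    exact ⟨k, hkl, (hrank k hkl).1.rank_inj hz (by rw [(hrank k hkl).2, hk]), hk⟩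
  obtain ⟨a, b, ha, hab, hb, hda, hub⟩ := hd
  refine ⟨_, _, p, ⟨hpP, hple, ⟨hp.start_mem, rfl, ?_⟩, ⟨hp.end_mem, rfl, ?_⟩, ?_⟩, ?_⟩
  · rintro ⟨c, j⟩ hq h0
    simp only at h0
    subst h0
    rw [hp.mem_verts_iff, hp.B_start, hp.T_start] at hq
    have := hp.le 0
    simp only
    omega
  · rintro ⟨c, j⟩ hq h0
    simp only at h0
    subst h0
    have h1 := hp.right w le_rfl
    rw [hp.mem_verts_iff, h1.1, h1.2] at hq
    have := hp.le (w - 1)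
    simp only [h1.1]
    omega
  · obtain ⟨i, hi0, hi1, hi⟩ := (hp.hasBoundingRectangle_iff.1 hR).2.2
    obtain ⟨k, -, hk, -⟩ := hfind (i, T i) (rank_horizontal hi0 hi1).1
    exact ⟨(i, T i), hk ▸ p.getVert_mem_support k, hi⟩
  -- The first step of the falling run on the line `a` starts at height `T (a - 1)`, the first step
  -- of the rising run on the line `b` at height `T (b - 1)`. Their ranks are the positions of the
  -- two steps in the path.
  · have h1 := rank_vertical (w := w) (F := T) (a := a) (j := T (a - 1) - 1) ha.le (by omega)
      (by omega)
    have h2 := rank_vertical (w := w) (F := T) (a := b) (j := T (b - 1)) (by omega) (by omega)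
      (by omega)
    rw [sub_add_cancel] at h1
    obtain ⟨i, hil, hi, hi'⟩ := hfind _ h1.2.1
    obtain ⟨i', hil', hi1, hi1'⟩ := hfind _ h1.1
    obtain ⟨j, hjl, hj, hj'⟩ := hfind _ h2.1
    obtain ⟨j', hjl', hj1, hj1'⟩ := hfind _ h2.2.1
    have hij := h1.1.rank_lt (z' := (b, T (b - 1))) (by simpa using hab)
    have hii : i' = i + 1 := by omega
    have hjj : j' = j + 1 := by omega
    subst hii hjj
    refine ⟨i, j, by omega, by omega, ?_, ?_⟩
    · rw [hi, hi1]
      simp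
    · rw [hj, hj1]
      simp

theorem hasTopIndent_iff (hp : Profile w B T) {h : ℕ}
    (hR : HasBoundingRectangle (profileGraph w B T) w h) :
    HasTopIndent (profileGraph w B T) w h ↔ TopDent w T :=
  ⟨hp.topDent_of_hasTopIndent hR, hp.hasTopIndent_of_topDent hR⟩

end Profile

/-! ### Polygons with convex rows have no vertical indent -/

namespace Profile

variable {w : ℕ} {B T : ℤ → ℤ}

theorem B_lt_height (hp : Profile w B T) {h : ℤ} (hT : ∀ i : ℤ, 0 ≤ i → i < w → T i ≤ h) (i : ℤ) :
    B i < h := by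
  have hpos := hp.pos
  by_cases h0 : i < 0
  · have := hp.left i h0
    have := hp.lt 0 le_rfl (by omega)
    have := hT 0 le_rfl (by omega)
    omega
  by_cases h1 : i < w
  · have := hp.lt i (by omega) h1
    have := hT i (by omega) h1
    omega
  · have := hp.right i (by omega)
    have := hp.lt (w - 1) (by omega) (by omega)
    have := hT (w - 1) (by omega) (by omega)
    omega

theorem B_nonneg (hp : Profile w B T) (hB : ∀ i : ℤ, 0 ≤ i → i < w → 0 ≤ B i) (i : ℤ) :
    0 ≤ B i := by
  have hpos := hp.pos
  by_cases h0 : i < 0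
  · have := hp.left i h0
    have := hB 0 le_rfl (by omega)
    omega
  by_cases h1 : i < w
  · exact hB i (by omega) h1
  · have := hp.right i (by omega)
    have := hB (w - 1) (by omega) (by omega)
    omega

theorem onArc_B_of_zero (hp : Profile w B T) (hB : ∀ i : ℤ, 0 ≤ i → i < w → 0 ≤ B i)
    {z : ℤ × ℤ} (hz : z ∈ (profileGraph w B T).verts) (h0 : z.2 = 0) : OnArc w B z := by
  rcases hp.onArc_of_mem_verts hz with h | h
  · obtain ⟨a, j⟩ := z
    simp only at h0
    subst h0
    have h1 := h
    simp only [OnArc] at h ⊢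
    have hpos := hp.pos
    have hB0 := hp.B_nonneg hB
    have := hB0 a
    have := hB0 (a - 1)
    have := hp.le a
    have := hp.le (a - 1)
    have hlt : ∀ i : ℤ, 0 ≤ i → i < w → 0 < T i := fun i h0 h1 => by
      have := hp.lt i h0 h1
      have := hB0 i
      omega
    by_cases ha : a = 0
    · subst ha
      have := hlt 0 le_rfl (by omega)
      have := hp.T_start
      have := hp.B_start
      omega
    by_cases ha' : a = w
    · subst ha'
      have := hlt (w - 1) (by omega) (by omega)
      have := hp.right w le_rfl
      omega
    · have := hlt a (by omega) (by omega)
      have := hlt (a - 1) (by omega) (by omega)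
      omega
  · exact h

theorem onArc_T_of_height (hp : Profile w B T) {h : ℤ}
    (hT : ∀ i : ℤ, 0 ≤ i → i < w → T i ≤ h)
    {z : ℤ × ℤ} (hz : z ∈ (profileGraph w B T).verts) (h0 : z.2 = h) :
    OnArc w T z ∧ 0 < arcRank T z := by
  have h1 := hp.B_lt_height hT z.1
  have h2 := hp.B_lt_height hT (z.1 - 1)
  rcases hp.onArc_of_mem_verts hz with h3 | h3
  · refine ⟨h3, lt_of_le_of_ne h3.rank_nonneg fun h4 => ?_⟩
    have h5 : z = (0, B 0) :=
      h3.rank_inj hp.onArc_T_start.1 (by rw [hp.onArc_T_start.2]; omega)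
    have h6 := hp.B_lt_height hT 0
    rw [h5] at h0
    simp only at h0
    omega
  · have := h3.2.2.2
    omega

/-- A track from the lower to the upper side that does not use the left side contains no vertex of
the right side if it runs against the lower arc. -/
theorem track_left (hp : Profile w B T) {g : ℕ → ℤ × ℤ} {m : ℕ}
    (hg : IsTrack (profileGraph w B T) g m)
    (hverts : ∀ k ≤ m, g k ∈ (profileGraph w B T).verts)
    (h0 : OnArc w B (g 0)) (hm : OnArc w T (g m)) (h0w : (g 0).1 < w) (hmw : (g m).1 < w)
    (hr : ∀ k ≤ m, arcLength w T + arcLength w B ∣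
      boundaryRank w B T (g k) - boundaryRank w B T (g 0) - k) {k : ℕ} (hk : k ≤ m) :
    (g k).1 < w := by
  have hT := hp.arcLength_pos T
  have hB := hp.arcLength_pos B
  have h0' := hp.boundaryRank_bottom h0
  have r0 := h0.rank_nonneg
  have r1 := hm.rank_nonneg
  have r2 : arcRank B (g 0) < arcLength w B := by
    have := h0.rank_lt (z' := ((w : ℤ), B w)) h0w
    rwa [rank_end] at this
  have r3 : arcRank T (g m) < arcLength w T := by
    have := hm.rank_lt (z' := ((w : ℤ), T w)) hmw
    rwa [rank_end] at this
  -- Running back along the lower arc to the left end and then up the upper arc, the track meets `g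
  -- m` after this number of steps and cannot continue beyond it without repeating a vertex.
  have hms : (m : ℤ) ≤ arcRank B (g 0) + arcRank T (g m) := by
    by_contra hlt
    obtain ⟨s, hs⟩ := Int.eq_ofNat_of_zero_le
      (show 0 ≤ arcRank B (g 0) + arcRank T (g m) by omega)
    have h1 := hr s (by omega)
    have h2 : g s = g m := by
      refine hp.boundaryRank_inj (hverts _ (by omega)) (hverts _ le_rfl) ?_
      rw [boundaryRank_top hm]
      refine dvd_of_dvd_of_eq (dvd_add h1 h0') ?_
      rw [← hs]
      ring
    have := hg.inj _ (by omega) _ le_rfl h2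
    omega
  by_contra hkw
  have h1 := dvd_add (hr k hk) h0'
  rcases hp.onArc_of_mem_verts (hverts k hk) with h2 | h2
  · rw [boundaryRank_top h2] at h1
    have h3 := hm.rank_lt (z' := g k) (by omega)
    have h4 := h2.rank_le_length
    have := dvd_small h1 (by omega) (by omega)
    omega
  · have h3 := h0.rank_lt (z' := g k) (by omega)
    have h4 := h2.rank_le_length
    have h5 : arcLength w T + arcLength w B ∣ arcRank B (g k) - arcRank B (g 0) + k :=
      dvd_of_dvd_of_eq (dvd_sub (hp.boundaryRank_bottom h2) h1) (by ring)
    have := dvd_small h5 (by omega) (by omega)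
    omega

/-- A track from the lower to the upper side that follows the lower arc makes no step to the left
before a step to the right. -/
theorem track_right (hp : Profile w B T) {g : ℕ → ℤ × ℤ} {m : ℕ}
    (hg : IsTrack (profileGraph w B T) g m)
    (hverts : ∀ k ≤ m, g k ∈ (profileGraph w B T).verts)
    (h0 : OnArc w B (g 0)) (hm : OnArc w T (g m)) (hm0 : 0 < arcRank T (g m))
    (hr : ∀ k ≤ m, arcLength w T + arcLength w B ∣
      boundaryRank w B T (g k) - boundaryRank w B T (g 0) + k)
    {i j : ℕ} (hij : i < j) (hj : j < m) (hi1 : g (i + 1) = g i - (1, 0))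
    (hj1 : g (j + 1) = g j + (1, 0)) : False := by
  have hT := hp.arcLength_pos T
  have hB := hp.arcLength_pos B
  have h0' := hp.boundaryRank_bottom h0
  have r0 := h0.rank_nonneg
  have r2 := h0.rank_le_length
  have r3 := hm.rank_le_length
  have hms : (m : ℤ) + arcRank B (g 0) + arcRank T (g m) ≤ arcLength w T + arcLength w B := by
    by_contra hlt
    obtain ⟨s, hs⟩ := Int.eq_ofNat_of_zero_le
      (show 0 ≤ arcLength w T + arcLength w B - arcRank B (g 0) - arcRank T (g m) by omega)
    have h1 := hr s (by omega)
    have h2 : g s = g m := by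
      refine hp.boundaryRank_inj (hverts _ (by omega)) (hverts _ le_rfl) ?_
      rw [boundaryRank_top hm]
      refine dvd_of_dvd_of_eq (dvd_sub (dvd_add h1 h0') (dvd_refl _)) ?_
      rw [← hs]
      ring
    have := hg.inj _ (by omega) _ le_rfl h2
    omega
  have hbot : ∀ k ≤ m, OnArc w B (g k) → arcRank B (g k) = arcRank B (g 0) + k := by
    intro k hk h
    have h1 : arcLength w T + arcLength w B ∣ arcRank B (g k) - arcRank B (g 0) - k :=
      dvd_of_dvd_of_eq (dvd_sub (dvd_sub (hp.boundaryRank_bottom h) (hr k hk)) h0') (by ring)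
    have := h.rank_nonneg
    have := h.rank_le_length
    have := dvd_small h1 (by omega) (by omega)
    omega
  have htop : ∀ k ≤ m, OnArc w T (g k) → 0 < arcRank T (g k) →
      arcLength w T + arcLength w B - arcRank T (g k) = arcRank B (g 0) + k := by
    intro k hk h hpos
    have h1 := hr k hk
    rw [boundaryRank_top h] at h1
    have h2 := dvd_sub (dvd_add h1 h0') (dvd_refl _)
    have := h.rank_le_length
    have := dvd_small h2 (by omega) (by omega)
    omega
  -- Ranks increase to the right on either arc. A step to the left therefore cannot be made along
  -- the lower arc, so by step `i` that arc has been completed.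
  have hi : arcLength w B ≤ arcRank B (g 0) + i := by
    have hadj := hg.adj i (by omega)
    have hlt : (g (i + 1)).1 < (g i).1 := by rw [hi1]; simp
    rcases hp.adj_cases hadj with ⟨h1, h2, -⟩ | ⟨h1, h2, -⟩
    · have h3 := h2.rank_lt hlt
      have h4 := h2.rank_nonneg
      have h5 := htop i (by omega) h1 (by omega)
      have := h1.rank_le_length
      omega
    · have h3 := h2.rank_lt hlt
      have h4 := hbot i (by omega) h1
      have h5 := hbot (i + 1) (by omega) h2
      push_cast at h5
      omega
  have hadj := hg.adj j (by omega)
  have hlt : (g j).1 < (g (j + 1)).1 := by rw [hj1]; simp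
  rcases hp.adj_cases hadj with ⟨h1, h2, -⟩ | ⟨h1, h2, -⟩
  · have h3 := h1.rank_lt hlt
    have h4 := h1.rank_nonneg
    have h5 := htop (j + 1) (by omega) h2 (by omega)
    push_cast at h5
    -- Rank zero on the upper arc means the left end point, which is also the start of the lower
    -- arc; there `hbot` gives a nonnegative number plus `j` equal to zero, but `j` is positive.
    rcases h4.eq_or_lt with h6 | h6
    · have h7 : g j = (0, B 0) :=
        h1.rank_inj hp.onArc_T_start.1 (by rw [hp.onArc_T_start.2]; omega)
      have h8 := hbot j (by omega) (h7 ▸ hp.onArc_B_start.1)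
      rw [h7, hp.onArc_B_start.2] at h8
      omega
    · have := htop j (by omega) h1 h6
      omega
  · have h3 := hbot j (by omega) h1
    have := h1.rank_le_length
    omega

/-- In the coordinates of the column-convex graph, the top arc of the transpose leads from the lower
to the upper side and has to touch the right side, and an indent is a step to the left followed by a
step to the right. Run backwards along the lower arc, it misses the right side (`track_left`); run
forwards, all its steps to the right precede those to the left (`track_right`). -/
theorem not_hasTopIndent_transpose (hp : Profile w B T) {h : ℕ}
    (hR : HasBoundingRectangle (profileGraph w B T) w h) :
    ¬ HasTopIndent (transpose (profileGraph w B T)) h w := by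
  rintro ⟨l, r, p, harc, i, j, hij, hj, hi1, hj1⟩
  obtain ⟨⟨hB, i0, hi0, hi0w, hBi⟩, hT, i2, hi2, hi2w, hTi⟩ := hp.hasBoundingRectangle_iff.1 hR
  have hg' := isTrack_of_isPath harc.isPath harc.le
  set g : ℕ → ℤ × ℤ := fun k => (p.getVert k).swap with hgdef
  have hg : IsTrack (profileGraph w B T) g p.length :=
    ⟨fun k hk => hg'.adj k hk, fun k hk l hl h => hg'.inj k hk l hl (Prod.swap_injective h)⟩
  have hg0 : g 0 = l.swap := by simp [hgdef]
  have hgm : g p.length = r.swap := by simp [hgdef]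
  have hl : l.swap ∈ (profileGraph w B T).verts := harc.left.1
  have hr : r.swap ∈ (profileGraph w B T).verts := harc.right.1
  have h0 : OnArc w B (g 0) := by
    rw [hg0]
    exact hp.onArc_B_of_zero hB hl harc.left.2.1
  have hm : OnArc w T (g p.length) ∧ 0 < arcRank T (g p.length) := by
    rw [hgm]
    exact hp.onArc_T_of_height hT hr harc.right.2.1
  have h0w : (g 0).1 < w := by
    have h1 := harc.left.2.2 (0, i0) (hp.mem_verts_of_onArc (z := (i0, 0)) (Or.inr (by
      have := (rank_horizontal (F := B) hi0 hi0w).1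
      rwa [hBi] at this))) rfl
    rw [hg0]
    exact lt_of_le_of_lt h1 hi0w
  have hmw : (g p.length).1 < w := by
    have h1 := harc.right.2.2 ((h : ℤ), i2) (hp.mem_verts_of_onArc (z := (i2, (h : ℤ))) (Or.inl (by
      have := (rank_horizontal (F := T) hi2 hi2w).1
      rwa [hTi] at this))) rfl
    rw [hgm]
    exact lt_of_le_of_lt h1 hi2w
  have hverts : ∀ k ≤ p.length, g k ∈ (profileGraph w B T).verts := fun k hk =>
    track_mem hg (by rw [hg0]; exact hl) hk
  rcases hg.follow (fun z z' h => hp.boundaryRank_adj h)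
    (fun z hz z' hz' h => hp.boundaryRank_inj hz hz' h) with hf | hf
  · obtain ⟨t, ht, hth⟩ := harc.top
    obtain ⟨k, rfl, hk⟩ := Walk.mem_support_iff_exists_getVert.1 ht
    have := hp.track_left hg hverts h0 hm.1 h0w hmw hf hk
    exact absurd hth this.ne
  · refine hp.track_right hg hverts h0 hm.1 hm.2 hf hij hj ?_ ?_
    · simp only [hgdef, hi1]
      rfl
    · simp only [hgdef, hj1]
      rfl

end Profile

/-! ### Integer sequences that go up and down once, except for one unit -/

/-- The maximum of the partial sums. -/
def maxPrefix : List ℤ → ℤ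
  | [] => 0
  | a :: l => max 0 (a + maxPrefix l)

/-- The total variation. -/
def variation : List ℤ → ℤ
  | [] => 0
  | a :: l => |a| + variation l

/-- The amount by which the variation of a sequence of increments exceeds its least possible value,
given the maximum and the end points. -/
def excess (l : List ℤ) : ℤ := variation l - 2 * maxPrefix l + l.sum

def Falling : List ℤ → Prop
  | [] => True
  | a :: l => a ≤ 0 ∧ Falling l

/-- Up, then down. -/
def Peak : List ℤ → Prop
  | [] => True
  | a :: l => (0 ≤ a ∧ Peak l) ∨ (a < 0 ∧ Falling l)

/-- Down, except for one unit step up. -/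
def FallingDent : List ℤ → Prop
  | [] => False
  | a :: l => (a ≤ 0 ∧ FallingDent l) ∨ (a = 1 ∧ Falling l)

/-- Up, then down, with one unit step up in the falling part. -/
def DescDent : List ℤ → Prop
  | [] => False
  | a :: l => (0 ≤ a ∧ DescDent l) ∨ (a < 0 ∧ FallingDent l)

def FlatDent : List ℤ → Prop
  | [] => False
  | a :: l => (a = 0 ∧ FlatDent l) ∨ (a = 1 ∧ Falling l)

/-- Up, one unit step down, one unit step up, then down. -/
def FlatPeakDent : List ℤ → Prop
  | [] => False
  | a :: l => (0 ≤ a ∧ FlatPeakDent l) ∨ (a = -1 ∧ FlatDent l)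

def RisingPeak : List ℤ → Prop
  | [] => False
  | a :: l => (a = 0 ∧ RisingPeak l) ∨ (0 < a ∧ Peak l)

/-- Up, then down, with one unit step down in the rising part. -/
def AscDent : List ℤ → Prop
  | [] => False
  | a :: l => (0 ≤ a ∧ AscDent l) ∨ (a = -1 ∧ RisingPeak l)

theorem maxPrefix_nonneg : ∀ l, 0 ≤ maxPrefix l
  | [] => le_rfl
  | _ :: _ => le_max_left _ _

theorem variation_ge : ∀ l, |l.sum| ≤ variation l
  | [] => by simp [variation]
  | a :: l => by
    rw [List.sum_cons, variation]
    have := variation_ge l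
    have := abs_add_le a l.sum
    omega

/-- If the maximum is not attained at the start only, it is that of `l` shifted by `a`, and a first
step down costs twice its size. Otherwise the start is the maximum and every later rise counts
twice. -/
theorem excess_cons (a : ℤ) (l : List ℤ) : excess (a :: l) =
    if 0 ≤ a + maxPrefix l then excess l + (|a| - a) else variation l + l.sum + (|a| + a) := by
  simp only [excess, variation, maxPrefix, List.sum_cons]
  split_ifs with h
  · rw [max_eq_right h]
    ring
  · rw [max_eq_left (by omega)]
    ring

theorem even_variation_add : ∀ l : List ℤ, Even (variation l + l.sum)
  | [] => by simp [variation]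
  | a :: l => by
    have := even_variation_add l
    rw [Int.even_iff] at this ⊢
    rw [variation, List.sum_cons, abs_eq_max_neg]
    omega

theorem maxPrefix_le_variation : ∀ l : List ℤ, 2 * maxPrefix l ≤ variation l + l.sum
  | [] => by simp [variation, maxPrefix]
  | a :: l => by
    have := maxPrefix_le_variation l
    have := variation_ge l
    rw [abs_le] at this
    rw [variation, List.sum_cons, maxPrefix, abs_eq_max_neg]
    omega

theorem even_excess (l : List ℤ) : Even (excess l) := by
  have := even_variation_add l
  rw [Int.even_iff] at this ⊢
  rw [excess]
  omega

theorem excess_nonneg (l : List ℤ) : 0 ≤ excess l := by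
  have := maxPrefix_le_variation l
  rw [excess]
  omega

/-- Falls cancel in `variation l + l.sum`, which is twice the total of the rises. This also explains
the value `2` for a single unit rise in `fallingDent_iff`. -/
theorem falling_iff : ∀ l, Falling l ↔ variation l + l.sum = 0
  | [] => by simp [Falling, variation]
  | a :: l => by
    have := variation_ge l
    rw [abs_le] at this
    rw [Falling, falling_iff l, variation, List.sum_cons, abs_eq_max_neg]
    omega

theorem falling_maxPrefix {l : List ℤ} (h : Falling l) : maxPrefix l = 0 := by
  have := maxPrefix_le_variation l
  have := maxPrefix_nonneg l
  rw [falling_iff] at h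
  omega

theorem Falling.peak : ∀ {l : List ℤ}, Falling l → Peak l
  | [], _ => trivial
  | a :: l, h => by
    rcases h.1.lt_or_eq with h1 | h1
    · exact Or.inr ⟨h1, h.2⟩
    · exact Or.inl ⟨h1.ge, h.2.peak⟩

theorem peak_iff : ∀ l, Peak l ↔ excess l = 0
  | [] => by simp [Peak, excess, variation, maxPrefix]
  | a :: l => by
    have h1 := maxPrefix_le_variation l
    have h2 := maxPrefix_nonneg l
    have h3 := excess_nonneg l
    have h4 := falling_maxPrefix (l := l)
    rw [falling_iff] at h4
    rw [Peak, peak_iff l, falling_iff l, excess_cons, abs_eq_max_neg]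
    split_ifs with h <;> omega

theorem fallingDent_iff : ∀ l, FallingDent l ↔ variation l + l.sum = 2
  | [] => by simp [FallingDent, variation]
  | a :: l => by
    have h1 := variation_ge l
    rw [abs_le] at h1
    have h2 := Int.even_iff.1 (even_variation_add l)
    rw [FallingDent, fallingDent_iff l, falling_iff l, variation, List.sum_cons, abs_eq_max_neg]
    omega

theorem risingPeak_iff : ∀ l, RisingPeak l ↔ excess l = 0 ∧ 1 ≤ maxPrefix l
  | [] => by simp [RisingPeak, maxPrefix]
  | a :: l => by
    have h1 := maxPrefix_le_variation l
    have h2 := maxPrefix_nonneg l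
    have h3 := excess_nonneg l
    rw [RisingPeak, risingPeak_iff l, peak_iff l, excess_cons, abs_eq_max_neg, maxPrefix]
    split_ifs with h <;> omega

theorem flatDent_iff : ∀ l, FlatDent l ↔ FallingDent l ∧ RisingPeak l
  | [] => by simp [FlatDent, FallingDent]
  | a :: l => by
    have := Falling.peak (l := l)
    rw [FlatDent, FallingDent, RisingPeak, flatDent_iff l]
    constructor
    · rintro (⟨rfl, h⟩ | ⟨rfl, h⟩)
      · exact ⟨Or.inl ⟨le_rfl, h.1⟩, Or.inl ⟨rfl, h.2⟩⟩
      · exact ⟨Or.inr ⟨rfl, h⟩, Or.inr ⟨one_pos, h.peak⟩⟩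
    · rintro ⟨⟨h1, h2⟩ | ⟨h1, h2⟩, ⟨h3, h4⟩ | ⟨h3, h4⟩⟩
      · exact Or.inl ⟨h3, h2, h4⟩
      · omega
      · omega
      · exact Or.inr ⟨h1, h2⟩

/-- The two descriptions apply together only to a unit dent that starts and ends at the maximum.
This is the intersection needed for inclusion and exclusion. -/
theorem flatPeakDent_iff : ∀ l, FlatPeakDent l ↔ DescDent l ∧ AscDent l
  | [] => by simp [FlatPeakDent, DescDent]
  | a :: l => by
    rw [FlatPeakDent, DescDent, AscDent, flatPeakDent_iff l, flatDent_iff l]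
    by_cases h : 0 ≤ a
    · have h1 : ¬ a = -1 := by omega
      have h2 : ¬ a < 0 := by omega
      tauto
    · have h2 : a < 0 := by omega
      tauto

/-- An excess of two is a single unit travelled forth and back. Induction on the first letter: a
letter `a ≥ 0` leaves the excess unchanged, a letter `a < 0` either starts the falling part or, if
the maximum still lies ahead, must be `-1` and be followed by a sequence without excess. -/
theorem excess_eq_two_iff : ∀ l, excess l = 2 ↔ DescDent l ∨ AscDent l
  | [] => by simp [excess, variation, maxPrefix, DescDent, AscDent]
  | a :: l => by
    have h1 := maxPrefix_le_variation l
    have h2 := maxPrefix_nonneg l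
    have h3 := excess_nonneg l
    rw [DescDent, AscDent]
    by_cases h : 0 ≤ a
    · have h1 : ¬ a = -1 := by omega
      have h2 : ¬ a < 0 := by omega
      have h4 := excess_eq_two_iff l
      rw [excess_cons, if_pos (by omega), abs_of_nonneg h, sub_self, add_zero, h4]
      tauto
    · have h4 : a < 0 := by omega
      have h5 : excess l = variation l - 2 * maxPrefix l + l.sum := rfl
      rw [fallingDent_iff, risingPeak_iff, excess_cons, abs_of_neg h4]
      split_ifs with h6 <;> simp only [h, h4, false_and, true_and, false_or] <;> omega

/-! ### Reversal of a sequence. -/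

/-- The sequence of increments of the sequence read backwards. -/
def reverseNeg (l : List ℤ) : List ℤ := (l.map Neg.neg).reverse

theorem falling_iff_forall : ∀ l, Falling l ↔ ∀ a ∈ l, a ≤ 0
  | [] => by simp [Falling]
  | a :: l => by simp [Falling, falling_iff_forall l]

/-- Descriptions by splitting, unlike the recursive definitions, are visibly exchanged by reversal;
they serve only for this. -/
theorem peak_iff_append : ∀ l, Peak l ↔ ∃ l₁ l₂, l = l₁ ++ l₂ ∧ (∀ a ∈ l₁, 0 ≤ a) ∧ ∀ a ∈ l₂, a ≤ 0
  | [] => by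
    simp only [Peak, true_iff]
    exact ⟨[], [], by simp⟩
  | a :: l => by
    rw [Peak, peak_iff_append l, falling_iff_forall]
    constructor
    · rintro (⟨h, l₁, l₂, rfl, h1, h2⟩ | ⟨h, h1⟩)
      · exact ⟨a :: l₁, l₂, rfl, by simpa using ⟨h, h1⟩, h2⟩
      · exact ⟨[], a :: l, rfl, by simp, by simpa using ⟨h.le, h1⟩⟩
    · rintro ⟨l₁, l₂, h, h1, h2⟩
      rcases l₁ with _ | ⟨b, l₁⟩
      · rw [List.nil_append] at h
        subst h
        simp only [List.mem_cons, forall_eq_or_imp] at h2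
        rcases h2.1.lt_or_eq with h3 | h3
        · exact Or.inr ⟨h3, h2.2⟩
        · exact Or.inl ⟨h3.ge, [], l, rfl, by simp, h2.2⟩
      · obtain ⟨rfl, rfl⟩ := List.cons.inj h
        simp only [List.mem_cons, forall_eq_or_imp] at h1
        exact Or.inl ⟨h1.1, l₁, l₂, rfl, h1.2, h2⟩

theorem fallingDent_iff_append : ∀ l, FallingDent l ↔
    ∃ l₁ l₂, l = l₁ ++ 1 :: l₂ ∧ (∀ a ∈ l₁, a ≤ 0) ∧ ∀ a ∈ l₂, a ≤ 0
  | [] => by simp [FallingDent]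
  | a :: l => by
    rw [FallingDent, fallingDent_iff_append l, falling_iff_forall]
    constructor
    · rintro (⟨h, l₁, l₂, rfl, h1, h2⟩ | ⟨rfl, h1⟩)
      · exact ⟨a :: l₁, l₂, rfl, by simpa using ⟨h, h1⟩, h2⟩
      · exact ⟨[], l, rfl, by simp, h1⟩
    · rintro ⟨l₁, l₂, h, h1, h2⟩
      rcases l₁ with _ | ⟨b, l₁⟩
      · obtain ⟨rfl, rfl⟩ := List.cons.inj h
        exact Or.inr ⟨rfl, h2⟩
      · obtain ⟨rfl, rfl⟩ := List.cons.inj h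
        simp only [List.mem_cons, forall_eq_or_imp] at h1
        exact Or.inl ⟨h1.1, l₁, l₂, rfl, h1.2, h2⟩

theorem descDent_iff_append : ∀ l, DescDent l ↔ ∃ l₁ b l₂ l₃, l = l₁ ++ b :: (l₂ ++ 1 :: l₃) ∧
    (∀ a ∈ l₁, 0 ≤ a) ∧ b < 0 ∧ (∀ a ∈ l₂, a ≤ 0) ∧ ∀ a ∈ l₃, a ≤ 0
  | [] => by simp [DescDent]
  | a :: l => by
    rw [DescDent, descDent_iff_append l, fallingDent_iff_append]
    constructor
    · rintro (⟨h, l₁, b, l₂, l₃, rfl, h1, h2⟩ | ⟨h, l₂, l₃, rfl, h1⟩)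
      · exact ⟨a :: l₁, b, l₂, l₃, rfl, by simpa using ⟨h, h1⟩, h2⟩
      · exact ⟨[], a, l₂, l₃, rfl, by simp, h, h1⟩
    · rintro ⟨l₁, b, l₂, l₃, h, h1, h2, h3⟩
      rcases l₁ with _ | ⟨c, l₁⟩
      · obtain ⟨rfl, rfl⟩ := List.cons.inj h
        exact Or.inr ⟨h2, l₂, l₃, rfl, h3⟩
      · obtain ⟨rfl, rfl⟩ := List.cons.inj h
        simp only [List.mem_cons, forall_eq_or_imp] at h1
        exact Or.inl ⟨h1.1, l₁, b, l₂, l₃, rfl, h1.2, h2, h3⟩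

theorem risingPeak_iff_append : ∀ l, RisingPeak l ↔ ∃ l₁ b l₂, l = l₁ ++ b :: l₂ ∧
    (∀ a ∈ l₁, 0 ≤ a) ∧ 0 < b ∧ ∀ a ∈ l₂, a ≤ 0
  | [] => by simp [RisingPeak]
  | a :: l => by
    rw [RisingPeak, risingPeak_iff_append l, peak_iff_append]
    constructor
    · rintro (⟨rfl, l₁, b, l₂, rfl, h1, h2⟩ | ⟨h, l₁, l₂, rfl, h1, h2⟩)
      · exact ⟨0 :: l₁, b, l₂, rfl, by simpa using h1, h2⟩
      · induction l₁ using List.reverseRecOn generalizing l₂ with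
        | nil => exact ⟨[], a, l₂, rfl, by simp, h, h2⟩
        | append_singleton l₁ c ih =>
          simp only [List.mem_append, List.mem_singleton] at h1
          rcases (h1 c (Or.inr rfl)).lt_or_eq with h3 | h3
          · exact ⟨a :: l₁, c, l₂, by simp, by
              simpa using ⟨h.le, fun b hb => h1 b (Or.inl hb)⟩, h3, h2⟩
          · have := ih (c :: l₂) (fun b hb => h1 b (Or.inl hb))
              (by simpa using ⟨h3.ge, h2⟩)
            simpa using this
    · rintro ⟨l₁, b, l₂, h, h1, h2, h3⟩
      rcases l₁ with _ | ⟨c, l₁⟩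
      · obtain ⟨rfl, rfl⟩ := List.cons.inj h
        exact Or.inr ⟨h2, [], l, rfl, by simp, h3⟩
      · obtain ⟨rfl, rfl⟩ := List.cons.inj h
        simp only [List.mem_cons, forall_eq_or_imp] at h1
        rcases h1.1.lt_or_eq with h4 | h4
        · refine Or.inr ⟨h4, l₁ ++ [b], l₂, by simp, ?_, h3⟩
          simp only [List.mem_append, List.mem_singleton]
          rintro c (hc | rfl)
          · exact h1.2 c hc
          · exact h2.le
        · exact Or.inl ⟨h4.symm, l₁, b, l₂, rfl, h1.2, h2, h3⟩

theorem ascDent_iff_append : ∀ l, AscDent l ↔ ∃ l₁ l₂ b l₃, l = l₁ ++ (-1) :: (l₂ ++ b :: l₃) ∧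
    (∀ a ∈ l₁, 0 ≤ a) ∧ (∀ a ∈ l₂, 0 ≤ a) ∧ 0 < b ∧ ∀ a ∈ l₃, a ≤ 0
  | [] => by simp [AscDent]
  | a :: l => by
    rw [AscDent, ascDent_iff_append l, risingPeak_iff_append]
    constructor
    · rintro (⟨h, l₁, l₂, b, l₃, rfl, h1, h2⟩ | ⟨rfl, l₂, b, l₃, rfl, h1⟩)
      · exact ⟨a :: l₁, l₂, b, l₃, rfl, by simpa using ⟨h, h1⟩, h2⟩
      · exact ⟨[], l₂, b, l₃, rfl, by simp, h1⟩
    · rintro ⟨l₁, l₂, b, l₃, h, h1, h2, h3⟩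
      rcases l₁ with _ | ⟨c, l₁⟩
      · obtain ⟨rfl, rfl⟩ := List.cons.inj h
        exact Or.inr ⟨rfl, l₂, b, l₃, rfl, h2, h3⟩
      · obtain ⟨rfl, rfl⟩ := List.cons.inj h
        simp only [List.mem_cons, forall_eq_or_imp] at h1
        exact Or.inl ⟨h1.1, l₁, l₂, b, l₃, rfl, h1.2, h2, h3⟩

theorem mem_reverseNeg {l : List ℤ} {a : ℤ} : a ∈ reverseNeg l ↔ -a ∈ l := by
  simp only [reverseNeg, List.mem_reverse, List.mem_map]
  constructor
  · rintro ⟨b, hb, rfl⟩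
    rwa [neg_neg]
  · exact fun h => ⟨-a, h, neg_neg a⟩

theorem reverseNeg_append (l l' : List ℤ) :
    reverseNeg (l ++ l') = reverseNeg l' ++ reverseNeg l := by
  simp [reverseNeg]

theorem reverseNeg_cons (a : ℤ) (l : List ℤ) : reverseNeg (a :: l) = reverseNeg l ++ [-a] := by
  simp [reverseNeg]

theorem descDent_reverseNeg_of_ascDent {l : List ℤ} (h : AscDent l) :
    DescDent (reverseNeg l) := by
  obtain ⟨l₁, l₂, b, l₃, rfl, h1, h2, h3, h4⟩ := (ascDent_iff_append l).1 h
  refine (descDent_iff_append _).2 ⟨reverseNeg l₃, -b, reverseNeg l₂, reverseNeg l₁, ?_, ?_, ?_,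
    ?_, ?_⟩
  · simp [reverseNeg_append, reverseNeg_cons]
  · intro a ha
    have := h4 _ (mem_reverseNeg.1 ha)
    omega
  · omega
  · intro a ha
    have := h2 _ (mem_reverseNeg.1 ha)
    omega
  · intro a ha
    have := h1 _ (mem_reverseNeg.1 ha)
    omega

theorem ascDent_reverseNeg_of_descDent {l : List ℤ} (h : DescDent l) :
    AscDent (reverseNeg l) := by
  obtain ⟨l₁, b, l₂, l₃, rfl, h1, h2, h3, h4⟩ := (descDent_iff_append l).1 h
  refine (ascDent_iff_append _).2 ⟨reverseNeg l₃, reverseNeg l₂, -b, reverseNeg l₁, ?_, ?_, ?_,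
    ?_, ?_⟩
  · simp [reverseNeg_append, reverseNeg_cons]
  · intro a ha
    have := h4 _ (mem_reverseNeg.1 ha)
    omega
  · intro a ha
    have := h3 _ (mem_reverseNeg.1 ha)
    omega
  · omega
  · intro a ha
    have := h1 _ (mem_reverseNeg.1 ha)
    omega

theorem peak_reverseNeg {l : List ℤ} (h : Peak l) : Peak (reverseNeg l) := by
  obtain ⟨l₁, l₂, rfl, h1, h2⟩ := (peak_iff_append l).1 h
  refine (peak_iff_append _).2 ⟨reverseNeg l₂, reverseNeg l₁, reverseNeg_append _ _, ?_, ?_⟩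
  · intro a ha
    have := h2 _ (mem_reverseNeg.1 ha)
    omega
  · intro a ha
    have := h1 _ (mem_reverseNeg.1 ha)
    omega

theorem maxPrefix_append (l l' : List ℤ) :
    maxPrefix (l ++ l') = max (maxPrefix l) (l.sum + maxPrefix l') := by
  induction l with
  | nil => simp [maxPrefix, maxPrefix_nonneg]
  | cons a l ih =>
    rw [List.cons_append, maxPrefix, maxPrefix, ih, List.sum_cons]
    omega

theorem sum_reverseNeg (l : List ℤ) : (reverseNeg l).sum = - l.sum := by
  induction l with
  | nil => rfl
  | cons a l ih =>
    rw [reverseNeg_cons, List.sum_append, ih, List.sum_singleton, List.sum_cons]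
    ring

theorem maxPrefix_reverseNeg (l : List ℤ) : maxPrefix (reverseNeg l) = maxPrefix l - l.sum := by
  induction l with
  | nil => rfl
  | cons a l ih =>
    have := maxPrefix_nonneg l
    simp only [reverseNeg_cons, maxPrefix_append, ih, sum_reverseNeg, List.sum_cons, maxPrefix]
    omega

/-! ### Column-convex polygons as words -/

/-- The increments of `F` between `i` and `i + k`. -/
def increments (F : ℤ → ℤ) (i : ℤ) : ℕ → List ℤ
  | 0 => []
  | k + 1 => (F (i + 1) - F i) :: increments F (i + 1) k

section Increments

variable (F : ℤ → ℤ)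

theorem length_increments (i : ℤ) (k : ℕ) : (increments F i k).length = k := by
  induction k generalizing i with
  | zero => rfl
  | succ k ih => rw [increments, List.length_cons, ih]

theorem sum_increments (i : ℤ) (k : ℕ) : (increments F i k).sum = F (i + k) - F i := by
  induction k generalizing i with
  | zero => simp [increments]
  | succ k ih =>
    rw [increments, List.sum_cons, ih, show i + 1 + (k : ℤ) = i + ((k + 1 : ℕ) : ℤ) by
      push_cast; ring]
    ring

theorem variation_increments (i : ℤ) (k : ℕ) : variation (increments F i k) =
    ∑ a ∈ Finset.Ioc i (i + k), |F a - F (a - 1)| := by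
  induction k generalizing i with
  | zero => simp [increments, variation]
  | succ k ih =>
    rw [increments, variation, ih, ← Finset.insert_Ioc_add_one_left_eq_Ioc (a := i) (by omega),
      Finset.sum_insert (by simp), add_sub_cancel_right, show i + 1 + (k : ℤ) =
      i + ((k + 1 : ℕ) : ℤ) by push_cast; ring]

theorem le_maxPrefix_increments (i : ℤ) (k : ℕ) {j : ℤ} (h1 : i ≤ j) (h2 : j ≤ i + k) :
    F j ≤ F i + maxPrefix (increments F i k) := by
  induction k generalizing i with
  | zero =>
    obtain rfl : i = j := by omega
    simp [increments, maxPrefix]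
  | succ k ih =>
    rw [increments, maxPrefix]
    rcases h1.eq_or_lt with rfl | h1
    · omega
    · have := ih (i + 1) (by omega) (by omega)
      omega

theorem exists_eq_maxPrefix_increments (i : ℤ) (k : ℕ) :
    ∃ j, i ≤ j ∧ j ≤ i + k ∧ F j = F i + maxPrefix (increments F i k) := by
  induction k generalizing i with
  | zero => exact ⟨i, by simp [increments, maxPrefix]⟩
  | succ k ih =>
    rw [increments, maxPrefix]
    obtain ⟨j, h1, h2, h3⟩ := ih (i + 1)
    rcases le_total 0 (F (i + 1) - F i + maxPrefix (increments F (i + 1) k)) with h | h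
    · exact ⟨j, by omega, by omega, by omega⟩
    · exact ⟨i, le_rfl, by omega, by omega⟩

theorem falling_increments (i : ℤ) (k : ℕ) : Falling (increments F i k) ↔
    ∀ a, i < a → a ≤ i + k → F a ≤ F (a - 1) := by
  induction k generalizing i with
  | zero =>
    simp only [increments, Falling, true_iff]
    intro a h1 h2
    omega
  | succ k ih =>
    rw [increments, Falling, ih]
    constructor
    · rintro ⟨h1, h2⟩ a h3 h4
      rcases (show i + 1 ≤ a by omega).eq_or_lt with rfl | h5
      · rw [add_sub_cancel_right]
        omega
      · exact h2 a h5 (by omega)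
    · intro h
      refine ⟨?_, fun a h1 h2 => h a (by omega) (by omega)⟩
      have := h (i + 1) (by omega) (by omega)
      rw [add_sub_cancel_right] at this
      omega

theorem not_peak_increments (i : ℤ) (k : ℕ) : ¬ Peak (increments F i k) ↔
    ∃ a b, i < a ∧ a < b ∧ b ≤ i + k ∧ F a < F (a - 1) ∧ F (b - 1) < F b := by
  induction k generalizing i with
  | zero =>
    simp only [increments, Peak, not_true_eq_false, false_iff]
    rintro ⟨a, b, h1, h2, h3, -⟩
    omega
  | succ k ih =>
    have h0 : ¬ Peak (increments F i (k + 1)) ↔ (0 ≤ F (i + 1) - F i →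
        ¬ Peak (increments F (i + 1) k)) ∧
        (F (i + 1) - F i < 0 → ¬ Falling (increments F (i + 1) k)) := by
      rw [increments, Peak]
      tauto
    rw [h0, ih, falling_increments]
    push Not
    constructor
    · rintro ⟨h1, h2⟩
      rcases le_or_gt 0 (F (i + 1) - F i) with h3 | h3
      · obtain ⟨a, b, h4, h5, h6, h7⟩ := h1 h3
        exact ⟨a, b, by omega, h5, by omega, h7⟩
      · obtain ⟨b, h4, h5, h6⟩ := h2 h3
        refine ⟨i + 1, b, by omega, h4, by omega, ?_, h6⟩
        rw [add_sub_cancel_right]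
        omega
    · rintro ⟨a, b, h1, h2, h3, h4, h5⟩
      refine ⟨fun h6 => ⟨a, b, ?_, h2, by omega, h4, h5⟩, fun h6 => ⟨b, by omega, by omega, h5⟩⟩
      rcases (show i + 1 ≤ a by omega).eq_or_lt with rfl | h7
      · rw [add_sub_cancel_right] at h4
        omega
      · exact h7

end Increments

/-- Pairs of increments of the upper and, negated, of the lower profile. -/
abbrev Word : Type := List (ℤ × ℤ)

/-- Starting from a column of height `n`, all columns are nonempty and neighbouring columns
overlap. -/
def Admissible (n : ℤ) : Word → Prop
  | [] => 0 < n
  | p :: l => 0 < n ∧ 0 < n + p.1 ∧ 0 < n + p.2 ∧ Admissible (n + p.1 + p.2) l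

theorem Admissible.pos {n : ℤ} {l : Word} (h : Admissible n l) : 0 < n := by
  cases l with
  | nil => exact h
  | cons p l => exact h.1

def profileWord (B T : ℤ → ℤ) (i : ℤ) (k : ℕ) : Word :=
  List.zip (increments T i k) (increments (fun a => - B a) i k)

theorem profileWord_succ (B T : ℤ → ℤ) (i : ℤ) (k : ℕ) : profileWord B T i (k + 1) =
    (T (i + 1) - T i, - B (i + 1) - - B i) :: profileWord B T (i + 1) k := rfl

theorem fst_profileWord (B T : ℤ → ℤ) (i : ℤ) (k : ℕ) :
    (profileWord B T i k).map Prod.fst = increments T i k := by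
  rw [profileWord, List.map_fst_zip]
  rw [length_increments, length_increments]

theorem snd_profileWord (B T : ℤ → ℤ) (i : ℤ) (k : ℕ) :
    (profileWord B T i k).map Prod.snd = increments (fun a => - B a) i k := by
  rw [profileWord, List.map_snd_zip]
  rw [length_increments, length_increments]

/-- With `n = T i - B i`, the numbers `n + p.1` and `n + p.2` are `T (i + 1) - B i` and `T i - B (i
+ 1)`, whose positivity is the overlap of the columns `i` and `i + 1`. -/
theorem admissible_profileWord (B T : ℤ → ℤ) (i : ℤ) (k : ℕ) :
    Admissible (T i - B i) (profileWord B T i k) ↔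
      (∀ j, i ≤ j → j ≤ i + k → B j < T j) ∧
      ∀ j, i < j → j ≤ i + k → B (j - 1) < T j ∧ B j < T (j - 1) := by
  induction k generalizing i with
  | zero =>
    simp only [profileWord, increments, List.zip_nil_right, Admissible]
    constructor
    · intro h
      refine ⟨fun j h1 h2 => ?_, fun j h1 h2 => ?_⟩
      · obtain rfl : i = j := by omega
        omega
      · omega
    · intro h
      have := h.1 i le_rfl (by omega)
      omega
  | succ k ih =>
    rw [profileWord_succ, Admissible]
    simp only
    rw [show T i - B i + (T (i + 1) - T i) + (-B (i + 1) - -B i) = T (i + 1) - B (i + 1) by ring,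
      ih]
    constructor
    · rintro ⟨h1, h2, h3, h4, h5⟩
      refine ⟨fun j h6 h7 => ?_, fun j h6 h7 => ?_⟩
      · rcases h6.eq_or_lt with rfl | h6
        · omega
        · exact h4 j (by omega) (by omega)
      · rcases (show i + 1 ≤ j by omega).eq_or_lt with rfl | h6
        · rw [add_sub_cancel_right]
          omega
        · exact h5 j (by omega) (by omega)
    · rintro ⟨h1, h2⟩
      have h3 := h1 i le_rfl (by omega)
      have h4 := h2 (i + 1) (by omega) (by omega)
      rw [add_sub_cancel_right] at h4
      exact ⟨by omega, by omega, by omega, fun j h5 h6 => h1 j (by omega) (by omega),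
        fun j h5 h6 => h2 j (by omega) (by omega)⟩

/-- Words, with the height of the first column, by the length of the word, the height of the
bounding rectangle and the excesses of the upper and the lower profile. -/
def wordsOfExcess (k : ℕ) (h e f : ℤ) : Set (ℤ × Word) :=
  {z | z.2.length = k ∧ Admissible z.1 z.2 ∧
    z.1 + maxPrefix (z.2.map Prod.fst) + maxPrefix (z.2.map Prod.snd) = h ∧
    excess (z.2.map Prod.fst) = e ∧ excess (z.2.map Prod.snd) = f}

/-- Profiles with bounding rectangle `[0, k + 1] × [0, h]`, by their excesses. -/
def profilesOfExcess (k h : ℕ) (e f : ℤ) : Set ((ℤ → ℤ) × (ℤ → ℤ)) :=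
  {z | Profile (k + 1) z.1 z.2 ∧
    HasBoundingRectangle (profileGraph (k + 1) z.1 z.2) (k + 1) h ∧
    excess (increments z.2 0 k) = e ∧ excess (increments (fun a => - z.1 a) 0 k) = f}

theorem topDent_iff {k : ℕ} {T : ℤ → ℤ} : TopDent (k + 1) T ↔ excess (increments T 0 k) ≠ 0 := by
  rw [Ne, ← peak_iff, not_peak_increments, TopDent]
  refine exists_congr fun a => exists_congr fun b => ?_
  push_cast
  constructor <;> rintro ⟨h1, h2, h3, h4⟩ <;> exact ⟨h1, h2, by omega, h4⟩

/-- The left and right sides contribute `T 0 - B 0` and `T k - B k`. The sums of the increments in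
the two excesses replace the latter by the former, which leaves twice the height of the rectangle
plus the excesses. -/
theorem Profile.ncard_verticalSteps_eq {k : ℕ} {B T : ℤ → ℤ} (hp : Profile (k + 1) B T) :
    ((verticalSteps (profileGraph (k + 1) B T)).ncard : ℤ) =
      2 * (T 0 - B 0 + maxPrefix (increments T 0 k) + maxPrefix (increments (fun a => - B a) 0 k)) +
      excess (increments T 0 k) + excess (increments (fun a => - B a) 0 k) := by
  have h1 := hp.lt 0 le_rfl (by push_cast; omega)
  have h2 := hp.lt k (by omega) (by push_cast; omega)
  have h3 := hp.right (k + 1 : ℕ) le_rfl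
  push_cast at h3
  rw [add_sub_cancel_right] at h3
  rw [hp.ncard_verticalSteps]
  push_cast
  rw [← Finset.insert_Icc_right_eq_Icc_add_one (a := (0 : ℤ)) (b := k) (by omega),
    Finset.sum_insert (by simp), ← Finset.Ioc_insert_left (a := (0 : ℤ)) (b := k) (by omega),
    Finset.sum_insert (by simp), Finset.sum_add_distrib]
  have e1 := variation_increments T 0 k
  have e2 := variation_increments (fun a => - B a) 0 k
  have e3 := sum_increments T 0 k
  have e4 := sum_increments (fun a => - B a) 0 k
  have e5 : ∀ a, |B a - B (a - 1)| = |-B a - -B (a - 1)| := fun a => by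
    rw [← abs_neg]
    ring_nf
  simp only [zero_add] at e1 e2 e3 e4
  simp only [e5, ← e1, ← e2, excess]
  rw [e3, e4, add_sub_cancel_right, h3.1, h3.2, hp.T_start, ← e5, hp.B_start,
    abs_of_pos (show 0 < T 0 - B 0 by omega), abs_of_neg (show B k - T k < 0 by omega), sub_self,
    sub_self, abs_zero]
  ring

/-- The minimum of `B` is `B 0` minus the maximal partial sum of the increments of `-B`; the maximum
of `T` is `T 0` plus that of its increments. They have to be `0` and `h`. -/
theorem Profile.rectangle_iff {k h : ℕ} {B T : ℤ → ℤ} (hp : Profile (k + 1) B T) :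
    HasBoundingRectangle (profileGraph (k + 1) B T) (k + 1) h ↔
      B 0 = maxPrefix (increments (fun a => - B a) 0 k) ∧
      T 0 + maxPrefix (increments T 0 k) = h := by
  have h1 := fun j => le_maxPrefix_increments T 0 k (j := j)
  have h2 := fun j => le_maxPrefix_increments (fun a => - B a) 0 k (j := j)
  obtain ⟨j3, h31, h32, h33⟩ := exists_eq_maxPrefix_increments T 0 k
  obtain ⟨j4, h41, h42, h43⟩ := exists_eq_maxPrefix_increments (fun a => - B a) 0 k
  rw [hp.hasBoundingRectangle_iff]
  push_cast
  constructor
  · rintro ⟨⟨h5, j6, h61, h62, h63⟩, h7, j8, h81, h82, h83⟩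
    have := h1 j8 h81 (by omega)
    have := h2 j6 h61 (by omega)
    have := h7 j3 h31 (by omega)
    have := h5 j4 h41 (by omega)
    omega
  · rintro ⟨h5, h6⟩
    refine ⟨⟨fun i hi hik => ?_, j4, h41, by omega, by omega⟩, fun i hi hik => ?_, j3, h31,
      by omega, by omega⟩
    · have := h2 i hi (by omega)
      omega
    · have := h1 i hi (by omega)
      omega

theorem Profile.admissible {k : ℕ} {B T : ℤ → ℤ} (hp : Profile (k + 1) B T) :
    Admissible (T 0 - B 0) (profileWord B T 0 k) := by
  rw [admissible_profileWord]
  refine ⟨fun j h1 h2 => hp.lt j h1 (by push_cast; omega),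
    fun j h1 h2 => hp.overlap j h1 (by push_cast; omega)⟩

/-! ### The bijection between profiles and words. -/

theorem mapsTo_wordsOfExcess (k h : ℕ) (e f : ℤ) : Set.MapsTo
    (fun z : (ℤ → ℤ) × (ℤ → ℤ) => (z.2 0 - z.1 0, profileWord z.1 z.2 0 k))
    (profilesOfExcess k h e f) (wordsOfExcess k h e f) := by
  rintro ⟨B, T⟩ ⟨hp, hR, he, hf⟩
  simp only at hp hR he hf
  rw [hp.rectangle_iff] at hR
  refine ⟨?_, hp.admissible, ?_, ?_, ?_⟩
  · change (List.zip _ _).length = k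
    rw [List.length_zip, length_increments, length_increments, min_self]
  all_goals
    simp only [fst_profileWord, snd_profileWord]
    omega

theorem eq_of_increments_eq {F G : ℤ → ℤ} {i : ℤ} {k : ℕ}
    (h : increments F i k = increments G i k) (h0 : F i = G i) {j : ℤ} (h1 : i ≤ j)
    (h2 : j ≤ i + k) : F j = G j := by
  induction k generalizing i with
  | zero =>
    obtain rfl : i = j := by omega
    exact h0
  | succ k ih =>
    rw [increments, increments] at h
    obtain ⟨h3, h4⟩ := List.cons.inj h
    rcases h1.eq_or_lt with rfl | h1
    · exact h0
    · exact ih h4 (by omega) (by omega) (by omega)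

theorem injOn_wordsOfExcess (k h : ℕ) (e f : ℤ) : Set.InjOn
    (fun z : (ℤ → ℤ) × (ℤ → ℤ) => (z.2 0 - z.1 0, profileWord z.1 z.2 0 k))
    (profilesOfExcess k h e f) := by
  rintro ⟨B, T⟩ ⟨hp, hR, -, -⟩ ⟨B', T'⟩ ⟨hp', hR', -, -⟩ heq
  simp only at hp hR hp' hR'
  rw [hp.rectangle_iff] at hR
  rw [hp'.rectangle_iff] at hR'
  obtain ⟨h1, h2⟩ := Prod.mk.inj heq
  have h3 : increments T 0 k = increments T' 0 k := by
    rw [← fst_profileWord B T, ← fst_profileWord B' T', h2]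
  have h4 : increments (fun a => - B a) 0 k = increments (fun a => - B' a) 0 k := by
    rw [← snd_profileWord B T, ← snd_profileWord B' T', h2]
  simp only at h1
  rw [h3, h4] at hR
  have hB0 : B 0 = B' 0 := by omega
  have hT0 : T 0 = T' 0 := by omega
  have hBk : ∀ j : ℤ, 0 ≤ j → j ≤ k → B j = B' j := fun j h5 h6 =>
    neg_injective (eq_of_increments_eq h4 (by simpa using hB0) h5 (by omega))
  have hTk : ∀ j : ℤ, 0 ≤ j → j ≤ k → T j = T' j := fun j h5 h6 =>
    eq_of_increments_eq h3 hT0 h5 (by omega)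
  have hend : ((k + 1 : ℕ) : ℤ) - 1 = k := by push_cast; ring
  have hk := hBk k (by omega) le_rfl
  refine Prod.ext (funext fun j => ?_) (funext fun j => ?_) <;> simp only <;>
    by_cases h5 : j < 0
  · rw [(hp.left j h5).1, (hp'.left j h5).1, hB0]
  · by_cases h6 : j ≤ k
    · exact hBk j (by omega) h6
    · rw [(hp.right j (by push_cast; omega)).1, (hp'.right j (by push_cast; omega)).1, hend, hk]
  · rw [(hp.left j h5).2, (hp'.left j h5).2, hB0]
  · by_cases h6 : j ≤ k
    · exact hTk j (by omega) h6
    · rw [(hp.right j (by push_cast; omega)).2, (hp'.right j (by push_cast; omega)).2, hend, hk]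

theorem increments_partialSum (l : List ℤ) (c : ℤ) (F : ℤ → ℤ) (i : ℤ)
    (hF : ∀ j : ℤ, i ≤ j → j ≤ i + l.length → F j = c + (l.take (j - i).toNat).sum) :
    increments F i l.length = l := by
  induction l generalizing c i with
  | nil => rfl
  | cons a l ih =>
    rw [List.length_cons] at hF ⊢
    rw [increments]
    congr 1
    · rw [hF i le_rfl (by omega), hF (i + 1) (by omega) (by push_cast; omega)]
      simp
    · refine ih (c + a) (i + 1) fun j h1 h2 => ?_
      rw [hF j (by omega) (by push_cast; omega)]
      obtain ⟨d, rfl⟩ := Int.le.dest h1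
      have e1 : (i + 1 + (d : ℤ) - i).toNat = d + 1 := by omega
      have e2 : (i + 1 + (d : ℤ) - (i + 1)).toNat = d := by omega
      rw [e1, e2, List.take_succ_cons, List.sum_cons]
      ring

theorem surjOn_wordsOfExcess (k h : ℕ) (e f : ℤ) : Set.SurjOn
    (fun z : (ℤ → ℤ) × (ℤ → ℤ) => (z.2 0 - z.1 0, profileWord z.1 z.2 0 k))
    (profilesOfExcess k h e f) (wordsOfExcess k h e f) := by
  rintro ⟨n, l⟩ ⟨hlen, hadm, hh, he1, he2⟩
  simp only at hlen hadm hh he1 he2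
  subst hlen
  set b := l.map Prod.snd with hb
  set a := l.map Prod.fst with ha
  have hla : a.length = l.length := List.length_map _
  have hlb : b.length = l.length := List.length_map _
  -- The starting height `maxPrefix b` puts the minimum of `B` at zero. Truncation of `toNat` and
  -- `take` continues `B` constantly on both sides, whereas `T` has to be redefined there.
  set B : ℤ → ℤ := fun i => maxPrefix b - (b.take i.toNat).sum with hB
  set T : ℤ → ℤ := fun i => if 0 ≤ i ∧ i ≤ l.length then maxPrefix b + n + (a.take i.toNat).sum
    else B i with hT
  have hTin : ∀ i : ℤ, 0 ≤ i → i ≤ l.length → T i = maxPrefix b + n + (a.take i.toNat).sum :=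
    fun i h1 h2 => if_pos ⟨h1, h2⟩
  have hB0 : B 0 = maxPrefix b := by simp [hB]
  have hT0 : T 0 = maxPrefix b + n := by rw [hTin 0 le_rfl (by omega)]; simp
  have hwT : increments T 0 l.length = a := by
    rw [← hla]
    refine increments_partialSum a (maxPrefix b + n) T 0 fun j h1 h2 => ?_
    rw [hTin j h1 (by omega), sub_zero]
  have hwB : increments (fun a => - B a) 0 l.length = b := by
    rw [← hlb]
    refine increments_partialSum b (- maxPrefix b) _ 0 fun j h1 h2 => ?_
    simp only [hB, sub_zero]
    ring
  have hw : profileWord B T 0 l.length = l := by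
    rw [profileWord, hwT, hwB, ha, hb]
    exact (List.zip_of_prod rfl rfl).symm
  have hn : T 0 - B 0 = n := by omega
  have hadm' := (admissible_profileWord B T 0 l.length).1 (by rw [hw, hn]; exact hadm)
  have hp : Profile (l.length + 1) B T := by
    refine ⟨by omega, fun i h1 h2 => hadm'.1 i h1 (by push_cast at h2; omega),
      fun i h1 h2 => hadm'.2 i h1 (by push_cast at h2; omega), fun i hi => ?_, fun i hi => ?_⟩
    · have h1 : B i = B 0 := by
        simp only [hB]
        rw [Int.toNat_of_nonpos hi.le]
        rfl
      refine ⟨h1, ?_⟩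
      rw [← h1]
      exact if_neg (by omega)
    · push_cast at hi ⊢
      rw [add_sub_cancel_right]
      have h1 : B i = B l.length := by
        simp only [hB]
        rw [List.take_of_length_le (by omega), List.take_of_length_le (by omega)]
      refine ⟨h1, ?_⟩
      rw [← h1]
      exact if_neg (by omega)
  refine ⟨(B, T), ⟨hp, ?_, ?_, ?_⟩, ?_⟩
  · rw [hp.rectangle_iff]
    simp only [hwT, hwB]
    omega
  · simp only [hwT, he1]
  · simp only [hwB, he2]
  · simp only [hw, hn]

theorem ncard_profilesOfExcess (k h : ℕ) (e f : ℤ) :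
    (profilesOfExcess k h e f).ncard = (wordsOfExcess k h e f).ncard :=
  Set.ncard_congr' ((Set.BijOn.mk (mapsTo_wordsOfExcess k h e f) (injOn_wordsOfExcess k h e f)
    (surjOn_wordsOfExcess k h e f)).equiv)

theorem admissible_swap (n : ℤ) (l : Word) : Admissible n (l.map Prod.swap) ↔ Admissible n l := by
  induction l generalizing n with
  | nil => rfl
  | cons p l ih =>
    simp only [List.map_cons, Admissible, Prod.fst_swap, Prod.snd_swap]
    rw [add_right_comm, ih]
    tauto

theorem map_fst_map_swap (l : Word) : (l.map Prod.swap).map Prod.fst = l.map Prod.snd := by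
  rw [List.map_map]
  rfl

theorem map_snd_map_swap (l : Word) : (l.map Prod.swap).map Prod.snd = l.map Prod.fst := by
  rw [List.map_map]
  rfl

/-- Turning the polygon upside down interchanges the components of each letter, since the second one
already carries the sign of the reflection. -/
theorem ncard_wordsOfExcess_comm (k : ℕ) (h e f : ℤ) :
    (wordsOfExcess k h e f).ncard = (wordsOfExcess k h f e).ncard := by
  refine Set.ncard_congr (fun z _ => (z.1, z.2.map Prod.swap)) ?_ ?_ ?_
  · rintro ⟨n, l⟩ ⟨h1, h2, h3, h4, h5⟩
    refine ⟨by simpa using h1, (admissible_swap n l).2 h2, ?_, ?_, ?_⟩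
    · simp only [map_fst_map_swap, map_snd_map_swap] at h3 ⊢
      omega
    · simpa only [map_fst_map_swap] using h5
    · simpa only [map_snd_map_swap] using h4
  · rintro ⟨n, l⟩ ⟨n', l'⟩ - - heq
    simp only [Prod.mk.injEq] at heq ⊢
    exact ⟨heq.1, List.map_injective_iff.2 Prod.swap_injective heq.2⟩
  · rintro ⟨n, l⟩ ⟨h1, h2, h3, h4, h5⟩
    refine ⟨(n, l.map Prod.swap), ⟨by simpa using h1, (admissible_swap n l).2 h2, ?_, ?_, ?_⟩, ?_⟩
    · simp only [map_fst_map_swap, map_snd_map_swap] at h3 ⊢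
      omega
    · simpa only [map_fst_map_swap] using h5
    · simpa only [map_snd_map_swap] using h4
    · simp [Function.comp_def]

theorem injOn_profileGraph (k h : ℕ) (e f : ℤ) : Set.InjOn
    (fun z : (ℤ → ℤ) × (ℤ → ℤ) => profileGraph (k + 1) z.1 z.2) (profilesOfExcess k h e f) := by
  rintro ⟨B, T⟩ h1 ⟨B', T'⟩ h2 h
  have := Profile.graph_injective h1.1 h2.1 h
  exact Prod.ext this.2.1 this.2.2

/-- Polygons with bounding rectangle `[0, k + 1] × [0, h]` and convex columns, by the excesses of
their profiles. -/
def polygonsOfExcess (k h : ℕ) (e f : ℤ) : Set squareLattice.Subgraph :=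
  (fun z : (ℤ → ℤ) × (ℤ → ℤ) => profileGraph (k + 1) z.1 z.2) '' profilesOfExcess k h e f

theorem ncard_polygonsOfExcess (k h : ℕ) (e f : ℤ) :
    (polygonsOfExcess k h e f).ncard = (wordsOfExcess k h e f).ncard := by
  rw [polygonsOfExcess, (injOn_profileGraph k h e f).ncard_image, ncard_profilesOfExcess]

theorem disjoint_polygonsOfExcess (k h : ℕ) :
    Disjoint (polygonsOfExcess k h 2 0) (polygonsOfExcess k h 0 2) := by
  rw [Set.disjoint_left]
  rintro P ⟨⟨B, T⟩, h1, rfl⟩ ⟨⟨B', T'⟩, h2, heq⟩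
  obtain ⟨-, rfl, rfl⟩ := Profile.graph_injective h2.1 h1.1 heq
  exact absurd (h1.2.2.1.symm.trans h2.2.2.1) (by norm_num)

/-! ### The families of polygons in terms of words -/

/-- 1-convex polygons with convex columns. -/
def verticalType (w h : ℕ) : Set squareLattice.Subgraph :=
  {P | IsConvexOfIndex 1 P w h ∧ (horizontalSteps P).ncard = 2 * w ∧
    (verticalSteps P).ncard = 2 * h + 2}

theorem verticalType_zero (h : ℕ) : verticalType 0 h = ∅ := by
  refine Set.eq_empty_of_forall_notMem ?_
  rintro P ⟨hP, h1, -⟩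
  obtain ⟨B, T, hp, -⟩ := exists_profile (isPolygon_iff.1 hP.polygon) hP.rectangle h1
  exact absurd hp.pos (lt_irrefl 0)

theorem Profile.isConvexOfIndex {k h : ℕ} {B T : ℤ → ℤ} (hp : Profile (k + 1) B T)
    (hR : HasBoundingRectangle (profileGraph (k + 1) B T) (k + 1) h)
    (he : excess (increments T 0 k) + excess (increments (fun a => - B a) 0 k) = 2) :
    profileGraph (k + 1) B T ∈ verticalType (k + 1) h := by
  have h1 := hp.ncard_verticalSteps_eq
  have h2 := hp.rectangle_iff.1 hR
  have h3 := hp.ncard_horizontalSteps hR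
  have h4 := isPolygon_iff.2 hp.isTwoRegular
  have h5 : (verticalSteps (profileGraph (k + 1) B T)).ncard = 2 * h + 2 := by omega
  exact ⟨⟨h4, hR, by rw [ncard_edgeSet h4, h3, h5]; ring⟩, h3, h5⟩

/-- The number `2 * h + 2` of vertical steps makes the two excesses add up to two; they are
nonnegative and even, so they are two and zero in some order. -/
theorem verticalType_succ (k h : ℕ) : verticalType (k + 1) h =
    polygonsOfExcess k h 2 0 ∪ polygonsOfExcess k h 0 2 := by
  ext P
  constructor
  · rintro ⟨hP, h1, h2⟩
    obtain ⟨B, T, hp, rfl⟩ := exists_profile (isPolygon_iff.1 hP.polygon) hP.rectangle h1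
    have h3 := hp.ncard_verticalSteps_eq
    have h4 := hp.rectangle_iff.1 hP.rectangle
    have h5 := excess_nonneg (increments T 0 k)
    have h6 := excess_nonneg (increments (fun a => - B a) 0 k)
    have h7 := Int.even_iff.1 (even_excess (increments T 0 k))
    have h8 : (excess (increments T 0 k) = 2 ∧ excess (increments (fun a => - B a) 0 k) = 0) ∨
        (excess (increments T 0 k) = 0 ∧ excess (increments (fun a => - B a) 0 k) = 2) := by
      omega
    rcases h8 with h8 | h8
    · exact Or.inl ⟨(B, T), ⟨hp, hP.rectangle, h8⟩, rfl⟩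
    · exact Or.inr ⟨(B, T), ⟨hp, hP.rectangle, h8⟩, rfl⟩
  · rintro (⟨⟨B, T⟩, ⟨hp, hR, h1, h2⟩, rfl⟩ | ⟨⟨B, T⟩, ⟨hp, hR, h1, h2⟩, rfl⟩)
    · exact hp.isConvexOfIndex hR (by rw [h1, h2]; norm_num)
    · exact hp.isConvexOfIndex hR (by rw [h1, h2]; norm_num)

theorem transpose_mem_verticalType {P : squareLattice.Subgraph} {w h : ℕ}
    (hP : IsConvexOfIndex 1 P w h) (h1 : (horizontalSteps P).ncard = 2 * w + 2)
    (h2 : (verticalSteps P).ncard = 2 * h) : transpose P ∈ verticalType h w := by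
  have h3 := isPolygon_transpose hP.polygon
  have h4 : (horizontalSteps (transpose P)).ncard = 2 * h := by rw [← ncard_verticalSteps, h2]
  have h5 : (verticalSteps (transpose P)).ncard = 2 * w + 2 := by
    rw [ncard_verticalSteps, transpose_transpose, h1]
  exact ⟨⟨h3, hP.rectangle.transpose, by rw [ncard_edgeSet h3, h4, h5]; ring⟩, h4, h5⟩

/-- Only the polygons with convex columns can have a vertical indent. -/
theorem mem_verticalType_of_hasTopIndent {P : squareLattice.Subgraph} {w h : ℕ}
    (hP : IsConvexOfIndex 1 P w h) (hd : HasTopIndent P w h) : P ∈ verticalType w h := by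
  rcases hP.cases with h1 | h1
  · exact ⟨hP, h1⟩
  · exfalso
    have h2 := transpose_mem_verticalType hP h1.1 h1.2
    obtain ⟨B, T, hp, heq⟩ := exists_profile (isPolygon_iff.1 h2.1.polygon) h2.1.rectangle h2.2.1
    have h3 := h2.1.rectangle
    rw [heq] at h3
    refine hp.not_hasTopIndent_transpose h3 ?_
    rw [← heq, transpose_transpose]
    exact hd

theorem topIndentPolygonsOfSize_zero (h : ℕ) : topIndentPolygonsOfSize 0 h = ∅ := by
  refine Set.eq_empty_of_forall_notMem fun P hP => ?_
  have := mem_verticalType_of_hasTopIndent hP.1 hP.2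
  rw [verticalType_zero] at this
  exact this

theorem topIndentPolygonsOfSize_succ (k h : ℕ) :
    topIndentPolygonsOfSize (k + 1) h = polygonsOfExcess k h 2 0 := by
  ext P
  constructor
  · rintro ⟨hP, hd⟩
    have h1 := mem_verticalType_of_hasTopIndent hP hd
    rw [verticalType_succ] at h1
    rcases h1 with h1 | ⟨⟨B, T⟩, ⟨hp, hR, h1, h2⟩, rfl⟩
    · exact h1
    · exact absurd h1 (topDent_iff.1 ((hp.hasTopIndent_iff hR).1 hd))
  · intro hP
    have h1 : P ∈ verticalType (k + 1) h := by
      rw [verticalType_succ]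
      exact Or.inl hP
    obtain ⟨⟨B, T⟩, ⟨hp, hR, h2, h3⟩, rfl⟩ := hP
    refine ⟨h1.1, (hp.hasTopIndent_iff hR).2 (topDent_iff.2 ?_)⟩
    rw [show excess (increments T 0 k) = 2 from h2]
    norm_num

theorem finite_verticalType (w h : ℕ) : (verticalType w h).Finite :=
  (finite_boundingRectangle w h).subset fun _ hP => hP.1.rectangle

theorem ncard_topIndentPolygonsOfSize_succ (k h : ℕ) :
    (topIndentPolygonsOfSize (k + 1) h).ncard = (wordsOfExcess k h 2 0).ncard := by
  rw [topIndentPolygonsOfSize_succ, ncard_polygonsOfExcess]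

/-- The indent is on the top or on the bottom arc. -/
theorem ncard_verticalType (w h : ℕ) :
    (verticalType w h).ncard = 2 * (topIndentPolygonsOfSize w h).ncard := by
  rcases w with _ | k
  · rw [verticalType_zero, topIndentPolygonsOfSize_zero]
    simp
  · have hfin := finite_verticalType (k + 1) h
    rw [verticalType_succ] at hfin ⊢
    rw [Set.ncard_union_eq (disjoint_polygonsOfExcess k h) (hfin.subset Set.subset_union_left)
      (hfin.subset Set.subset_union_right), topIndentPolygonsOfSize_succ, ncard_polygonsOfExcess,
      ncard_polygonsOfExcess, ncard_wordsOfExcess_comm k h 0 2]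
    ring

theorem topIndentPolygons_zero (m : ℕ) : topIndentPolygons m 0 = ∅ := by
  refine Set.eq_empty_of_forall_notMem ?_
  rintro P ⟨w, h, hP, hd, h1, h2⟩
  have := (mem_verticalType_of_hasTopIndent hP hd).2
  omega

/-- A rectangle of height `n` goes with `2 * n + 2` vertical steps. This shift is the factor `y`
between the two generating functions. -/
theorem topIndentPolygons_succ (m n : ℕ) :
    topIndentPolygons m (n + 1) = topIndentPolygonsOfSize m n := by
  ext P
  constructor
  · rintro ⟨w, h, hP, hd, h1, h2⟩
    have h3 := (mem_verticalType_of_hasTopIndent hP hd).2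
    obtain rfl : w = m := by omega
    obtain rfl : h = n := by omega
    exact ⟨hP, hd⟩
  · rintro ⟨hP, hd⟩
    have h3 := (mem_verticalType_of_hasTopIndent hP hd).2
    exact ⟨m, n, hP, hd, h3.1, h3.2⟩

theorem HasBoundingRectangle.unique {P : squareLattice.Subgraph} {w h w' h' : ℕ}
    (h1 : HasBoundingRectangle P w h) (h2 : HasBoundingRectangle P w' h') : w = w' ∧ h = h' := by
  have := h1.2.1.unique h2.2.1
  have := h1.2.2.2.unique h2.2.2.2
  omega

/-- The polygons with `2 * m` horizontal and `2 * n` vertical steps whose columns are convex. -/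
def columnConvexPolygons (m n : ℕ) : Set squareLattice.Subgraph :=
  {P | ∃ h, n = h + 1 ∧ P ∈ verticalType m h}

theorem ncard_columnConvexPolygons_zero (m : ℕ) : (columnConvexPolygons m 0).ncard = 0 := by
  have : columnConvexPolygons m 0 = ∅ := by
    refine Set.eq_empty_of_forall_notMem ?_
    rintro P ⟨h, h1, -⟩
    omega
  rw [this, Set.ncard_empty]

theorem ncard_columnConvexPolygons_succ (m n : ℕ) :
    (columnConvexPolygons m (n + 1)).ncard = 2 * (topIndentPolygonsOfSize m n).ncard := by
  have : columnConvexPolygons m (n + 1) = verticalType m n := by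
    ext P
    constructor
    · rintro ⟨h, h1, h2⟩
      obtain rfl : n = h := by omega
      exact h2
    · exact fun h => ⟨n, rfl, h⟩
  rw [this, ncard_verticalType]

theorem transpose_injective : Function.Injective transpose :=
  Function.LeftInverse.injective transpose_transpose

theorem oneConvexPolygons_eq (m n : ℕ) : oneConvexPolygons m n =
    columnConvexPolygons m n ∪ transpose '' columnConvexPolygons n m := by
  ext P
  constructor
  · rintro ⟨w, h, hP, h1, h2⟩
    rcases hP.cases with h3 | h3
    · obtain rfl : w = m := by omega
      exact Or.inl ⟨h, by omega, hP, h3⟩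
    · obtain rfl : h = n := by omega
      exact Or.inr ⟨transpose P, ⟨w, by omega, transpose_mem_verticalType hP h3.1 h3.2⟩,
        transpose_transpose P⟩
  · rintro (⟨h, rfl, hP, h1, h2⟩ | ⟨P, ⟨w, rfl, hP, h1, h2⟩, rfl⟩)
    · exact ⟨m, h, hP, h1, h2⟩
    · have h3 := isPolygon_transpose hP.polygon
      have h4 : (horizontalSteps (transpose P)).ncard = 2 * w + 2 := by
        rw [← ncard_verticalSteps, h2]
      have h5 : (verticalSteps (transpose P)).ncard = 2 * n := by
        rw [ncard_verticalSteps, transpose_transpose, h1]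
      exact ⟨w, n, ⟨h3, hP.rectangle.transpose, by rw [ncard_edgeSet h3, h4, h5]; ring⟩, h4, h5⟩

/-- The two kinds are told apart by their bounding rectangles, which are `m` by `n - 1` for convex
columns and `m - 1` by `n` for convex rows. -/
theorem ncard_oneConvexPolygons (m n : ℕ) : (oneConvexPolygons m n).ncard =
    (columnConvexPolygons m n).ncard + (columnConvexPolygons n m).ncard := by
  have hfin := finite_oneConvexPolygons m n
  rw [oneConvexPolygons_eq] at hfin ⊢
  rw [Set.ncard_union_eq ?_ (hfin.subset Set.subset_union_left)
    (hfin.subset Set.subset_union_right), Set.InjOn.ncard_image transpose_injective.injOn]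
  rw [Set.disjoint_left]
  rintro P ⟨h, rfl, hP, -⟩ ⟨Q, ⟨w, rfl, hQ, -⟩, rfl⟩
  have := hP.rectangle.unique hQ.rectangle.transpose
  omega

theorem ncard_biUnion_finset {α ι : Type*} (t : Finset ι) {s : ι → Set α}
    (hs : ∀ i ∈ t, (s i).Finite) (h : ∀ i ∈ t, ∀ j ∈ t, i ≠ j → Disjoint (s i) (s j)) :
    (⋃ i ∈ t, s i).ncard = ∑ i ∈ t, (s i).ncard := by
  rw [← finsum_mem_coe_finset]
  exact t.finite_toSet.ncard_biUnion hs fun i hi j hj hij => h i hi j hj hij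

theorem ncard_oneConvexPolygonsOfPerimeter (N : ℕ) : (oneConvexPolygonsOfPerimeter N).ncard =
    ∑ d ∈ Finset.HasAntidiagonal.antidiagonal N, (oneConvexPolygons d.1 d.2).ncard := by
  have h : oneConvexPolygonsOfPerimeter N =
      ⋃ d ∈ Finset.HasAntidiagonal.antidiagonal N, oneConvexPolygons d.1 d.2 := by
    ext P
    simp only [Set.mem_iUnion, Finset.HasAntidiagonal.mem_antidiagonal]
    constructor
    · rintro ⟨w, h, hP, h1⟩
      rw [ncard_edgeSet hP.polygon] at h1
      rcases hP.cases with h2 | h2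
      · exact ⟨(w, h + 1), by simp only; omega, w, h, hP, by omega, by omega⟩
      · exact ⟨(w + 1, h), by simp only; omega, w, h, hP, by omega, by omega⟩
    · rintro ⟨⟨m, n⟩, h1, w, h, hP, h2, h3⟩
      simp only at h1 h2 h3
      exact ⟨w, h, hP, by rw [ncard_edgeSet hP.polygon]; omega⟩
  rw [h]
  refine ncard_biUnion_finset _ (fun d _ => finite_oneConvexPolygons _ _) ?_
  intro d _ d' _ hne
  rw [Set.disjoint_left]
  rintro P ⟨w, h, -, h1, h2⟩ ⟨w', h', -, h3, h4⟩
  exact hne (Prod.ext (by omega) (by omega))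

/-! ### Counting words by the first letter -/

/-- The kinds of moves of one of the two profiles; `up` and `down` allow the move by zero. -/
inductive Move
  | up
  | down
  | strictDown
  | inc
  | stay
  | dec
  | none

namespace Move

/-- The sizes that a move may have. -/
def Allows : Move → ℕ → Prop
  | up, _ => True
  | down, _ => True
  | strictDown, d => 1 ≤ d
  | inc, d => d = 0
  | stay, d => d = 0
  | dec, d => d = 0
  | none, _ => False

/-- The change of the height of the column. -/
def shift : Move → ℕ → ℤ
  | up, d => d
  | down, d => -d
  | strictDown, d => -d
  | inc, _ => 1
  | stay, _ => 0
  | dec, _ => -1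
  | none, _ => 0

/-- The contribution to the height of the bounding rectangle. -/
def weight : Move → ℕ → ℕ
  | up, d => d
  | _, _ => 0

/-- The effect of a move on counting functions of the height `n` and the weight `m`. -/
def count : Move → (ℕ → ℕ → ℕ) → ℕ → ℕ → ℕ
  | up, f, n, m => ∑ q ∈ Finset.range (m + 1), f (n + q) (m - q)
  | down, f, n, m => ∑ j ∈ Finset.range n, f (j + 1) m
  | strictDown, f, n, m => ∑ j ∈ Finset.range (n - 1), f (j + 1) m
  | inc, f, n, m => f (n + 1) m
  | stay, f, n, m => f n m
  | dec, f, n, m => if 2 ≤ n then f (n - 1) m else 0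
  | none, _, _, _ => 0

/-- A move, from a column of height `n`, followed by an element of a family. -/
def prepend {α : Type*} (o : Move) (A : ℕ → ℕ → Set α) (n m : ℕ) : Set (ℕ × α) :=
  {z | o.Allows z.1 ∧ 0 < (n : ℤ) + o.shift z.1 ∧ o.weight z.1 ≤ m ∧
    z.2 ∈ A ((n : ℤ) + o.shift z.1).toNat (m - o.weight z.1)}

theorem finite_ncard_of_eq_iUnion {α : Type*} {S : Set (ℕ × α)} (t : Finset ℕ) (g : ℕ → ℕ)
    (hg : Set.InjOn g t) (B : ℕ → Set α) (hB : ∀ i, (B i).Finite)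
    (hS : S = ⋃ i ∈ t, Prod.mk (g i) '' B i) : S.Finite ∧ S.ncard = ∑ i ∈ t, (B i).ncard := by
  subst hS
  refine ⟨t.finite_toSet.biUnion fun i _ => (hB i).image _, ?_⟩
  rw [ncard_biUnion_finset t (fun i _ => (hB i).image _)]
  · refine Finset.sum_congr rfl fun i _ => ?_
    exact ((Prod.mk_right_injective (g i)).injOn).ncard_image
  · intro i hi j hj hij
    rw [Set.disjoint_left]
    rintro _ ⟨a, -, rfl⟩ ⟨b, -, h⟩
    exact hij (hg hi hj (Prod.mk.inj h).1.symm)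

/-- For falling moves the sum runs over the new height `j + 1` instead of the size `n - 1 - j` of
the move; the requirement of a nonempty column bounds it from below. -/
theorem prepend_spec {α : Type*} (o : Move) {A : ℕ → ℕ → Set α} (hA : ∀ n m, (A n m).Finite)
    {n : ℕ} (hn : 1 ≤ n) (m : ℕ) : (o.prepend A n m).Finite ∧
      (o.prepend A n m).ncard = o.count (fun n m => (A n m).ncard) n m := by
  cases o with
  | up =>
    refine finite_ncard_of_eq_iUnion (Finset.range (m + 1)) id Function.injective_id.injOn
      (fun q => A (n + q) (m - q)) (fun _ => hA _ _) ?_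
    ext ⟨d, a⟩
    simp only [prepend, Allows, shift, weight, Set.mem_ofPred_eq, Set.mem_iUnion, Set.mem_image,
      Prod.mk.injEq, Finset.mem_range, id]
    constructor
    · rintro ⟨-, h1, h2, h3⟩
      refine ⟨d, by omega, a, ?_, rfl, rfl⟩
      rwa [show ((n : ℤ) + d).toNat = n + d by omega] at h3
    · rintro ⟨q, h1, b, h2, rfl, rfl⟩
      refine ⟨trivial, by omega, by omega, ?_⟩
      rwa [show ((n : ℤ) + q).toNat = n + q by omega]
  | down =>
    refine finite_ncard_of_eq_iUnion (Finset.range n) (fun j => n - 1 - j) ?_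
      (fun j => A (j + 1) m) (fun _ => hA _ _) ?_
    · intro i hi j hj h
      simp only [Finset.coe_range, Set.mem_Iio] at hi hj h
      omega
    ext ⟨d, a⟩
    simp only [prepend, Allows, shift, weight, Set.mem_ofPred_eq, Set.mem_iUnion, Set.mem_image,
      Prod.mk.injEq, Finset.mem_range]
    constructor
    · rintro ⟨-, h1, h2, h3⟩
      refine ⟨n - 1 - d, by omega, a, ?_, by omega, rfl⟩
      rwa [show ((n : ℤ) + -d).toNat = n - 1 - d + 1 by omega] at h3
    · rintro ⟨q, h1, b, h2, rfl, rfl⟩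
      refine ⟨trivial, by omega, by omega, ?_⟩
      rwa [show ((n : ℤ) + -((n - 1 - q : ℕ) : ℤ)).toNat = q + 1 by omega]
  | strictDown =>
    refine finite_ncard_of_eq_iUnion (Finset.range (n - 1)) (fun j => n - 1 - j) ?_
      (fun j => A (j + 1) m) (fun _ => hA _ _) ?_
    · intro i hi j hj h
      simp only [Finset.coe_range, Set.mem_Iio] at hi hj h
      omega
    ext ⟨d, a⟩
    simp only [prepend, Allows, shift, weight, Set.mem_ofPred_eq, Set.mem_iUnion, Set.mem_image,
      Prod.mk.injEq, Finset.mem_range]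
    constructor
    · rintro ⟨h0, h1, h2, h3⟩
      refine ⟨n - 1 - d, by omega, a, ?_, by omega, rfl⟩
      rwa [show ((n : ℤ) + -d).toNat = n - 1 - d + 1 by omega] at h3
    · rintro ⟨q, h1, b, h2, rfl, rfl⟩
      refine ⟨by omega, by omega, by omega, ?_⟩
      rwa [show ((n : ℤ) + -((n - 1 - q : ℕ) : ℤ)).toNat = q + 1 by omega]
  | inc =>
    have := finite_ncard_of_eq_iUnion (S := inc.prepend A n m) {0} id Function.injective_id.injOn
      (fun q => A (n + 1) m) (fun _ => hA _ _) ?_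
    · rwa [Finset.sum_singleton] at this
    ext ⟨d, a⟩
    simp only [prepend, Allows, shift, weight, Set.mem_ofPred_eq, Set.mem_iUnion, Set.mem_image,
      Prod.mk.injEq, Finset.mem_singleton, id]
    rw [show ((n : ℤ) + 1).toNat = n + 1 by omega]
    constructor
    · rintro ⟨rfl, h1, h2, h3⟩
      exact ⟨0, rfl, a, h3, rfl, rfl⟩
    · rintro ⟨q, rfl, b, h2, rfl, rfl⟩
      exact ⟨rfl, by omega, by omega, h2⟩
  | stay =>
    have := finite_ncard_of_eq_iUnion (S := stay.prepend A n m) {0} id Function.injective_id.injOn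
      (fun q => A n m) (fun _ => hA _ _) ?_
    · rwa [Finset.sum_singleton] at this
    ext ⟨d, a⟩
    simp only [prepend, Allows, shift, weight, Set.mem_ofPred_eq, Set.mem_iUnion, Set.mem_image,
      Prod.mk.injEq, Finset.mem_singleton, id]
    rw [show ((n : ℤ) + 0).toNat = n by omega]
    constructor
    · rintro ⟨rfl, h1, h2, h3⟩
      exact ⟨0, rfl, a, h3, rfl, rfl⟩
    · rintro ⟨q, rfl, b, h2, rfl, rfl⟩
      exact ⟨rfl, by omega, by omega, h2⟩
  | dec =>
    rw [count]
    split_ifs with hn2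
    · have := finite_ncard_of_eq_iUnion (S := dec.prepend A n m) {0} id
        Function.injective_id.injOn (fun q => A (n - 1) m) (fun _ => hA _ _) ?_
      · rwa [Finset.sum_singleton] at this
      ext ⟨d, a⟩
      simp only [prepend, Allows, shift, weight, Set.mem_ofPred_eq, Set.mem_iUnion, Set.mem_image,
        Prod.mk.injEq, Finset.mem_singleton, id]
      rw [show ((n : ℤ) + -1).toNat = n - 1 by omega]
      constructor
      · rintro ⟨rfl, h1, h2, h3⟩
        exact ⟨0, rfl, a, h3, rfl, rfl⟩
      · rintro ⟨q, rfl, b, h2, rfl, rfl⟩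
        exact ⟨rfl, by omega, by omega, h2⟩
    · have : dec.prepend A n m = ∅ := by
        refine Set.eq_empty_of_forall_notMem ?_
        rintro ⟨d, a⟩ ⟨-, h1, -⟩
        simp only [shift] at h1
        omega
      rw [this]
      simp
  | none =>
    have : none.prepend A n m = ∅ :=
      Set.eq_empty_of_forall_notMem fun z hz => hz.1
    rw [this]
    simp [count]

/-- Whether the move makes the column shorter. -/
def Shrinks : Move → Prop
  | down => True
  | strictDown => True
  | dec => True
  | _ => False

open scoped Classical in
/-- The effect of a move of the upper and a move of the lower profile: what makes the column
shorter comes first, so that neighbouring columns overlap. -/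
def count₂ (o o' : Move) (f : ℕ → ℕ → ℕ) : ℕ → ℕ → ℕ :=
  if o.Shrinks then o.count (o'.count f) else o'.count (o.count f)

/-- Two moves, from a column of height `n`, followed by an element of a family. -/
def prepend₂ {α : Type*} (o o' : Move) (A : ℕ → ℕ → Set α) (n m : ℕ) : Set (ℕ × ℕ × α) :=
  {z | o.Allows z.1 ∧ o'.Allows z.2.1 ∧ 0 < (n : ℤ) + o.shift z.1 ∧
    0 < (n : ℤ) + o'.shift z.2.1 ∧ 0 < (n : ℤ) + o.shift z.1 + o'.shift z.2.1 ∧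
    o.weight z.1 + o'.weight z.2.1 ≤ m ∧
    z.2.2 ∈ A ((n : ℤ) + o.shift z.1 + o'.shift z.2.1).toNat
      (m - (o.weight z.1 + o'.weight z.2.1))}

theorem shift_nonpos {o : Move} (h : o.Shrinks) (d : ℕ) : o.shift d ≤ 0 := by
  cases o <;> simp [Shrinks, shift] at h ⊢

theorem shift_nonneg {o : Move} (h : ¬ o.Shrinks) (d : ℕ) : 0 ≤ o.shift d := by
  cases o <;> simp [Shrinks, shift] at h ⊢

theorem count_congr (o : Move) {f g : ℕ → ℕ → ℕ} (h : ∀ n m, 1 ≤ n → f n m = g n m) {n : ℕ}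
    (hn : 1 ≤ n) (m : ℕ) : o.count f n m = o.count g n m := by
  cases o with
  | up => exact Finset.sum_congr rfl fun q _ => h _ _ (by omega)
  | down => exact Finset.sum_congr rfl fun q _ => h _ _ (by omega)
  | strictDown => exact Finset.sum_congr rfl fun q _ => h _ _ (by omega)
  | inc => exact h _ _ (by omega)
  | stay => exact h _ _ hn
  | dec =>
    simp only [count]
    split_ifs with h2
    · exact h _ _ (by omega)
    · rfl
  | none => rfl

/-- Positivity is required of the height after either move alone and after both. When the moves are
carried out one after the other, one of the three conditions is not tested: if `o` shrinks and comes
first, the height after `o'` alone is at least the final one; if `o` does not shrink and comes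
second, the height after `o` alone is at least `n`. -/
theorem prepend₂_spec {α : Type*} (o o' : Move) {A : ℕ → ℕ → Set α}
    (hA : ∀ n m, (A n m).Finite) {n : ℕ} (hn : 1 ≤ n) (m : ℕ) :
    (o.prepend₂ o' A n m).Finite ∧
      (o.prepend₂ o' A n m).ncard = o.count₂ o' (fun n m => (A n m).ncard) n m := by
  have key : ∀ o o' : Move, ∃ C : ℕ → ℕ → Set (ℕ × α), (∀ n m, (C n m).Finite) ∧
      (∀ n m, 1 ≤ n → C n m = o'.prepend A n m) ∧ ∀ n m, 1 ≤ n →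
      (o.prepend C n m).Finite ∧
      (o.prepend C n m).ncard = o.count (o'.count (fun n m => (A n m).ncard)) n m := by
    intro o o'
    -- `prepend_spec` applies to heights at least one only, so the inner family is replaced by the
    -- empty one at height zero, which is never reached.
    have hC : ∀ n m, (if 1 ≤ n then o'.prepend A n m else ∅ : Set (ℕ × α)).Finite := by
      intro n m
      split_ifs with h
      · exact (o'.prepend_spec hA h m).1
      · exact Set.finite_empty
    refine ⟨fun n m => if 1 ≤ n then o'.prepend A n m else ∅, hC, fun n m h => if_pos h,
      fun n m h => ?_⟩
    have h1 := o.prepend_spec hC h m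
    refine ⟨h1.1, h1.2.trans (o.count_congr (fun n m hn => ?_) h m)⟩
    rw [if_pos hn]
    exact (o'.prepend_spec hA hn m).2
  by_cases ho : o.Shrinks
  · obtain ⟨C, -, hC, h⟩ := key o o'
    have h1 := h n m hn
    rw [count₂, if_pos ho]
    suffices o.prepend₂ o' A n m = o.prepend C n m by rwa [this]
    ext ⟨d, e, a⟩
    have h2 := shift_nonpos ho d
    have h3 : 0 < (n : ℤ) + o.shift d → (((n : ℤ) + o.shift d).toNat : ℤ) = n + o.shift d :=
      fun h => Int.toNat_of_nonneg h.le
    constructor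
    · rintro ⟨g1, g2, g3, g4, g5, g6, g7⟩
      simp only at g1 g2 g3 g4 g5 g6 g7
      refine ⟨g1, g3, by simp only; omega, ?_⟩
      rw [hC _ _ (by simp only; omega)]
      refine ⟨g2, ?_, ?_, ?_⟩ <;> simp only [h3 g3]
      · omega
      · omega
      · rwa [Nat.sub_sub]
    · rintro ⟨g1, g3, g6, g7⟩
      simp only at g1 g3 g6
      rw [hC _ _ (by simp only; omega)] at g7
      obtain ⟨g2, g5, g8, g9⟩ := g7
      simp only [h3 g3] at g2 g5 g8 g9
      refine ⟨g1, g2, g3, ?_, g5, ?_, ?_⟩ <;> simp only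
      · omega
      · omega
      · rwa [Nat.sub_sub] at g9
  · obtain ⟨C, hCf, hC, h⟩ := key o' o
    have h1 := h n m hn
    rw [count₂, if_neg ho]
    have hf : Function.Injective (fun z : ℕ × ℕ × α => (z.2.1, z.1, z.2.2)) := by
      rintro ⟨a, b, c⟩ ⟨a', b', c'⟩ h
      simp only [Prod.mk.injEq] at h ⊢
      tauto
    suffices o.prepend₂ o' A n m =
        (fun z : ℕ × ℕ × α => (z.2.1, z.1, z.2.2)) '' o'.prepend C n m by
      rw [this, hf.injOn.ncard_image]
      exact ⟨h1.1.image _, h1.2⟩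
    ext ⟨d, e, a⟩
    have h2 := shift_nonneg ho d
    have h3 : 0 < (n : ℤ) + o'.shift e → (((n : ℤ) + o'.shift e).toNat : ℤ) = n + o'.shift e :=
      fun h => Int.toNat_of_nonneg h.le
    constructor
    · rintro ⟨g1, g2, g3, g4, g5, g6, g7⟩
      simp only at g1 g2 g3 g4 g5 g6 g7
      refine ⟨(e, d, a), ⟨g2, g4, by simp only; omega, ?_⟩, rfl⟩
      rw [hC _ _ (by simp only; omega)]
      refine ⟨g1, ?_, ?_, ?_⟩ <;> simp only [h3 g4]
      · omega
      · omega
      · rwa [Nat.sub_sub, add_comm (o'.weight e), add_right_comm]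
    · rintro ⟨⟨e', d', a'⟩, ⟨g1, g3, g6, g7⟩, heq⟩
      simp only [Prod.mk.injEq] at heq
      obtain ⟨rfl, rfl, rfl⟩ := heq
      simp only at g1 g3 g6
      rw [hC _ _ (by simp only; omega)] at g7
      obtain ⟨g2, g5, g8, g9⟩ := g7
      simp only [h3 g3] at g2 g5 g8 g9
      refine ⟨g2, g1, ?_, g3, ?_, ?_, ?_⟩ <;> simp only
      · omega
      · omega
      · omega
      · rwa [Nat.sub_sub, add_comm (o'.weight _), add_right_comm] at g9

end Move

/-! ### Automata that read the two profiles. -/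

/-- The states of the automata that read the increments of a profile. -/
inductive Phase
  | peak
  | falling
  | descDent
  | fallingDent
  | flatPeakDent
  | flatDent

namespace Phase

def Accepts : Phase → List ℤ → Prop
  | peak => Peak
  | falling => Falling
  | descDent => DescDent
  | fallingDent => FallingDent
  | flatPeakDent => FlatPeakDent
  | flatDent => FlatDent

/-- The contribution to the height of the bounding rectangle. -/
def weight : Phase → List ℤ → ℕ
  | peak, l => (maxPrefix l).toNat
  | descDent, l => (maxPrefix l).toNat
  | flatPeakDent, l => (maxPrefix l).toNat
  | _, _ => 0

/-- The two kinds of letters that can be read. -/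
def next : Phase → Bool → Move × Phase
  | peak, true => (.up, peak)
  | peak, false => (.strictDown, falling)
  | falling, true => (.down, falling)
  | falling, false => (.none, falling)
  | descDent, true => (.up, descDent)
  | descDent, false => (.strictDown, fallingDent)
  | fallingDent, true => (.down, fallingDent)
  | fallingDent, false => (.inc, falling)
  | flatPeakDent, true => (.up, flatPeakDent)
  | flatPeakDent, false => (.dec, flatDent)
  | flatDent, true => (.stay, flatDent)
  | flatDent, false => (.inc, falling)

theorem accepts_cons (p : Phase) (a : ℤ) (l : List ℤ) : p.Accepts (a :: l) ↔
    ∃ i d, (p.next i).1.Allows d ∧ a = (p.next i).1.shift d ∧ (p.next i).2.Accepts l := by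
  have hup : ∀ {a : ℤ}, (∃ d : ℕ, a = d) ↔ 0 ≤ a := fun {a} =>
    ⟨fun ⟨d, h⟩ => by omega, fun h => ⟨a.toNat, by omega⟩⟩
  have hdn : ∀ {a : ℤ}, (∃ d : ℕ, a = -d) ↔ a ≤ 0 := fun {a} =>
    ⟨fun ⟨d, h⟩ => by omega, fun h => ⟨(-a).toNat, by omega⟩⟩
  have hsd : ∀ {a : ℤ}, (∃ d : ℕ, 1 ≤ d ∧ a = -d) ↔ a < 0 := fun {a} =>
    ⟨fun ⟨d, _, h⟩ => by omega, fun h => ⟨(-a).toNat, by omega, by omega⟩⟩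
  simp only [Bool.exists_bool, ← and_assoc, exists_and_right]
  cases p <;> simp [Accepts, next, Move.Allows, Move.shift, Peak, Falling, DescDent, FallingDent,
    FlatPeakDent, FlatDent, hup, hdn, hsd] <;> tauto

/-- The phases after the maximum carry no weight: they are entered from it by a descent of at least
one, so the single unit rise that may follow does not exceed the maximum. -/
theorem weight_cons (p : Phase) (i : Bool) (d : ℕ) (l : List ℤ)
    (h : (p.next i).1.Allows d) (hl : (p.next i).2.Accepts l) :
    p.weight ((p.next i).1.shift d :: l) =
      (p.next i).1.weight d + (p.next i).2.weight l := by
  have h1 := maxPrefix_nonneg l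
  have h2 := maxPrefix_le_variation l
  cases p <;> cases i <;> simp only [next, Accepts, Move.Allows, weight, Move.weight, Move.shift,
    maxPrefix, falling_iff, flatDent_iff, fallingDent_iff] at h hl ⊢ <;> omega

/-- The automata are deterministic; `strictDown` is strict so that a zero step is read in one way
only. Hence each word has one decomposition and the counts simply add. -/
theorem next_disjoint (p : Phase) {i j : Bool} {d e : ℕ} (h1 : (p.next i).1.Allows d)
    (h2 : (p.next j).1.Allows e) (h : (p.next i).1.shift d = (p.next j).1.shift e) :
    i = j ∧ d = e := by
  cases p <;> cases i <;> cases j <;> simp [next, Move.Allows, Move.shift] at h1 h2 h ⊢ <;> omega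

end Phase

/-- The words that are accepted from a column of height `n`, of length `k` and weight `m`. -/
def acceptedWords (p q : Phase) (k n m : ℕ) : Set Word :=
  {l | l.length = k ∧ Admissible n l ∧ p.Accepts (l.map Prod.fst) ∧ q.Accepts (l.map Prod.snd) ∧
    p.weight (l.map Prod.fst) + q.weight (l.map Prod.snd) = m}

/-- The word that begins with the two given moves. -/
def consMoves (o o' : Move) (z : ℕ × ℕ × Word) : Word := (o.shift z.1, o'.shift z.2.1) :: z.2.2

theorem acceptedWords_succ (p q : Phase) (k : ℕ) {n : ℕ} (hn : 1 ≤ n) (m : ℕ) :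
    acceptedWords p q (k + 1) n m = ⋃ i ∈ (Finset.univ : Finset (Bool × Bool)),
      consMoves (p.next i.1).1 (q.next i.2).1 ''
        (p.next i.1).1.prepend₂ (q.next i.2).1
          (acceptedWords (p.next i.1).2 (q.next i.2).2 k) n m := by
  ext l
  simp only [Set.mem_iUnion, Finset.mem_univ, exists_true_left, Set.mem_image, Prod.exists]
  constructor
  · rintro ⟨h1, h2, h3, h4, h5⟩
    rcases l with _ | ⟨⟨a, b⟩, l⟩
    · simp at h1
    rw [List.map_cons] at h3 h4 h5
    obtain ⟨i, d, g1, g2, g3⟩ := (p.accepts_cons _ _).1 h3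
    obtain ⟨j, e, g4, g5, g6⟩ := (q.accepts_cons _ _).1 h4
    simp only at g2 g5
    subst g2 g5
    obtain ⟨h6, h7, h8, h9⟩ := h2
    have h10 := h9.pos
    rw [List.map_cons, p.weight_cons i d _ g1 g3, q.weight_cons j e _ g4 g6] at h5
    refine ⟨i, j, d, e, l, ⟨g1, g4, h7, h8, h10, by simp only; omega, ?_⟩, rfl⟩
    refine ⟨by simpa using h1, ?_, g3, g6, by simp only; omega⟩
    simp only at h10 h9 ⊢
    rwa [Int.toNat_of_nonneg h10.le]
  · rintro ⟨i, j, d, e, l, ⟨g1, g4, h7, h8, h10, h11, h1, h9, g3, g6, h12⟩, rfl⟩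
    have h13 : (p.next i).2.weight (l.map Prod.fst) + (q.next j).2.weight (l.map Prod.snd) =
      m - ((p.next i).1.weight d + (q.next j).1.weight e) := h12
    have h14 : (p.next i).1.weight d + (q.next j).1.weight e ≤ m := h11
    simp only at g1 g4 h7 h8 h10 h9
    rw [Int.toNat_of_nonneg h10.le] at h9
    refine ⟨by simpa [consMoves] using h1, ⟨by omega, h7, h8, h9⟩,
      (p.accepts_cons _ _).2 ⟨i, d, g1, rfl, g3⟩, (q.accepts_cons _ _).2 ⟨j, e, g4, rfl, g6⟩, ?_⟩
    rw [consMoves, List.map_cons, List.map_cons, p.weight_cons i d _ g1 g3,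
      q.weight_cons j e _ g4 g6]
    dsimp only
    omega

theorem injOn_consMoves (p q : Phase) (i j : Bool) (A : ℕ → ℕ → Set Word) (n m : ℕ) :
    Set.InjOn (consMoves (p.next i).1 (q.next j).1)
      ((p.next i).1.prepend₂ (q.next j).1 A n m) := by
  rintro ⟨d, e, l⟩ ⟨h1, h2, -⟩ ⟨d', e', l'⟩ ⟨h3, h4, -⟩ h
  obtain ⟨h5, h6⟩ := List.cons.inj h
  obtain ⟨h7, h8⟩ := Prod.mk.inj h5
  exact Prod.ext (p.next_disjoint h1 h3 h7).2 (Prod.ext (q.next_disjoint h2 h4 h8).2 h6)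

theorem disjoint_consMoves (p q : Phase) {i j : Bool × Bool} (hij : i ≠ j)
    (A B : ℕ → ℕ → Set Word) (n m : ℕ) :
    Disjoint (consMoves (p.next i.1).1 (q.next i.2).1 ''
        (p.next i.1).1.prepend₂ (q.next i.2).1 A n m)
      (consMoves (p.next j.1).1 (q.next j.2).1 ''
        (p.next j.1).1.prepend₂ (q.next j.2).1 B n m) := by
  rw [Set.disjoint_left]
  rintro _ ⟨⟨d, e, l⟩, ⟨h1, h2, -⟩, rfl⟩ ⟨⟨d', e', l'⟩, ⟨h3, h4, -⟩, h⟩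
  obtain ⟨h5, h6⟩ := List.cons.inj h
  obtain ⟨h7, h8⟩ := Prod.mk.inj h5
  exact hij (Prod.ext (p.next_disjoint h1 h3 h7.symm).1 (q.next_disjoint h2 h4 h8.symm).1)

theorem acceptedWords_height_zero (p q : Phase) (k m : ℕ) : acceptedWords p q k 0 m = ∅ :=
  Set.eq_empty_of_forall_notMem fun _ hl => absurd hl.2.1.pos (by simp)

theorem finite_acceptedWords (p q : Phase) (k n m : ℕ) : (acceptedWords p q k n m).Finite := by
  induction k generalizing p q n m with
  | zero => exact (Set.finite_singleton []).subset fun l hl => List.length_eq_zero_iff.1 hl.1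
  | succ k ih =>
    rcases Nat.eq_zero_or_pos n with rfl | hn
    · rw [acceptedWords_height_zero]
      exact Set.finite_empty
    · rw [acceptedWords_succ p q k hn m]
      exact (Finset.finite_toSet _).biUnion fun i _ =>
        ((Move.prepend₂_spec _ _ (ih _ _) hn m).1).image _

theorem ncard_acceptedWords_succ (p q : Phase) (k : ℕ) {n : ℕ} (hn : 1 ≤ n) (m : ℕ) :
    (acceptedWords p q (k + 1) n m).ncard = ∑ i : Bool × Bool,
      (p.next i.1).1.count₂ (q.next i.2).1
        (fun n m => (acceptedWords (p.next i.1).2 (q.next i.2).2 k n m).ncard) n m := by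
  rw [acceptedWords_succ p q k hn m, ncard_biUnion_finset]
  · refine Finset.sum_congr rfl fun i _ => ?_
    rw [(injOn_consMoves p q i.1 i.2 _ n m).ncard_image,
      (Move.prepend₂_spec _ _ (finite_acceptedWords _ _ k) hn m).2]
  · exact fun i _ => ((Move.prepend₂_spec _ _ (finite_acceptedWords _ _ k) hn m).1).image _
  · exact fun i _ j _ hij => disjoint_consMoves p q hij _ _ n m

open scoped Classical in
theorem ncard_acceptedWords_zero (p q : Phase) {n : ℕ} (hn : 1 ≤ n) (m : ℕ) :
    (acceptedWords p q 0 n m).ncard = if p.Accepts [] ∧ q.Accepts [] ∧ m = 0 then 1 else 0 := by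
  have hw : ∀ p : Phase, p.weight [] = 0 := fun p => by cases p <;> rfl
  split_ifs with h
  · have : acceptedWords p q 0 n m = {[]} := by
      ext l
      rw [Set.mem_singleton_iff]
      constructor
      · exact fun hl => List.length_eq_zero_iff.1 hl.1
      · rintro rfl
        refine ⟨rfl, ?_, h.1, h.2.1, ?_⟩
        · change (0 : ℤ) < n
          omega
        · simp [hw, h.2.2]
    rw [this, Set.ncard_singleton]
  · have : acceptedWords p q 0 n m = ∅ := by
      refine Set.eq_empty_of_forall_notMem fun l hl => ?_
      obtain rfl := List.length_eq_zero_iff.1 hl.1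
      have h1 := hl.2.2.2.2
      simp only [List.map_nil, hw] at h1
      exact h ⟨hl.2.2.1, hl.2.2.2.1, h1.symm⟩
    rw [this, Set.ncard_empty]

/-! ### Words with a dent, by the position of the dent -/

/-- The word of the polygon that is reflected in a vertical line. -/
def reverseWord (l : Word) : Word := (l.map Neg.neg).reverse

theorem map_fst_reverseWord (l : Word) :
    (reverseWord l).map Prod.fst = reverseNeg (l.map Prod.fst) := by
  simp [reverseWord, reverseNeg, List.map_reverse, Function.comp_def]

theorem map_snd_reverseWord (l : Word) :
    (reverseWord l).map Prod.snd = reverseNeg (l.map Prod.snd) := by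
  simp [reverseWord, reverseNeg, List.map_reverse, Function.comp_def]

theorem length_reverseWord (l : Word) : (reverseWord l).length = l.length := by
  simp [reverseWord]

theorem reverseWord_reverseWord (l : Word) : reverseWord (reverseWord l) = l := by
  simp [reverseWord, ← List.map_reverse]

/-- The height of the last column. -/
def lastHeight (n : ℤ) (l : Word) : ℤ := n + (l.map Prod.fst).sum + (l.map Prod.snd).sum

theorem admissible_append_singleton (n : ℤ) (l : Word) (p : ℤ × ℤ) :
    Admissible n (l ++ [p]) ↔ Admissible n l ∧ 0 < lastHeight n l + p.1 ∧
      0 < lastHeight n l + p.2 ∧ 0 < lastHeight n l + p.1 + p.2 := by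
  induction l generalizing n with
  | nil => simp [Admissible, lastHeight]
  | cons q l ih =>
    have h : lastHeight n (q :: l) = lastHeight (n + q.1 + q.2) l := by
      simp only [lastHeight, List.map_cons, List.sum_cons]
      ring
    rw [List.cons_append, Admissible, ih, Admissible, h]
    tauto

theorem Admissible.reverse {n : ℤ} {l : Word} (h : Admissible n l) :
    Admissible (lastHeight n l) (reverseWord l) ∧
      lastHeight (lastHeight n l) (reverseWord l) = n := by
  refine ⟨?_, ?_⟩
  · induction l generalizing n with
    | nil => simpa [lastHeight, reverseWord] using h
    | cons p l ih =>
      obtain ⟨h1, h2, h3, h4⟩ := h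
      have h5 : lastHeight n (p :: l) = lastHeight (n + p.1 + p.2) l := by
        simp only [lastHeight, List.map_cons, List.sum_cons]
        ring
      have h6 : reverseWord (p :: l) = reverseWord l ++ [-p] := by simp [reverseWord]
      have h7 : lastHeight (lastHeight (n + p.1 + p.2) l) (reverseWord l) = n + p.1 + p.2 := by
        rw [lastHeight, map_fst_reverseWord, map_snd_reverseWord, sum_reverseNeg, sum_reverseNeg,
          lastHeight]
        ring
      rw [h5, h6, admissible_append_singleton, h7]
      refine ⟨ih h4, ?_, ?_, ?_⟩ <;> simp only [Prod.fst_neg, Prod.snd_neg] <;> omega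
  · rw [lastHeight, map_fst_reverseWord, map_snd_reverseWord, sum_reverseNeg, sum_reverseNeg,
      lastHeight]
    ring

/-- Words, with the height of the first column, by length and height of the bounding rectangle,
whose upper profile satisfies a condition and whose lower profile has no dent. -/
def wordsSatisfying (D : List ℤ → Prop) (k : ℕ) (h : ℤ) : Set (ℤ × Word) :=
  {z | z.2.length = k ∧ Admissible z.1 z.2 ∧
    z.1 + maxPrefix (z.2.map Prod.fst) + maxPrefix (z.2.map Prod.snd) = h ∧
    D (z.2.map Prod.fst) ∧ Peak (z.2.map Prod.snd)}

theorem wordsOfExcess_eq_union (k : ℕ) (h : ℤ) :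
    wordsOfExcess k h 2 0 = wordsSatisfying DescDent k h ∪ wordsSatisfying AscDent k h := by
  ext z
  simp only [wordsOfExcess, wordsSatisfying, Set.mem_ofPred_eq, Set.mem_union, peak_iff,
    excess_eq_two_iff]
  tauto

theorem wordsSatisfying_inter (k : ℕ) (h : ℤ) :
    wordsSatisfying DescDent k h ∩ wordsSatisfying AscDent k h =
      wordsSatisfying FlatPeakDent k h := by
  ext z
  simp only [wordsSatisfying, Set.mem_ofPred_eq, Set.mem_inter_iff, flatPeakDent_iff]
  tauto

theorem reverse_mem_wordsSatisfying {D D' : List ℤ → Prop} (hD : ∀ l, D l → D' (reverseNeg l))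
    {k : ℕ} {h : ℤ} {z : ℤ × Word} (hz : z ∈ wordsSatisfying D k h) :
    (lastHeight z.1 z.2, reverseWord z.2) ∈ wordsSatisfying D' k h := by
  obtain ⟨h1, h2, h3, h4, h5⟩ := hz
  refine ⟨by rwa [length_reverseWord], h2.reverse.1, ?_, ?_, ?_⟩
  · simp only [map_fst_reverseWord, map_snd_reverseWord, maxPrefix_reverseNeg, lastHeight]
    omega
  · simp only [map_fst_reverseWord]
    exact hD _ h4
  · simp only [map_snd_reverseWord]
    exact peak_reverseNeg h5

/-- Reflection in a vertical line is an involution on admissible words, whose starting height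
becomes the height of the last column. -/
theorem ncard_ascDent (k : ℕ) (h : ℤ) :
    (wordsSatisfying AscDent k h).ncard = (wordsSatisfying DescDent k h).ncard := by
  have hinv : ∀ z : ℤ × Word, Admissible z.1 z.2 →
      (lastHeight (lastHeight z.1 z.2) (reverseWord z.2), reverseWord (reverseWord z.2)) = z :=
    fun z hz => Prod.ext hz.reverse.2 (reverseWord_reverseWord z.2)
  refine Set.ncard_congr (fun z _ => (lastHeight z.1 z.2, reverseWord z.2)) ?_ ?_ ?_
  · exact fun z hz => reverse_mem_wordsSatisfying (fun l => descDent_reverseNeg_of_ascDent) hz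
  · intro z z' hz hz' heq
    rw [← hinv z hz.2.1, ← hinv z' hz'.2.1]
    obtain ⟨h1, h2⟩ := Prod.mk.inj heq
    rw [h1, h2]
  · intro z hz
    exact ⟨_, reverse_mem_wordsSatisfying (fun l => ascDent_reverseNeg_of_descDent) hz,
      hinv z hz.2.1⟩

theorem wordsSatisfying_eq_iUnion (p : Phase) (hp : ∀ l, p.weight l = (maxPrefix l).toNat)
    (k h : ℕ) : wordsSatisfying p.Accepts k h =
      ⋃ q ∈ Finset.range h, (fun l => (((q + 1 : ℕ) : ℤ), l)) ''
        acceptedWords p .peak k (q + 1) (h - (q + 1)) := by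
  ext ⟨n, l⟩
  simp only [Set.mem_iUnion, Finset.mem_range, Set.mem_image, Prod.mk.injEq]
  have hm1 := maxPrefix_nonneg (l.map Prod.fst)
  have hm2 := maxPrefix_nonneg (l.map Prod.snd)
  constructor
  · rintro ⟨h1, h2, h3, h4, h5⟩
    have hn := h2.pos
    simp only at h3 hn h2
    obtain ⟨q, rfl⟩ : ∃ q : ℕ, n = ((q + 1 : ℕ) : ℤ) := ⟨(n - 1).toNat, by omega⟩
    refine ⟨q, by omega, l, ⟨h1, h2, h4, h5, ?_⟩, rfl, rfl⟩
    rw [hp]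
    change _ + (maxPrefix _).toNat = _
    omega
  · rintro ⟨q, hq, l, ⟨h1, h2, h3, h4, h5⟩, rfl, rfl⟩
    rw [hp] at h5
    change _ + (maxPrefix _).toNat = _ at h5
    refine ⟨h1, h2, ?_, h3, h4⟩
    simp only
    omega

theorem finite_ncard_wordsSatisfying (p : Phase) (hp : ∀ l, p.weight l = (maxPrefix l).toNat)
    (k h : ℕ) : (wordsSatisfying p.Accepts k h).Finite ∧
      (wordsSatisfying p.Accepts k h).ncard =
        ∑ q ∈ Finset.range h, (acceptedWords p .peak k (q + 1) (h - (q + 1))).ncard := by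
  have hfin : ∀ q ∈ Finset.range h, ((fun l => (((q + 1 : ℕ) : ℤ), l)) ''
      acceptedWords p .peak k (q + 1) (h - (q + 1))).Finite :=
    fun q _ => (finite_acceptedWords _ _ _ _ _).image _
  rw [wordsSatisfying_eq_iUnion p hp]
  refine ⟨(Finset.finite_toSet _).biUnion hfin, ?_⟩
  rw [ncard_biUnion_finset _ hfin]
  · exact Finset.sum_congr rfl fun q _ => (Prod.mk_right_injective _).injOn.ncard_image
  · intro i _ j _ hij
    rw [Set.disjoint_left]
    rintro _ ⟨a, -, rfl⟩ ⟨b, -, h⟩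
    have := (Prod.mk.inj h).1
    omega

/-- Inclusion and exclusion for the two kinds of dents, which are equally numerous by reflection.
The intersection is kept on the left to avoid subtraction of natural numbers. -/
theorem ncard_wordsOfExcess (k h : ℕ) : (wordsOfExcess k h 2 0).ncard +
    ∑ q ∈ Finset.range h, (acceptedWords .flatPeakDent .peak k (q + 1) (h - (q + 1))).ncard =
    2 * ∑ q ∈ Finset.range h, (acceptedWords .descDent .peak k (q + 1) (h - (q + 1))).ncard := by
  have h1 := finite_ncard_wordsSatisfying .descDent (fun _ => rfl) k h
  have h2 := finite_ncard_wordsSatisfying .flatPeakDent (fun _ => rfl) k h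
  change (wordsSatisfying DescDent k h).Finite ∧ (wordsSatisfying DescDent k h).ncard = _ at h1
  change _ ∧ (wordsSatisfying FlatPeakDent k h).ncard = _ at h2
  have h3 : (wordsSatisfying AscDent k h).Finite := by
    refine Set.Finite.of_finite_image (f := fun z => (lastHeight z.1 z.2, reverseWord z.2))
      (h1.1.subset ?_) ?_
    · rintro _ ⟨z, hz, rfl⟩
      exact reverse_mem_wordsSatisfying (fun l => descDent_reverseNeg_of_ascDent) hz
    · intro z hz z' hz' heq
      obtain ⟨g1, g2⟩ := Prod.mk.inj heq
      refine Prod.ext ?_ ?_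
      · rw [← hz.2.1.reverse.2, ← hz'.2.1.reverse.2, g1, g2]
      · rw [← reverseWord_reverseWord z.2, g2, reverseWord_reverseWord]
  have h4 := Set.ncard_union_add_ncard_inter _ _ h1.1 h3
  rw [← wordsOfExcess_eq_union, wordsSatisfying_inter, ncard_ascDent, h2.2, h1.2] at h4
  rw [h4]
  ring

/-! ### Generating functions of words -/

namespace Move

/-- The effect of a move on families of power series that are indexed by the height. -/
def act : Move → (ℕ → MvPowerSeries (Fin 2) ℚ) → ℕ → MvPowerSeries (Fin 2) ℚ
  | up, f, n => fun d => ∑ q ∈ Finset.range (d 1 + 1), f (n + q) (d - Finsupp.single 1 q)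
  | down, f, n => ∑ j ∈ Finset.range n, f (j + 1)
  | strictDown, f, n => ∑ j ∈ Finset.range (n - 1), f (j + 1)
  | inc, f, n => f (n + 1)
  | stay, f, n => f n
  | dec, f, n => if 2 ≤ n then f (n - 1) else 0
  | none, _, _ => 0

open scoped Classical in
def act₂ (o o' : Move) (f : ℕ → MvPowerSeries (Fin 2) ℚ) : ℕ → MvPowerSeries (Fin 2) ℚ :=
  if o.Shrinks then o.act (o'.act f) else o'.act (o.act f)

theorem sum_apply {ι : Type*} (t : Finset ι) (f : ι → MvPowerSeries (Fin 2) ℚ)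
    (d : Fin 2 →₀ ℕ) : (∑ i ∈ t, f i) d = ∑ i ∈ t, f i d :=
  map_sum (MvPowerSeries.coeff (R := ℚ) d) f t

theorem act_apply (o : Move) {f : ℕ → MvPowerSeries (Fin 2) ℚ} {c : ℕ → ℕ → ℕ → ℕ}
    (h : ∀ n d, f n d = c (d 0) n (d 1)) (n : ℕ) (d : Fin 2 →₀ ℕ) :
    o.act f n d = o.count (c (d 0)) n (d 1) := by
  cases o with
  | up =>
    simp only [act, count, Nat.cast_sum]
    refine Finset.sum_congr rfl fun q _ => ?_
    rw [h]
    simp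
  | down =>
    simp only [act, count, Nat.cast_sum, sum_apply]
    exact Finset.sum_congr rfl fun q _ => h _ _
  | strictDown =>
    simp only [act, count, Nat.cast_sum, sum_apply]
    exact Finset.sum_congr rfl fun q _ => h _ _
  | inc => exact h _ _
  | stay => exact h _ _
  | dec =>
    simp only [act, count]
    split_ifs
    · exact h _ _
    · exact Nat.cast_zero.symm
  | none => exact Nat.cast_zero.symm

theorem act₂_apply (o o' : Move) {f : ℕ → MvPowerSeries (Fin 2) ℚ} {c : ℕ → ℕ → ℕ → ℕ}
    (h : ∀ n d, f n d = c (d 0) n (d 1)) (n : ℕ) (d : Fin 2 →₀ ℕ) :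
    o.act₂ o' f n d = o.count₂ o' (c (d 0)) n (d 1) := by
  rw [act₂, count₂]
  split_ifs
  · exact o.act_apply (c := fun k => o'.count (c k)) (fun n d => o'.act_apply h n d) n d
  · exact o'.act_apply (c := fun k => o.count (c k)) (fun n d => o.act_apply h n d) n d

/-- Two families agree up to terms of degree at least `k` in `x`. -/
def Agree (k : ℕ) (f g : ℕ → MvPowerSeries (Fin 2) ℚ) : Prop :=
  ∀ n, 1 ≤ n → ∀ d : Fin 2 →₀ ℕ, d 0 < k → f n d = g n d

/-- Moves change the height and the exponent of `y` only, and they never lead to height zero. -/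
theorem Agree.act {k : ℕ} {f g : ℕ → MvPowerSeries (Fin 2) ℚ} (h : Agree k f g) (o : Move) :
    Agree k (o.act f) (o.act g) := by
  intro n hn d hd
  cases o with
  | up => exact Finset.sum_congr rfl fun q _ => h _ (by omega) _ (by simpa using hd)
  | down =>
    simp only [Move.act, sum_apply]
    exact Finset.sum_congr rfl fun q _ => h _ (by omega) _ hd
  | strictDown =>
    simp only [Move.act, sum_apply]
    exact Finset.sum_congr rfl fun q _ => h _ (by omega) _ hd
  | inc => exact h _ (by omega) _ hd
  | stay => exact h _ hn _ hd
  | dec =>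
    simp only [Move.act]
    split_ifs
    · exact h _ (by omega) _ hd
    · rfl
  | none => rfl

end Move

theorem apply_x_mul (f : MvPowerSeries (Fin 2) ℚ) (d : Fin 2 →₀ ℕ) :
    (x * f) d = if d 0 = 0 then 0 else f (d - Finsupp.single 0 1) := by
  change MvPowerSeries.coeff d (MvPowerSeries.X 0 * f) = _
  split_ifs with h
  · rw [MvPowerSeries.X, MvPowerSeries.coeff_monomial_mul, if_neg]
    intro hle
    have := hle 0
    simp [h] at this
  · rw [MvPowerSeries.X, MvPowerSeries.coeff_monomial_mul, if_pos, one_mul]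
    · rfl
    · rw [Finsupp.single_le_iff]
      omega

theorem apply_y_mul (f : MvPowerSeries (Fin 2) ℚ) (d : Fin 2 →₀ ℕ) :
    (y * f) d = if d 1 = 0 then 0 else f (d - Finsupp.single 1 1) := by
  change MvPowerSeries.coeff d (MvPowerSeries.X 1 * f) = _
  split_ifs with h
  · rw [MvPowerSeries.X, MvPowerSeries.coeff_monomial_mul, if_neg]
    intro hle
    have := hle 1
    simp [h] at this
  · rw [MvPowerSeries.X, MvPowerSeries.coeff_monomial_mul, if_pos, one_mul]
    · rfl
    · rw [Finsupp.single_le_iff]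
      omega

/-- Recurrences that raise the degree in `x` have at most one solution. -/
theorem eq_of_recurrence {Φ : (ℕ → MvPowerSeries (Fin 2) ℚ) → ℕ → MvPowerSeries (Fin 2) ℚ}
    (hΦ : ∀ k f g, Move.Agree k f g → Move.Agree k (Φ f) (Φ g))
    {A f g : ℕ → MvPowerSeries (Fin 2) ℚ} (hf : ∀ n, 1 ≤ n → f n = A n + x * Φ f n)
    (hg : ∀ n, 1 ≤ n → g n = A n + x * Φ g n) {n : ℕ} (hn : 1 ≤ n) : f n = g n := by
  have key : ∀ k, Move.Agree k f g := by
    intro k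
    induction k with
    | zero => exact fun n _ d hd => absurd hd (Nat.not_lt_zero _)
    | succ k ih =>
      intro n hn d hd
      rw [hf n hn, hg n hn]
      change A n d + (x * Φ f n) d = A n d + (x * Φ g n) d
      rw [apply_x_mul, apply_x_mul]
      split_ifs with h
      · rfl
      · rw [hΦ k f g ih n hn]
        simp only [Finsupp.coe_tsub, Pi.sub_apply, Finsupp.single_eq_same]
        omega
  funext d
  exact key (d 0 + 1) n hn d (Nat.lt_succ_self _)

/-- The generating function, by length and weight, of the words accepted from a column of
height `n`. -/
def wordGF (p q : Phase) (n : ℕ) : MvPowerSeries (Fin 2) ℚ :=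
  fun d => ((acceptedWords p q (d 0) n (d 1)).ncard : ℚ)

open scoped Classical in
-- The constant is the empty word; each further word has a first letter, marked by `x`, one of four
-- combinations of moves.
theorem wordGF_eq (p q : Phase) {n : ℕ} (hn : 1 ≤ n) : wordGF p q n =
    (if p.Accepts [] ∧ q.Accepts [] then 1 else 0) +
      x * ∑ i : Bool × Bool, (p.next i.1).1.act₂ (q.next i.2).1
        (wordGF (p.next i.1).2 (q.next i.2).2) n := by
  funext d
  change ((acceptedWords p q (d 0) n (d 1)).ncard : ℚ) = (if p.Accepts [] ∧ q.Accepts [] then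
    (1 : MvPowerSeries (Fin 2) ℚ) else 0) d + (x * _ : MvPowerSeries (Fin 2) ℚ) d
  rw [apply_x_mul]
  split_ifs with h1 h2 h2
  · rw [h2, ncard_acceptedWords_zero p q hn]
    change _ = MvPowerSeries.coeff d 1 + _
    rw [MvPowerSeries.coeff_one, add_zero]
    have : d = 0 ↔ d 1 = 0 := by
      constructor
      · rintro rfl
        rfl
      · intro h3
        ext i
        fin_cases i
        · exact h2
        · exact h3
    simp [h1, this]
  · obtain ⟨k, hk⟩ := Nat.exists_eq_succ_of_ne_zero h2
    rw [hk, Nat.succ_eq_add_one, ncard_acceptedWords_succ p q k hn, Move.sum_apply]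
    change _ = MvPowerSeries.coeff d 1 + _
    rw [MvPowerSeries.coeff_one, if_neg (by rintro rfl; exact h2 rfl), zero_add, Nat.cast_sum]
    refine Finset.sum_congr rfl fun i _ => ?_
    refine Eq.trans ?_ (Move.act₂_apply (f := wordGF _ _)
      (c := fun k n m => (acceptedWords _ _ k n m).ncard) _ _ (fun _ _ => rfl) _ _).symm
    simp [hk]
  · rw [h2, ncard_acceptedWords_zero p q hn]
    rw [if_neg (by tauto)]
    change _ = MvPowerSeries.coeff d 0 + _
    simp
  · obtain ⟨k, hk⟩ := Nat.exists_eq_succ_of_ne_zero h2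
    rw [hk, Nat.succ_eq_add_one, ncard_acceptedWords_succ p q k hn, Move.sum_apply]
    change _ = MvPowerSeries.coeff d 0 + _
    rw [map_zero, zero_add, Nat.cast_sum]
    refine Finset.sum_congr rfl fun i _ => ?_
    refine Eq.trans ?_ (Move.act₂_apply (f := wordGF _ _)
      (c := fun k n m => (acceptedWords _ _ k n m).ncard) _ _ (fun _ _ => rfl) _ _).symm
    simp [hk]

/-- A polygon of width `k + 1` is a word of `k` letters, hence the factor `x`. The factor `y` and
the move `up` from height one together sum over the first column of height `q + 1` with weight `y ^
(q + 1)`. -/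
theorem topIndentSizeGF_eq : topIndentSizeGF = x * (y *
    (2 * Move.up.act (wordGF .descDent .peak) 1 -
      Move.up.act (wordGF .flatPeakDent .peak) 1)) := by
  funext d
  rw [apply_x_mul]
  change ((topIndentPolygonsOfSize (d 0) (d 1)).ncard : ℚ) = _
  split_ifs with h0
  · rw [h0, topIndentPolygonsOfSize_zero]
    simp
  obtain ⟨k, hk⟩ := Nat.exists_eq_succ_of_ne_zero h0
  rw [apply_y_mul, hk, Nat.succ_eq_add_one, ncard_topIndentPolygonsOfSize_succ]
  have h1 := ncard_wordsOfExcess k (d 1)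
  have h2 : ((wordsOfExcess k (d 1) 2 0).ncard : ℚ) =
      2 * ∑ q ∈ Finset.range (d 1),
        ((acceptedWords .descDent .peak k (q + 1) (d 1 - (q + 1))).ncard : ℚ) -
      ∑ q ∈ Finset.range (d 1),
        ((acceptedWords .flatPeakDent .peak k (q + 1) (d 1 - (q + 1))).ncard : ℚ) := by
    rw [eq_sub_iff_add_eq]
    exact_mod_cast h1
  rw [h2]
  split_ifs with h3
  · simp only [Finsupp.coe_tsub, Pi.sub_apply] at h3
    simp at h3
    simp [h3]
  · simp at h3
    obtain ⟨m, hm⟩ := Nat.exists_eq_succ_of_ne_zero h3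
    set d' := d - Finsupp.single 0 1 - Finsupp.single 1 1 with hd'
    have e0 : d' 0 = k := by simp [hd', hk]
    have e1 : d' 1 = m := by simp [hd', hm]
    have h4 : ∀ p, Move.up.act (wordGF p .peak) 1 d' = ∑ q ∈ Finset.range (d 1),
        ((acceptedWords p .peak k (q + 1) (d 1 - (q + 1))).ncard : ℚ) := by
      intro p
      refine (Move.act_apply (f := wordGF _ _)
        (c := fun k n m => (acceptedWords _ _ k n m).ncard) _ (fun _ _ => rfl) _ _).trans ?_
      rw [e0, e1, hm]
      simp only [Move.count, Nat.cast_sum]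
      refine Finset.sum_congr rfl fun q _ => ?_
      rw [add_comm 1 q, show m.succ - (q + 1) = m - q by omega]
    have h5 : (2 * Move.up.act (wordGF .descDent .peak) 1 -
        Move.up.act (wordGF .flatPeakDent .peak) 1 : MvPowerSeries (Fin 2) ℚ) d' =
        2 * Move.up.act (wordGF .descDent .peak) 1 d' -
          Move.up.act (wordGF .flatPeakDent .peak) 1 d' := by
      rw [two_mul, two_mul]
      rfl
    rw [h5, h4, h4]

/-! ### Closed forms in a field

With `x = U (1 - V)` and `y = V (1 - U)`, all generating functions are combinations of a few
sequences in the height `n`. -/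

/-- `U` and `V` are generic. -/
structure Generic {F : Type*} [Field F] (U V : F) : Prop where
  two : (2 : F) ≠ 0
  U_ne : U ≠ 0
  V_ne : V ≠ 0
  one_sub_U : 1 - U ≠ 0
  one_sub_V : 1 - V ≠ 0
  root : 1 - U - V ≠ 0
  one_sub_x : 1 - U * (1 - V) ≠ 0
  disc : (1 - U * (1 - V)) ^ 2 - V * (1 - U) ≠ 0

/-- The coefficients of a combination of `K n`, `J n`, `n K n`, `n J n`, `(1 - U) ^ (-n)`,
`n (1 - U) ^ (-n)`, `(1 - x) ^ (-n)`, `((1 - U) ^ (-n) - (1 - x) ^ (-n)) / V` and `1`. -/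
@[ext]
structure Coeffs (F : Type*) where
  K : F := by exact 0
  J : F := by exact 0
  nK : F := by exact 0
  nJ : F := by exact 0
  L : F := by exact 0
  nL : F := by exact 0
  X : F := by exact 0
  W : F := by exact 0
  c : F := by exact 0

namespace Coeffs

variable {F : Type*} [Field F]

instance : Add (Coeffs F) where
  add a b := ⟨a.K + b.K, a.J + b.J, a.nK + b.nK, a.nJ + b.nJ, a.L + b.L, a.nL + b.nL, a.X + b.X,
    a.W + b.W, a.c + b.c⟩

instance : Sub (Coeffs F) where
  sub a b := ⟨a.K - b.K, a.J - b.J, a.nK - b.nK, a.nJ - b.nJ, a.L - b.L, a.nL - b.nL, a.X - b.X,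
    a.W - b.W, a.c - b.c⟩

instance : SMul F (Coeffs F) where
  smul r a := ⟨r * a.K, r * a.J, r * a.nK, r * a.nJ, r * a.L, r * a.nL, r * a.X, r * a.W, r * a.c⟩

theorem add_def (a b : Coeffs F) : a + b = ⟨a.K + b.K, a.J + b.J, a.nK + b.nK, a.nJ + b.nJ,
    a.L + b.L, a.nL + b.nL, a.X + b.X, a.W + b.W, a.c + b.c⟩ := rfl

theorem sub_def (a b : Coeffs F) : a - b = ⟨a.K - b.K, a.J - b.J, a.nK - b.nK, a.nJ - b.nJ,
    a.L - b.L, a.nL - b.nL, a.X - b.X, a.W - b.W, a.c - b.c⟩ := rfl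

theorem smul_def (r : F) (a : Coeffs F) : r • a = ⟨r * a.K, r * a.J, r * a.nK, r * a.nJ,
    r * a.L, r * a.nL, r * a.X, r * a.W, r * a.c⟩ := rfl

/-- The combination of the basis sequences, given as functions of `n`. -/
def combine (a : Coeffs F) (K J L X W : F) (n : ℕ) : F :=
  a.K * K + a.J * J + a.nK * (n * K) + a.nJ * (n * J) + a.L * L + a.nL * (n * L) + a.X * X +
    a.W * W + a.c

variable (U V : F)

/-- The sequences `K` and `J`. -/
def seqKJ : ℕ → F × F
  | 0 => (1, 0)
  | n + 1 => (((seqKJ n).1 + U * (1 - V) * (seqKJ n).2) / (1 - U * (1 - V)),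
      (seqKJ n).2 + ((seqKJ n).1 + U * (1 - V) * (seqKJ n).2) / (1 - U * (1 - V)))

/-- The sequence `((1 - U) ^ (-n) - (1 - x) ^ (-n)) / V`. -/
def seqW : ℕ → F
  | 0 => 0
  | n + 1 => seqW n / (1 - U) + (1 - U * (1 - V))⁻¹ ^ n * U / ((1 - U) * (1 - U * (1 - V)))

def eval (a : Coeffs F) (n : ℕ) : F :=
  a.combine (seqKJ U V n).1 (seqKJ U V n).2 ((1 - U)⁻¹ ^ n) ((1 - U * (1 - V))⁻¹ ^ n)
    (seqW U V n) n

theorem eval_add (a b : Coeffs F) (n : ℕ) : (a + b).eval U V n = a.eval U V n + b.eval U V n := by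
  simp only [eval, combine, add_def]
  ring

theorem eval_sub (a b : Coeffs F) (n : ℕ) : (a - b).eval U V n = a.eval U V n - b.eval U V n := by
  simp only [eval, combine, sub_def]
  ring

theorem eval_smul (r : F) (a : Coeffs F) (n : ℕ) : (r • a).eval U V n = r * a.eval U V n := by
  simp only [eval, combine, smul_def]
  ring

/-- The combination at `n + 1`. -/
def next (a : Coeffs F) : Coeffs F where
  K := (a.K + a.J + a.nK + a.nJ) / (1 - U * (1 - V))
  J := (U * (1 - V) * (a.K + a.nK) + a.J + a.nJ) / (1 - U * (1 - V))
  nK := (a.nK + a.nJ) / (1 - U * (1 - V))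
  nJ := (U * (1 - V) * a.nK + a.nJ) / (1 - U * (1 - V))
  L := (a.L + a.nL) / (1 - U)
  nL := a.nL / (1 - U)
  X := a.X / (1 - U * (1 - V)) + a.W * U / ((1 - U) * (1 - U * (1 - V)))
  W := a.W / (1 - U)
  c := a.c

theorem eval_next (h : Generic U V) (a : Coeffs F) (n : ℕ) :
    (a.next U V).eval U V n = a.eval U V (n + 1) := by
  have h1 := h.one_sub_U
  have h2 := h.one_sub_x
  simp only [eval, combine, next, seqKJ, seqW, pow_succ]
  push_cast
  generalize (1 - U)⁻¹ ^ n = L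
  generalize (1 - U * (1 - V))⁻¹ ^ n = X
  field_simp
  ring

/-- The combination at `n - 1`. -/
def prev (a : Coeffs F) : Coeffs F where
  K := a.K - a.J - a.nK + a.nJ
  J := a.J - a.nJ - U * (1 - V) * (a.K - a.nK)
  nK := a.nK - a.nJ
  nJ := a.nJ - U * (1 - V) * a.nK
  L := (1 - U) * (a.L - a.nL)
  nL := (1 - U) * a.nL
  X := (1 - U * (1 - V)) * a.X - U * a.W
  W := (1 - U) * a.W
  c := a.c

theorem next_prev (h : Generic U V) (a : Coeffs F) : (a.prev U V).next U V = a := by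
  have h1 := h.one_sub_U
  have h2 := h.one_sub_x
  ext <;> simp only [next, prev] <;> field_simp <;> ring

/-- The sum of the values from `1` to `n` of a combination without constant term. -/
def down (a : Coeffs F) : Coeffs F where
  K := (a.J - a.nK + a.nJ) / (U * (1 - V))
  J := a.K + a.nK - a.nJ / (U * (1 - V))
  nK := a.nJ / (U * (1 - V))
  nJ := a.nK
  L := a.L / U + a.nL * (U - 1) / U ^ 2
  nL := a.nL / U
  X := (a.X - a.W) / (U * (1 - V))
  W := a.W / U
  c := -((a.J - a.nK + a.nJ + a.X - a.W) / (U * (1 - V))) - (a.L / U + a.nL * (U - 1) / U ^ 2)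

theorem next_down (h : Generic U V) (a : Coeffs F) (ha : a.c = 0) :
    (a.down U V).next U V = a.down U V + a.next U V := by
  have h0 := h.U_ne
  have h1 := h.one_sub_U
  have h2 := h.one_sub_x
  have h3 := h.one_sub_V
  ext <;> simp only [next, down, add_def, ha] <;> field_simp <;> ring

/-- Discrete integration: by `next_down` the increments agree, and the constant term of `a.down U V`
makes it vanish at zero. A constant in `a` would sum to a multiple of `n`, which is outside the
span. -/
theorem eval_down (h : Generic U V) (a : Coeffs F) (ha : a.c = 0) (n : ℕ) :
    (a.down U V).eval U V n = ∑ j ∈ Finset.range n, a.eval U V (j + 1) := by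
  induction n with
  | zero =>
    simp only [eval, combine, down, seqKJ, seqW, pow_zero, Finset.sum_range_zero]
    push_cast
    ring
  | succ n ih =>
    rw [Finset.sum_range_succ, ← ih, ← eval_next U V h, next_down U V h a ha, eval_add,
      ← eval_next U V h]

/-- `(1 - U) ^ (-n)` in terms of the last two sequences. -/
def toW (a : Coeffs F) : Coeffs F :=
  { a with L := 0, X := a.X + a.L, W := a.W + V * a.L }

/-- `seqW` is a divided difference. Its recursion avoids the division by `V`, which is not
invertible among the power series, and so keeps the closed forms integral. -/
theorem seqW_eq (h : Generic U V) (n : ℕ) :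
    (1 - U * (1 - V))⁻¹ ^ n + V * seqW U V n = (1 - U)⁻¹ ^ n := by
  have h1 := h.one_sub_U
  have h2 := h.one_sub_x
  induction n with
  | zero => simp [seqW]
  | succ n ih =>
    rw [pow_succ (1 - U)⁻¹, ← ih, seqW, pow_succ]
    generalize (1 - U * (1 - V))⁻¹ ^ n = X
    field_simp
    ring

theorem eval_toW (h : Generic U V) (a : Coeffs F) (n : ℕ) :
    (a.toW V).eval U V n = a.eval U V n := by
  simp only [eval, combine, toW]
  rw [← seqW_eq U V h n]
  ring

end Coeffs

namespace ClosedForm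

variable {F : Type*} [Field F] (U V : F)

/-! ### Coefficients of the closed forms. -/

def cK : Coeffs F := { K := 1 }

def cOne : Coeffs F := { c := 1 }

/-- The names encode the phases. `cK` and `cM` belong to an upper profile in phase `falling`, with
the lower one in phase `falling` or `peak`. The letters `Q`, `P`, `B`, `C` stand for the upper
phases `fallingDent`, `descDent`, `flatDent`, `flatPeakDent`, followed by `U` or `D` if the lower
phase is `falling` or `peak`. A prefix `Up` or `Down` denotes the image under that move. The values
are solutions by undetermined coefficients and are justified only by the identities below. -/
def cM : Coeffs F where
  K := (1 - 2 * U - 2 * V + U ^ 2 + 4 * U * V + V ^ 2 - 2 * U ^ 2 * V - 2 * U * V ^ 2 + 2 * U ^ 2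
    * V ^ 2) * (1 - U - V)⁻¹ ^ 2
  J := U * V * (1 - U) * (1 - V) * (1 + U - V) * (1 - U - V)⁻¹ ^ 2
  L := -(2 * U * V * (1 - U) * (1 - V) * (1 - U - V)⁻¹ ^ 2)

def cUpM : Coeffs F where
  K := (1 - 2 * U - V + U ^ 2 + 2 * U * V - U ^ 2 * V + U * V ^ 2) * (1 - U - V)⁻¹ ^ 2
  J := 2 * U * V * (1 - U) * (1 - V) * (1 - U - V)⁻¹ ^ 2
  L := -(2 * U * V * (1 - U) * (1 - U - V)⁻¹ ^ 2)

def cQU : Coeffs F where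
  J := U * (1 - V) * (1 - U * (1 - V))⁻¹ * 2⁻¹
  nK := U * (1 - V) * (1 + U - U * V) * (1 - U * (1 - V))⁻¹ ^ 2 * 2⁻¹
  nJ := U ^ 2 * (1 - V) ^ 2 * (1 - U * (1 - V))⁻¹ ^ 2

def cDownQU : Coeffs F where
  J := -(U * (1 - V) * (1 - U * (1 - V))⁻¹ * 2⁻¹)
  nK := U * (1 - V) * (1 - U * (1 - V))⁻¹ ^ 2
  nJ := U * (1 - V) * (1 + U - U * V) * (1 - U * (1 - V))⁻¹ ^ 2 * 2⁻¹

def cQD : Coeffs F where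
  K := U * V * (1 - U) * (1 - V) * (1 + 4 * U - 3 * V - 3 * U ^ 2 - 9 * U * V + 3 * V ^ 2 - 2 * U
    ^ 3 + 13 * U ^ 2 * V + 6 * U * V ^ 2 - V ^ 3 + 7 * U ^ 3 * V - 14 * U ^ 2 * V ^ 2 - U * V ^ 3
    - 4 * U ^ 3 * V ^ 2 + 4 * U ^ 2 * V ^ 3) * (1 - U - V)⁻¹ ^ 4 * (1 - U * (1 - V))⁻¹
  J := U * (1 - V) * (1 - 4 * U - 4 * V + 6 * U ^ 2 + 19 * U * V + 6 * V ^ 2 - 4 * U ^ 3 - 18 * U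
    ^ 2 * V - 34 * U * V ^ 2 - 4 * V ^ 3 + U ^ 4 - 4 * U ^ 3 * V + 31 * U ^ 2 * V ^ 2 + 28 * U * V
    ^ 3 + V ^ 4 + 6 * U ^ 4 * V + 29 * U ^ 3 * V ^ 2 - 35 * U ^ 2 * V ^ 3 - 10 * U * V ^ 4 + U ^ 5
    * V - 29 * U ^ 4 * V ^ 2 - 26 * U ^ 3 * V ^ 3 + 19 * U ^ 2 * V ^ 4 + U * V ^ 5 - 3 * U ^ 5 * V
    ^ 2 + 35 * U ^ 4 * V ^ 3 + 3 * U ^ 3 * V ^ 4 - 3 * U ^ 2 * V ^ 5 + 2 * U ^ 5 * V ^ 3 - 12 * U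
    ^ 4 * V ^ 4 + 2 * U ^ 3 * V ^ 5) * (1 - U - V)⁻¹ ^ 4 * (1 - U * (1 - V))⁻¹ * 2⁻¹
  nK := U * (1 - V) * (1 - 2 * V - U ^ 2 + V ^ 2 + 4 * U ^ 2 * V - 2 * U ^ 2 * V ^ 2) * (1 - U -
    V)⁻¹ ^ 2 * (1 - U * (1 - V))⁻¹ * 2⁻¹
  nJ := U ^ 2 * (1 - V) ^ 2 * (2 - 2 * U - 3 * V + 4 * U * V + V ^ 2 + U ^ 2 * V - U * V ^ 2) * (1
    - U - V)⁻¹ ^ 2 * (1 - U * (1 - V))⁻¹ * 2⁻¹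
  L := U ^ 2 * V * (1 - V) * (-5 + 7 * U + 9 * V + U ^ 2 - 19 * U * V - 3 * V ^ 2 - 3 * U ^ 3 + 3
    * U ^ 2 * V + 17 * U * V ^ 2 - V ^ 3 + 7 * U ^ 3 * V - 10 * U ^ 2 * V ^ 2 - 5 * U * V ^ 3 - 4
    * U ^ 3 * V ^ 2 + 4 * U ^ 2 * V ^ 3) * (1 - U - V)⁻¹ ^ 4 * (1 - U * (1 - V))⁻¹
  nL := -(2 * U ^ 3 * V * (1 - V) ^ 2 * (1 - U - V)⁻¹ ^ 3)

def cUpQD : Coeffs F where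
  K := U * V * (1 - U) * (1 - V) * (2 + 3 * U - 4 * V - 4 * U ^ 2 - U * V + 2 * V ^ 2 - U ^ 3 + 12
    * U ^ 2 * V - 3 * U * V ^ 2 + U ^ 3 * V - 6 * U ^ 2 * V ^ 2 + U * V ^ 3) * (1 - U - V)⁻¹ ^ 4 *
    (1 - U * (1 - V))⁻¹
  J := U * (1 - V) * (1 - 4 * U - 3 * V + 6 * U ^ 2 + 18 * U * V + 3 * V ^ 2 - 4 * U ^ 3 - 20 * U
    ^ 2 * V - 23 * U * V ^ 2 - V ^ 3 + U ^ 4 - 2 * U ^ 3 * V + 37 * U ^ 2 * V ^ 2 + 8 * U * V ^ 3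
    + 7 * U ^ 4 * V - U ^ 3 * V ^ 2 - 31 * U ^ 2 * V ^ 3 + U * V ^ 4 - 16 * U ^ 4 * V ^ 2 + 16 * U
    ^ 3 * V ^ 3 + 8 * U ^ 2 * V ^ 4 + 8 * U ^ 4 * V ^ 3 - 8 * U ^ 3 * V ^ 4) * (1 - U - V)⁻¹ ^ 4 *
    (1 - U * (1 - V))⁻¹ * 2⁻¹
  nK := U * (1 - V) * (1 + U - V) * (1 - U - V)⁻¹ ^ 2 * 2⁻¹
  nJ := U ^ 2 * (1 - V) ^ 2 * (1 - U - V)⁻¹ ^ 2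
  L := U ^ 2 * V * (1 - U) * (1 - V) * (-5 + 2 * U + 4 * V + 3 * U ^ 2 - 10 * U * V + V ^ 2 - 2 *
    U ^ 2 * V + 6 * U * V ^ 2) * (1 - U - V)⁻¹ ^ 4 * (1 - U * (1 - V))⁻¹
  nL := -(2 * U ^ 3 * V * (1 - V) * (1 - U - V)⁻¹ ^ 3)

def cPU : Coeffs F where
  K := U * (1 - V) * (-2 + 2 * U + 3 * V - 5 * U * V - V ^ 2 + 2 * U * V ^ 2 - U ^ 2 * V ^ 2) * (1
    - U - V)⁻¹ ^ 2 * (1 - U * (1 - V))⁻¹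
  J := U * (1 - V) * (-1 - 2 * U + 2 * V + 3 * U ^ 2 + U * V - V ^ 2 - 8 * U ^ 2 * V + 2 * U * V ^
    2 + U ^ 3 * V + 3 * U ^ 2 * V ^ 2 - U * V ^ 3 - U ^ 3 * V ^ 2 + U ^ 2 * V ^ 3) * (1 - U - V)⁻¹
    ^ 2 * (1 - U * (1 - V))⁻¹ * 2⁻¹
  nK := U * (1 - V) * (1 - 2 * V - U ^ 2 + V ^ 2 + 4 * U ^ 2 * V - 2 * U ^ 2 * V ^ 2) * (1 - U -
    V)⁻¹ ^ 2 * (1 - U * (1 - V))⁻¹ * 2⁻¹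
  nJ := U ^ 2 * (1 - V) ^ 2 * (2 - 2 * U - 3 * V + 4 * U * V + V ^ 2 + U ^ 2 * V - U * V ^ 2) * (1
    - U - V)⁻¹ ^ 2 * (1 - U * (1 - V))⁻¹ * 2⁻¹
  L := U * (1 - V) * (2 - 2 * U - 3 * V + 5 * U * V + V ^ 2 - 2 * U * V ^ 2 + U ^ 2 * V ^ 2) * (1
    - U - V)⁻¹ ^ 2 * (1 - U * (1 - V))⁻¹

def cUpPU : Coeffs F where
  K := U * (1 - V) * (-2 + 2 * U + V - 3 * U * V) * (1 - U - V)⁻¹ ^ 2 * (1 - U * (1 - V))⁻¹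
  J := U * (1 - V) * (-1 - 2 * U + V + 3 * U ^ 2 - 2 * U * V - 3 * U ^ 2 * V + 3 * U * V ^ 2) * (1
    - U - V)⁻¹ ^ 2 * (1 - U * (1 - V))⁻¹ * 2⁻¹
  nK := U * (1 - V) * (1 + U - V) * (1 - U - V)⁻¹ ^ 2 * 2⁻¹
  nJ := U ^ 2 * (1 - V) ^ 2 * (1 - U - V)⁻¹ ^ 2
  L := U * (2 - 2 * U - 3 * V + 5 * U * V + V ^ 2 - 2 * U * V ^ 2 + U ^ 2 * V ^ 2) * (1 - U - V)⁻¹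
    ^ 2 * (1 - U * (1 - V))⁻¹

set_option maxHeartbeats 1000000 in
def cPD : Coeffs F where
  K := U * (1 - V) * (-2 + 10 * U + 11 * V - 20 * U ^ 2 - 50 * U * V - 25 * V ^ 2 + 20 * U ^ 3 +
    91 * U ^ 2 * V + 106 * U * V ^ 2 + 30 * V ^ 3 - 10 * U ^ 4 - 84 * U ^ 3 * V - 162 * U ^ 2 * V
    ^ 2 - 124 * U * V ^ 3 - 20 * V ^ 4 + 2 * U ^ 5 + 41 * U ^ 4 * V + 115 * U ^ 3 * V ^ 2 + 150 *
    U ^ 2 * V ^ 3 + 86 * U * V ^ 4 + 7 * V ^ 5 - 10 * U ^ 5 * V - 57 * U ^ 4 * V ^ 2 - 22 * U ^ 3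
    * V ^ 3 - 89 * U ^ 2 * V ^ 4 - 34 * U * V ^ 5 - V ^ 6 + U ^ 6 * V + 36 * U ^ 5 * V ^ 2 - 18 *
    U ^ 4 * V ^ 3 - 71 * U ^ 3 * V ^ 4 + 42 * U ^ 2 * V ^ 5 + 6 * U * V ^ 6 - 12 * U ^ 6 * V ^ 2 -
    56 * U ^ 5 * V ^ 3 + 126 * U ^ 4 * V ^ 4 + 46 * U ^ 3 * V ^ 5 - 13 * U ^ 2 * V ^ 6 - U ^ 7 * V
    ^ 2 + 38 * U ^ 6 * V ^ 3 + 12 * U ^ 5 * V ^ 4 - 108 * U ^ 4 * V ^ 5 - 2 * U ^ 3 * V ^ 6 + U ^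
    2 * V ^ 7 + 2 * U ^ 7 * V ^ 3 - 43 * U ^ 6 * V ^ 4 + 30 * U ^ 5 * V ^ 5 + 25 * U ^ 4 * V ^ 6 -
    2 * U ^ 3 * V ^ 7 - U ^ 7 * V ^ 4 + 15 * U ^ 6 * V ^ 5 - 15 * U ^ 5 * V ^ 6 + U ^ 4 * V ^ 7) *
    (1 - U - V)⁻¹ ^ 6 * (1 - U * (1 - V))⁻¹
  J := U * (1 - V) * (-1 + 2 * U + 6 * V + 5 * U ^ 2 - 12 * U * V - 15 * V ^ 2 - 20 * U ^ 3 - 20 *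
    U ^ 2 * V + 33 * U * V ^ 2 + 20 * V ^ 3 + 25 * U ^ 4 + 82 * U ^ 3 * V + 38 * U ^ 2 * V ^ 2 -
    55 * U * V ^ 3 - 15 * V ^ 4 - 14 * U ^ 5 - 98 * U ^ 4 * V - 139 * U ^ 3 * V ^ 2 - 48 * U ^ 2 *
    V ^ 3 + 60 * U * V ^ 4 + 6 * V ^ 5 + 3 * U ^ 6 + 56 * U ^ 5 * V + 97 * U ^ 4 * V ^ 2 + 173 * U
    ^ 3 * V ^ 3 + 37 * U ^ 2 * V ^ 4 - 42 * U * V ^ 5 - V ^ 6 - 16 * U ^ 6 * V - 17 * U ^ 5 * V ^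
    2 + 40 * U ^ 4 * V ^ 3 - 216 * U ^ 3 * V ^ 4 - 8 * U ^ 2 * V ^ 5 + 17 * U * V ^ 6 + 2 * U ^ 7
    * V + 16 * U ^ 6 * V ^ 2 - 217 * U ^ 5 * V ^ 3 - 56 * U ^ 4 * V ^ 4 + 190 * U ^ 3 * V ^ 5 - 8
    * U ^ 2 * V ^ 6 - 3 * U * V ^ 7 - 13 * U ^ 7 * V ^ 2 + 52 * U ^ 6 * V ^ 3 + 378 * U ^ 5 * V ^
    4 - 80 * U ^ 4 * V ^ 5 - 81 * U ^ 3 * V ^ 6 + 4 * U ^ 2 * V ^ 7 + 35 * U ^ 7 * V ^ 3 - 152 * U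
    ^ 6 * V ^ 4 - 218 * U ^ 5 * V ^ 5 + 96 * U ^ 4 * V ^ 6 + 11 * U ^ 3 * V ^ 7 - 36 * U ^ 7 * V ^
    4 + 136 * U ^ 6 * V ^ 5 + 20 * U ^ 5 * V ^ 6 - 24 * U ^ 4 * V ^ 7 + 12 * U ^ 7 * V ^ 5 - 40 *
    U ^ 6 * V ^ 6 + 12 * U ^ 5 * V ^ 7) * (1 - U - V)⁻¹ ^ 6 * (1 - U * (1 - V))⁻¹ * 2⁻¹
  nK := U * (1 - V) * (1 - U - 4 * V - U ^ 2 + 5 * U * V + 6 * V ^ 2 + U ^ 3 + 6 * U ^ 2 * V - 9 *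
    U * V ^ 2 - 4 * V ^ 3 - 7 * U ^ 3 * V - 8 * U ^ 2 * V ^ 2 + 7 * U * V ^ 3 + V ^ 4 + 12 * U ^ 3
    * V ^ 2 + 2 * U ^ 2 * V ^ 3 - 2 * U * V ^ 4 + U ^ 4 * V ^ 2 - 6 * U ^ 3 * V ^ 3 + U ^ 2 * V ^
    4) * (1 - U - V)⁻¹ ^ 4 * 2⁻¹
  nJ := U ^ 2 * (1 - V) ^ 2 * (1 - U * (1 - V) - V * (1 - U)) * (1 - U - 2 * V + 2 * U * V + V ^ 2
    + U ^ 2 * V - U * V ^ 2) * (1 - U - V)⁻¹ ^ 4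
  L := U * (1 - U) * (1 - V) ^ 2 * (2 - 6 * U - 7 * V + 6 * U ^ 2 + 16 * U * V + 9 * V ^ 2 - 2 * U
    ^ 3 - 14 * U ^ 2 * V - 17 * U * V ^ 2 - 5 * V ^ 3 + 8 * U ^ 3 * V + 3 * U ^ 2 * V ^ 2 + 10 * U
    * V ^ 3 + V ^ 4 - 3 * U ^ 4 * V - 5 * U ^ 3 * V ^ 2 + 7 * U ^ 2 * V ^ 3 - 3 * U * V ^ 4 + 10 *
    U ^ 4 * V ^ 2 - 10 * U ^ 3 * V ^ 3 - 2 * U ^ 2 * V ^ 4 - 6 * U ^ 4 * V ^ 3 + 6 * U ^ 3 * V ^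
    4) * (1 - U - V)⁻¹ ^ 5 * (1 - U * (1 - V))⁻¹
  nL := -(2 * U ^ 3 * V * (1 - U) * (1 - V) ^ 3 * (1 - U - V)⁻¹ ^ 4)

def cUpPD : Coeffs F where
  K := U * (1 - V) * (-2 + 10 * U + 9 * V - 20 * U ^ 2 - 40 * U * V - 16 * V ^ 2 + 20 * U ^ 3 + 71
    * U ^ 2 * V + 69 * U * V ^ 2 + 14 * V ^ 3 - 10 * U ^ 4 - 64 * U ^ 3 * V - 97 * U ^ 2 * V ^ 2 -
    66 * U * V ^ 3 - 6 * V ^ 4 + 2 * U ^ 5 + 31 * U ^ 4 * V + 46 * U ^ 3 * V ^ 2 + 82 * U ^ 2 * V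
    ^ 3 + 34 * U * V ^ 4 + V ^ 5 - 8 * U ^ 5 * V - 6 * U ^ 4 * V ^ 2 + 24 * U ^ 3 * V ^ 3 - 60 * U
    ^ 2 * V ^ 4 - 6 * U * V ^ 5 + U ^ 6 * V + 13 * U ^ 5 * V ^ 2 - 86 * U ^ 4 * V ^ 3 - 10 * U ^ 3
    * V ^ 4 + 27 * U ^ 2 * V ^ 5 - U * V ^ 6 - 9 * U ^ 6 * V ^ 2 + 18 * U ^ 5 * V ^ 3 + 94 * U ^ 4
    * V ^ 4 - 26 * U ^ 3 * V ^ 5 - 3 * U ^ 2 * V ^ 6 + 14 * U ^ 6 * V ^ 3 - 46 * U ^ 5 * V ^ 4 -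
    18 * U ^ 4 * V ^ 5 + 10 * U ^ 3 * V ^ 6 - 6 * U ^ 6 * V ^ 4 + 20 * U ^ 5 * V ^ 5 - 6 * U ^ 4 *
    V ^ 6) * (1 - U - V)⁻¹ ^ 6 * (1 - U * (1 - V))⁻¹
  J := U * (1 - V) * (-1 + 2 * U + 5 * V + 5 * U ^ 2 - 11 * U * V - 10 * V ^ 2 - 20 * U ^ 3 - 9 *
    U ^ 2 * V + 30 * U * V ^ 2 + 10 * V ^ 3 + 25 * U ^ 4 + 47 * U ^ 3 * V + U ^ 2 * V ^ 2 - 50 * U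
    * V ^ 3 - 5 * V ^ 4 - 14 * U ^ 5 - 53 * U ^ 4 * V - 52 * U ^ 3 * V ^ 2 + 15 * U ^ 2 * V ^ 3 +
    50 * U * V ^ 4 + V ^ 5 + 3 * U ^ 6 + 27 * U ^ 5 * V + 4 * U ^ 4 * V ^ 2 + 113 * U ^ 3 * V ^ 3
    - 37 * U ^ 2 * V ^ 4 - 27 * U * V ^ 5 - 7 * U ^ 6 * V + 50 * U ^ 5 * V ^ 2 - 28 * U ^ 4 * V ^
    3 - 166 * U ^ 3 * V ^ 4 + 41 * U ^ 2 * V ^ 5 + 6 * U * V ^ 6 + U ^ 7 * V - 19 * U ^ 6 * V ^ 2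
    - 148 * U ^ 5 * V ^ 3 + 186 * U ^ 4 * V ^ 4 + 83 * U ^ 3 * V ^ 5 - 17 * U ^ 2 * V ^ 6 - 4 * U
    ^ 7 * V ^ 2 + 83 * U ^ 6 * V ^ 3 + 64 * U ^ 5 * V ^ 4 - 182 * U ^ 4 * V ^ 5 - 2 * U ^ 3 * V ^
    6 + U ^ 2 * V ^ 7 + 5 * U ^ 7 * V ^ 3 - 90 * U ^ 6 * V ^ 4 + 50 * U ^ 5 * V ^ 5 + 46 * U ^ 4 *
    V ^ 6 - 3 * U ^ 3 * V ^ 7 - 2 * U ^ 7 * V ^ 4 + 30 * U ^ 6 * V ^ 5 - 30 * U ^ 5 * V ^ 6 + 2 *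
    U ^ 4 * V ^ 7) * (1 - U - V)⁻¹ ^ 6 * (1 - U * (1 - V))⁻¹ * 2⁻¹
  nK := U * (1 - V) * (1 - U * (1 - V) - V * (1 - U)) ^ 2 * (1 + U - V) * (1 - U - V)⁻¹ ^ 4 * 2⁻¹
  nJ := U ^ 2 * (1 - V) ^ 2 * (2 - 4 * U - 3 * V + 2 * U ^ 2 + 9 * U * V - 5 * U ^ 2 * V - 4 * U *
    V ^ 2 + V ^ 3 - U ^ 3 * V + 6 * U ^ 2 * V ^ 2 - U * V ^ 3) * (1 - U - V)⁻¹ ^ 4 * 2⁻¹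
  L := U * (1 - U) * (1 - V) * (1 - U * (1 - V) - V * (1 - U)) * (2 - 4 * U - 5 * V + 2 * U ^ 2 +
    3 * U * V + 4 * V ^ 2 - U ^ 2 * V - V ^ 3 + 3 * U ^ 3 * V - 6 * U ^ 2 * V ^ 2 + U * V ^ 3 - 2
    * U ^ 3 * V ^ 2 + 4 * U ^ 2 * V ^ 3) * (1 - U - V)⁻¹ ^ 5 * (1 - U * (1 - V))⁻¹
  nL := -(2 * U ^ 3 * V * (1 - U) * (1 - V) ^ 2 * (1 - U - V)⁻¹ ^ 4)

def cUpUpPD : Coeffs F where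
  K := U * (1 - V) * (-2 + 10 * U + 7 * V - 20 * U ^ 2 - 30 * U * V - 9 * V ^ 2 + 20 * U ^ 3 + 51
    * U ^ 2 * V + 43 * U * V ^ 2 + 5 * V ^ 3 - 10 * U ^ 4 - 44 * U ^ 3 * V - 56 * U ^ 2 * V ^ 2 -
    32 * U * V ^ 3 - V ^ 4 + 2 * U ^ 5 + 21 * U ^ 4 * V + 2 * U ^ 3 * V ^ 2 + 59 * U ^ 2 * V ^ 3 +
    5 * U * V ^ 4 - 6 * U ^ 5 * V + 35 * U ^ 4 * V ^ 2 - 8 * U ^ 3 * V ^ 3 - 36 * U ^ 2 * V ^ 4 +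
    4 * U * V ^ 5 + U ^ 6 * V - 13 * U ^ 5 * V ^ 2 - 57 * U ^ 4 * V ^ 3 + 52 * U ^ 3 * V ^ 4 + U ^
    2 * V ^ 5 - 2 * U ^ 6 * V ^ 2 + 32 * U ^ 5 * V ^ 3 - 5 * U ^ 4 * V ^ 4 - 22 * U ^ 3 * V ^ 5 +
    U ^ 2 * V ^ 6 + U ^ 6 * V ^ 3 - 15 * U ^ 5 * V ^ 4 + 15 * U ^ 4 * V ^ 5 - U ^ 3 * V ^ 6) * (1
    - U - V)⁻¹ ^ 6 * (1 - U * (1 - V))⁻¹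
  J := U * (1 - V) * (-1 + 2 * U + 4 * V + 5 * U ^ 2 - 10 * U * V - 6 * V ^ 2 - 20 * U ^ 3 + 2 * U
    ^ 2 * V + 28 * U * V ^ 2 + 4 * V ^ 3 + 25 * U ^ 4 + 12 * U ^ 3 * V - 21 * U ^ 2 * V ^ 2 - 44 *
    U * V ^ 3 - V ^ 4 - 14 * U ^ 5 - 8 * U ^ 4 * V - 20 * U ^ 3 * V ^ 2 + 52 * U ^ 2 * V ^ 3 + 34
    * U * V ^ 4 + 3 * U ^ 6 - 2 * U ^ 5 * V - 4 * U ^ 4 * V ^ 2 + 92 * U ^ 3 * V ^ 3 - 75 * U ^ 2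
    * V ^ 4 - 10 * U * V ^ 5 + 2 * U ^ 6 * V + 48 * U ^ 5 * V ^ 2 - 152 * U ^ 4 * V ^ 3 - 48 * U ^
    3 * V ^ 4 + 38 * U ^ 2 * V ^ 5 - 25 * U ^ 6 * V ^ 2 + 16 * U ^ 5 * V ^ 3 + 190 * U ^ 4 * V ^ 4
    - 32 * U ^ 3 * V ^ 5 - U ^ 2 * V ^ 6 + 32 * U ^ 6 * V ^ 3 - 88 * U ^ 5 * V ^ 4 - 40 * U ^ 4 *
    V ^ 5 + 16 * U ^ 3 * V ^ 6 - 12 * U ^ 6 * V ^ 4 + 40 * U ^ 5 * V ^ 5 - 12 * U ^ 4 * V ^ 6) *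
    (1 - U - V)⁻¹ ^ 6 * (1 - U * (1 - V))⁻¹ * 2⁻¹
  nK := U * (1 - V) * (1 - U - 2 * V - U ^ 2 + 7 * U * V + V ^ 2 + U ^ 3 - 4 * U ^ 2 * V - 5 * U *
    V ^ 2 - U ^ 3 * V + 6 * U ^ 2 * V ^ 2 - U * V ^ 3) * (1 - U - V)⁻¹ ^ 4 * 2⁻¹
  nJ := U ^ 2 * (1 - V) ^ 2 * (1 - U * (1 - V) - V * (1 - U)) * (1 - U + V) * (1 - U - V)⁻¹ ^ 4
  L := U * (1 - U) * (2 - 6 * U - 7 * V + 6 * U ^ 2 + 16 * U * V + 9 * V ^ 2 - 2 * U ^ 3 - 14 * U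
    ^ 2 * V - 17 * U * V ^ 2 - 5 * V ^ 3 + 8 * U ^ 3 * V - U ^ 2 * V ^ 2 + 10 * U * V ^ 3 + V ^ 4
    - 3 * U ^ 4 * V + 3 * U ^ 3 * V ^ 2 + 11 * U ^ 2 * V ^ 3 - 3 * U * V ^ 4 + 6 * U ^ 4 * V ^ 2 -
    18 * U ^ 3 * V ^ 3 - 2 * U ^ 2 * V ^ 4 - 2 * U ^ 4 * V ^ 3 + 10 * U ^ 3 * V ^ 4) * (1 - U -
    V)⁻¹ ^ 5 * (1 - U * (1 - V))⁻¹
  nL := -(2 * U ^ 3 * V * (1 - U) * (1 - V) * (1 - U - V)⁻¹ ^ 4)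

def cBU : Coeffs F where
  K := 2 * U * (1 - V) * (1 - U * (1 - V))⁻¹ ^ 2
  J := U * (1 - V) * (1 + U - U * V) * (1 - U * (1 - V))⁻¹ ^ 2
  X := -(2 * U * (1 - V) * (1 - U * (1 - V))⁻¹ ^ 2)

def cBD : Coeffs F where
  K := U * (1 - V) * (2 - 2 * U - 3 * V + 4 * U * V + V ^ 2 + U ^ 2 * V - U * V ^ 2) * (1 - U -
    V)⁻¹ ^ 2 * (1 - U * (1 - V))⁻¹
  J := U * (1 - V) * (1 - 2 * V - U ^ 2 + V ^ 2 + 4 * U ^ 2 * V - 2 * U ^ 2 * V ^ 2) * (1 - U -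
    V)⁻¹ ^ 2 * (1 - U * (1 - V))⁻¹
  X := 2 * U * (1 - V) * (-1 + 4 * U + 3 * V - 6 * U ^ 2 - 12 * U * V - 3 * V ^ 2 + 4 * U ^ 3 + 18
    * U ^ 2 * V + 11 * U * V ^ 2 + V ^ 3 - U ^ 4 - 12 * U ^ 3 * V - 16 * U ^ 2 * V ^ 2 - 3 * U * V
    ^ 3 + 3 * U ^ 4 * V + 11 * U ^ 3 * V ^ 2 + 3 * U ^ 2 * V ^ 3 - 3 * U ^ 4 * V ^ 2 - 4 * U ^ 3 *
    V ^ 3 + 3 * U ^ 4 * V ^ 3 - U ^ 4 * V ^ 4) * (1 - U)⁻¹ * (1 - U - V)⁻¹ ^ 2 * (1 - U * (1 -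
    V))⁻¹ * ((1 - U * (1 - V)) ^ 2 - V * (1 - U))⁻¹
  W := -(2 * U ^ 2 * V ^ 2 * (1 - V) * (1 - U)⁻¹ * (1 - U - V)⁻¹ ^ 2)

def cUpBD : Coeffs F where
  K := 2 * U * (1 - V) * (1 - U - V)⁻¹ ^ 2
  J := U * (1 - V) * (1 + U - V) * (1 - U - V)⁻¹ ^ 2
  X := 2 * U * (-1 + 3 * U + 3 * V - 3 * U ^ 2 - 8 * U * V - 3 * V ^ 2 + U ^ 3 + 7 * U ^ 2 * V + 6
    * U * V ^ 2 + V ^ 3 - 2 * U ^ 3 * V - 5 * U ^ 2 * V ^ 2 - U * V ^ 3 + 2 * U ^ 3 * V ^ 2 - U ^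
    3 * V ^ 3) * (1 - U)⁻¹ * (1 - U - V)⁻¹ ^ 2 * ((1 - U * (1 - V)) ^ 2 - V * (1 - U))⁻¹
  W := -(2 * U ^ 2 * V ^ 2 * (1 - U)⁻¹ * (1 - U - V)⁻¹ ^ 2)

def cCU : Coeffs F where
  K := U * (1 - V) * (1 - 2 * V - U ^ 2 + V ^ 2 + 4 * U ^ 2 * V - 2 * U ^ 2 * V ^ 2) * (1 - U -
    V)⁻¹ ^ 2 * (1 - U * (1 - V))⁻¹
  J := U ^ 2 * (1 - V) ^ 2 * (2 - 2 * U - 3 * V + 4 * U * V + V ^ 2 + U ^ 2 * V - U * V ^ 2) * (1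
    - U - V)⁻¹ ^ 2 * (1 - U * (1 - V))⁻¹
  X := U * (1 - V) * (-1 + 2 * V + U ^ 2 - V ^ 2 - 4 * U ^ 2 * V + 2 * U ^ 2 * V ^ 2) * (1 - U -
    V)⁻¹ ^ 2 * (1 - U * (1 - V))⁻¹
  W := U * (1 - V) * (-2 + 6 * U + 5 * V - 6 * U ^ 2 - 15 * U * V - 4 * V ^ 2 + 2 * U ^ 3 + 15 * U
    ^ 2 * V + 12 * U * V ^ 2 + V ^ 3 - 5 * U ^ 3 * V - 12 * U ^ 2 * V ^ 2 - 3 * U * V ^ 3 + 4 * U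
    ^ 3 * V ^ 2 + 2 * U ^ 2 * V ^ 3 - 2 * U ^ 3 * V ^ 3) * (1 - U)⁻¹ * (1 - U - V)⁻¹ ^ 2 * (1 - U
    * (1 - V))⁻¹

def cUpCU : Coeffs F where
  K := U * (1 - V) * (1 + U - V) * (1 - U - V)⁻¹ ^ 2
  J := 2 * U ^ 2 * (1 - V) ^ 2 * (1 - U - V)⁻¹ ^ 2
  X := U * (-1 + U + 2 * V + U ^ 2 - 4 * U * V - V ^ 2 - U ^ 3 + 5 * U * V ^ 2 + 2 * U ^ 3 * V - 2
    * U ^ 2 * V ^ 2 - 2 * U * V ^ 3 - 2 * U ^ 3 * V ^ 2) * (1 - U)⁻¹ * (1 - U - V)⁻¹ ^ 2 * (1 - U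
    * (1 - V))⁻¹
  W := U * (-2 + 6 * U + 5 * V - 6 * U ^ 2 - 15 * U * V - 4 * V ^ 2 + 2 * U ^ 3 + 15 * U ^ 2 * V +
    12 * U * V ^ 2 + V ^ 3 - 5 * U ^ 3 * V - 12 * U ^ 2 * V ^ 2 - 3 * U * V ^ 3 + 4 * U ^ 3 * V ^
    2 + 2 * U ^ 2 * V ^ 3 - 2 * U ^ 3 * V ^ 3) * (1 - U)⁻¹ * (1 - U - V)⁻¹ ^ 2 * (1 - U * (1 -
    V))⁻¹

def cCD : Coeffs F where
  K := U * (1 - V) * (1 - U - 4 * V - U ^ 2 + 5 * U * V + 6 * V ^ 2 + U ^ 3 + 6 * U ^ 2 * V - 9 *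
    U * V ^ 2 - 4 * V ^ 3 - 7 * U ^ 3 * V - 8 * U ^ 2 * V ^ 2 + 7 * U * V ^ 3 + V ^ 4 + 12 * U ^ 3
    * V ^ 2 + 2 * U ^ 2 * V ^ 3 - 2 * U * V ^ 4 + U ^ 4 * V ^ 2 - 6 * U ^ 3 * V ^ 3 + U ^ 2 * V ^
    4) * (1 - U - V)⁻¹ ^ 4
  J := 2 * U ^ 2 * (1 - V) ^ 2 * (1 - U * (1 - V) - V * (1 - U)) * (1 - U - 2 * V + 2 * U * V + V
    ^ 2 + U ^ 2 * V - U * V ^ 2) * (1 - U - V)⁻¹ ^ 4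
  X := U * (1 - V) * (-1 + 4 * U + 4 * V - 5 * U ^ 2 - 19 * U * V - 6 * V ^ 2 + 25 * U ^ 2 * V +
    35 * U * V ^ 2 + 4 * V ^ 3 + 5 * U ^ 4 + 10 * U ^ 3 * V - 55 * U ^ 2 * V ^ 2 - 31 * U * V ^ 3
    - V ^ 4 - 4 * U ^ 5 - 50 * U ^ 4 * V - 16 * U ^ 3 * V ^ 2 + 62 * U ^ 2 * V ^ 3 + 13 * U * V ^
    4 + U ^ 6 + 41 * U ^ 5 * V + 118 * U ^ 4 * V ^ 2 - 5 * U ^ 3 * V ^ 3 - 34 * U ^ 2 * V ^ 4 - 2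
    * U * V ^ 5 - 11 * U ^ 6 * V - 107 * U ^ 5 * V ^ 2 - 107 * U ^ 4 * V ^ 3 + 15 * U ^ 3 * V ^ 4
    + 7 * U ^ 2 * V ^ 5 + 31 * U ^ 6 * V ^ 2 + 112 * U ^ 5 * V ^ 3 + 39 * U ^ 4 * V ^ 4 - 4 * U ^
    3 * V ^ 5 - 35 * U ^ 6 * V ^ 3 - 50 * U ^ 5 * V ^ 4 - 5 * U ^ 4 * V ^ 5 + 18 * U ^ 6 * V ^ 4 +
    6 * U ^ 5 * V ^ 5 - 4 * U ^ 6 * V ^ 5) * (1 - U)⁻¹ * (1 - U - V)⁻¹ ^ 3 * (1 - U * (1 - V))⁻¹ *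
    ((1 - U * (1 - V)) ^ 2 - V * (1 - U))⁻¹
  W := U * (1 - V) ^ 2 * (-2 + 6 * U + 5 * V - 6 * U ^ 2 - 15 * U * V - 4 * V ^ 2 + 2 * U ^ 3 + 15
    * U ^ 2 * V + 12 * U * V ^ 2 + V ^ 3 - 5 * U ^ 3 * V - 14 * U ^ 2 * V ^ 2 - 3 * U * V ^ 3 + 6
    * U ^ 3 * V ^ 2 + 2 * U ^ 2 * V ^ 3 - 4 * U ^ 3 * V ^ 3) * (1 - U - V)⁻¹ ^ 3 * (1 - U * (1 -
    V))⁻¹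

def cUpCD : Coeffs F where
  K := U * (1 - V) * (1 - U * (1 - V) - V * (1 - U)) ^ 2 * (1 + U - V) * (1 - U - V)⁻¹ ^ 4
  J := U ^ 2 * (1 - V) ^ 2 * (2 - 4 * U - 3 * V + 2 * U ^ 2 + 9 * U * V - 5 * U ^ 2 * V - 4 * U *
    V ^ 2 + V ^ 3 - U ^ 3 * V + 6 * U ^ 2 * V ^ 2 - U * V ^ 3) * (1 - U - V)⁻¹ ^ 4
  X := U * (1 - V) * (-1 + 4 * U + 3 * V - 5 * U ^ 2 - 17 * U * V - 3 * V ^ 2 + 30 * U ^ 2 * V +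
    26 * U * V ^ 2 + V ^ 3 + 5 * U ^ 4 - 10 * U ^ 3 * V - 63 * U ^ 2 * V ^ 2 - 17 * U * V ^ 3 - 4
    * U ^ 5 - 25 * U ^ 4 * V + 46 * U ^ 3 * V ^ 2 + 55 * U ^ 2 * V ^ 3 + 4 * U * V ^ 4 + U ^ 6 +
    27 * U ^ 5 * V + 25 * U ^ 4 * V ^ 2 - 59 * U ^ 3 * V ^ 3 - 19 * U ^ 2 * V ^ 4 - 8 * U ^ 6 * V
    - 48 * U ^ 5 * V ^ 2 + 2 * U ^ 4 * V ^ 3 + 24 * U ^ 3 * V ^ 4 + 2 * U ^ 2 * V ^ 5 + 17 * U ^ 6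
    * V ^ 2 + 32 * U ^ 5 * V ^ 3 - 7 * U ^ 4 * V ^ 4 - 4 * U ^ 3 * V ^ 5 - 14 * U ^ 6 * V ^ 3 - 6
    * U ^ 5 * V ^ 4 + 4 * U ^ 6 * V ^ 4) * (1 - U)⁻¹ * (1 - U - V)⁻¹ ^ 3 * (1 - U * (1 - V))⁻¹ *
    ((1 - U * (1 - V)) ^ 2 - V * (1 - U))⁻¹
  W := U * (1 - V) * (-2 + 6 * U + 5 * V - 6 * U ^ 2 - 15 * U * V - 4 * V ^ 2 + 2 * U ^ 3 + 15 * U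
    ^ 2 * V + 12 * U * V ^ 2 + V ^ 3 - 5 * U ^ 3 * V - 14 * U ^ 2 * V ^ 2 - 3 * U * V ^ 3 + 6 * U
    ^ 3 * V ^ 2 + 2 * U ^ 2 * V ^ 3 - 4 * U ^ 3 * V ^ 3) * (1 - U - V)⁻¹ ^ 3 * (1 - U * (1 - V))⁻¹

def cUpUpCD : Coeffs F where
  K := U * (1 - V) * (1 - U - 2 * V - U ^ 2 + 7 * U * V + V ^ 2 + U ^ 3 - 4 * U ^ 2 * V - 5 * U *
    V ^ 2 - U ^ 3 * V + 6 * U ^ 2 * V ^ 2 - U * V ^ 3) * (1 - U - V)⁻¹ ^ 4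
  J := 2 * U ^ 2 * (1 - V) ^ 2 * (1 - U * (1 - V) - V * (1 - U)) * (1 - U + V) * (1 - U - V)⁻¹ ^ 4
  X := U * (-1 + 4 * U + 3 * V - 5 * U ^ 2 - 19 * U * V - 3 * V ^ 2 + 40 * U ^ 2 * V + 32 * U * V
    ^ 2 + V ^ 3 + 5 * U ^ 4 - 30 * U ^ 3 * V - 91 * U ^ 2 * V ^ 2 - 23 * U * V ^ 3 - 4 * U ^ 5 - 5
    * U ^ 4 * V + 98 * U ^ 3 * V ^ 2 + 85 * U ^ 2 * V ^ 3 + 6 * U * V ^ 4 + U ^ 6 + 17 * U ^ 5 * V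
    - 23 * U ^ 4 * V ^ 2 - 115 * U ^ 3 * V ^ 3 - 35 * U ^ 2 * V ^ 4 - 6 * U ^ 6 * V - 26 * U ^ 5 *
    V ^ 2 + 50 * U ^ 4 * V ^ 3 + 56 * U ^ 3 * V ^ 4 + 6 * U ^ 2 * V ^ 5 + 13 * U ^ 6 * V ^ 2 + 14
    * U ^ 5 * V ^ 3 - 31 * U ^ 4 * V ^ 4 - 14 * U ^ 3 * V ^ 5 - 12 * U ^ 6 * V ^ 3 + 6 * U ^ 4 * V
    ^ 5 + 2 * U ^ 3 * V ^ 6 + 4 * U ^ 6 * V ^ 4) * (1 - U)⁻¹ * (1 - U - V)⁻¹ ^ 3 * (1 - U * (1 -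
    V))⁻¹ * ((1 - U * (1 - V)) ^ 2 - V * (1 - U))⁻¹
  W := U * (-2 + 6 * U + 5 * V - 6 * U ^ 2 - 15 * U * V - 4 * V ^ 2 + 2 * U ^ 3 + 15 * U ^ 2 * V +
    12 * U * V ^ 2 + V ^ 3 - 5 * U ^ 3 * V - 14 * U ^ 2 * V ^ 2 - 3 * U * V ^ 3 + 6 * U ^ 3 * V ^
    2 + 2 * U ^ 2 * V ^ 3 - 4 * U ^ 3 * V ^ 3) * (1 - U - V)⁻¹ ^ 3 * (1 - U * (1 - V))⁻¹

/-! ### Verification of the recurrences on coefficients. -/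

theorem upM_eq (h : Generic U V) :
    cUpM U V = cM U V + (V * (1 - U)) • (cUpM U V).next U V := by
  obtain ⟨h1, h2, h3, h4, h5, h6, h7, h8⟩ := h
  ext <;> simp only [cM, cUpM, Coeffs.next, Coeffs.add_def, Coeffs.smul_def] <;> field_simp <;>
    ring

theorem upQD_eq (h : Generic U V) :
    cUpQD U V = cQD U V + (V * (1 - U)) • (cUpQD U V).next U V := by
  obtain ⟨h1, h2, h3, h4, h5, h6, h7, h8⟩ := h
  ext <;> simp only [cQD, cUpQD, Coeffs.next, Coeffs.add_def, Coeffs.smul_def] <;> field_simp <;>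
    ring

theorem upPU_eq (h : Generic U V) :
    cUpPU U V = cPU U V + (V * (1 - U)) • (cUpPU U V).next U V := by
  obtain ⟨h1, h2, h3, h4, h5, h6, h7, h8⟩ := h
  ext <;> simp only [cPU, cUpPU, Coeffs.next, Coeffs.add_def, Coeffs.smul_def] <;> field_simp <;>
    ring

theorem upPD_eq (h : Generic U V) :
    cUpPD U V = cPD U V + (V * (1 - U)) • (cUpPD U V).next U V := by
  obtain ⟨h1, h2, h3, h4, h5, h6, h7, h8⟩ := h
  ext <;> simp only [cPD, cUpPD, Coeffs.next, Coeffs.add_def, Coeffs.smul_def] <;> field_simp <;>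
    ring

theorem upUpPD_eq (h : Generic U V) :
    cUpUpPD U V = cUpPD U V + (V * (1 - U)) • (cUpUpPD U V).next U V := by
  obtain ⟨h1, h2, h3, h4, h5, h6, h7, h8⟩ := h
  ext <;> simp only [cUpPD, cUpUpPD, Coeffs.next, Coeffs.add_def, Coeffs.smul_def] <;> field_simp
    <;> ring

theorem upBD_eq (h : Generic U V) :
    cUpBD U V = cBD U V + (V * (1 - U)) • (cUpBD U V).next U V := by
  obtain ⟨h1, h2, h3, h4, h5, h6, h7, h8⟩ := h
  ext <;> simp only [cBD, cUpBD, Coeffs.next, Coeffs.add_def, Coeffs.smul_def] <;> field_simp <;>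
    ring

theorem upCU_eq (h : Generic U V) :
    cUpCU U V = cCU U V + (V * (1 - U)) • (cUpCU U V).next U V := by
  obtain ⟨h1, h2, h3, h4, h5, h6, h7, h8⟩ := h
  ext <;> simp only [cCU, cUpCU, Coeffs.next, Coeffs.add_def, Coeffs.smul_def] <;> field_simp <;>
    ring

theorem upCD_eq (h : Generic U V) :
    cUpCD U V = cCD U V + (V * (1 - U)) • (cUpCD U V).next U V := by
  obtain ⟨h1, h2, h3, h4, h5, h6, h7, h8⟩ := h
  ext <;> simp only [cCD, cUpCD, Coeffs.next, Coeffs.add_def, Coeffs.smul_def] <;> field_simp <;>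
    ring

theorem upUpCD_eq (h : Generic U V) :
    cUpUpCD U V = cUpCD U V + (V * (1 - U)) • (cUpUpCD U V).next U V := by
  obtain ⟨h1, h2, h3, h4, h5, h6, h7, h8⟩ := h
  ext <;> simp only [cUpCD, cUpUpCD, Coeffs.next, Coeffs.add_def, Coeffs.smul_def] <;> field_simp
    <;> ring

variable {U V}

theorem downQU_eq (h : Generic U V) :
    cDownQU U V = (cQU U V).down U V := by
  obtain ⟨h1, h2, h3, h4, h5, h6, h7, h8⟩ := h
  ext <;> simp only [cDownQU, cQU, Coeffs.down] <;> field_simp <;> ring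

/-- This identity and the following ones are the recurrences of `wordGF` transcribed to
coefficients: `down` for a weak descent, `down` minus the sequence itself for a strict one, `next`
and `prev` for unit steps, and multiplication by `x = U * (1 - V)` for the letter. -/
theorem M_eq (h : Generic U V) :
    cM U V = cOne + (U * (1 - V)) • ((cUpM U V).down U V + (cK.down U V - cK).down U V) := by
  obtain ⟨h1, h2, h3, h4, h5, h6, h7, h8⟩ := h
  ext <;> simp only [cK, cM, cOne, cUpM, Coeffs.down, Coeffs.add_def, Coeffs.sub_def,
    Coeffs.smul_def] <;> field_simp <;> ring

theorem QU_eq (h : Generic U V) :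
    cQU U V = (U * (1 - V)) • ((cDownQU U V).down U V + (cK.next U V).down U V) := by
  obtain ⟨h1, h2, h3, h4, h5, h6, h7, h8⟩ := h
  ext <;> simp only [cDownQU, cK, cQU, Coeffs.next, Coeffs.down, Coeffs.add_def, Coeffs.smul_def]
    <;> field_simp <;> ring

theorem QD_eq (h : Generic U V) :
    cQD U V = (U * (1 - V)) • ((cUpQD U V).down U V + (cDownQU U V - cQU U V).down U V +
      (cUpM U V).next U V + ((cK.next U V).down U V - cK.next U V)) := by
  obtain ⟨h1, h2, h3, h4, h5, h6, h7, h8⟩ := h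
  ext <;> simp only [cDownQU, cK, cQD, cQU, cUpM, cUpQD, Coeffs.next, Coeffs.down, Coeffs.add_def,
    Coeffs.sub_def, Coeffs.smul_def] <;> field_simp <;> ring

theorem PU_eq (h : Generic U V) :
    cPU U V = (U * (1 - V)) • ((cUpPU U V).down U V + ((cDownQU U V).down U V - cDownQU U V)) := by
  obtain ⟨h1, h2, h3, h4, h5, h6, h7, h8⟩ := h
  ext <;> simp only [cDownQU, cPU, cUpPU, Coeffs.down, Coeffs.add_def, Coeffs.sub_def,
    Coeffs.smul_def] <;> field_simp <;> ring

theorem PD_eq (h : Generic U V) :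
    cPD U V = (U * (1 - V)) • (cUpUpPD U V + ((cUpPU U V).down U V - cUpPU U V) +
      ((cUpQD U V).down U V - cUpQD U V) +
      ((cDownQU U V - cQU U V).down U V - (cDownQU U V - cQU U V))) := by
  obtain ⟨h1, h2, h3, h4, h5, h6, h7, h8⟩ := h
  ext <;> simp only [cDownQU, cPD, cQU, cUpPU, cUpQD, cUpUpPD, Coeffs.down, Coeffs.add_def,
    Coeffs.sub_def, Coeffs.smul_def] <;> field_simp <;> ring

theorem BU_eq (h : Generic U V) :
    cBU U V = (U * (1 - V)) • ((cBU U V).down U V + (cK.next U V).down U V) := by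
  obtain ⟨h1, h2, h3, h4, h5, h6, h7, h8⟩ := h
  ext <;> simp only [cBU, cK, Coeffs.next, Coeffs.down, Coeffs.add_def, Coeffs.smul_def] <;>
    field_simp <;> ring

/-- The forcing term from `cUpM` contains powers of `1 / (1 - U)`, while flat dents have the root `1
/ (1 - x)`. These roots merge at `V = 0`, so resolving the recurrence in `L` and `X` would divide by
`V`; `toW` passes to the basis in which this does not happen. -/
theorem BD_eq (h : Generic U V) :
    cBD U V = (U * (1 - V)) • (cUpBD U V + ((cBU U V).down U V - cBU U V) +
      ((cUpM U V).next U V).toW V + ((cK.next U V).down U V - cK.next U V)) := by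
  obtain ⟨h1, h2, h3, h4, h5, h6, h7, h8⟩ := h
  ext <;> simp only [cBD, cBU, cK, cUpBD, cUpM, Coeffs.next, Coeffs.down, Coeffs.toW,
    Coeffs.add_def, Coeffs.sub_def, Coeffs.smul_def] <;> field_simp <;> ring

theorem CU_eq (h : Generic U V) :
    cCU U V = (U * (1 - V)) • ((cUpCU U V).down U V + ((cBU U V).down U V).prev U V) := by
  obtain ⟨h1, h2, h3, h4, h5, h6, h7, h8⟩ := h
  ext <;> simp only [cBU, cCU, cUpCU, Coeffs.prev, Coeffs.down, Coeffs.add_def, Coeffs.smul_def]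
    <;> field_simp <;> ring

theorem CD_eq (h : Generic U V) :
    cCD U V = (U * (1 - V)) • (cUpUpCD U V + ((cUpCU U V).down U V - cUpCU U V) +
      ((cUpBD U V).prev U V + ((cBU U V).down U V - cBU U V).prev U V)) := by
  obtain ⟨h1, h2, h3, h4, h5, h6, h7, h8⟩ := h
  ext <;> simp only [cBU, cCD, cUpBD, cUpCU, cUpUpCD, Coeffs.prev, Coeffs.down, Coeffs.add_def,
    Coeffs.sub_def, Coeffs.smul_def] <;> field_simp <;> ring

end ClosedForm

/-! ### Integrality of the closed forms -/

/-- `S` contains `U`, `V` and the inverses of all denominators. -/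
structure Generic.Contained {F : Type*} [Field F] (S : Subring F) (U V : F) : Prop where
  mem_U : U ∈ S
  mem_V : V ∈ S
  inv_two : (2 : F)⁻¹ ∈ S
  inv_one_sub_U : (1 - U)⁻¹ ∈ S
  inv_root : (1 - U - V)⁻¹ ∈ S
  inv_one_sub_x : (1 - U * (1 - V))⁻¹ ∈ S
  inv_disc : ((1 - U * (1 - V)) ^ 2 - V * (1 - U))⁻¹ ∈ S

namespace Coeffs

variable {F : Type*} [Field F]

/-- All coefficients belong to `S`. -/
structure Mem (S : Subring F) (a : Coeffs F) : Prop where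
  K : a.K ∈ S
  J : a.J ∈ S
  nK : a.nK ∈ S
  nJ : a.nJ ∈ S
  L : a.L ∈ S
  nL : a.nL ∈ S
  X : a.X ∈ S
  W : a.W ∈ S
  c : a.c ∈ S

theorem seqKJ_mem {S : Subring F} {U V : F} (hS : Generic.Contained S U V) (n : ℕ) :
    (seqKJ U V n).1 ∈ S ∧ (seqKJ U V n).2 ∈ S := by
  induction n with
  | zero => exact ⟨one_mem S, zero_mem S⟩
  | succ n ih =>
    have h : ((seqKJ U V n).1 + U * (1 - V) * (seqKJ U V n).2) / (1 - U * (1 - V)) ∈ S := by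
      rw [div_eq_mul_inv]
      exact mul_mem (add_mem ih.1 (mul_mem (mul_mem hS.mem_U (sub_mem (one_mem S) hS.mem_V)) ih.2))
        hS.inv_one_sub_x
    exact ⟨h, add_mem ih.2 h⟩

theorem seqW_mem {S : Subring F} {U V : F} (hS : Generic.Contained S U V) (n : ℕ) :
    seqW U V n ∈ S := by
  induction n with
  | zero => exact zero_mem S
  | succ n ih =>
    rw [seqW, div_eq_mul_inv, div_eq_mul_inv, mul_inv]
    exact add_mem (mul_mem ih hS.inv_one_sub_U) (mul_mem (mul_mem (pow_mem hS.inv_one_sub_x n)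
      hS.mem_U) (mul_mem hS.inv_one_sub_U hS.inv_one_sub_x))

/-- With `S` the image of the ring of power series, this makes the field-valued closed forms honest
power series, to which uniqueness of recurrences applies. -/
theorem Mem.eval {S : Subring F} {a : Coeffs F} (ha : a.Mem S) {U V : F}
    (hS : Generic.Contained S U V) (n : ℕ) : a.eval U V n ∈ S := by
  have h1 := seqKJ_mem hS n
  have hn := natCast_mem S n
  exact add_mem (add_mem (add_mem (add_mem (add_mem (add_mem (add_mem (add_mem
    (mul_mem ha.K h1.1) (mul_mem ha.J h1.2)) (mul_mem ha.nK (mul_mem hn h1.1)))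
    (mul_mem ha.nJ (mul_mem hn h1.2))) (mul_mem ha.L (pow_mem hS.inv_one_sub_U n)))
    (mul_mem ha.nL (mul_mem hn (pow_mem hS.inv_one_sub_U n))))
    (mul_mem ha.X (pow_mem hS.inv_one_sub_x n))) (mul_mem ha.W (seqW_mem hS n))) ha.c

end Coeffs

namespace ClosedForm

variable {F : Type*} [Field F] {S : Subring F} {U V : F}

theorem mem_cK (S : Subring F) : (cK : Coeffs F).Mem S :=
  ⟨one_mem S, zero_mem S, zero_mem S, zero_mem S, zero_mem S, zero_mem S, zero_mem S, zero_mem S,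
    zero_mem S⟩

theorem mem_cM (hS : Generic.Contained S U V) : (cM U V).Mem S := by
  obtain ⟨h1, h2, h3, h4, h5, h6, h7⟩ := hS
  have hp : ∀ (a : F) n, a ∈ S → a ^ n ∈ S := fun _ n h => pow_mem h n
  have hn : ∀ (n : ℕ) [n.AtLeastTwo], (OfNat.ofNat n : F) ∈ S := fun n _ => ofNat_mem S n
  constructor <;> simp only [cM] <;> repeat' (with_reducible first
    | apply S.add_mem | apply S.sub_mem | apply S.mul_mem | apply hp | assumption
    | exact S.one_mem | exact S.zero_mem | exact hn _ | apply S.neg_mem)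

theorem mem_cUpM (hS : Generic.Contained S U V) : (cUpM U V).Mem S := by
  obtain ⟨h1, h2, h3, h4, h5, h6, h7⟩ := hS
  have hp : ∀ (a : F) n, a ∈ S → a ^ n ∈ S := fun _ n h => pow_mem h n
  have hn : ∀ (n : ℕ) [n.AtLeastTwo], (OfNat.ofNat n : F) ∈ S := fun n _ => ofNat_mem S n
  constructor <;> simp only [cUpM] <;> repeat' (with_reducible first
    | apply S.add_mem | apply S.sub_mem | apply S.mul_mem | apply hp | assumption
    | exact S.one_mem | exact S.zero_mem | exact hn _ | apply S.neg_mem)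

theorem mem_cQU (hS : Generic.Contained S U V) : (cQU U V).Mem S := by
  obtain ⟨h1, h2, h3, h4, h5, h6, h7⟩ := hS
  have hp : ∀ (a : F) n, a ∈ S → a ^ n ∈ S := fun _ n h => pow_mem h n
  constructor <;> simp only [cQU] <;> repeat' (with_reducible first
    | apply S.add_mem | apply S.sub_mem | apply S.mul_mem | apply hp | assumption
    | exact S.one_mem | exact S.zero_mem)

theorem mem_cQD (hS : Generic.Contained S U V) : (cQD U V).Mem S := by
  obtain ⟨h1, h2, h3, h4, h5, h6, h7⟩ := hS
  have hp : ∀ (a : F) n, a ∈ S → a ^ n ∈ S := fun _ n h => pow_mem h n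
  have hn : ∀ (n : ℕ) [n.AtLeastTwo], (OfNat.ofNat n : F) ∈ S := fun n _ => ofNat_mem S n
  constructor <;> simp only [cQD] <;> repeat' (with_reducible first
    | apply S.add_mem | apply S.sub_mem | apply S.mul_mem | apply hp | assumption
    | exact S.one_mem | exact S.zero_mem | exact hn _ | apply S.neg_mem)

theorem mem_cUpQD (hS : Generic.Contained S U V) : (cUpQD U V).Mem S := by
  obtain ⟨h1, h2, h3, h4, h5, h6, h7⟩ := hS
  have hp : ∀ (a : F) n, a ∈ S → a ^ n ∈ S := fun _ n h => pow_mem h n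
  have hn : ∀ (n : ℕ) [n.AtLeastTwo], (OfNat.ofNat n : F) ∈ S := fun n _ => ofNat_mem S n
  constructor <;> simp only [cUpQD] <;> repeat' (with_reducible first
    | apply S.add_mem | apply S.sub_mem | apply S.mul_mem | apply hp | assumption
    | exact S.one_mem | exact S.zero_mem | exact hn _ | apply S.neg_mem)

theorem mem_cPU (hS : Generic.Contained S U V) : (cPU U V).Mem S := by
  obtain ⟨h1, h2, h3, h4, h5, h6, h7⟩ := hS
  have hp : ∀ (a : F) n, a ∈ S → a ^ n ∈ S := fun _ n h => pow_mem h n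
  have hn : ∀ (n : ℕ) [n.AtLeastTwo], (OfNat.ofNat n : F) ∈ S := fun n _ => ofNat_mem S n
  constructor <;> simp only [cPU] <;> repeat' (with_reducible first
    | apply S.add_mem | apply S.sub_mem | apply S.mul_mem | apply hp | assumption
    | exact S.one_mem | exact S.zero_mem | exact hn _ | apply S.neg_mem)

theorem mem_cUpPU (hS : Generic.Contained S U V) : (cUpPU U V).Mem S := by
  obtain ⟨h1, h2, h3, h4, h5, h6, h7⟩ := hS
  have hp : ∀ (a : F) n, a ∈ S → a ^ n ∈ S := fun _ n h => pow_mem h n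
  have hn : ∀ (n : ℕ) [n.AtLeastTwo], (OfNat.ofNat n : F) ∈ S := fun n _ => ofNat_mem S n
  constructor <;> simp only [cUpPU] <;> repeat' (with_reducible first
    | apply S.add_mem | apply S.sub_mem | apply S.mul_mem | apply hp | assumption
    | exact S.one_mem | exact S.zero_mem | exact hn _ | apply S.neg_mem)

theorem mem_cPD (hS : Generic.Contained S U V) : (cPD U V).Mem S := by
  obtain ⟨h1, h2, h3, h4, h5, h6, h7⟩ := hS
  have hp : ∀ (a : F) n, a ∈ S → a ^ n ∈ S := fun _ n h => pow_mem h n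
  have hn : ∀ (n : ℕ) [n.AtLeastTwo], (OfNat.ofNat n : F) ∈ S := fun n _ => ofNat_mem S n
  constructor <;> simp only [cPD] <;> repeat' (with_reducible first
    | apply S.add_mem | apply S.sub_mem | apply S.mul_mem | apply hp | assumption
    | exact S.one_mem | exact S.zero_mem | exact hn _ | apply S.neg_mem)

theorem mem_cUpPD (hS : Generic.Contained S U V) : (cUpPD U V).Mem S := by
  obtain ⟨h1, h2, h3, h4, h5, h6, h7⟩ := hS
  have hp : ∀ (a : F) n, a ∈ S → a ^ n ∈ S := fun _ n h => pow_mem h n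
  have hn : ∀ (n : ℕ) [n.AtLeastTwo], (OfNat.ofNat n : F) ∈ S := fun n _ => ofNat_mem S n
  constructor <;> simp only [cUpPD] <;> repeat' (with_reducible first
    | apply S.add_mem | apply S.sub_mem | apply S.mul_mem | apply hp | assumption
    | exact S.one_mem | exact S.zero_mem | exact hn _ | apply S.neg_mem)

theorem mem_cUpUpPD (hS : Generic.Contained S U V) : (cUpUpPD U V).Mem S := by
  obtain ⟨h1, h2, h3, h4, h5, h6, h7⟩ := hS
  have hp : ∀ (a : F) n, a ∈ S → a ^ n ∈ S := fun _ n h => pow_mem h n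
  have hn : ∀ (n : ℕ) [n.AtLeastTwo], (OfNat.ofNat n : F) ∈ S := fun n _ => ofNat_mem S n
  constructor <;> simp only [cUpUpPD] <;> repeat' (with_reducible first
    | apply S.add_mem | apply S.sub_mem | apply S.mul_mem | apply hp | assumption
    | exact S.one_mem | exact S.zero_mem | exact hn _ | apply S.neg_mem)

theorem mem_cBU (hS : Generic.Contained S U V) : (cBU U V).Mem S := by
  obtain ⟨h1, h2, h3, h4, h5, h6, h7⟩ := hS
  have hp : ∀ (a : F) n, a ∈ S → a ^ n ∈ S := fun _ n h => pow_mem h n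
  have hn : ∀ (n : ℕ) [n.AtLeastTwo], (OfNat.ofNat n : F) ∈ S := fun n _ => ofNat_mem S n
  constructor <;> simp only [cBU] <;> repeat' (with_reducible first
    | apply S.add_mem | apply S.sub_mem | apply S.mul_mem | apply hp | assumption
    | exact S.one_mem | exact S.zero_mem | exact hn _ | apply S.neg_mem)

theorem mem_cBD (hS : Generic.Contained S U V) : (cBD U V).Mem S := by
  obtain ⟨h1, h2, h3, h4, h5, h6, h7⟩ := hS
  have hp : ∀ (a : F) n, a ∈ S → a ^ n ∈ S := fun _ n h => pow_mem h n
  have hn : ∀ (n : ℕ) [n.AtLeastTwo], (OfNat.ofNat n : F) ∈ S := fun n _ => ofNat_mem S n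
  constructor <;> simp only [cBD] <;> repeat' (with_reducible first
    | apply S.add_mem | apply S.sub_mem | apply S.mul_mem | apply hp | assumption
    | exact S.one_mem | exact S.zero_mem | exact hn _ | apply S.neg_mem)

theorem mem_cUpBD (hS : Generic.Contained S U V) : (cUpBD U V).Mem S := by
  obtain ⟨h1, h2, h3, h4, h5, h6, h7⟩ := hS
  have hp : ∀ (a : F) n, a ∈ S → a ^ n ∈ S := fun _ n h => pow_mem h n
  have hn : ∀ (n : ℕ) [n.AtLeastTwo], (OfNat.ofNat n : F) ∈ S := fun n _ => ofNat_mem S n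
  constructor <;> simp only [cUpBD] <;> repeat' (with_reducible first
    | apply S.add_mem | apply S.sub_mem | apply S.mul_mem | apply hp | assumption
    | exact S.one_mem | exact S.zero_mem | exact hn _ | apply S.neg_mem)

theorem mem_cCU (hS : Generic.Contained S U V) : (cCU U V).Mem S := by
  obtain ⟨h1, h2, h3, h4, h5, h6, h7⟩ := hS
  have hp : ∀ (a : F) n, a ∈ S → a ^ n ∈ S := fun _ n h => pow_mem h n
  have hn : ∀ (n : ℕ) [n.AtLeastTwo], (OfNat.ofNat n : F) ∈ S := fun n _ => ofNat_mem S n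
  constructor <;> simp only [cCU] <;> repeat' (with_reducible first
    | apply S.add_mem | apply S.sub_mem | apply S.mul_mem | apply hp | assumption
    | exact S.one_mem | exact S.zero_mem | exact hn _ | apply S.neg_mem)

theorem mem_cUpCU (hS : Generic.Contained S U V) : (cUpCU U V).Mem S := by
  obtain ⟨h1, h2, h3, h4, h5, h6, h7⟩ := hS
  have hp : ∀ (a : F) n, a ∈ S → a ^ n ∈ S := fun _ n h => pow_mem h n
  have hn : ∀ (n : ℕ) [n.AtLeastTwo], (OfNat.ofNat n : F) ∈ S := fun n _ => ofNat_mem S n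
  constructor <;> simp only [cUpCU] <;> repeat' (with_reducible first
    | apply S.add_mem | apply S.sub_mem | apply S.mul_mem | apply hp | assumption
    | exact S.one_mem | exact S.zero_mem | exact hn _ | apply S.neg_mem)

theorem mem_cCD (hS : Generic.Contained S U V) : (cCD U V).Mem S := by
  obtain ⟨h1, h2, h3, h4, h5, h6, h7⟩ := hS
  have hp : ∀ (a : F) n, a ∈ S → a ^ n ∈ S := fun _ n h => pow_mem h n
  have hn : ∀ (n : ℕ) [n.AtLeastTwo], (OfNat.ofNat n : F) ∈ S := fun n _ => ofNat_mem S n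
  constructor <;> simp only [cCD] <;> repeat' (with_reducible first
    | apply S.add_mem | apply S.sub_mem | apply S.mul_mem | apply hp | assumption
    | exact S.one_mem | exact S.zero_mem | exact hn _ | apply S.neg_mem)

theorem mem_cUpCD (hS : Generic.Contained S U V) : (cUpCD U V).Mem S := by
  obtain ⟨h1, h2, h3, h4, h5, h6, h7⟩ := hS
  have hp : ∀ (a : F) n, a ∈ S → a ^ n ∈ S := fun _ n h => pow_mem h n
  have hn : ∀ (n : ℕ) [n.AtLeastTwo], (OfNat.ofNat n : F) ∈ S := fun n _ => ofNat_mem S n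
  constructor <;> simp only [cUpCD] <;> repeat' (with_reducible first
    | apply S.add_mem | apply S.sub_mem | apply S.mul_mem | apply hp | assumption
    | exact S.one_mem | exact S.zero_mem | exact hn _ | apply S.neg_mem)

theorem mem_cUpUpCD (hS : Generic.Contained S U V) : (cUpUpCD U V).Mem S := by
  obtain ⟨h1, h2, h3, h4, h5, h6, h7⟩ := hS
  have hp : ∀ (a : F) n, a ∈ S → a ^ n ∈ S := fun _ n h => pow_mem h n
  have hn : ∀ (n : ℕ) [n.AtLeastTwo], (OfNat.ofNat n : F) ∈ S := fun n _ => ofNat_mem S n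
  constructor <;> simp only [cUpUpCD] <;> repeat' (with_reducible first
    | apply S.add_mem | apply S.sub_mem | apply S.mul_mem | apply hp | assumption
    | exact S.one_mem | exact S.zero_mem | exact hn _ | apply S.neg_mem)

end ClosedForm

/-! ### Families of power series with a closed form -/

/-- An embedding of the ring of power series into a field that maps `x` to `U (1 - V)` and `y` to
`V (1 - U)`. -/
structure Uniformization {F : Type*} [Field F] (φ : MvPowerSeries (Fin 2) ℚ →+* F) (U V : F) :
    Prop where
  injective : Function.Injective φ
  map_x : φ x = U * (1 - V)
  map_y : φ y = V * (1 - U)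
  generic : Generic U V
  contained : Generic.Contained φ.range U V

/-- The family `f` has the closed form `c`. -/
def HasClosedForm {F : Type*} [Field F] (φ : MvPowerSeries (Fin 2) ℚ →+* F) (U V : F)
    (c : Coeffs F) (f : ℕ → MvPowerSeries (Fin 2) ℚ) : Prop :=
  ∀ n, 1 ≤ n → φ (f n) = c.eval U V n

namespace Move

theorem Agree.add_const {k : ℕ} {f g : ℕ → MvPowerSeries (Fin 2) ℚ} (h : Agree k f g)
    (B : ℕ → MvPowerSeries (Fin 2) ℚ) : Agree k (fun n => f n + B n) (fun n => g n + B n) :=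
  fun n hn d hd => congrArg (· + B n d) (h n hn d hd)

theorem act_zero (o : Move) (n : ℕ) : o.act (fun _ => 0) n = 0 := by
  cases o with
  | up => exact funext fun d => Finset.sum_const_zero
  | dec => exact ite_self 0
  | _ => simp [act]

theorem act_none (f : ℕ → MvPowerSeries (Fin 2) ℚ) : none.act f = fun _ => 0 := rfl

/-- `act₂` puts `up` outermost for this pair of moves; the exchange makes the already known closed
form of the inner `up` usable. -/
theorem up_act_inc_act (f : ℕ → MvPowerSeries (Fin 2) ℚ) :
    up.act (inc.act f) = inc.act (up.act f) := by
  funext n d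
  refine Finset.sum_congr rfl fun q _ => ?_
  change f (n + q + 1) _ = f (n + 1 + q) _
  rw [add_right_comm]

/-- The series `∑ y ^ q * f (n + q)` is determined by its functional equation, since iterating the
latter raises the degree in `y`. No convergence condition on `g` is needed. -/
theorem up_act_eq {f g : ℕ → MvPowerSeries (Fin 2) ℚ}
    (h : ∀ n, 1 ≤ n → g n = f n + y * g (n + 1)) {n : ℕ} (hn : 1 ≤ n) : up.act f n = g n := by
  funext d
  obtain ⟨m, hm⟩ : ∃ m, d 1 = m := ⟨_, rfl⟩
  induction m generalizing n d with
  | zero =>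
    rw [h n hn]
    change _ = f n d + (y * g (n + 1)) d
    rw [apply_y_mul, if_pos hm, add_zero]
    simp [act, hm]
  | succ m ih =>
    rw [h n hn]
    change _ = f n d + (y * g (n + 1)) d
    rw [apply_y_mul, if_neg (by omega), ← ih (n := n + 1) (by omega) (d - Finsupp.single 1 1) (by simp [hm])]
    simp only [act]
    rw [hm, Finset.sum_range_succ', add_comm]
    have hm' : (d - Finsupp.single 1 1 : Fin 2 →₀ ℕ) 1 + 1 = m + 1 := by simp [hm]
    rw [hm', add_zero, Finsupp.single_zero, tsub_zero]
    refine congrArg (f n d + ·) (Finset.sum_congr rfl fun q _ => ?_)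
    rw [add_right_comm, ← add_assoc, tsub_tsub, ← Finsupp.single_add, add_comm 1 q]

end Move

theorem wordGF_unique {p q : Phase} {o o' : Move} {a : MvPowerSeries (Fin 2) ℚ}
    {B f : ℕ → MvPowerSeries (Fin 2) ℚ}
    (hw : ∀ n, 1 ≤ n → wordGF p q n = a + x * (o.act (o'.act (wordGF p q)) n + B n))
    (hf : ∀ n, 1 ≤ n → f n = a + x * (o.act (o'.act f) n + B n)) {n : ℕ} (hn : 1 ≤ n) :
    wordGF p q n = f n :=
  eq_of_recurrence (Φ := fun f n => o.act (o'.act f) n + B n) (A := fun _ => a)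
    (fun _ _ _ h => ((h.act o').act o).add_const B) hw hf hn

namespace HasClosedForm

variable {F : Type*} [Field F] {φ : MvPowerSeries (Fin 2) ℚ →+* F} {U V : F} {c c' : Coeffs F}
  {f g : ℕ → MvPowerSeries (Fin 2) ℚ}

/-- The candidate solution has to be pulled back from the field, because `eq_of_recurrence` compares
coefficients of power series. -/
theorem exists_of_mem (hφ : Uniformization φ U V) (hc : c.Mem φ.range) :
    ∃ f : ℕ → MvPowerSeries (Fin 2) ℚ, ∀ n, φ (f n) = c.eval U V n :=
  Classical.axiom_of_choice fun n => hc.eval hφ.contained n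

theorem add (hf : HasClosedForm φ U V c f) (hg : HasClosedForm φ U V c' g) :
    HasClosedForm φ U V (c + c') (fun n => f n + g n) := fun n hn => by
  rw [map_add, hf n hn, hg n hn, Coeffs.eval_add]

theorem x_mul (hφ : Uniformization φ U V) (hf : HasClosedForm φ U V c f) :
    HasClosedForm φ U V ((U * (1 - V)) • c) (fun n => x * f n) := fun n hn => by
  rw [map_mul, hf n hn, Coeffs.eval_smul, hφ.map_x]

theorem one : HasClosedForm φ U V ClosedForm.cOne (fun _ => 1) := fun n _ => by
  simp [Coeffs.eval, Coeffs.combine, ClosedForm.cOne]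

theorem zero_add (hf : HasClosedForm φ U V c f) : HasClosedForm φ U V c (fun n => 0 + f n) := by
  simpa only [_root_.zero_add] using hf

theorem inc (hφ : Uniformization φ U V) (hf : HasClosedForm φ U V c f) :
    HasClosedForm φ U V (c.next U V) (Move.inc.act f) := fun n _ => by
  rw [Coeffs.eval_next U V hφ.generic]
  exact hf _ (by omega)

theorem toW (hφ : Uniformization φ U V) (hf : HasClosedForm φ U V c f) :
    HasClosedForm φ U V (c.toW V) f := fun n hn => by
  rw [Coeffs.eval_toW U V hφ.generic, hf n hn]

theorem down (hφ : Uniformization φ U V) (hf : HasClosedForm φ U V c f) (hc : c.c = 0) :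
    HasClosedForm φ U V (c.down U V) (Move.down.act f) := fun n _ => by
  rw [Coeffs.eval_down U V hφ.generic c hc]
  exact (map_sum φ _ _).trans (Finset.sum_congr rfl fun j _ => hf _ (by omega))

theorem strictDown (hφ : Uniformization φ U V) (hf : HasClosedForm φ U V c f) (hc : c.c = 0) :
    HasClosedForm φ U V (c.down U V - c) (Move.strictDown.act f) := fun n hn => by
  obtain ⟨m, rfl⟩ := Nat.exists_eq_add_of_le' hn
  rw [Coeffs.eval_sub, Coeffs.eval_down U V hφ.generic c hc, Finset.sum_range_succ,
    add_sub_cancel_right]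
  exact (map_sum φ _ _).trans (Finset.sum_congr rfl fun j _ => hf _ (by omega))

theorem dec_of_ne (hφ : Uniformization φ U V) (hf : HasClosedForm φ U V c f) {n : ℕ}
    (hn : 2 ≤ n) : φ (Move.dec.act f n) = (c.prev U V).eval U V n := by
  obtain ⟨m, rfl⟩ := Nat.exists_eq_add_of_le' (show 1 ≤ n by omega)
  rw [← Coeffs.eval_next U V hφ.generic, Coeffs.next_prev U V hφ.generic]
  simp only [Move.act, if_pos hn, Nat.add_sub_cancel]
  exact hf _ (by omega)

/-- At height one the move is impossible and gives zero, whereas the shifted closed form takes the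
value at height zero. The two agree only if that value vanishes. -/
theorem dec (hφ : Uniformization φ U V) (hf : HasClosedForm φ U V c f) (hc : c.eval U V 0 = 0) :
    HasClosedForm φ U V (c.prev U V) (Move.dec.act f) := fun n hn => by
  rcases Nat.lt_or_ge n 2 with h | h
  · obtain rfl : n = 0 + 1 := by omega
    rw [← Coeffs.eval_next U V hφ.generic, Coeffs.next_prev U V hφ.generic, hc]
    exact map_zero φ
  · exact dec_of_ne hφ hf h

theorem up (hφ : Uniformization φ U V) (hf : HasClosedForm φ U V c f) (hc' : c'.Mem φ.range)
    (h : c' = c + (V * (1 - U)) • c'.next U V) : HasClosedForm φ U V c' (Move.up.act f) := by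
  obtain ⟨g, hg⟩ := exists_of_mem hφ hc'
  intro n hn
  rw [Move.up_act_eq (g := g) (fun m hm => hφ.injective ?_) hn, hg]
  rw [map_add, map_mul, hg, hg, hf m hm, hφ.map_y, ← Coeffs.eval_next U V hφ.generic,
    ← Coeffs.eval_smul, ← Coeffs.eval_add, ← h]

/-- If the right-hand side of the recurrence sends families with closed form `c` to such families,
then the family with closed form `c` is a fixed point, and the fixed point is unique. -/
theorem wordGF (hφ : Uniformization φ U V) (hc : c.Mem φ.range) {p q : Phase} {o o' : Move}
    {a : MvPowerSeries (Fin 2) ℚ} {B : ℕ → MvPowerSeries (Fin 2) ℚ}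
    (hw : ∀ n, 1 ≤ n → AlmostConvex.wordGF p q n =
      a + x * (o.act (o'.act (AlmostConvex.wordGF p q)) n + B n))
    (h : ∀ f, HasClosedForm φ U V c f →
      HasClosedForm φ U V c (fun n => a + x * (o.act (o'.act f) n + B n))) :
    HasClosedForm φ U V c (AlmostConvex.wordGF p q) := by
  obtain ⟨f, hf⟩ := exists_of_mem hφ hc
  intro n hn
  have hf' : HasClosedForm φ U V c f := fun n _ => hf n
  rw [wordGF_unique (f := f) hw (fun m hm => hφ.injective ?_) hn, hf]
  rw [hf, h f hf' m hm]

end HasClosedForm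

/-! ### The recurrences -/

-- The system is triangular: in each recurrence the phase itself occurs in the first term only, and
-- the remaining terms involve phases treated before. The arguments of `wordGF_unique` follow this
-- shape.
open Move in
theorem wordGF_falling_falling {n : ℕ} (hn : 1 ≤ n) : wordGF .falling .falling n =
    1 + x * (down.act (down.act (wordGF .falling .falling)) n + 0) := by
  rw [wordGF_eq _ _ hn]
  simp [Fintype.sum_prod_type, Phase.next, Phase.Accepts, Falling, act₂, Shrinks, act_none,
    act_zero]

open Move in
theorem wordGF_falling_peak {n : ℕ} (hn : 1 ≤ n) : wordGF .falling .peak n =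
    1 + x * (down.act (up.act (wordGF .falling .peak)) n +
      down.act (strictDown.act (wordGF .falling .falling)) n) := by
  rw [wordGF_eq _ _ hn]
  simp [Fintype.sum_prod_type, Phase.next, Phase.Accepts, Falling, Peak, act₂, Shrinks, act_none,
    act_zero]

open Move in
theorem wordGF_fallingDent_falling {n : ℕ} (hn : 1 ≤ n) : wordGF .fallingDent .falling n =
    0 + x * (down.act (down.act (wordGF .fallingDent .falling)) n +
      down.act (inc.act (wordGF .falling .falling)) n) := by
  rw [wordGF_eq _ _ hn]
  simp [Fintype.sum_prod_type, Phase.next, Phase.Accepts, Falling, FallingDent, act₂, Shrinks,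
    act_none, act_zero]

open Move in
theorem wordGF_fallingDent_peak {n : ℕ} (hn : 1 ≤ n) : wordGF .fallingDent .peak n =
    0 + x * (down.act (up.act (wordGF .fallingDent .peak)) n +
      (down.act (strictDown.act (wordGF .fallingDent .falling)) n +
      (inc.act (up.act (wordGF .falling .peak)) n +
      strictDown.act (inc.act (wordGF .falling .falling)) n))) := by
  rw [wordGF_eq _ _ hn]
  simp [Fintype.sum_prod_type, Phase.next, Phase.Accepts, FallingDent, act₂, Shrinks,
    up_act_inc_act, add_assoc]

open Move in
theorem wordGF_descDent_falling {n : ℕ} (hn : 1 ≤ n) : wordGF .descDent .falling n =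
    0 + x * (down.act (up.act (wordGF .descDent .falling)) n +
      strictDown.act (down.act (wordGF .fallingDent .falling)) n) := by
  rw [wordGF_eq _ _ hn]
  simp [Fintype.sum_prod_type, Phase.next, Phase.Accepts, Falling, DescDent, act₂, Shrinks,
    act_none, act_zero]

open Move in
theorem wordGF_descDent_peak {n : ℕ} (hn : 1 ≤ n) : wordGF .descDent .peak n =
    0 + x * (up.act (up.act (wordGF .descDent .peak)) n +
      (strictDown.act (up.act (wordGF .descDent .falling)) n +
      (strictDown.act (up.act (wordGF .fallingDent .peak)) n +
      strictDown.act (strictDown.act (wordGF .fallingDent .falling)) n))) := by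
  rw [wordGF_eq _ _ hn]
  simp [Fintype.sum_prod_type, Phase.next, Phase.Accepts, DescDent, act₂, Shrinks, add_assoc]

open Move in
theorem wordGF_flatDent_falling {n : ℕ} (hn : 1 ≤ n) : wordGF .flatDent .falling n =
    0 + x * (down.act (stay.act (wordGF .flatDent .falling)) n +
      down.act (inc.act (wordGF .falling .falling)) n) := by
  rw [wordGF_eq _ _ hn]
  simp [Fintype.sum_prod_type, Phase.next, Phase.Accepts, Falling, FlatDent, act₂, Shrinks,
    act_none]

open Move in
theorem wordGF_flatDent_peak {n : ℕ} (hn : 1 ≤ n) : wordGF .flatDent .peak n =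
    0 + x * (up.act (stay.act (wordGF .flatDent .peak)) n +
      (strictDown.act (stay.act (wordGF .flatDent .falling)) n +
      (inc.act (up.act (wordGF .falling .peak)) n +
      strictDown.act (inc.act (wordGF .falling .falling)) n))) := by
  rw [wordGF_eq _ _ hn]
  simp [Fintype.sum_prod_type, Phase.next, Phase.Accepts, FlatDent, act₂, Shrinks, up_act_inc_act,
    add_assoc]

open Move in
theorem wordGF_flatPeakDent_falling {n : ℕ} (hn : 1 ≤ n) : wordGF .flatPeakDent .falling n =
    0 + x * (down.act (up.act (wordGF .flatPeakDent .falling)) n +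
      dec.act (down.act (wordGF .flatDent .falling)) n) := by
  rw [wordGF_eq _ _ hn]
  simp [Fintype.sum_prod_type, Phase.next, Phase.Accepts, Falling, FlatPeakDent, act₂, Shrinks,
    act_none, act_zero]

open Move in
theorem wordGF_flatPeakDent_peak {n : ℕ} (hn : 1 ≤ n) : wordGF .flatPeakDent .peak n =
    0 + x * (up.act (up.act (wordGF .flatPeakDent .peak)) n +
      (strictDown.act (up.act (wordGF .flatPeakDent .falling)) n +
      (dec.act (up.act (wordGF .flatDent .peak)) n +
      dec.act (strictDown.act (wordGF .flatDent .falling)) n))) := by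
  rw [wordGF_eq _ _ hn]
  simp [Fintype.sum_prod_type, Phase.next, Phase.Accepts, FlatPeakDent, act₂, Shrinks, add_assoc]

/-! ### The closed forms of the generating functions of words -/

theorem Coeffs.add_assoc {F : Type*} [Field F] (a b c : Coeffs F) : a + b + c = a + (b + c) := by
  simp only [Coeffs.add_def, _root_.add_assoc]

namespace Uniformization

open ClosedForm

variable {F : Type*} [Field F] {φ : MvPowerSeries (Fin 2) ℚ →+* F} {U V : F}

/-- The sequence `K` is made for this case: `J n` is the sum of `K 1, …, K n`, and `K n` is one plus
`x` times the sum of `J 1, …, J n`. -/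
theorem falling_falling (h : Uniformization φ U V) : HasClosedForm φ U V cK (wordGF .falling .falling) := by
  refine .wordGF h (mem_cK _) (B := fun _ => 0) (fun n => wordGF_falling_falling) fun f hf => ?_
  have e : cK = cOne + (U * (1 - V)) • (cK.down U V).down U V := by
    obtain ⟨h1, h2, h3, h4, h5, h6, h7, h8⟩ := h.generic
    ext <;> simp only [cK, cOne, Coeffs.down, Coeffs.add_def, Coeffs.smul_def] <;> field_simp <;>
      ring
  simp only [add_zero]
  rw [e]
  exact .add .one (.x_mul h (.down h (.down h hf rfl) (by simp [Coeffs.down, cK])))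

theorem falling_peak (h : Uniformization φ U V) : HasClosedForm φ U V (cM U V) (wordGF .falling .peak) := by
  refine .wordGF h (mem_cM h.contained) (fun n => wordGF_falling_peak) fun f hf => ?_
  rw [M_eq h.generic]
  exact .add .one (.x_mul h (.add (.down h (.up h hf (mem_cUpM h.contained) (upM_eq _ _ h.generic))
    rfl) (.down h (.strictDown h h.falling_falling rfl)
    (by simp [Coeffs.down, cK, Coeffs.sub_def]))))

theorem up_falling_peak (h : Uniformization φ U V) : HasClosedForm φ U V (cUpM U V) (Move.up.act (wordGF .falling .peak)) :=
  .up h h.falling_peak (mem_cUpM h.contained) (upM_eq _ _ h.generic)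

theorem down_fallingDent_falling (h : Uniformization φ U V) {f : ℕ → MvPowerSeries (Fin 2) ℚ}
    (hf : HasClosedForm φ U V (cQU U V) f) :
    HasClosedForm φ U V (cDownQU U V) (Move.down.act f) :=
  downQU_eq h.generic ▸ .down h hf rfl

theorem fallingDent_falling (h : Uniformization φ U V) :
    HasClosedForm φ U V (cQU U V) (wordGF .fallingDent .falling) := by
  refine .wordGF h (mem_cQU h.contained) (fun n => wordGF_fallingDent_falling) fun f hf => ?_
  rw [QU_eq h.generic]
  exact .zero_add (.x_mul h (.add (.down h (h.down_fallingDent_falling hf) rfl)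
    (.down h (.inc h h.falling_falling) rfl)))

theorem strictDown_fallingDent_falling (h : Uniformization φ U V) : HasClosedForm φ U V (cDownQU U V - cQU U V)
    (Move.strictDown.act (wordGF .fallingDent .falling)) := by
  rw [downQU_eq h.generic]
  exact .strictDown h h.fallingDent_falling rfl

theorem up_fallingDent_peak (h : Uniformization φ U V) {f : ℕ → MvPowerSeries (Fin 2) ℚ}
    (hf : HasClosedForm φ U V (cQD U V) f) : HasClosedForm φ U V (cUpQD U V) (Move.up.act f) :=
  .up h hf (mem_cUpQD h.contained) (upQD_eq _ _ h.generic)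

theorem fallingDent_peak (h : Uniformization φ U V) : HasClosedForm φ U V (cQD U V) (wordGF .fallingDent .peak) := by
  refine .wordGF h (mem_cQD h.contained) (fun n => wordGF_fallingDent_peak) fun f hf => ?_
  rw [QD_eq h.generic, Coeffs.add_assoc, Coeffs.add_assoc]
  exact .zero_add (.x_mul h (.add (.down h (h.up_fallingDent_peak hf) rfl)
    (.add (.down h h.strictDown_fallingDent_falling (sub_zero 0))
    (.add (.inc h h.up_falling_peak) (.strictDown h (.inc h h.falling_falling) rfl)))))

theorem up_descDent_falling (h : Uniformization φ U V) {f : ℕ → MvPowerSeries (Fin 2) ℚ}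
    (hf : HasClosedForm φ U V (cPU U V) f) : HasClosedForm φ U V (cUpPU U V) (Move.up.act f) :=
  .up h hf (mem_cUpPU h.contained) (upPU_eq _ _ h.generic)

theorem descDent_falling (h : Uniformization φ U V) : HasClosedForm φ U V (cPU U V) (wordGF .descDent .falling) := by
  refine .wordGF h (mem_cPU h.contained) (fun n => wordGF_descDent_falling) fun f hf => ?_
  rw [PU_eq h.generic]
  exact .zero_add (.x_mul h (.add (.down h (h.up_descDent_falling hf) rfl)
    (.strictDown h (h.down_fallingDent_falling h.fallingDent_falling) rfl)))

theorem up_descDent_peak (h : Uniformization φ U V) {f : ℕ → MvPowerSeries (Fin 2) ℚ}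
    (hf : HasClosedForm φ U V (cPD U V) f) : HasClosedForm φ U V (cUpPD U V) (Move.up.act f) :=
  .up h hf (mem_cUpPD h.contained) (upPD_eq _ _ h.generic)

theorem descDent_peak (h : Uniformization φ U V) : HasClosedForm φ U V (cPD U V) (wordGF .descDent .peak) := by
  refine .wordGF h (mem_cPD h.contained) (fun n => wordGF_descDent_peak) fun f hf => ?_
  rw [PD_eq h.generic, Coeffs.add_assoc, Coeffs.add_assoc]
  exact .zero_add (.x_mul h (.add (.up h (h.up_descDent_peak hf) (mem_cUpUpPD h.contained)
    (upUpPD_eq _ _ h.generic))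
    (.add (.strictDown h (h.up_descDent_falling h.descDent_falling) rfl)
    (.add (.strictDown h (h.up_fallingDent_peak h.fallingDent_peak) rfl)
    (.strictDown h h.strictDown_fallingDent_falling (sub_zero 0))))))

theorem flatDent_falling (h : Uniformization φ U V) : HasClosedForm φ U V (cBU U V) (wordGF .flatDent .falling) := by
  refine .wordGF h (mem_cBU h.contained) (fun n => wordGF_flatDent_falling) fun f hf => ?_
  rw [BU_eq h.generic]
  exact .zero_add (.x_mul h (.add (.down h hf rfl) (.down h (.inc h h.falling_falling) rfl)))

theorem up_flatDent_peak (h : Uniformization φ U V) {f : ℕ → MvPowerSeries (Fin 2) ℚ}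
    (hf : HasClosedForm φ U V (cBD U V) f) : HasClosedForm φ U V (cUpBD U V) (Move.up.act f) :=
  .up h hf (mem_cUpBD h.contained) (upBD_eq _ _ h.generic)

theorem flatDent_peak (h : Uniformization φ U V) : HasClosedForm φ U V (cBD U V) (wordGF .flatDent .peak) := by
  refine .wordGF h (mem_cBD h.contained) (fun n => wordGF_flatDent_peak) fun f hf => ?_
  rw [BD_eq h.generic, Coeffs.add_assoc, Coeffs.add_assoc]
  exact .zero_add (.x_mul h (.add (h.up_flatDent_peak hf)
    (.add (.strictDown h h.flatDent_falling rfl)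
    (.add (.toW h (.inc h h.up_falling_peak)) (.strictDown h (.inc h h.falling_falling) rfl)))))

theorem up_flatPeakDent_falling (h : Uniformization φ U V) {f : ℕ → MvPowerSeries (Fin 2) ℚ}
    (hf : HasClosedForm φ U V (cCU U V) f) : HasClosedForm φ U V (cUpCU U V) (Move.up.act f) :=
  .up h hf (mem_cUpCU h.contained) (upCU_eq _ _ h.generic)

theorem eval_down_zero (h : Uniformization φ U V) {c : Coeffs F} (hc : c.c = 0) : (c.down U V).eval U V 0 = 0 :=
  (Coeffs.eval_down U V h.generic c hc 0).trans (Finset.sum_range_zero _)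

theorem eval_cBU_zero : (cBU U V).eval U V 0 = 0 := by
  simp [Coeffs.eval, Coeffs.combine, cBU, Coeffs.seqKJ, Coeffs.seqW]

theorem flatPeakDent_falling (h : Uniformization φ U V) :
    HasClosedForm φ U V (cCU U V) (wordGF .flatPeakDent .falling) := by
  refine .wordGF h (mem_cCU h.contained) (fun n => wordGF_flatPeakDent_falling) fun f hf => ?_
  rw [CU_eq h.generic]
  exact .zero_add (.x_mul h (.add (.down h (h.up_flatPeakDent_falling hf) rfl)
    (.dec h (.down h h.flatDent_falling rfl) (h.eval_down_zero rfl))))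

/-- The correction that is due to the minimal height of a column that can shrink. -/
def correction (U V : F) : F :=
  -(U * (1 - V) * (cUpBD U V).eval U V 0) * (1 - U * (1 - V))⁻¹

theorem correction_mem (h : Uniformization φ U V) : correction U V ∈ φ.range :=
  mul_mem (neg_mem (mul_mem (mul_mem h.contained.mem_U (sub_mem (one_mem _) h.contained.mem_V))
    ((mem_cUpBD h.contained).eval h.contained 0))) h.contained.inv_one_sub_x

/-- A term supported at height one is reproduced by `up`, which reaches height one only from height
one with a move of size zero. -/
theorem up_act_corrected (h : Uniformization φ U V) {f : ℕ → MvPowerSeries (Fin 2) ℚ} {c c' : Coeffs F} {κ : F}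
    (hf : ∀ n, 1 ≤ n → φ (f n) = c.eval U V n + if n = 1 then κ else 0) (hκ : κ ∈ φ.range)
    (hc' : c'.Mem φ.range) (e : c' = c + (V * (1 - U)) • c'.next U V) {n : ℕ} (hn : 1 ≤ n) :
    φ (Move.up.act f n) = c'.eval U V n + if n = 1 then κ else 0 := by
  obtain ⟨k, rfl⟩ := hκ
  obtain ⟨g, hg⟩ := HasClosedForm.exists_of_mem h hc'
  have hk : ∀ n : ℕ, φ (if n = 1 then k else 0) = if n = 1 then φ k else 0 := fun n => by
    split_ifs
    · rfl
    · exact map_zero φ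
  rw [Move.up_act_eq (g := fun n => g n + if n = 1 then k else 0)
    (fun m hm => h.injective ?_) hn, map_add, hg, hk]
  rw [map_add, map_add, map_mul, map_add, hg, hg, hf m hm, hk, hk, if_neg (by omega : m + 1 ≠ 1),
    h.map_y, add_zero, ← Coeffs.eval_next U V h.generic]
  nth_rw 1 [e]
  rw [Coeffs.eval_add, Coeffs.eval_smul]
  ring

theorem flatPeakDent_peak (h : Uniformization φ U V) {n : ℕ} (hn : 1 ≤ n) : φ (wordGF .flatPeakDent .peak n) =
    (cCD U V).eval U V n + if n = 1 then correction U V else 0 := by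
  obtain ⟨k, hk⟩ := h.correction_mem
  obtain ⟨g, hg⟩ := HasClosedForm.exists_of_mem h (mem_cCD h.contained)
  have hf : ∀ n, φ (g n + if n = 1 then k else 0) =
      (cCD U V).eval U V n + if n = 1 then correction U V else 0 := fun n => by
    rw [map_add, hg]
    split_ifs
    · rw [hk]
    · rw [map_zero]
  rw [wordGF_unique (f := fun n => g n + if n = 1 then k else 0)
    (fun n => wordGF_flatPeakDent_peak) (fun m hm => h.injective ?_) hn, hf]
  have h1 := fun n (hn : 1 ≤ n) => h.up_act_corrected (fun n _ => hf n) h.correction_mem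
    (mem_cUpCD h.contained) (upCD_eq _ _ h.generic) hn
  have h2 := h.up_act_corrected h1 h.correction_mem (mem_cUpUpCD h.contained)
    (upUpCD_eq _ _ h.generic) hm
  have h3 := HasClosedForm.strictDown h (h.up_flatPeakDent_falling h.flatPeakDent_falling) rfl m hm
  have h4 := HasClosedForm.dec h (HasClosedForm.strictDown h h.flatDent_falling rfl)
    (by rw [Coeffs.eval_sub, h.eval_down_zero rfl, eval_cBU_zero, sub_zero]) m hm
  -- Here the closed form does not vanish at height zero, so `dec` deviates from `prev` at height
  -- one; this is the source of the correction.
  have h5 : φ (Move.dec.act (Move.up.act (wordGF .flatDent .peak)) m) =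
      ((cUpBD U V).prev U V).eval U V m -
        if m = 1 then (cUpBD U V).eval U V 0 else 0 := by
    split_ifs with hm1
    · subst hm1
      rw [← Coeffs.eval_next U V h.generic _ 0, Coeffs.next_prev U V h.generic, sub_self]
      exact map_zero φ
    · rw [sub_zero]
      exact HasClosedForm.dec_of_ne h (h.up_flatDent_peak h.flatDent_peak) (by omega)
  refine (hf m).trans ?_
  rw [map_add, map_zero, map_mul, map_add, map_add, map_add, h2, h3, h4, h5, h.map_x]
  nth_rw 1 [CD_eq h.generic]
  rw [Coeffs.eval_smul, Coeffs.eval_add, Coeffs.eval_add, Coeffs.eval_add]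
  -- The equation that the term at height one must satisfy: both moves `up` reproduce it, and `dec`
  -- contributes the missing value, all multiplied by `x`.
  have h6 : correction U V =
      U * (1 - V) * (correction U V - (cUpBD U V).eval U V 0) := by
    have := h.generic.one_sub_x
    rw [correction]
    field_simp
    ring
  split_ifs
  · linear_combination h6
  · ring

/-- The generating function of the polygons with an indent on the top arc. -/
theorem map_topIndentSizeGF (h : Uniformization φ U V) : φ topIndentSizeGF = U * (1 - V) * (V * (1 - U) *
    (2 * (cUpPD U V).eval U V 1 - ((cUpCD U V).eval U V 1 + correction U V))) := by
  have h1 := h.up_act_corrected (fun n hn => h.flatPeakDent_peak hn) h.correction_mem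
    (mem_cUpCD h.contained) (upCD_eq _ _ h.generic) le_rfl
  rw [if_pos rfl] at h1
  rw [topIndentSizeGF_eq, map_mul, map_mul, map_sub, map_mul, h1,
    h.up_descDent_peak h.descDent_peak 1 le_rfl, h.map_x, h.map_y, map_ofNat]

end Uniformization

/-! ### The parametrization of the basic series -/

section Units

variable {F : Type*} [Field F] (φ : MvPowerSeries (Fin 2) ℚ →+* F)

theorem map_ne_zero_of_constantCoeff {a : MvPowerSeries (Fin 2) ℚ}
    (h : MvPowerSeries.constantCoeff a = 1) : φ a ≠ 0 := by
  intro h0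
  have h1 := congrArg φ (MvPowerSeries.mul_inv_cancel a (by rw [h]; exact one_ne_zero))
  rw [map_mul, h0, zero_mul, map_one] at h1
  exact zero_ne_one h1

theorem map_inv_of_constantCoeff {a : MvPowerSeries (Fin 2) ℚ}
    (h : MvPowerSeries.constantCoeff a = 1) : φ a⁻¹ = (φ a)⁻¹ := by
  refine eq_inv_of_mul_eq_one_left ?_
  rw [← map_mul, MvPowerSeries.inv_mul_cancel a (by rw [h]; exact one_ne_zero), map_one]

end Units

theorem constantCoeff_SP : MvPowerSeries.constantCoeff SP = 0 := by
  simp [SP, constantCoeff_sqrtΔ]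

theorem constantCoeff_u : MvPowerSeries.constantCoeff u = 0 := by
  simp [u, constantCoeff_SP]

theorem constantCoeff_v : MvPowerSeries.constantCoeff v = 0 := by
  simp [v, constantCoeff_SP]

theorem two_mul_SP : 2 * SP = 1 - x - y - sqrtΔ := by
  have h : (2 : MvPowerSeries (Fin 2) ℚ) * MvPowerSeries.C (1 / 2 : ℚ) = 1 := by
    rw [← map_ofNat MvPowerSeries.C 2, ← map_mul, ← map_one MvPowerSeries.C]
    norm_num
  rw [SP, ← mul_assoc, h, one_mul]

theorem sqrtΔ_eq : sqrtΔ = 1 - u - v := by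
  rw [u, v]
  linear_combination two_mul_SP

/-- `SP` solves the quadratic equation `SP = (x + SP) * (y + SP)`, which is `Δ = (1 - u - v) ^ 2`
written out. It gives the parametrization `x = u * (1 - v)`, `y = v * (1 - u)`. -/
theorem SP_eq : SP = u * v := by
  have h : (4 : MvPowerSeries (Fin 2) ℚ) * (SP - u * v) = 0 := by
    have h1 := sqrtΔ_sq
    rw [Δ, sqrtΔ_eq] at h1
    rw [u, v] at h1 ⊢
    linear_combination -h1
  have h4 : (4 : MvPowerSeries (Fin 2) ℚ) ≠ 0 := by
    intro h4
    have := congrArg MvPowerSeries.constantCoeff h4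
    rw [map_ofNat, map_zero] at this
    exact four_ne_zero this
  exact sub_eq_zero.1 ((mul_eq_zero.1 h).resolve_left h4)

theorem x_eq : x = u * (1 - v) := by
  have h := SP_eq
  have h1 : u = x + SP := rfl
  linear_combination -h1 - h

theorem y_eq : y = v * (1 - u) := by
  have h := SP_eq
  have h1 : v = y + SP := rfl
  linear_combination -h1 - h

theorem X_ne_zero (i : Fin 2) : (MvPowerSeries.X i : MvPowerSeries (Fin 2) ℚ) ≠ 0 := fun h => by
  have := congrArg (MvPowerSeries.coeff (Finsupp.single i 1)) h
  rw [MvPowerSeries.coeff_index_single_self_X, map_zero] at this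
  exact one_ne_zero this

/-- The factors `u`, `1 - v`, `v`, `1 - u` do not vanish because `x` and `y` do not; the other
denominators have constant term one, so that their inverses are power series as well. -/
theorem uniformization {F : Type*} [Field F] (φ : MvPowerSeries (Fin 2) ℚ →+* F)
    (hφ : Function.Injective φ) : Uniformization φ (φ u) (φ v) := by
  have hx : φ x = φ u * (1 - φ v) := by
    conv_lhs => rw [x_eq]
    simp only [map_mul, map_sub, map_one]
  have hy : φ y = φ v * (1 - φ u) := by
    conv_lhs => rw [y_eq]
    simp only [map_mul, map_sub, map_one]
  have hx0 : φ x ≠ 0 := (map_ne_zero_iff φ hφ).2 (X_ne_zero 0)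
  have hy0 : φ y ≠ 0 := (map_ne_zero_iff φ hφ).2 (X_ne_zero 1)
  have key : ∀ {a : MvPowerSeries (Fin 2) ℚ} {b : F}, MvPowerSeries.constantCoeff a = 1 →
      φ a = b → b ≠ 0 ∧ b⁻¹ ∈ φ.range := by
    rintro a b h rfl
    exact ⟨map_ne_zero_of_constantCoeff φ h, a⁻¹, map_inv_of_constantCoeff φ h⟩
  have k1 := @key (1 - u) (1 - φ u) (by simp [constantCoeff_u]) (by simp)
  have k2 := @key (1 - u - v) (1 - φ u - φ v) (by simp [constantCoeff_u, constantCoeff_v])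
    (by simp)
  have k3 := @key (1 - x) (1 - φ u * (1 - φ v)) (by simp) (by rw [← hx]; simp)
  have k4 := @key ((1 - x) ^ 2 - y) ((1 - φ u * (1 - φ v)) ^ 2 - φ v * (1 - φ u)) (by simp)
    (by rw [← hx, ← hy]; simp)
  rw [hx] at hx0
  rw [hy] at hy0
  have h2 : φ (MvPowerSeries.C (1 / 2 : ℚ)) * 2 = 1 := by
    rw [← map_ofNat φ 2, ← map_mul, ← map_one φ, ← map_ofNat MvPowerSeries.C 2, ← map_mul]
    norm_num
  exact {
    injective := hφ
    map_x := hx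
    map_y := hy
    generic :=
      { two := right_ne_zero_of_mul_eq_one h2
        U_ne := left_ne_zero_of_mul hx0
        V_ne := left_ne_zero_of_mul hy0
        one_sub_U := right_ne_zero_of_mul hy0
        one_sub_V := right_ne_zero_of_mul hx0
        root := k2.1
        one_sub_x := k3.1
        disc := k4.1 }
    contained :=
      { mem_U := ⟨u, rfl⟩
        mem_V := ⟨v, rfl⟩
        inv_two := ⟨_, eq_inv_of_mul_eq_one_left h2⟩
        inv_one_sub_U := k1.2
        inv_root := k2.2
        inv_one_sub_x := k3.2
        inv_disc := k4.2 } }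

/-! ### The half-perimeter operator on rational functions -/

/-- The asterisk as a homomorphism of rings. -/
def starredHom : MvPowerSeries (Fin 2) ℚ →+* MvPowerSeries (Fin 2) ℚ :=
  (MvPowerSeries.expand 2 two_ne_zero : MvPowerSeries (Fin 2) ℚ →ₐ[ℚ] _).toRingHom

theorem starred_eq (f : MvPowerSeries (Fin 2) ℚ) : starred f = starredHom f := rfl

theorem starredHom_x : starredHom x = x ^ 2 := MvPowerSeries.expand_X _ _ _

theorem starredHom_y : starredHom y = y ^ 2 := MvPowerSeries.expand_X _ _ _

theorem constantCoeff_starredHom (f : MvPowerSeries (Fin 2) ℚ) :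
    MvPowerSeries.constantCoeff (starredHom f) = MvPowerSeries.constantCoeff f := by
  have := MvPowerSeries.coeff_expand_smul 2 two_ne_zero f 0
  rwa [smul_zero] at this

theorem E_add (f g : MvPowerSeries (Fin 2) ℚ) : E (f + g) = E f + E g := rfl

/-- Starred series are the series in `x ^ 2` and `y ^ 2`, so this is the splitting by the parities
of both degrees, of which `E` keeps the doubly even part. -/
theorem E_eq_of_parts (a b c d : MvPowerSeries (Fin 2) ℚ) :
    E (starred a + x * starred b + y * starred c + x * y * starred d) = a := by
  have h1 : E 1 = 1 := by
    ext d
    change MvPowerSeries.coeff (2 • d) 1 = _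
    simp [MvPowerSeries.coeff_one]
  have hx : E x = 0 := by
    ext d
    change MvPowerSeries.coeff (2 • d) (MvPowerSeries.X 0) = _
    rw [MvPowerSeries.coeff_X, if_neg, map_zero]
    intro h
    have := DFunLike.congr_fun h 0
    simp at this
  have hy : E y = 0 := by
    ext d
    change MvPowerSeries.coeff (2 • d) (MvPowerSeries.X 1) = _
    rw [MvPowerSeries.coeff_X, if_neg, map_zero]
    intro h
    have := DFunLike.congr_fun h 1
    simp at this
  have hxy : E (x * y) = 0 := by
    ext d
    change MvPowerSeries.coeff (2 • d) (x * y) = _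
    rw [x, y, MvPowerSeries.X, MvPowerSeries.X, MvPowerSeries.monomial_mul_monomial,
      MvPowerSeries.coeff_monomial, if_neg, map_zero]
    intro h
    have := DFunLike.congr_fun h 0
    simp at this
  rw [E_add, E_add, E_add, ← one_mul (starred a), E_mul_starred, E_mul_starred, E_mul_starred,
    E_mul_starred, h1, hx, hy, hxy]
  ring

section Units

variable {F : Type*} [Field F] (φ : MvPowerSeries (Fin 2) ℚ →+* F)

theorem map_inv_of_map_eq {a : MvPowerSeries (Fin 2) ℚ} {b : F}
    (h : MvPowerSeries.constantCoeff a = 1) (hab : φ a = b) : φ a⁻¹ = b⁻¹ ∧ b ≠ 0 := by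
  subst hab
  exact ⟨map_inv_of_constantCoeff φ h, map_ne_zero_of_constantCoeff φ h⟩

end Units

/-- Only products of matching parities survive. Two odd parts in `x` contribute `x ^ 2`, which is
the starred `x` and leaves `E` as `x`; likewise for `y`. -/
theorem E_mul_mul (p₀ p₁ h₀ h₁ r₀ r₁ r₂ r₃ : MvPowerSeries (Fin 2) ℚ) :
    E ((starred p₀ + x * starred p₁) * (starred h₀ + y * starred h₁) *
      (starred r₀ + x * starred r₁ + y * starred r₂ + x * y * starred r₃)) =
    p₀ * h₀ * r₀ + x * p₁ * h₀ * r₁ + y * p₀ * h₁ * r₂ + x * y * p₁ * h₁ * r₃ := by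
  rw [← E_eq_of_parts (p₀ * h₀ * r₀ + x * p₁ * h₀ * r₁ + y * p₀ * h₁ * r₂ + x * y * p₁ * h₁ * r₃)
    (p₀ * h₀ * r₁ + p₁ * h₀ * r₀ + y * (p₀ * h₁ * r₃ + p₁ * h₁ * r₂))
    (p₀ * h₀ * r₂ + p₀ * h₁ * r₀ + x * (p₁ * h₀ * r₃ + p₁ * h₁ * r₁))
    (p₀ * h₀ * r₃ + p₁ * h₀ * r₂ + p₀ * h₁ * r₁ + p₁ * h₁ * r₀)]
  congr 1
  simp only [starred_eq, map_add, map_mul, starredHom_x, starredHom_y]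
  ring

theorem E_mul_x (p₀ p₁ q₀ q₁ : MvPowerSeries (Fin 2) ℚ) :
    E ((starred p₀ + x * starred p₁) * (starred q₀ + x * starred q₁)) =
      p₀ * q₀ + x * p₁ * q₁ := by
  rw [← E_eq_of_parts (p₀ * q₀ + x * p₁ * q₁) (p₀ * q₁ + p₁ * q₀) 0 0]
  congr 1
  simp only [starred_eq, map_add, map_mul, starredHom_x, map_zero]
  ring

theorem E_mul_y (p₀ p₁ q₀ q₁ : MvPowerSeries (Fin 2) ℚ) :
    E ((starred p₀ + y * starred p₁) * (starred q₀ + y * starred q₁)) =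
      p₀ * q₀ + y * p₁ * q₁ := by
  rw [← E_eq_of_parts (p₀ * q₀ + y * p₁ * q₁) 0 (p₀ * q₁ + p₁ * q₀) 0]
  congr 1
  simp only [starred_eq, map_add, map_mul, starredHom_y, map_zero]
  ring

theorem constantCoeff_Δ : MvPowerSeries.constantCoeff Δ = 1 := by simp [Δ]

/-! ### The even and odd parts of the factors -/

abbrev xPart₀ : MvPowerSeries (Fin 2) ℚ :=
  y * x * ((1 - x) ^ 2 - y ^ 2 + 4 * y) * (1 - x)⁻¹ * Δ⁻¹

abbrev xPart₁ : MvPowerSeries (Fin 2) ℚ :=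
  y * ((1 - x) ^ 2 - y ^ 2 + 4 * x * y) * (1 - x)⁻¹ * Δ⁻¹

abbrev yPart₀ : MvPowerSeries (Fin 2) ℚ :=
  x ^ 2 * (((1 - x) ^ 2 - y)⁻¹) ^ 2 * (((1 - x) ^ 2 + y) *
    (((1 - y) ^ 2 - x * (1 + y)) * Δ⁻¹ + x * (1 - x)⁻¹) + 4 * x * y * (1 - x) * Δ⁻¹)

abbrev yPart₁ : MvPowerSeries (Fin 2) ℚ :=
  x ^ 2 * (((1 - x) ^ 2 - y)⁻¹) ^ 2 * (((1 - x) ^ 2 + y) * (2 * x * Δ⁻¹) +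
    2 * (1 - x) * (((1 - y) ^ 2 - x * (1 + y)) * Δ⁻¹ + x * (1 - x)⁻¹))

section Parts

variable {F : Type*} [Field F] (φ : MvPowerSeries (Fin 2) ℚ →+* F)

theorem map_starredHom_inv {a : MvPowerSeries (Fin 2) ℚ} {b : F}
    (h : MvPowerSeries.constantCoeff a = 1) (hab : φ (starredHom a) = b) :
    φ (starredHom a⁻¹) = b⁻¹ ∧ b ≠ 0 :=
  map_inv_of_map_eq (φ.comp starredHom) h hab

/-- The starred `Δ` is the product of `1 ± x ± y` over all signs; this is why `Δ` becomes the common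
denominator of the even and odd parts. Its image is kept as an atom `D` until the denominators have
been cleared. -/
theorem exists_map_starredHom_Δ_inv : ∃ D : F, D = 1 - 2 * φ x ^ 2 - 2 * φ y ^ 2 -
    2 * φ x ^ 2 * φ y ^ 2 + φ x ^ 4 + φ y ^ 4 ∧ D ≠ 0 ∧ φ (starredHom Δ⁻¹) = D⁻¹ := by
  have h := map_starredHom_inv φ constantCoeff_Δ rfl
  refine ⟨_, ?_, h.2, h.1⟩
  simp only [Δ, map_add, map_sub, map_mul, map_pow, map_one, map_ofNat, starredHom_x,
    starredHom_y]
  ring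

variable {φ}

theorem xPart_eq (hφ : Function.Injective φ) :
    x * (1 - x) * starred y * ((1 - x) ^ 2 - starred y)⁻¹ *
      (1 + starred y * ((1 - x) ^ 2)⁻¹) =
    starred xPart₀ + x * starred xPart₁ := by
  apply hφ
  have h1 := map_inv_of_map_eq φ (a := (1 - x) ^ 2 - y ^ 2) (b := (1 - φ x) ^ 2 - φ y ^ 2)
    (by simp) (by simp)
  have h2 := map_inv_of_map_eq φ (a := (1 - x) ^ 2) (b := (1 - φ x) ^ 2) (by simp) (by simp)
  have h3 := map_starredHom_inv φ (a := 1 - x) (b := 1 - φ x ^ 2) (by simp)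
    (by simp [starredHom_x])
  obtain ⟨D, hD, hD0, h4⟩ := exists_map_starredHom_Δ_inv φ
  have h5 : 1 - φ x ≠ 0 := fun h => h2.2 (by rw [h, zero_pow two_ne_zero])
  have h6 := h1.2
  have h7 := h3.2
  simp only [starred_eq, map_add, map_sub, map_mul, map_pow, map_one, map_ofNat, h1.1, h2.1, h3.1,
    h4, starredHom_x, starredHom_y]
  generalize φ x = X at *
  generalize φ y = Y at *
  field_simp
  rw [hD]
  ring

theorem yPart_eq (hφ : Function.Injective φ) :
    (starred x * (1 - starred x - y)⁻¹) ^ 2 *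
      ((1 - y) ^ 2 * ((1 - y) ^ 2 - starred x)⁻¹ + starred x * (1 - starred x)⁻¹) =
    starred yPart₀ + y * starred yPart₁ := by
  apply hφ
  have h1 := map_inv_of_map_eq φ (a := 1 - x ^ 2 - y) (b := 1 - φ x ^ 2 - φ y)
    (by simp) (by simp)
  have h2 := map_inv_of_map_eq φ (a := (1 - y) ^ 2 - x ^ 2) (b := (1 - φ y) ^ 2 - φ x ^ 2)
    (by simp) (by simp)
  have h3 := map_inv_of_map_eq φ (a := 1 - x ^ 2) (b := 1 - φ x ^ 2)
    (by simp) (by simp)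
  obtain ⟨D, hD, hD0, h4⟩ := exists_map_starredHom_Δ_inv φ
  have h5 := map_starredHom_inv φ (a := 1 - x) (b := 1 - φ x ^ 2) (by simp)
    (by simp [starredHom_x])
  have h6 := map_starredHom_inv φ (a := (1 - x) ^ 2 - y) (b := (1 - φ x ^ 2) ^ 2 - φ y ^ 2)
    (by simp) (by simp [starredHom_x, starredHom_y])
  have g1 := h1.2
  have g2 := h2.2
  have g3 := h3.2
  have g6 := h6.2
  simp only [starred_eq, map_add, map_sub, map_mul, map_pow, map_one, map_ofNat, h1.1, h2.1, h3.1,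
    h4, h5.1, h6.1, starredHom_x, starredHom_y]
  generalize φ x = X at *
  generalize φ y = Y at *
  field_simp
  rw [hD]
  ring

/-- The fraction is extended by the three other factors `1 ± x ± y` of the starred `Δ`. -/
theorem xyPart_eq (hφ : Function.Injective φ) :
    x * (1 - x - y)⁻¹ = starred (x * (1 - x + y) * Δ⁻¹) + x * starred ((1 - x - y) * Δ⁻¹) +
      y * starred (2 * x * Δ⁻¹) + x * y * starred ((1 + x - y) * Δ⁻¹) := by
  apply hφ
  have h1 := map_inv_of_map_eq φ (a := 1 - x - y) (b := 1 - φ x - φ y) (by simp) (by simp)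
  obtain ⟨D, hD, hD0, h4⟩ := exists_map_starredHom_Δ_inv φ
  have g1 := h1.2
  simp only [starred_eq, map_add, map_sub, map_mul, map_pow, map_one, map_ofNat, h1.1,
    h4, starredHom_x, starredHom_y]
  generalize φ x = X at *
  generalize φ y = Y at *
  field_simp
  rw [hD]
  ring

/-- The starred `u` has even degrees only and acts as a constant; extending by `1 - starred u + y`
separates the parities in `y`. -/
theorem uPart_eq (hφ : Function.Injective φ) :
    starred u * (1 - starred u - y)⁻¹ = starred (u * (1 - u) * ((1 - u) ^ 2 - y)⁻¹) +
      y * starred (u * ((1 - u) ^ 2 - y)⁻¹) := by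
  apply hφ
  have h1 := map_inv_of_map_eq φ (a := 1 - starred u - y) (b := 1 - φ (starredHom u) - φ y)
    (by simp [starred_eq, constantCoeff_starredHom, constantCoeff_u]) (by simp [starred_eq])
  have h2 := map_starredHom_inv φ (a := (1 - u) ^ 2 - y)
    (b := (1 - φ (starredHom u)) ^ 2 - φ y ^ 2) (by simp [constantCoeff_u])
    (by simp [starredHom_y])
  have g1 := h1.2
  have g2 := h2.2
  simp only [starred_eq] at h1
  simp only [starred_eq, map_sub, map_add, map_mul, map_one, h1.1, h2.1]
  generalize φ (starredHom u) = a at *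
  generalize φ y = Y at *
  field_simp
  ring

theorem vPart_eq (hφ : Function.Injective φ) :
    x * (1 - x - starred v)⁻¹ = starred (x * ((1 - v) ^ 2 - x)⁻¹) +
      x * starred ((1 - v) * ((1 - v) ^ 2 - x)⁻¹) := by
  apply hφ
  have h1 := map_inv_of_map_eq φ (a := 1 - x - starred v) (b := 1 - φ x - φ (starredHom v))
    (by simp [starred_eq, constantCoeff_starredHom, constantCoeff_v]) (by simp [starred_eq])
  have h2 := map_starredHom_inv φ (a := (1 - v) ^ 2 - x)
    (b := (1 - φ (starredHom v)) ^ 2 - φ x ^ 2) (by simp [constantCoeff_v])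
    (by simp [starredHom_x])
  have g1 := h1.2
  have g2 := h2.2
  simp only [starred_eq] at h1
  simp only [starred_eq, map_sub, map_add, map_mul, map_pow, map_one, h1.1, h2.1, starredHom_x]
  generalize φ (starredHom v) = b at *
  generalize φ x = X at *
  field_simp
  ring

end Parts

/-! ### Evaluation of both sides -/

/-- The generating function of the polygons with an indent on the top arc, as a rational function
of `U` and `V`. -/
def topIndentRational {A : Type*} [CommRing A] [Inv A] (U V : A) : A :=
  U ^ 3 * V ^ 2 * (1 - V) ^ 2 * (1 - 4 * U + 4 * U ^ 2 + 17 * U * V - 7 * V ^ 2 + 4 * U ^ 3 - 59 *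
    U ^ 2 * V + 7 * U * V ^ 2 + 8 * V ^ 3 - 10 * U ^ 4 + 45 * U ^ 3 * V + 134 * U ^ 2 * V ^ 2 - 86
    * U * V ^ 3 + 3 * V ^ 4 + 4 * U ^ 5 + 65 * U ^ 4 * V - 355 * U ^ 3 * V ^ 2 + 3 * U ^ 2 * V ^ 3
    + 106 * U * V ^ 4 - 8 * V ^ 5 + 4 * U ^ 6 - 125 * U ^ 5 * V + 194 * U ^ 4 * V ^ 2 + 598 * U ^
    3 * V ^ 3 - 228 * U ^ 2 * V ^ 4 - 43 * U * V ^ 5 + 3 * V ^ 6 - 4 * U ^ 7 + 63 * U ^ 6 * V +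
    241 * U ^ 5 * V ^ 2 - 893 * U ^ 4 * V ^ 3 - 250 * U ^ 3 * V ^ 4 + 183 * U ^ 2 * V ^ 5 + 3 * U
    * V ^ 6 + U ^ 8 - U ^ 7 * V - 298 * U ^ 6 * V ^ 2 + 190 * U ^ 5 * V ^ 3 + 933 * U ^ 4 * V ^ 4
    - 95 * U ^ 3 * V ^ 5 - 38 * U ^ 2 * V ^ 6 - 5 * U ^ 8 * V + 75 * U ^ 7 * V ^ 2 + 345 * U ^ 6 *
    V ^ 3 - 630 * U ^ 5 * V ^ 4 - 281 * U ^ 4 * V ^ 5 + 57 * U ^ 3 * V ^ 6 + U ^ 2 * V ^ 7 + 9 * U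
    ^ 8 * V ^ 2 - 158 * U ^ 7 * V ^ 3 - 54 * U ^ 6 * V ^ 4 + 364 * U ^ 5 * V ^ 5 - 13 * U ^ 4 * V
    ^ 6 - 4 * U ^ 3 * V ^ 7 - 7 * U ^ 8 * V ^ 3 + 118 * U ^ 7 * V ^ 4 - 90 * U ^ 6 * V ^ 5 - 50 *
    U ^ 5 * V ^ 6 + 5 * U ^ 4 * V ^ 7 + 2 * U ^ 8 * V ^ 4 - 30 * U ^ 7 * V ^ 5 + 30 * U ^ 6 * V ^
    6 - 2 * U ^ 5 * V ^ 7) * (1 - U - V)⁻¹ ^ 6 * (1 - U * (1 - V))⁻¹ * ((1 - U * (1 - V)) ^ 2 - V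
    * (1 - U))⁻¹

namespace Uniformization

variable {F : Type*} [Field F] {φ : MvPowerSeries (Fin 2) ℚ →+* F} {U V : F}

open ClosedForm in
theorem eval_cUpPD_one (h : Uniformization φ U V) : (cUpPD U V).eval U V 1 =
    U ^ 2 * V * (1 - V) * (1 - U - 2 * U ^ 2 + 12 * U * V - 6 * V ^ 2 + 2 * U ^ 3 - 6 * U ^ 2 * V
      - 17 * U * V ^ 2 + 8 * V ^ 3 + U ^ 4 - 22 * U ^ 3 * V + 46 * U ^ 2 * V ^ 2 + U * V ^ 3 - 3 *
      V ^ 4 - U ^ 5 + 14 * U ^ 4 * V + 10 * U ^ 3 * V ^ 2 - 49 * U ^ 2 * V ^ 3 + 6 * U * V ^ 4 + 2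
      * U ^ 5 * V - 32 * U ^ 4 * V ^ 2 + 25 * U ^ 3 * V ^ 3 + 10 * U ^ 2 * V ^ 4 - U * V ^ 5 - U ^
      5 * V ^ 2 + 15 * U ^ 4 * V ^ 3 - 15 * U ^ 3 * V ^ 4 + U ^ 2 * V ^ 5) * (1 - U - V)⁻¹ ^ 6 *
      (1 - U * (1 - V))⁻¹ := by
  obtain ⟨h1, h2, h3, h4, h5, h6, h7, h8⟩ := h.generic
  simp only [Coeffs.eval, Coeffs.combine, Coeffs.seqKJ, Coeffs.seqW, cUpPD, pow_one, pow_zero,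
    Nat.cast_one]
  field_simp
  ring

open ClosedForm in
theorem eval_cUpCD_one (h : Uniformization φ U V) : (cUpCD U V).eval U V 1 =
    U ^ 2 * V * (1 - V) * (3 - 8 * U - 8 * V + 3 * U ^ 2 + 31 * U * V + 6 * V ^ 2 + 8 * U ^ 3 - 25
      * U ^ 2 * V - 41 * U * V ^ 2 - 7 * U ^ 4 - 28 * U ^ 3 * V + 61 * U ^ 2 * V ^ 2 + 21 * U * V
      ^ 3 - V ^ 4 + 44 * U ^ 4 * V + 10 * U ^ 3 * V ^ 2 - 56 * U ^ 2 * V ^ 3 - 3 * U * V ^ 4 + U ^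
      6 - 11 * U ^ 5 * V - 66 * U ^ 4 * V ^ 2 + 27 * U ^ 3 * V ^ 3 + 18 * U ^ 2 * V ^ 4 - 3 * U ^
      6 * V + 27 * U ^ 5 * V ^ 2 + 31 * U ^ 4 * V ^ 3 - 15 * U ^ 3 * V ^ 4 - U ^ 2 * V ^ 5 + 3 * U
      ^ 6 * V ^ 2 - 22 * U ^ 5 * V ^ 3 + U ^ 4 * V ^ 4 + 2 * U ^ 3 * V ^ 5 - U ^ 6 * V ^ 3 + 6 * U
      ^ 5 * V ^ 4 - U ^ 4 * V ^ 5) * (1 - U)⁻¹ * (1 - U - V)⁻¹ ^ 4 * (1 - U * (1 - V))⁻¹ * ((1 - U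
      * (1 - V)) ^ 2 - V * (1 - U))⁻¹ := by
  obtain ⟨h1, h2, h3, h4, h5, h6, h7, h8⟩ := h.generic
  simp only [Coeffs.eval, Coeffs.combine, Coeffs.seqKJ, Coeffs.seqW, cUpCD, pow_one, pow_zero,
    Nat.cast_one]
  field_simp
  ring

open ClosedForm in
theorem correction_eq (h : Uniformization φ U V) : correction U V =
    2 * U ^ 2 * V * (1 - V) * (-1 + V + U ^ 2 - U * V - U ^ 2 * V) * (1 - U)⁻¹ * (1 - U - V)⁻¹ *
      (1 - U * (1 - V))⁻¹ * ((1 - U * (1 - V)) ^ 2 - V * (1 - U))⁻¹ := by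
  obtain ⟨h1, h2, h3, h4, h5, h6, h7, h8⟩ := h.generic
  simp only [correction, Coeffs.eval, Coeffs.combine, Coeffs.seqKJ, Coeffs.seqW, cUpBD, pow_zero,
    Nat.cast_zero]
  field_simp
  ring

theorem map_topIndentSizeGF_eq (h : Uniformization φ U V) :
    φ topIndentSizeGF = topIndentRational U V := by
  rw [h.map_topIndentSizeGF, h.eval_cUpPD_one, h.eval_cUpCD_one, h.correction_eq,
    topIndentRational]
  obtain ⟨h1, h2, h3, h4, h5, h6, h7, h8⟩ := h.generic
  field_simp
  ring

theorem map_SP (φ : MvPowerSeries (Fin 2) ℚ →+* F) : φ SP = φ u * φ v := by rw [SP_eq, map_mul]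

theorem map_Z (φ : MvPowerSeries (Fin 2) ℚ →+* F) : φ Z = (1 - φ u - φ v)⁻¹ := by
  rw [Z, map_inv_of_constantCoeff φ constantCoeff_sqrtΔ, sqrtΔ_eq]
  simp

theorem map_Δ (φ : MvPowerSeries (Fin 2) ℚ →+* F) : φ Δ = (1 - φ u - φ v) ^ 2 := by
  rw [← sqrtΔ_sq, sqrtΔ_eq]
  simp

theorem map_Δ_inv (φ : MvPowerSeries (Fin 2) ℚ →+* F) : φ Δ⁻¹ = (1 - φ u - φ v)⁻¹ ^ 2 := by
  rw [map_inv_of_constantCoeff φ constantCoeff_Δ, map_Δ, inv_pow]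

theorem map_one_sub_x_inv (h : Uniformization φ U V) :
    φ (1 - x)⁻¹ = (1 - U * (1 - V))⁻¹ :=
  (map_inv_of_map_eq φ (by simp) (by simp [← h.map_x])).1

theorem map_disc_inv (h : Uniformization φ U V) :
    φ ((1 - x) ^ 2 - y)⁻¹ = ((1 - U * (1 - V)) ^ 2 - V * (1 - U))⁻¹ :=
  (map_inv_of_map_eq φ (by simp) (by simp [← h.map_x, ← h.map_y])).1

/-- Since `y = v * (1 - u)`, the denominator factors as `(1 - u) * (1 - u - v)`. -/
theorem map_one_sub_u_sq_sub_y_inv (h : Uniformization φ (φ u) (φ v)) :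
    φ ((1 - u) ^ 2 - y)⁻¹ = (1 - φ u)⁻¹ * (1 - φ u - φ v)⁻¹ := by
  rw [← mul_inv]
  refine (map_inv_of_map_eq φ (by simp [constantCoeff_u]) ?_).1
  simp only [map_sub, map_pow, map_one, h.map_y]
  ring

theorem map_one_sub_v_sq_sub_x_inv (h : Uniformization φ (φ u) (φ v)) :
    φ ((1 - v) ^ 2 - x)⁻¹ = (1 - φ v)⁻¹ * (1 - φ u - φ v)⁻¹ := by
  rw [← mul_inv]
  refine (map_inv_of_map_eq φ (by simp [constantCoeff_v]) ?_).1
  simp only [map_sub, map_pow, map_one, h.map_x]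
  ring

theorem map_xPart₀ (h : Uniformization φ U V) (hu : φ u = U) (hv : φ v = V) : φ xPart₀ =
    U * V * (1 - U) * (1 - V) * (1 - 2 * U + 4 * V + U ^ 2 - 2 * U * V - V ^ 2 - 2 * U ^ 2 * V + 2
      * U * V ^ 2) * (1 - U - V)⁻¹ ^ 2 * (1 - U * (1 - V))⁻¹ := by
  obtain ⟨h1, h2, h3, h4, h5, h6, h7, h8⟩ := h.generic
  simp only [map_add, map_sub, map_mul, map_pow, map_one, map_ofNat, h.map_x, h.map_y,
    h.map_one_sub_x_inv, map_Δ_inv, hu, hv]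
  field_simp
  ring

theorem map_xPart₁ (h : Uniformization φ U V) (hu : φ u = U) (hv : φ v = V) : φ xPart₁ =
    V * (1 - U) * (1 - 2 * U + U ^ 2 + 6 * U * V - V ^ 2 - 6 * U ^ 2 * V - 2 * U * V ^ 2 + 4 * U ^
      2 * V ^ 2) * (1 - U - V)⁻¹ ^ 2 * (1 - U * (1 - V))⁻¹ := by
  obtain ⟨h1, h2, h3, h4, h5, h6, h7, h8⟩ := h.generic
  simp only [map_add, map_sub, map_mul, map_pow, map_one, map_ofNat, h.map_x, h.map_y,
    h.map_one_sub_x_inv, map_Δ_inv, hu, hv]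
  field_simp
  ring

theorem map_yPart₀ (h : Uniformization φ U V) (hu : φ u = U) (hv : φ v = V) : φ yPart₀ =
    U ^ 2 * (1 - V) ^ 2 * (1 - U - U ^ 2 + 6 * U * V - V ^ 2 + U ^ 3 - 4 * U ^ 2 * V - 3 * U * V ^
      2 - 2 * U ^ 3 * V + 5 * U ^ 2 * V ^ 2 + U ^ 3 * V ^ 2 - U ^ 2 * V ^ 3) * (1 - U - V)⁻¹ ^ 2 *
      (1 - U * (1 - V))⁻¹ * ((1 - U * (1 - V)) ^ 2 - V * (1 - U))⁻¹ := by
  obtain ⟨h1, h2, h3, h4, h5, h6, h7, h8⟩ := h.generic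
  simp only [map_add, map_sub, map_mul, map_pow, map_one, map_ofNat, h.map_x, h.map_y,
    h.map_one_sub_x_inv, h.map_disc_inv, map_Δ_inv, hu, hv]
  field_simp
  ring

theorem map_yPart₁ (h : Uniformization φ U V) (hu : φ u = U) (hv : φ v = V) : φ yPart₁ =
    2 * U ^ 2 * (1 - V) ^ 2 * (1 + 2 * U - V - U * V) * (1 - U - V)⁻¹ ^ 2 * ((1 - U * (1 - V)) ^ 2
      - V * (1 - U))⁻¹ := by
  obtain ⟨h1, h2, h3, h4, h5, h6, h7, h8⟩ := h.generic
  simp only [map_add, map_sub, map_mul, map_pow, map_one, map_ofNat, h.map_x, h.map_y,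
    h.map_one_sub_x_inv, h.map_disc_inv, map_Δ_inv, hu, hv]
  field_simp
  ring

theorem map_E_xyPart (h : Uniformization φ U V) (hu : φ u = U) (hv : φ v = V) :
    φ (E (x * (1 - x) * starred y * ((1 - x) ^ 2 - starred y)⁻¹
      * ((1 + starred y * ((1 - x) ^ 2)⁻¹) * (starred x * (1 - starred x - y)⁻¹) ^ 2
        * (y ^ 2 * (1 - y) ^ 2 * ((1 - y) ^ 2 - starred x)⁻¹
            + starred x * y ^ 2 * (1 - starred x)⁻¹)
        * (x * (1 - x - y)⁻¹)))) =
    U ^ 3 * V ^ 2 * (1 - U) ^ 2 * (1 - V) ^ 3 * (1 - 2 * U + V - U ^ 2 + 23 * U * V - 6 * V ^ 2 +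
      4 * U ^ 3 - 42 * U ^ 2 * V + 8 * U * V ^ 2 + 2 * V ^ 3 - U ^ 4 - 18 * U ^ 3 * V + 149 * U ^
      2 * V ^ 2 - 86 * U * V ^ 3 + 5 * V ^ 4 - 2 * U ^ 5 + 61 * U ^ 4 * V - 192 * U ^ 3 * V ^ 2 -
      84 * U ^ 2 * V ^ 3 + 66 * U * V ^ 4 - 3 * V ^ 5 + U ^ 6 - 21 * U ^ 5 * V - 60 * U ^ 4 * V ^
      2 + 378 * U ^ 3 * V ^ 3 - 51 * U ^ 2 * V ^ 4 - 9 * U * V ^ 5 - 4 * U ^ 6 * V + 96 * U ^ 5 *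
      V ^ 2 - 108 * U ^ 4 * V ^ 3 - 174 * U ^ 3 * V ^ 4 + 30 * U ^ 2 * V ^ 5 + 5 * U ^ 6 * V ^ 2 -
      100 * U ^ 5 * V ^ 3 + 128 * U ^ 4 * V ^ 4 + 8 * U ^ 3 * V ^ 5 - U ^ 2 * V ^ 6 - 2 * U ^ 6 *
      V ^ 3 + 30 * U ^ 5 * V ^ 4 - 30 * U ^ 4 * V ^ 5 + 2 * U ^ 3 * V ^ 6) * (1 - U - V)⁻¹ ^ 6 *
      (1 - U * (1 - V))⁻¹ * ((1 - U * (1 - V)) ^ 2 - V * (1 - U))⁻¹ := by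
  -- The factor `y ^ 2` of the bracket is the starred `y`; it is split off so that the remaining
  -- factors are exactly those of `xPart_eq`, `yPart_eq` and `xyPart_eq`.
  have e : x * (1 - x) * starred y * ((1 - x) ^ 2 - starred y)⁻¹
      * ((1 + starred y * ((1 - x) ^ 2)⁻¹) * (starred x * (1 - starred x - y)⁻¹) ^ 2
        * (y ^ 2 * (1 - y) ^ 2 * ((1 - y) ^ 2 - starred x)⁻¹
            + starred x * y ^ 2 * (1 - starred x)⁻¹)
        * (x * (1 - x - y)⁻¹)) =
      x * (1 - x) * starred y * ((1 - x) ^ 2 - starred y)⁻¹ *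
        (1 + starred y * ((1 - x) ^ 2)⁻¹) * ((starred x * (1 - starred x - y)⁻¹) ^ 2 *
        ((1 - y) ^ 2 * ((1 - y) ^ 2 - starred x)⁻¹ + starred x * (1 - starred x)⁻¹)) *
        (x * (1 - x - y)⁻¹) * starredHom y := by
    rw [starredHom_y]
    ring
  rw [e, ← starred_eq y, E_mul_starred, xPart_eq h.injective, yPart_eq h.injective,
    xyPart_eq h.injective, E_mul_mul]
  simp only [map_add, map_mul, h.map_xPart₀ hu hv, h.map_xPart₁ hu hv, h.map_yPart₀ hu hv,
    h.map_yPart₁ hu hv]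
  obtain ⟨h1, h2, h3, h4, h5, h6, h7, h8⟩ := h.generic
  simp only [map_add, map_sub, map_one, map_ofNat, h.map_x, h.map_y, map_Δ_inv, hu, hv]
  field_simp
  ring

theorem map_E_uPart (h : Uniformization φ U V) (hu : φ u = U) (hv : φ v = V) :
    φ (E ((starred x * y * (1 - starred x - y)⁻¹) ^ 2
        * ((1 - y) ^ 2 * ((1 - y) ^ 2 - starred x)⁻¹ + starred x * (1 - starred x)⁻¹)
        * (starred u * (1 - starred u - y)⁻¹))) =
    U ^ 3 * V * (1 - U) * (1 - V) ^ 2 * (1 - U + 2 * V - U ^ 2 + 8 * U * V - 3 * V ^ 2 + U ^ 3 - 8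
      * U ^ 2 * V - U * V ^ 2 - 2 * U ^ 3 * V + 11 * U ^ 2 * V ^ 2 - 2 * U * V ^ 3 + U ^ 3 * V ^ 2
      - 3 * U ^ 2 * V ^ 3) * (1 - U - V)⁻¹ ^ 3 * (1 - U * (1 - V))⁻¹ * ((1 - U * (1 - V)) ^ 2 - V
      * (1 - U))⁻¹ := by
  have e : (starred x * y * (1 - starred x - y)⁻¹) ^ 2
        * ((1 - y) ^ 2 * ((1 - y) ^ 2 - starred x)⁻¹ + starred x * (1 - starred x)⁻¹)
        * (starred u * (1 - starred u - y)⁻¹) =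
      (starred x * (1 - starred x - y)⁻¹) ^ 2 *
        ((1 - y) ^ 2 * ((1 - y) ^ 2 - starred x)⁻¹ + starred x * (1 - starred x)⁻¹) *
        (starred u * (1 - starred u - y)⁻¹) * starredHom y := by
    rw [starredHom_y]
    ring
  have h' : Uniformization φ (φ u) (φ v) := by rwa [hu, hv]
  rw [e, ← starred_eq y, E_mul_starred, yPart_eq h.injective, uPart_eq h.injective, E_mul_y]
  simp only [map_add, map_mul, h.map_yPart₀ hu hv, h.map_yPart₁ hu hv]
  obtain ⟨h1, h2, h3, h4, h5, h6, h7, h8⟩ := h.generic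
  simp only [map_sub, map_one, h.map_y, h'.map_one_sub_u_sq_sub_y_inv, hu, hv]
  field_simp
  ring

theorem map_E_vPart (h : Uniformization φ U V) (hu : φ u = U) (hv : φ v = V) :
    φ (E (x * (1 - x) * starred y * ((1 - x) ^ 2 - starred y)⁻¹
        * ((1 + starred y * ((1 - x) ^ 2)⁻¹) * (x * (1 - x - starred v)⁻¹)))) =
    U * V * (1 - U) * (1 - V) * (1 - U - U ^ 2 + 10 * U * V - V ^ 2 + U ^ 3 - 8 * U ^ 2 * V - 3 *
      U * V ^ 2 - 2 * U ^ 3 * V + 6 * U ^ 2 * V ^ 2) * (1 - U - V)⁻¹ ^ 3 * (1 - U * (1 - V))⁻¹ := by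
  have h' : Uniformization φ (φ u) (φ v) := by rwa [hu, hv]
  rw [← mul_assoc, xPart_eq h.injective, vPart_eq h.injective, E_mul_x]
  simp only [map_add, map_mul, h.map_xPart₀ hu hv, h.map_xPart₁ hu hv]
  obtain ⟨h1, h2, h3, h4, h5, h6, h7, h8⟩ := h.generic
  simp only [map_sub, map_one, h.map_x, h'.map_one_sub_v_sq_sub_x_inv, hu, hv]
  field_simp
  ring

theorem map_topIndentExpression (h : Uniformization φ U V) (hu : φ u = U) (hv : φ v = V) :
    φ topIndentExpression = topIndentRational U V := by
  have e1 : φ ((1 - u) ^ 2 * Δ)⁻¹ = (1 - U)⁻¹ ^ 2 * (1 - U - V)⁻¹ ^ 2 := by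
    rw [← mul_pow, ← mul_inv, inv_pow]
    refine (map_inv_of_map_eq φ (by simp [constantCoeff_u, constantCoeff_Δ]) ?_).1
    rw [map_mul, map_Δ, hu, hv]
    simp only [map_sub, map_pow, map_one, hu]
    ring
  have e2 : φ (1 - u)⁻¹ = (1 - U)⁻¹ :=
    (map_inv_of_map_eq φ (by simp [constantCoeff_u]) (by simp [hu])).1
  rw [topIndentExpression]
  simp only [map_add (f := φ), map_sub φ, map_mul φ]
  rw [h.map_E_xyPart hu hv, h.map_E_uPart hu hv, h.map_E_vPart hu hv]
  simp only [map_mul, map_pow, map_one, map_ofNat, h.map_x, h.map_y, map_Δ_inv, map_Z,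
    h.map_one_sub_x_inv, e1, e2, map_SP, hu, hv, topIndentRational]
  obtain ⟨h1, h2, h3, h4, h5, h6, h7, h8⟩ := h.generic
  field_simp
  ring

theorem map_topIndentRational (φ : MvPowerSeries (Fin 2) ℚ →+* F) :
    φ (topIndentRational u v) = topIndentRational (φ u) (φ v) := by
  have h1 := (map_inv_of_map_eq φ (a := 1 - u - v) (b := 1 - φ u - φ v)
    (by simp [constantCoeff_u, constantCoeff_v]) (by simp)).1
  have h2 := (map_inv_of_map_eq φ (a := 1 - u * (1 - v)) (b := 1 - φ u * (1 - φ v))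
    (by simp [constantCoeff_u]) (by simp)).1
  have h3 := (map_inv_of_map_eq φ (a := (1 - u * (1 - v)) ^ 2 - v * (1 - u))
    (b := (1 - φ u * (1 - φ v)) ^ 2 - φ v * (1 - φ u))
    (by simp [constantCoeff_u, constantCoeff_v]) (by simp)).1
  simp only [topIndentRational, map_add, map_sub, map_mul, map_pow, map_one, map_ofNat, h1, h2,
    h3]

end Uniformization

/-- The identity is proved in the fraction field and pulled back. As an identity of power series it
can then be specialized to `x = y`, although that homomorphism is not injective. -/
theorem topIndentExpression_eq : topIndentExpression = topIndentRational u v := by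
  have hφ := IsFractionRing.injective (MvPowerSeries (Fin 2) ℚ)
    (FractionRing (MvPowerSeries (Fin 2) ℚ))
  refine hφ (((uniformization _ hφ).map_topIndentExpression rfl rfl).trans ?_)
  exact (Uniformization.map_topIndentRational _).symm

theorem topIndentSizeGF_eq_topIndentExpression : topIndentSizeGF = topIndentExpression := by
  have hφ := IsFractionRing.injective (MvPowerSeries (Fin 2) ℚ)
    (FractionRing (MvPowerSeries (Fin 2) ℚ))
  have h := uniformization _ hφ
  exact hφ (h.map_topIndentSizeGF_eq.trans (h.map_topIndentExpression rfl rfl).symm)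

/-! ### Generating functions by perimeter -/

theorem topIndentGF_eq : topIndentGF = y * topIndentSizeGF := by
  funext d
  rw [apply_y_mul]
  change ((topIndentPolygons (d 0) (d 1)).ncard : ℚ) = _
  split_ifs with h
  · rw [h, topIndentPolygons_zero, Set.ncard_empty, Nat.cast_zero]
  · obtain ⟨n, hn⟩ := Nat.exists_eq_succ_of_ne_zero h
    rw [hn, Nat.succ_eq_add_one, topIndentPolygons_succ]
    simp [topIndentSizeGF, hn]

theorem ncard_columnConvexPolygons_eq (d : Fin 2 →₀ ℕ) :
    ((columnConvexPolygons (d 0) (d 1)).ncard : ℚ) = 2 * (y * topIndentSizeGF) d := by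
  rw [apply_y_mul]
  split_ifs with h
  · rw [h, ncard_columnConvexPolygons_zero, Nat.cast_zero, mul_zero]
  · obtain ⟨n, hn⟩ := Nat.exists_eq_succ_of_ne_zero h
    rw [hn, Nat.succ_eq_add_one, ncard_columnConvexPolygons_succ]
    simp [topIndentSizeGF, hn]

/-! ### Interchange of the variables and restriction to the diagonal. -/

theorem swapXY_apply (f : MvPowerSeries (Fin 2) ℚ) (d : Fin 2 →₀ ℕ) :
    swapXY f d = f (d.mapDomain (Equiv.swap 0 1)) := by
  have h := MvPowerSeries.coeff_embDomain_rename (Equiv.swap (0 : Fin 2) 1).toEmbedding f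
    (d.mapDomain (Equiv.swap 0 1))
  have e : (d.mapDomain (Equiv.swap (0 : Fin 2) 1)).embDomain
      (Equiv.swap (0 : Fin 2) 1).toEmbedding = d := by
    rw [Finsupp.embDomain_eq_mapDomain, ← Finsupp.mapDomain_comp]
    simp [Function.comp_def, ← Function.id_def, Finsupp.mapDomain_id]
  rw [e] at h
  exact h

theorem swapXY_mul (f g : MvPowerSeries (Fin 2) ℚ) : swapXY (f * g) = swapXY f * swapXY g :=
  map_mul (MvPowerSeries.rename (R := ℚ) (Equiv.swap (0 : Fin 2) 1)) f g

theorem swapXY_y : swapXY y = x := by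
  rw [swapXY, MvPowerSeries.rename_X, Equiv.swap_apply_right]

/-- The factor two accounts for the indent on the top or the bottom arc of a polygon with convex
columns; those with convex rows are the transposes. -/
theorem oneConvexGF_eq : oneConvexGF =
    2 * (y * topIndentSizeGF + x * swapXY topIndentSizeGF) := by
  rw [← swapXY_y, ← swapXY_mul, two_mul]
  funext d
  change ((oneConvexPolygons (d 0) (d 1)).ncard : ℚ) =
    ((y * topIndentSizeGF) d + swapXY (y * topIndentSizeGF) d) +
      ((y * topIndentSizeGF) d + swapXY (y * topIndentSizeGF) d)
  have h0 : d.mapDomain (Equiv.swap (0 : Fin 2) 1) 0 = d 1 := by simp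
  have h1 : d.mapDomain (Equiv.swap (0 : Fin 2) 1) 1 = d 0 := by simp
  have h2 := ncard_columnConvexPolygons_eq (d.mapDomain (Equiv.swap (0 : Fin 2) 1))
  rw [h0, h1] at h2
  rw [ncard_oneConvexPolygons, Nat.cast_add, ncard_columnConvexPolygons_eq, h2, swapXY_apply]
  ring

/-- The substitution of one variable for `x` and `y`. -/
def diagonal : MvPowerSeries (Fin 2) ℚ →+* PowerSeries ℚ :=
  (MvPowerSeries.rename (R := ℚ) (fun _ : Fin 2 => ())).toRingHom

theorem diagonal_x : diagonal x = PowerSeries.X := MvPowerSeries.rename_X _ _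

theorem diagonal_y : diagonal y = PowerSeries.X := MvPowerSeries.rename_X _ _

theorem diagonal_swapXY (f : MvPowerSeries (Fin 2) ℚ) : diagonal (swapXY f) = diagonal f :=
  MvPowerSeries.rename_rename _ _ f

theorem coeff_diagonal (f : MvPowerSeries (Fin 2) ℚ) (n : ℕ) :
    PowerSeries.coeff n (diagonal f) = ∑ d ∈ Finset.HasAntidiagonal.antidiagonal n,
      f (Finsupp.single 0 d.1 + Finsupp.single 1 d.2) := by
  classical
  refine (MvPowerSeries.coeff_rename (fun _ : Fin 2 => ()) f (Finsupp.single () n)).trans ?_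
  symm
  refine Finset.sum_bij (fun d _ => Finsupp.single 0 d.1 + Finsupp.single 1 d.2) ?_ ?_ ?_ ?_
  · intro d hd
    rw [Finset.HasAntidiagonal.mem_antidiagonal] at hd
    simp [Finsupp.mapDomain_add, Finsupp.mapDomain_single, ← Finsupp.single_add, hd]
  · intro d _ d' _ h
    have h0 := DFunLike.congr_fun h 0
    have h1 := DFunLike.congr_fun h 1
    simp at h0 h1
    exact Prod.ext h0 h1
  · intro d hd
    have e : d = Finsupp.single 0 (d 0) + Finsupp.single 1 (d 1) := by
      ext i
      fin_cases i <;> simp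
    refine ⟨(d 0, d 1), ?_, e.symm⟩
    rw [e] at hd
    simp [Finsupp.mapDomain_add, Finsupp.mapDomain_single, ← Finsupp.single_add] at hd
    rwa [Finset.HasAntidiagonal.mem_antidiagonal]
  · intro d _
    rfl

theorem oneConvexIsotropicGF_eq : oneConvexIsotropicGF = diagonal oneConvexGF := by
  ext n
  rw [coeff_diagonal, oneConvexIsotropicGF, PowerSeries.coeff_mk,
    ncard_oneConvexPolygonsOfPerimeter, Nat.cast_sum]
  refine Finset.sum_congr rfl fun d _ => ?_
  simp [oneConvexGF]

/-! ### Lin's generating function -/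

theorem map_topIndentExpression_of_field {F : Type*} [Field F]
    (φ : MvPowerSeries (Fin 2) ℚ →+* F) :
    φ topIndentExpression = topIndentRational (φ u) (φ v) := by
  rw [topIndentExpression_eq, Uniformization.map_topIndentRational]

/-- On the diagonal `Δ` becomes `1 - 4t`, so the square of the product is one; the constant term
decides the sign. -/
theorem oneSubFourPow_mul : oneSubFourPow * diagonal sqrtΔ ^ 5 = 1 := by
  have h1 : oneSubFourPow ^ 2 * (1 - 4 * PowerSeries.X) ^ 5 = 1 := by
    have h2 : (1 - 4 * PowerSeries.X : PowerSeries ℚ) ^ 5 =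
        PowerSeries.rescale (-4 : ℚ) (PowerSeries.binomialSeries ℚ (5 : ℚ)) := by
      have := PowerSeries.binomialSeries_nat (R := ℚ) (A := ℚ) 5
      rw [Nat.cast_ofNat] at this
      rw [this, map_pow, map_add, map_one, PowerSeries.rescale_X, map_neg, map_ofNat]
      ring
    rw [h2, oneSubFourPow, sq, ← map_mul, ← map_mul, ← PowerSeries.binomialSeries_add,
      ← PowerSeries.binomialSeries_add]
    norm_num
  have h2 : diagonal sqrtΔ ^ 2 = 1 - 4 * PowerSeries.X := by
    rw [← map_pow, sqrtΔ_sq, Δ]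
    simp only [map_add, map_sub, map_mul, map_pow, map_one, map_ofNat, diagonal_x, diagonal_y]
    ring
  have h3 : (oneSubFourPow * diagonal sqrtΔ ^ 5 - 1) * (oneSubFourPow * diagonal sqrtΔ ^ 5 + 1) =
      0 := by
    rw [← h2] at h1
    linear_combination h1
  refine sub_eq_zero.1 ((mul_eq_zero.1 h3).resolve_right fun h4 => ?_)
  have h5 := congrArg PowerSeries.constantCoeff h4
  have h6 : PowerSeries.constantCoeff (diagonal sqrtΔ) = 1 :=
    (MvPowerSeries.constantCoeff_rename (fun _ : Fin 2 => ()) sqrtΔ).trans constantCoeff_sqrtΔ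
  have h7 : PowerSeries.constantCoeff oneSubFourPow = 1 := by
    rw [oneSubFourPow, ← PowerSeries.coeff_zero_eq_constantCoeff_apply, PowerSeries.coeff_rescale,
      PowerSeries.coeff_zero_eq_constantCoeff_apply, PowerSeries.binomialSeries_constantCoeff]
    simp
  rw [map_add, map_mul, map_pow, h6, h7] at h5
  norm_num at h5

theorem map_powerSeries_inv {F : Type*} [Field F] (ψ : PowerSeries ℚ →+* F) {a : PowerSeries ℚ}
    {b : F} (h : PowerSeries.constantCoeff a = 1) (hab : ψ a = b) : ψ a⁻¹ = b⁻¹ ∧ b ≠ 0 := by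
  subst hab
  have h1 := congrArg ψ (PowerSeries.mul_inv_cancel a (by rw [h]; exact one_ne_zero))
  rw [map_mul, map_one] at h1
  exact ⟨eq_inv_of_mul_eq_one_right h1, left_ne_zero_of_mul_eq_one h1⟩

/-- On the diagonal `u` and `v` have a common value `c`, with `t = c * (1 - c)` and `√(1 - 4t) = 1 -
2c`, so both sides are rational functions of `c`. -/
theorem X_mul_diagonal_topIndentExpression :
    PowerSeries.X * diagonal topIndentExpression = linSeries := by
  have hψ := IsFractionRing.injective (PowerSeries ℚ) (FractionRing (PowerSeries ℚ))
  generalize algebraMap (PowerSeries ℚ) (FractionRing (PowerSeries ℚ)) = ψ at hψ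
  apply hψ
  set c := ψ (diagonal u) with hc
  have hv : ψ (diagonal v) = c := by
    rw [hc, v, u, map_add, map_add, map_add, map_add, diagonal_x, diagonal_y]
  have hX : ψ PowerSeries.X = c * (1 - c) := by
    rw [← diagonal_x, x_eq]
    simp only [map_mul, map_sub, map_one, hv, hc]
  have hr : ψ (diagonal sqrtΔ) = 1 - 2 * c := by
    rw [sqrtΔ_eq]
    simp only [map_sub, map_one, hv, ← hc]
    ring
  have h1 := map_powerSeries_inv ψ (a := 1 - PowerSeries.X) (b := 1 - c * (1 - c)) (by simp)
    (by simp [hX])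
  have h2 := map_powerSeries_inv ψ
    (a := (1 - PowerSeries.X) * (1 - 3 * PowerSeries.X + PowerSeries.X ^ 2) *
      (1 - 4 * PowerSeries.X) ^ 3)
    (b := (1 - c * (1 - c)) * (1 - 3 * (c * (1 - c)) + (c * (1 - c)) ^ 2) * (1 - 2 * c) ^ 6)
    (by simp) (by
      simp only [map_mul, map_sub, map_add, map_pow, map_one, map_ofNat, hX]
      ring)
  have h3 : ψ oneSubFourPow = (1 - 2 * c)⁻¹ ^ 5 := by
    rw [inv_pow]
    refine eq_inv_of_mul_eq_one_left ?_
    rw [← hr, ← map_pow, ← map_mul, oneSubFourPow_mul, map_one]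
  have h4 := map_topIndentExpression_of_field (ψ.comp diagonal)
  simp only [RingHom.comp_apply, hv, ← hc] at h4
  rw [map_mul, h4, linSeries]
  simp only [map_add, map_sub, map_mul, map_pow, map_neg, map_one, map_ofNat, hX, h1.1, h2.1, h3]
  have g1 := h1.2
  obtain ⟨⟨g2, g3⟩, g4⟩ : (1 - c * (1 - c) ≠ 0 ∧ 1 - 3 * (c * (1 - c)) + (c * (1 - c)) ^ 2 ≠ 0) ∧
      1 - 2 * c ≠ 0 := by
    simpa [mul_ne_zero_iff] using h2.2
  -- The denominator `(1 - x) ^ 2 - y` specializes to the factor `1 - 3t + t ^ 2` of Lin's formula.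
  have e1 : (1 - c * (1 - c)) ^ 2 - c * (1 - c) = 1 - 3 * (c * (1 - c)) + (c * (1 - c)) ^ 2 := by
    ring
  have e2 : 1 - c - c = 1 - 2 * c := by ring
  rw [topIndentRational, e1, e2]
  generalize hD : 1 - 3 * (c * (1 - c)) + (c * (1 - c)) ^ 2 = D at *
  field_simp
  rw [← hD]
  ring

theorem oneConvexIsotropicGF_eq_linSeries : oneConvexIsotropicGF = 4 * linSeries := by
  rw [oneConvexIsotropicGF_eq, oneConvexGF_eq, topIndentSizeGF_eq_topIndentExpression,
    ← X_mul_diagonal_topIndentExpression]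
  simp only [map_mul, map_add, map_ofNat, diagonal_x, diagonal_y, diagonal_swapXY]
  ring

end AlmostConvex

end

theorem mainTheorem4 :
    AlmostConvex.topIndentSizeGF = AlmostConvex.topIndentExpression ∧
    AlmostConvex.topIndentGF = AlmostConvex.y * AlmostConvex.topIndentExpression ∧
    AlmostConvex.oneConvexGF =
      2 * (AlmostConvex.y * AlmostConvex.topIndentExpression +
        AlmostConvex.x * AlmostConvex.swapXY AlmostConvex.topIndentExpression) ∧
    AlmostConvex.oneConvexIsotropicGF = 4 * AlmostConvex.linSeries := by
  have h := AlmostConvex.topIndentSizeGF_eq_topIndentExpression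
  refine ⟨h, ?_, ?_, AlmostConvex.oneConvexIsotropicGF_eq_linSeries⟩
  · rw [AlmostConvex.topIndentGF_eq, h]
  · rw [AlmostConvex.oneConvexGF_eq, h]
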